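/- **Setting.** Let $\mathcal M=[0,1]\times\mathbb R^3$ with coordinates $(t,x^1,x^2,x^3)$; Greek indices run over $0,\dots,3$, repeated indices are summed, and $T_{(\alpha\beta)}=T_{\alpha\beta}+T_{\beta\alpha}$. Let $\mathcal A$ be a finite set and let a $C^2$ Lorentzian metric $\mathbf g_0$, $C^2$ functions $(u_A)_{A\in\mathcal A}$ and functions $(F_A)_{A\in\mathcal A}$ on $\mathcal M$ satisfy $$R_{\mu\nu}(\mathbf g_0)=\sum_AF_A^2\,\partial_\mu u_A\partial_\nu u_A,\qquad \mathbf g_0^{-1}(du_A,du_A)=0,\qquad \mathbf g_0^{\mu\nu}\Gamma(\mathbf g_0)^\rho_{\mu\nu}=0 .$$ Indices are raised with $\mathbf g_0$ and $\mathbf D$ is its Levi-Civita connection. Let $L_A=-\mathbf g_0^{\alpha\beta}\partial_\alpha u_A\,\partial_\beta$, and let $\underline L_A$ be a null vector field with $\mathbf g_0(L_A,\underline L_A)=-2$. An index $L_A$ or $\underline L_A$ denotes contraction with that vector. For a metric $\mathbf g$, a function $v$ and symmetric 2-tensors $S,T$ put $$|T\cdot S|_{\mathbf g}=\mathbf g^{\alpha\beta}\mathbf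 g^{\mu\nu}T_{\alpha\mu}S_{\beta\nu},\quad |T|^2_{\mathbf g}=|T\cdot T|_{\mathbf g},\quad \tilde\Box_{\mathbf g}=\mathbf g^{\mu\nu}\partial_\mu\partial_\nu,\quad \Box_{\mathbf g}=\mathbf g^{\mu\nu}(\partial_\mu\partial_\nu-\Gamma(\mathbf g)^\rho_{\mu\nu}\partial_\rho),$$ $$\mathrm{Pol}(S,v)_\alpha=\mathbf g_0^{\mu\nu}S_{\alpha\mu}\partial_\nu v-\tfrac12(\mathrm{tr}_{\mathbf g_0}S)\,\partial_\alpha v,\qquad \mathcal P_v(S)_{\alpha\beta}=-\mathbf g_0^{-1}(dv,dv)S_{\alpha\beta}+\partial_{(\alpha}v\,\mathrm{Pol}(S,v)_{\beta)},\qquad \mathscr L_A=-2\mathbf D_{L_A}+\Box_{\mathbf g_0}u_A .$$ The phases are formal integer combinations of the $u_A$: $$\mathcal N=\{ku_A: 1\le k\le 3\},\qquad \mathcal I=\{u_A\pm u_B\}_{A\ne B}\cup\{u_A\pm2u_B\}_{A\ne B}\cup\{u_A\pm_1u_B\pm_2u_C\}_{A,B,C\text{ distinct}} .$$ Sums over $A\neq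 B,\pm$ run over ordered pairs of distinct indices and both signs; sums over $T$ run over $\{\cos,\sin\}$. **The metric.** For $\lambda>0$ let $$\begin{aligned}\mathbf g_\lambda={}&\mathbf g_0+\lambda\sum_A\cos\tfrac{u_A}\lambda F^{(1)}_A+\lambda^2\sum_A\Big(\sin\tfrac{u_A}\lambda\,(\mathfrak F_A+F^{(2,1)}_A)+\cos\tfrac{2u_A}\lambda F^{(2,2)}_A\Big)+\lambda^2\sum_{A\ne B,\pm}\cos\tfrac{u_A\pm u_B}\lambda F^{(2,\pm)}_{AB}\\&+\lambda^2\mathfrak h_\lambda+\lambda^3\sum_{u\in\mathcal N,T}T(\tfrac u\lambda)\,\mathfrak g^{(3,h)}_{u,T}+\lambda^3\sum_{v\in\mathcal I,T}T(\tfrac v\lambda)\,\mathfrak g^{(3,e)}_{v,T},\end{aligned}$$ where all amplitudes are symmetric 2-tensors of class $C^2$ ($\mathfrak F_A,\mathfrak h_\lambda,\mathfrak g^{(3,h)}_{u,T},\mathfrak g^{(3,e)}_{v,T}$ may depend on $\lambda$), $F^{(2,\pm)}_{AB}=F^{(2,\pm)}_{BA}$, and the polarization assumptions $$\mathrm{Pol}(F^{(1)}_A,u_A)=0,\qquad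 (F^{(1)}_A)_{L_A\underline L_A}=0$$ hold. Assume that $\mathbf g_\lambda$ is nondegenerate on $\mathcal M$. For a quantity $S$ built from $\mathbf g_\lambda$ and the amplitudes, $S^{(k)}$ is the coefficient of $\lambda^k$ in its expansion, in which the amplitudes and the quotients $u_A/\lambda$ are treated as independent of $\lambda$ (and $\partial_\mu$ of an oscillating factor produces $\lambda^{-1}\partial_\mu u_A$); $S^{(\ge j)}$ is defined by $S=\sum_{k<j}\lambda^kS^{(k)}+\lambda^jS^{(\ge j)}$. Put $H^\rho=\mathbf g_\lambda^{\mu\nu}\Gamma(\mathbf g_\lambda)^\rho_{\mu\nu}$ and $$\begin{aligned}\Upsilon^\rho={}&\mathbf g_\lambda^{\rho\sigma}\mathbf g_\lambda^{\mu\nu}\Big(E_{\mu\nu\sigma}(\mathfrak h_\lambda)+\sum_A\sin\tfrac{u_A}\lambda E_{\mu\nu\sigma}(\mathfrak F_A)+\lambda\sum_{u\in\mathcal N,T}T(\tfrac u\lambda)E_{\mu\nu\sigma}(\mathfrak g^{(3,h)}_{u,T})+\lambda\sum_{v\in\mathcal I,T}T(\tfrac v\lambda)E_{\mu\nu\sigma}(\mathfrak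 g^{(3,e)}_{v,T})+\sum_{v\in\mathcal I,T}T'(\tfrac v\lambda)E^v_{\mu\nu\sigma}(\mathfrak g^{(3,e)}_{v,T})\Big)\\&-\mathbf g_0^{\rho\sigma}\mathfrak h_\lambda^{\mu\nu}\Big(E_{\mu\nu\sigma}(\mathbf g_0)-\sum_A\sin\tfrac{u_A}\lambda E^{u_A}_{\mu\nu\sigma}(F^{(1)}_A)\Big),\end{aligned}$$ where $E_{\mu\nu\sigma}(S)=\partial_\mu S_{\sigma\nu}-\frac12\partial_\sigma S_{\mu\nu}$ and $E^v_{\mu\nu\sigma}(S)=\partial_\mu v\,S_{\sigma\nu}-\frac12\partial_\sigma v\,S_{\mu\nu}$. **Schematic notation.** $\{\cdot\}$ denotes a linear combination of components of the expression inside (products denote products of components, $\partial^{\le k}$ coordinate derivatives of order at most $k$; the indices $A,\pm,u,v,T$ of the amplitudes are arbitrary), with coefficients that are continuous functions on $\mathcal M$ depending only on the background $(\mathbf g_0,u_A,F_A,\underline L_A)$, not on $\lambda$ or the amplitudes. $\{\cdot\}^{\rm osc}$ denotes a finite sum of terms $\lambda^iT(z/\lambda)\{\cdot\}$ with $i\ge0$,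 $T\in\{1,\cos,\sin\}$ and $z$ an integer combination of the $u_A$. In such a bracket $\mathbf g_\lambda^{-1}$ stands for $\mathbf g_\lambda^{-1}$ or one of its tails $(\mathbf g_\lambda^{-1})^{(\ge k)}$, $k\le3$. **Proposition.** The Ricci tensor of $\mathbf g_\lambda$ is $$R_{\alpha\beta}(\mathbf g_\lambda)=R^{(0)}_{\alpha\beta}+\lambda R^{(1)}_{\alpha\beta}+\lambda^2R^{(\ge2)}_{\alpha\beta}.$$ Moreover its coefficient of $\lambda^{-1}$ vanishes, and $R^{(0)}$, $R^{(1)}$ are its coefficients of $\lambda^0$, $\lambda^1$. Here: *Order 0.* $$R^{(0)}_{\alpha\beta}=\sum_A\big(F_A^2-\tfrac18|F^{(1)}_A|^2_{\mathbf g_0}\big)\partial_\alpha u_A\partial_\beta u_A+(R^{(0)}_{\rm null})_{\alpha\beta}+(R^{(0)}_{\rm mixed})_{\alpha\beta},$$ $$\begin{aligned}2(R^{(0)}_{\rm null})_{\alpha\beta}={}&\sum_A\sin\tfrac{u_A}\lambda\Big((\mathscr L_AF^{(1)}_A)_{\alpha\beta}-\partial_{(\alpha}u_A\mathrm{Pol}(\mathfrak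 F_A,u_A)_{\beta)}-\partial_{(\alpha}u_A\big(\mathrm{Pol}(F^{(2,1)}_A,u_A)_{\beta)}+(Q^{(0)}_A)_{\beta)}\big)\Big)\\&-4\sum_A\cos\tfrac{2u_A}\lambda\,\partial_{(\alpha}u_A\Big(\mathrm{Pol}(F^{(2,2)}_A,u_A)_{\beta)}+\tfrac3{32}\partial_{\beta)}u_A|F^{(1)}_A|^2_{\mathbf g_0}\Big),\\2(R^{(0)}_{\rm mixed})_{\alpha\beta}={}&\sum_{A\ne B,\pm}\cos\tfrac{u_A\pm u_B}\lambda\Big(-\mathcal P_{u_A\pm u_B}(F^{(2,\pm)}_{AB})_{\alpha\beta}+(\mathcal I^{(0,\pm)}_{AB})_{\alpha\beta}\Big),\end{aligned}$$ with $(Q^{(0)}_A)_\beta=\mathbf g_0^{\mu\nu}\big(\partial_\mu(F^{(1)}_A)_{\beta\nu}-\frac12\partial_\beta(F^{(1)}_A)_{\mu\nu}\big)$, $$\begin{aligned}(\mathcal I^{(0,\pm)}_{AB})_{\alpha\beta}={}&-\tfrac14\Big((F^{(1)}_B)_{L_AL_A}(F^{(1)}_A)_{\alpha\beta}+(F^{(1)}_A)_{L_BL_B}(F^{(1)}_B)_{\alpha\beta}\Big)+(P^{(0,\pm)}_{AB})_{\alpha\beta}\\&+\partial_{(\alpha}(u_A\pm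 u_B)\Big(-\tfrac18\partial_{\beta)}(u_A\pm u_B)|F^{(1)}_A\cdot F^{(1)}_B|_{\mathbf g_0}-\tfrac14(F^{(1)}_B)^\nu_{L_A}(F^{(1)}_A)_{\nu\beta)}\mp\tfrac14(F^{(1)}_A)^\nu_{L_B}(F^{(1)}_B)_{\nu\beta)}\Big),\\(P^{(0,\pm)}_{AB})_{\alpha\beta}={}&\tfrac14\Big(\pm\partial_{(\alpha}u_A(F^{(1)}_A)_{L_B\sigma}(F^{(1)}_B)_{\beta)}^\sigma\pm\partial_{(\alpha}u_B(F^{(1)}_B)_{L_A\sigma}(F^{(1)}_A)_{\beta)}^\sigma\pm\tfrac12\partial_{(\alpha}u_A\partial_{\beta)}u_B|F^{(1)}_A\cdot F^{(1)}_B|_{\mathbf g_0}\\&\quad\pm(F^{(1)}_A)_{(\alpha L_B}(F^{(1)}_B)_{\beta)L_A}\mp\mathbf g_0^{-1}(du_A,du_B)(F^{(1)}_A)_{(\alpha}^\nu(F^{(1)}_B)_{\nu\beta)}\Big).\end{aligned}$$ *Order 1.* $$R^{(1)}_{\alpha\beta}=(R^{(1)}_{\rm null})_{\alpha\beta}+(R^{(1)}_{\rm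 mixed})_{\alpha\beta}+\tfrac12(\mathbf g_0)_{\rho(\alpha}(\partial_{\beta)}\Upsilon^\rho)^{(-1)},$$ $$\begin{aligned}2(R^{(1)}_{\rm null})_{\alpha\beta}={}&-\sum_A\cos\tfrac{u_A}\lambda\Big((\mathscr L_A\mathfrak F_A)_{\alpha\beta}+(\mathscr L_AF^{(2,1)}_A)_{\alpha\beta}+(\mathfrak h_\lambda)_{L_AL_A}(F^{(1)}_A)_{\alpha\beta}-\mathbf D_{(\alpha}\mathrm{Pol}(\mathfrak F_A+F^{(2,1)}_A,u_A)_{\beta)}+(\tilde R^{(1,1)}_A)_{\alpha\beta}\Big)\\&+2\sum_A\sin\tfrac{2u_A}\lambda\Big((\mathscr L_AF^{(2,2)}_A)_{\alpha\beta}-\mathbf D_{(\alpha}\mathrm{Pol}(F^{(2,2)}_A,u_A)_{\beta)}+(\tilde R^{(1,2)}_A)_{\alpha\beta}\Big)\\&+\sum_A\Big(2\sin\tfrac{u_A}\lambda\sin\tfrac{2u_A}\lambda-\cos\tfrac{u_A}\lambda\cos\tfrac{2u_A}\lambda\Big)(F^{(2,2)}_A)_{L_AL_A}(F^{(1)}_A)_{\alpha\beta}-\sum_A\sin\tfrac{2u_A}\lambda(\mathfrak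 F_A)_{L_AL_A}(F^{(1)}_A)_{\alpha\beta}\\&+\sum_{u\in\mathcal N,T}T(\tfrac u\lambda)\,\partial_{(\alpha}u\Big(-\mathrm{Pol}(\mathfrak g^{(3,h)}_{u,T},u)_{\beta)}+(\tilde R^{(1,h,T,u)})_{\beta)}\Big),\\2(R^{(1)}_{\rm mixed})_{\alpha\beta}={}&\sum_{v\in\mathcal I,T}T(\tfrac v\lambda)\Big(\mathbf g_0^{-1}(dv,dv)(\mathfrak g^{(3,e)}_{v,T})_{\alpha\beta}+(\tilde R^{(1,e,T,v)})_{\alpha\beta}\Big),\end{aligned}$$ with some $$\begin{aligned}\tilde R^{(1,1)}_A&=\{(F^{(2,\pm)}+(F^{(1)})^2)F^{(1)}+\partial^{\le2}F^{(1)}+(F^{(1)})^2\},\qquad\tilde R^{(1,2)}_A=\{(F^{(2,1)}+\partial^{\le1}F^{(1)})F^{(1)}\},\\\tilde R^{(1,h,T,u)}&=\{\partial F^{(2,1)}+\partial F^{(2,2)}+(\mathfrak F+F^{(2,1)}+F^{(2,2)}+F^{(2,\pm)}+(F^{(1)})^2+\partial F^{(1)})(1+F^{(1)})\},\\\tilde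 R^{(1,e,T,v)}&=\{\partial^{\le1}F^{(2,\pm)}+(F^{(1)})^2+(\mathfrak F+F^{(2,1)}+F^{(2,2)}+F^{(2,\pm)}+(F^{(1)})^2+\partial^{\le1}F^{(1)})(1+F^{(1)})\}.\end{aligned}$$ *Remainder.* $$\begin{aligned}2R^{(\ge2)}_{\alpha\beta}={}&-\tilde\Box_{\mathbf g_\lambda}(\mathfrak h_\lambda)_{\alpha\beta}-\sum_A\sin\tfrac{u_A}\lambda\tilde\Box_{\mathbf g_\lambda}(\mathfrak F_A)_{\alpha\beta}-\lambda\sum_{u\in\mathcal N,T}T(\tfrac u\lambda)\tilde\Box_{\mathbf g_\lambda}(\mathfrak g^{(3,h)}_{u,T})_{\alpha\beta}-\lambda\sum_{v\in\mathcal I,T}T(\tfrac v\lambda)\tilde\Box_{\mathbf g_\lambda}(\mathfrak g^{(3,e)}_{v,T})_{\alpha\beta}\\&+\tilde R^{(2)}_{\alpha\beta}+\big(H^\rho\partial_\rho(\mathbf g_\lambda)_{\alpha\beta}+(\mathbf g_\lambda)_{\rho(\alpha}\partial_{\beta)}H^\rho\big)^{(\ge2)},\end{aligned}$$ with some $$\begin{aligned}\tilde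 R^{(2)}=\Big\{&(\mathbf g_\lambda^{-1}\mathbf g_\lambda^{-1}\partial\mathbf g_\lambda\partial\mathbf g_\lambda)^{(\ge2)}+(\mathbf g_\lambda^{-1})^{(\ge2)}+\mathbf g_\lambda^{-1}\big(\partial^{\le1}\mathfrak g^{(3,h)}+\partial^{\le1}\mathfrak g^{(3,e)}+\partial^{\le2}F^{(1)}+\partial^{\le1}\mathfrak F\\&+\partial^{\le2}F^{(2,1)}+\partial^{\le2}F^{(2,2)}+\partial^{\le2}F^{(2,\pm)}\big)\Big\}^{\rm osc}.\end{aligned}$$ The quantities $\tilde R^{(1,1)}_A,\tilde R^{(1,2)}_A,\tilde R^{(1,h,T,u)},\tilde R^{(1,e,T,v)},\tilde R^{(2)}$ are given by fixed expressions of these forms, chosen before the amplitudes and $\lambda$. -/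

import Mathlib

open scoped Pointwise Topology

namespace MultiphaseRicci

noncomputable section

/-! ## The manifold `[0,1] × ℝ³` and tensor fields in the coordinates `(t, x¹, x², x³)` -/

/-- Coordinate space; index `0` is time, indices `1, 2, 3` are space. -/
abbrev Spacetime : Type := Fin 4 → ℝ

/-- The manifold `[0,1] × ℝ³`. -/
def slab : Set Spacetime := {x | 0 ≤ x 0 ∧ x 0 ≤ 1}

/-- Scalar fields, and the components `X_α`, `S_{αβ}` of covariant tensor fields. -/
abbrev Scalar : Type := Spacetime → ℝ
abbrev CoVec : Type := Fin 4 → Scalar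
abbrev Tensor2 : Type := Fin 4 → Fin 4 → Scalar

/-- The coordinate derivative `∂_μ` on `[0,1] × ℝ³` (one-sided in time on the two boundary
slices; the slab is a set of unique differentiability). -/
def pd (μ : Fin 4) (f : Scalar) : Scalar :=
  fun x => fderivWithin ℝ f slab x (Pi.single μ 1)

/-! ## Riemannian formulas, for an arbitrary choice `d` of coordinate derivatives

`X` is the space on which functions live and `d μ` plays the role of `∂_μ`. -/

section Geometry

variable {X : Type*} (d : Fin 4 → (X → ℝ) → X → ℝ) (g : Fin 4 → Fin 4 → X → ℝ)

/-- The inverse metric `g^{μν}`. -/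
def inv (g : Fin 4 → Fin 4 → X → ℝ) (μ ν : Fin 4) : X → ℝ :=
  fun x => (Matrix.of fun a b => g a b x)⁻¹ μ ν

/-- The Christoffel symbols `Γ(g)^ρ_{μν}`. -/
def christoffel (ρ μ ν : Fin 4) : X → ℝ := fun x =>
  (1 / 2) * ∑ σ, inv g ρ σ x * (d μ (g ν σ) x + d ν (g μ σ) x - d σ (g μ ν) x)

/-- The Ricci tensor `R_{αβ}(g) = ∂_ρ Γ^ρ_{αβ} - ∂_α Γ^ρ_{ρβ} + Γ^ρ_{ρσ} Γ^σ_{αβ} - Γ^ρ_{ασ} Γ^σ_{ρβ}`. -/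
def ricci (α β : Fin 4) : X → ℝ := fun x =>
  ∑ ρ, (d ρ (christoffel d g ρ α β) x - d α (christoffel d g ρ ρ β) x)
  + ∑ ρ, ∑ σ, (christoffel d g ρ ρ σ x * christoffel d g σ α β x
      - christoffel d g ρ α σ x * christoffel d g σ ρ β x)

/-- The gauge term `H^ρ = g^{μν} Γ(g)^ρ_{μν}`. -/
def gaugeH (ρ : Fin 4) : X → ℝ := fun x =>
  ∑ μ, ∑ ν, inv g μ ν x * christoffel d g ρ μ ν x

/-- `H^ρ ∂_ρ g_{αβ} + g_{ρ(α} ∂_{β)} H^ρ`, where `T_{(αβ)} = T_{αβ} + T_{βα}`. -/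
def gaugeTerm (α β : Fin 4) : X → ℝ := fun x =>
  ∑ ρ, (gaugeH d g ρ x * d ρ (g α β) x
    + (g ρ α x * d β (gaugeH d g ρ) x + g ρ β x * d α (gaugeH d g ρ) x))

end Geometry

/-- `Γ(g)^ρ_{μν}` on the slab. -/
def Gam (g : Tensor2) (ρ μ ν : Fin 4) : Scalar := christoffel pd g ρ μ ν

/-- `g⁻¹(dv, dw) = g^{μν} ∂_μ v ∂_ν w`. -/
def pair (g : Tensor2) (v w : Scalar) : Scalar := fun x =>
  ∑ μ, ∑ ν, inv g μ ν x * pd μ v x * pd ν w x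

/-- The reduced wave operator `g^{μν} ∂_μ ∂_ν f`. -/
def boxTilde (g : Tensor2) (f : Scalar) : Scalar := fun x =>
  ∑ μ, ∑ ν, inv g μ ν x * pd μ (pd ν f) x

/-- The wave operator `g^{μν} (∂_μ ∂_ν f - Γ(g)^ρ_{μν} ∂_ρ f)`. -/
def box (g : Tensor2) (f : Scalar) : Scalar := fun x =>
  ∑ μ, ∑ ν, inv g μ ν x * (pd μ (pd ν f) x - ∑ ρ, Gam g ρ μ ν x * pd ρ f x)

/-- The trace `g^{μν} S_{μν}`. -/
def trace (g S : Tensor2) : Scalar := fun x => ∑ μ, ∑ ν, inv g μ ν x * S μ ν x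

/-- `|T·S|_g = g^{αβ} g^{μν} T_{αμ} S_{βν}`; in particular `dot g T T` is `|T|²_g`. -/
def dot (g T S : Tensor2) : Scalar := fun x =>
  ∑ α, ∑ β, ∑ μ, ∑ ν, inv g α β x * inv g μ ν x * T α μ x * S β ν x

/-- Both indices raised: `S^{μν} = g^{μα} g^{νβ} S_{αβ}`. -/
def raise (g S : Tensor2) (μ ν : Fin 4) : Scalar := fun x =>
  ∑ α, ∑ β, inv g μ α x * inv g ν β x * S α β x

/-- The covariant derivative of a 1-form, `(D_μ X)_α`. -/
def covD1 (g : Tensor2) (Y : CoVec) (μ α : Fin 4) : Scalar := fun x =>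
  pd μ (Y α) x - ∑ ρ, Gam g ρ μ α x * Y ρ x

/-- The covariant derivative of a 2-tensor, `(D_μ S)_{αβ}`. -/
def covD2 (g S : Tensor2) (μ α β : Fin 4) : Scalar := fun x =>
  pd μ (S α β) x - ∑ ρ, (Gam g ρ μ α x * S ρ β x + Gam g ρ μ β x * S α ρ x)

/-- The polarization tensor `Pol(S, v)_α = g^{μν} S_{αμ} ∂_ν v - ½ (tr_g S) ∂_α v`. -/
def pol (g S : Tensor2) (v : Scalar) : CoVec := fun α x =>
  ∑ μ, ∑ ν, inv g μ ν x * S α μ x * pd ν v x - (1 / 2) * trace g S x * pd α v x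

/-- The operator `𝒫_v(S)_{αβ} = -g⁻¹(dv, dv) S_{αβ} + ∂_{(α} v Pol(S, v)_{β)}`. -/
def opP (g : Tensor2) (v : Scalar) (S : Tensor2) : Tensor2 := fun α β x =>
  -pair g v v x * S α β x + (pd α v x * pol g S v β x + pd β v x * pol g S v α x)

/-- A real symmetric matrix of signature `(-, +, +, +)`. -/
def IsLorentzianMatrix (M : Matrix (Fin 4) (Fin 4) ℝ) : Prop :=
  ∃ P : Matrix (Fin 4) (Fin 4) ℝ, IsUnit P.det ∧
    M = P.transpose * Matrix.diagonal ![-1, 1, 1, 1] * P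

/-! ## The background null dust spacetime -/

/-- The background metric, the phases `u_A`, the densities `F_A`, and for each phase the second
null vector field `L̲_A` (contravariant components) of a null frame. -/
structure Background (𝒜 : Type*) where
  g₀ : Tensor2
  u : 𝒜 → Scalar
  F : 𝒜 → Scalar
  Lbar : 𝒜 → Fin 4 → Scalar

section Background

variable {𝒜 : Type*} (bg : Background 𝒜)

/-- `L_A = -g₀^{αβ} ∂_β u_A ∂_α`. -/
def Background.L (A : 𝒜) (μ : Fin 4) : Scalar := fun x =>
  -∑ ν, inv bg.g₀ μ ν x * pd ν (bg.u A) x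

/-- Solutions of the Einstein-null dusts system in wave gauge, with `L̲_A` null and
`g₀(L_A, L̲_A) = -2`. -/
structure Background.IsNullDust [Fintype 𝒜] : Prop where
  lorentzian : ∀ x ∈ slab, IsLorentzianMatrix (Matrix.of fun μ ν => bg.g₀ μ ν x)
  smooth_metric : ∀ μ ν, ContDiffOn ℝ 2 (bg.g₀ μ ν) slab
  smooth_phase : ∀ A, ContDiffOn ℝ 2 (bg.u A) slab
  einstein : ∀ x ∈ slab, ∀ μ ν, ricci pd bg.g₀ μ ν x
    = ∑ A, bg.F A x ^ 2 * pd μ (bg.u A) x * pd ν (bg.u A) x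
  eikonal : ∀ x ∈ slab, ∀ A, pair bg.g₀ (bg.u A) (bg.u A) x = 0
  wave_gauge : ∀ x ∈ slab, ∀ ρ, gaugeH pd bg.g₀ ρ x = 0
  frame_null : ∀ x ∈ slab, ∀ A,
    ∑ μ, ∑ ν, bg.g₀ μ ν x * bg.Lbar A μ x * bg.Lbar A ν x = 0
  frame_pair : ∀ x ∈ slab, ∀ A,
    ∑ μ, ∑ ν, bg.g₀ μ ν x * bg.L A μ x * bg.Lbar A ν x = -2

/-- The transport operator `ℒ_A = -2 D_{L_A} + □_{g₀} u_A` on symmetric 2-tensors. -/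
def Background.transport (A : 𝒜) (S : Tensor2) : Tensor2 := fun α β x =>
  -2 * ∑ μ, bg.L A μ x * covD2 bg.g₀ S μ α β x + box bg.g₀ (bg.u A) x * S α β x

/-- `S_{L_A L_A}`. -/
def Background.LL (A : 𝒜) (S : Tensor2) : Scalar := fun x =>
  ∑ μ, ∑ ν, bg.L A μ x * bg.L A ν x * S μ ν x

/-- `S_{L_A α}`. -/
def Background.contrL (A : 𝒜) (S : Tensor2) : CoVec := fun α x => ∑ μ, bg.L A μ x * S μ α x

/-- The phase `∑_A n_A u_A` with integer coefficients `n`. -/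
def Background.phase [Fintype 𝒜] (n : 𝒜 → ℤ) : Scalar := fun x => ∑ A, (n A : ℝ) * bg.u A x

end Background

/-! ## The sets of phases

A phase is recorded by its integer coefficients on the `u_A`. -/

section Phases

variable (𝒜 : Type*) [Fintype 𝒜] [DecidableEq 𝒜]

/-- `u_A`, as a vector of coefficients. -/
def unit {𝒜 : Type*} [DecidableEq 𝒜] (A : 𝒜) : 𝒜 → ℤ := Pi.single A 1

/-- `𝒩_k = {k u_A}`. -/
def nullPhasesOf (k : ℤ) : Finset (𝒜 → ℤ) := Finset.univ.image fun A => k • unit A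

/-- `𝒩 = 𝒩_1 ∪ 𝒩_2 ∪ 𝒩_3`. -/
def nullPhases : Finset (𝒜 → ℤ) := nullPhasesOf 𝒜 1 ∪ nullPhasesOf 𝒜 2 ∪ nullPhasesOf 𝒜 3

/-- `{u_A ± k u_B : A ≠ B}`. -/
def mixedTwo (k : ℤ) : Finset (𝒜 → ℤ) :=
  ((Finset.univ : Finset (𝒜 × 𝒜 × ℤˣ)).filter fun p => p.1 ≠ p.2.1).image
    fun p => unit p.1 + ((p.2.2 : ℤ) * k) • unit p.2.1

/-- `{u_A ±₁ u_B ±₂ u_C : A, B, C all distinct}`. -/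
def mixedThree : Finset (𝒜 → ℤ) :=
  ((Finset.univ : Finset (𝒜 × 𝒜 × 𝒜 × ℤˣ × ℤˣ)).filter
      fun p => p.1 ≠ p.2.1 ∧ p.1 ≠ p.2.2.1 ∧ p.2.1 ≠ p.2.2.1).image
    fun p => unit p.1 + (p.2.2.2.1 : ℤ) • unit p.2.1 + (p.2.2.2.2 : ℤ) • unit p.2.2.1

/-- `ℐ = ℐ_2 ∪ ℐ_3`. -/
def mixedPhases : Finset (𝒜 → ℤ) := mixedTwo 𝒜 1 ∪ (mixedTwo 𝒜 2 ∪ mixedThree 𝒜)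

end Phases

/-- The index set `{cos, sin}` is `Bool`. -/
def trig : Bool → ℝ → ℝ
  | true => Real.cos
  | false => Real.sin

/-- The coefficients `n` of `u_A ± u_B`; the sign is `ε`. -/
def pm {𝒜 : Type*} [DecidableEq 𝒜] (A B : 𝒜) (ε : ℤˣ) : 𝒜 → ℤ := unit A + (ε : ℤ) • unit B

/-! ## The amplitudes of the ansatz -/

/-- The tensors in the ansatz. `Fpm A B ε` is `F^{(2,±)}_{AB}`, and `g3h T n`, `g3e T n` are
`𝔤^{(3,h)}_{u,T}`, `𝔤^{(3,e)}_{v,T}` for the phase with coefficients `n`. For the fields which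
depend on the parameter of the family, these are their values at the parameter considered. -/
structure Amplitudes (𝒜 : Type*) where
  F1 : 𝒜 → Tensor2
  frakF : 𝒜 → Tensor2
  F21 : 𝒜 → Tensor2
  F22 : 𝒜 → Tensor2
  Fpm : 𝒜 → 𝒜 → ℤˣ → Tensor2
  h : Tensor2
  g3h : Bool → (𝒜 → ℤ) → Tensor2
  g3e : Bool → (𝒜 → ℤ) → Tensor2

/-- Symmetric 2-tensors of class `C²`. -/
def IsSymmC2 (S : Tensor2) : Prop :=
  (∀ μ ν, S μ ν = S ν μ) ∧ ∀ μ ν, ContDiffOn ℝ 2 (S μ ν) slab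

/-- All amplitudes are symmetric tensors, `F^{(2,±)}_{AB} = F^{(2,±)}_{BA}`, and the polarization
assumptions `Pol(F^{(1)}_A, u_A) = 0` and `(F^{(1)}_A)_{L_A L̲_A} = 0` hold. -/
structure Amplitudes.Admissible {𝒜 : Type*} [Fintype 𝒜] [DecidableEq 𝒜] (a : Amplitudes 𝒜)
    (bg : Background 𝒜) : Prop where
  F1 : ∀ A, IsSymmC2 (a.F1 A)
  frakF : ∀ A, IsSymmC2 (a.frakF A)
  F21 : ∀ A, IsSymmC2 (a.F21 A)
  F22 : ∀ A, IsSymmC2 (a.F22 A)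
  Fpm : ∀ A B ε, A ≠ B → IsSymmC2 (a.Fpm A B ε)
  Fpm_swap : ∀ A B ε, A ≠ B → a.Fpm A B ε = a.Fpm B A ε
  h : IsSymmC2 a.h
  g3h : ∀ T, ∀ n ∈ nullPhases 𝒜, IsSymmC2 (a.g3h T n)
  g3e : ∀ T, ∀ n ∈ mixedPhases 𝒜, IsSymmC2 (a.g3e T n)
  polarized : ∀ x ∈ slab, ∀ A α, pol bg.g₀ (a.F1 A) (bg.u A) α x = 0
  polarized_frame : ∀ x ∈ slab, ∀ A,
    ∑ μ, ∑ ν, a.F1 A μ ν x * bg.L A μ x * bg.Lbar A ν x = 0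

/-! ## Actual quantities and profiles

The metric `g_λ`, and every quantity built from it, is used in two ways: as a function on the slab
for a given `λ`, and as a *profile*, a function of `(s, x, θ)` in which `λ` is replaced by a
variable `s` and each `u_A / λ` by an independent angle `θ_A`. For profiles, `∂_μ` becomes
`∂_μ + s⁻¹ ∑_A (∂_μ u_A) ∂_{θ_A}`. The coefficient of `λ^k` of a quantity is the coefficient of
`s^k` of its profile at `θ = u / λ`, all amplitudes being held fixed. A `Calculus` collects what is
needed to write both versions by the same formulas. -/

structure Calculus (𝒜 X : Type*) where
  /-- the function on `X` defined by a scalar field -/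
  field : Scalar → X → ℝ
  /-- the small parameter -/
  lam : X → ℝ
  /-- `T(z / λ)` for the phase `z` with coefficients `n` -/
  osc : (ℝ → ℝ) → (𝒜 → ℤ) → X → ℝ
  /-- the coordinate derivatives -/
  d : Fin 4 → (X → ℝ) → X → ℝ

section Ansatz

variable {𝒜 : Type*} [Fintype 𝒜] [DecidableEq 𝒜] {X : Type*}

/-- Functions on the slab, for a given value of the parameter. -/
def actual (bg : Background 𝒜) (lam : ℝ) : Calculus 𝒜 Spacetime where
  field f := f
  lam _ := lam
  osc T n x := T (bg.phase n x / lam)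
  d := pd

/-- Profiles, functions of `(s, x, θ)`. -/
def profile (bg : Background 𝒜) : Calculus 𝒜 (ℝ × Spacetime × (𝒜 → ℝ)) where
  field f p := f p.2.1
  lam p := p.1
  osc T n p := T (∑ A, (n A : ℝ) * p.2.2 A)
  d μ S p := pd μ (fun y => S (p.1, y, p.2.2)) p.2.1
    + p.1⁻¹ * ∑ A, pd μ (bg.u A) p.2.1
        * deriv (fun t => S (p.1, p.2.1, Function.update p.2.2 A t)) (p.2.2 A)

/-- The metric `g_λ`. -/
def metric (bg : Background 𝒜) (a : Amplitudes 𝒜) (c : Calculus 𝒜 X) :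
    Fin 4 → Fin 4 → X → ℝ := fun μ ν p =>
  c.field (bg.g₀ μ ν) p
  + c.lam p * ∑ A, c.osc Real.cos (unit A) p * c.field (a.F1 A μ ν) p
  + c.lam p ^ 2 * ∑ A,
      (c.osc Real.sin (unit A) p * (c.field (a.frakF A μ ν) p + c.field (a.F21 A μ ν) p)
        + c.osc Real.cos ((2 : ℤ) • unit A) p * c.field (a.F22 A μ ν) p)
  + c.lam p ^ 2 * ∑ q ∈ (Finset.univ : Finset 𝒜).offDiag, ∑ ε : ℤˣ,
      c.osc Real.cos (pm q.1 q.2 ε) p * c.field (a.Fpm q.1 q.2 ε μ ν) p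
  + c.lam p ^ 2 * c.field (a.h μ ν) p
  + c.lam p ^ 3 * ∑ n ∈ nullPhases 𝒜, ∑ T, c.osc (trig T) n p * c.field (a.g3h T n μ ν) p
  + c.lam p ^ 3 * ∑ n ∈ mixedPhases 𝒜, ∑ T, c.osc (trig T) n p * c.field (a.g3e T n μ ν) p

/-- `∂_μ S_{σν} - ½ ∂_σ S_{μν}` for a field `S`. -/
def gaugeDeriv (c : Calculus 𝒜 X) (S : Tensor2) (μ ν σ : Fin 4) : X → ℝ := fun p =>
  c.d μ (c.field (S σ ν)) p - (1 / 2) * c.d σ (c.field (S μ ν)) p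

/-- `∂_μ v S_{σν} - ½ ∂_σ v S_{μν}` for a phase `v` and a field `S`. -/
def gaugeSymbol (c : Calculus 𝒜 X) (v : Scalar) (S : Tensor2) (μ ν σ : Fin 4) : X → ℝ :=
  fun p => c.field (pd μ v) p * c.field (S σ ν) p
    - (1 / 2) * (c.field (pd σ v) p * c.field (S μ ν) p)

/-- The part `Υ^ρ` of the gauge term. -/
def upsilon (bg : Background 𝒜) (a : Amplitudes 𝒜) (c : Calculus 𝒜 X) (ρ : Fin 4) : X → ℝ :=
  fun p =>
  ∑ σ, ∑ μ, ∑ ν, inv (metric bg a c) ρ σ p * inv (metric bg a c) μ ν p *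
    (gaugeDeriv c a.h μ ν σ p
      + ∑ A, c.osc Real.sin (unit A) p * gaugeDeriv c (a.frakF A) μ ν σ p
      + c.lam p * ∑ n ∈ nullPhases 𝒜, ∑ T,
          c.osc (trig T) n p * gaugeDeriv c (a.g3h T n) μ ν σ p
      + c.lam p * ∑ n ∈ mixedPhases 𝒜, ∑ T,
          c.osc (trig T) n p * gaugeDeriv c (a.g3e T n) μ ν σ p
      + ∑ n ∈ mixedPhases 𝒜, ∑ T,
          c.osc (deriv (trig T)) n p * gaugeSymbol c (bg.phase n) (a.g3e T n) μ ν σ p)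
  - ∑ σ, ∑ μ, ∑ ν, c.field (inv bg.g₀ ρ σ) p * c.field (raise bg.g₀ a.h μ ν) p *
    (gaugeDeriv c bg.g₀ μ ν σ p
      - ∑ A, c.osc Real.sin (unit A) p * gaugeSymbol c (bg.u A) (a.F1 A) μ ν σ p)

/-- `laurentCoeff f j` is the coefficient of `s^(j-1)` in the expansion of `f` as `s → 0⁺`,
for a function `f` whose expansion starts at `s⁻¹` at the earliest. -/
def laurentCoeff (f : ℝ → ℝ) : ℕ → ℝ
  | j => Filter.limUnder (𝓝[>] (0 : ℝ)) fun s =>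
      (f s - ∑ i : Fin j, s ^ ((i : ℤ) - 1) * laurentCoeff f i) * s ^ (1 - (j : ℤ))
termination_by j => j
decreasing_by exact i.2

/-- The coefficient `S^{(k)}`, `k ≥ -1`, of `λ^k` of the quantity with profile `S`. -/
def coeffAt (bg : Background 𝒜) (lam : ℝ) (S : ℝ × Spacetime × (𝒜 → ℝ) → ℝ) (k : ℤ) : Scalar :=
  fun x => laurentCoeff (fun s => S (s, x, fun A => bg.u A x / lam)) (k + 1).toNat

/-- `S^{(≥ k)}`, defined by `S = ∑_{j < k} λ^j S^{(j)} + λ^k S^{(≥ k)}`; here `Sact` is the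
quantity itself and `Sprof` its profile. -/
def tail (bg : Background 𝒜) (lam : ℝ) (k : ℤ) (Sact : Scalar)
    (Sprof : ℝ × Spacetime × (𝒜 → ℝ) → ℝ) : Scalar := fun x =>
  lam ^ (-k) * (Sact x - ∑ j ∈ Finset.Ico (-1) k, lam ^ j * coeffAt bg lam Sprof j x)

end Ansatz

/-! ## Schematic notation

The background is fixed. A schematic quantity is a function of the amplitudes (and of `λ` for the
oscillating version), and a bracket is a set of such functions: the linear combinations, with
coefficients that depend on the background only, of given monomials in the components of the
amplitudes and of their derivatives. Sums inside a bracket are unions of sets of monomials, and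
products are pointwise products of sets. -/

section Schematic

variable {𝒜 : Type*}

abbrev Functional (𝒜 : Type*) : Type _ := Amplitudes 𝒜 → Spacetime → ℝ
abbrev OscFunctional (𝒜 : Type*) : Type _ := ℝ → Amplitudes 𝒜 → Spacetime → ℝ

/-- The components of `F^{(1)}`, `𝔉`, `F^{(2,1)}`, `F^{(2,2)}`, `F^{(2,±)}`, `𝔤^{(3,h)}`,
`𝔤^{(3,e)}`. -/
def compF1 : Set (Functional 𝒜) := {m | ∃ A μ ν, m = fun a => a.F1 A μ ν}
def compFrakF : Set (Functional 𝒜) := {m | ∃ A μ ν, m = fun a => a.frakF A μ ν}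
def compF21 : Set (Functional 𝒜) := {m | ∃ A μ ν, m = fun a => a.F21 A μ ν}
def compF22 : Set (Functional 𝒜) := {m | ∃ A μ ν, m = fun a => a.F22 A μ ν}
def compFpm : Set (Functional 𝒜) := {m | ∃ A B ε μ ν, A ≠ B ∧ m = fun a => a.Fpm A B ε μ ν}
def compG3h [Fintype 𝒜] [DecidableEq 𝒜] : Set (Functional 𝒜) :=
  {m | ∃ T, ∃ n ∈ nullPhases 𝒜, ∃ μ ν, m = fun a => a.g3h T n μ ν}
def compG3e [Fintype 𝒜] [DecidableEq 𝒜] : Set (Functional 𝒜) :=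
  {m | ∃ T, ∃ n ∈ mixedPhases 𝒜, ∃ μ ν, m = fun a => a.g3e T n μ ν}

/-- `∂S`: the partial derivatives of the elements of `S`. -/
def derivs (S : Set (Functional 𝒜)) : Set (Functional 𝒜) :=
  {m' | ∃ m ∈ S, ∃ μ, m' = fun a => pd μ (m a)}

/-- `∂^{≤ k} S`. -/
def derivsLE : ℕ → Set (Functional 𝒜) → Set (Functional 𝒜)
  | 0, S => S
  | k + 1, S => S ∪ derivs (derivsLE k S)

/-- The bracket `{S}`. -/
def bracket (S : Set (Functional 𝒜)) : Set (Functional 𝒜) :=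
  {Φ | ∃ (N : ℕ) (c : Fin N → Scalar) (m : Fin N → Functional 𝒜),
    (∀ i, ContinuousOn (c i) slab) ∧ (∀ i, m i ∈ S) ∧
    ∀ a, ∀ x ∈ slab, Φ a x = ∑ i, c i x * m i a x}

/-- The bracket `{S}^osc`: sums of terms `λ^i T(z/λ) {S}` with `i ≥ 0`, `T ∈ {1, cos, sin}` and
`z` an integer combination of the `u_A` (`T = 1` is `cos` with `z = 0`). -/
def oscBracket [Fintype 𝒜] (bg : Background 𝒜) (S : Set (OscFunctional 𝒜)) :
    Set (OscFunctional 𝒜) :=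
  {Φ | ∃ (N : ℕ) (c : Fin N → Scalar) (k : Fin N → ℕ) (T : Fin N → Bool) (z : Fin N → 𝒜 → ℤ)
      (m : Fin N → OscFunctional 𝒜),
    (∀ i, ContinuousOn (c i) slab) ∧ (∀ i, m i ∈ S) ∧
    ∀ lam a, ∀ x ∈ slab, Φ lam a x
      = ∑ i, c i x * lam ^ k i * trig (T i) (bg.phase (z i) x / lam) * m i lam a x}

/-- Monomials without `λ`, seen as monomials which may contain `λ`. -/
def const (S : Set (Functional 𝒜)) : Set (OscFunctional 𝒜) := (fun m _ => m) '' S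

variable [Fintype 𝒜] [DecidableEq 𝒜] (bg : Background 𝒜)

/-- The components of `(g_λ⁻¹)^{(≥ k)}`. -/
def invTail (k : ℤ) : Set (OscFunctional 𝒜) :=
  {m | ∃ μ ν, m = fun lam a => tail bg lam k (inv (metric bg a (actual bg lam)) μ ν)
    (inv (metric bg a (profile bg)) μ ν)}

/-- `g_λ⁻¹` in a bracket: the components of `g_λ⁻¹` and of the `(g_λ⁻¹)^{(≥ k)}`, `k ≤ 3`. -/
def invAny : Set (OscFunctional 𝒜) := invTail bg 0 ∪ invTail bg 1 ∪ invTail bg 2 ∪ invTail bg 3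

/-- A component of `g_λ⁻¹ g_λ⁻¹ ∂g_λ ∂g_λ`. -/
def quadratic {X : Type*} (a : Amplitudes 𝒜) (c : Calculus 𝒜 X) (i : Fin 4 → Fin 4)
    (j k : Fin 3 → Fin 4) : X → ℝ := fun p =>
  inv (metric bg a c) (i 0) (i 1) p * inv (metric bg a c) (i 2) (i 3) p
    * c.d (j 0) (metric bg a c (j 1) (j 2)) p * c.d (k 0) (metric bg a c (k 1) (k 2)) p

/-- The components of `(g_λ⁻¹ g_λ⁻¹ ∂g_λ ∂g_λ)^{(≥ 2)}`. -/
def quadTail : Set (OscFunctional 𝒜) :=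
  {m | ∃ i j k, m = fun lam a => tail bg lam 2 (quadratic bg a (actual bg lam) i j k)
    (quadratic bg a (profile bg) i j k)}

/-- The bracket of `R̃^{(1,1)}`:
`{(F^{(2,±)} + (F^{(1)})²) F^{(1)} + ∂^{≤2} F^{(1)} + (F^{(1)})²}`. -/
def class11 : Set (Functional 𝒜) :=
  bracket ((compFpm ∪ compF1 * compF1) * compF1 ∪ derivsLE 2 compF1 ∪ compF1 * compF1)

/-- The bracket of `R̃^{(1,2)}`: `{(F^{(2,1)} + ∂^{≤1} F^{(1)}) F^{(1)}}`. -/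
def class12 : Set (Functional 𝒜) := bracket ((compF21 ∪ derivsLE 1 compF1) * compF1)

/-- The bracket of `R̃^{(1,h,T,u)}`: `{∂F^{(2,1)} + ∂F^{(2,2)}
+ (𝔉 + F^{(2,1)} + F^{(2,2)} + F^{(2,±)} + (F^{(1)})² + ∂F^{(1)}) (1 + F^{(1)})}`. -/
def class1h : Set (Functional 𝒜) :=
  bracket (derivs compF21 ∪ derivs compF22
    ∪ (compFrakF ∪ compF21 ∪ compF22 ∪ compFpm ∪ compF1 * compF1 ∪ derivs compF1)
        * (1 ∪ compF1))

/-- The bracket of `R̃^{(1,e,T,v)}`: `{∂^{≤1} F^{(2,±)} + (F^{(1)})²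
+ (𝔉 + F^{(2,1)} + F^{(2,2)} + F^{(2,±)} + (F^{(1)})² + ∂^{≤1} F^{(1)}) (1 + F^{(1)})}`. -/
def class1e : Set (Functional 𝒜) :=
  bracket (derivsLE 1 compFpm ∪ compF1 * compF1
    ∪ (compFrakF ∪ compF21 ∪ compF22 ∪ compFpm ∪ compF1 * compF1 ∪ derivsLE 1 compF1)
        * (1 ∪ compF1))

/-- The bracket of `R̃^{(2)}`: `{(g_λ⁻¹ g_λ⁻¹ ∂g_λ ∂g_λ)^{(≥2)} + (g_λ⁻¹)^{(≥2)}
+ g_λ⁻¹ (∂^{≤1} 𝔤^{(3,h)} + ∂^{≤1} 𝔤^{(3,e)} + ∂^{≤2} F^{(1)} + ∂^{≤1} 𝔉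
+ ∂^{≤2} F^{(2,1)} + ∂^{≤2} F^{(2,2)} + ∂^{≤2} F^{(2,±)})}^osc`. The term `(g_λ⁻¹)^{(≥2)}` comes
with the second derivatives of the background metric. -/
def class2 : Set (OscFunctional 𝒜) :=
  oscBracket bg (quadTail bg ∪ invTail bg 2
    ∪ invAny bg * const (derivsLE 1 compG3h ∪ derivsLE 1 compG3e ∪ derivsLE 2 compF1
        ∪ derivsLE 1 compFrakF ∪ derivsLE 2 compF21 ∪ derivsLE 2 compF22 ∪ derivsLE 2 compFpm))

end Schematic

/-! ## The terms of the expansion -/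

section Terms

variable {𝒜 : Type*} [Fintype 𝒜] [DecidableEq 𝒜] (bg : Background 𝒜) (a : Amplitudes 𝒜)

/-- `(Q^{(0)}_A)_β = g₀^{μν} (∂_μ (F^{(1)}_A)_{βν} - ½ ∂_β (F^{(1)}_A)_{μν})`. -/
def Q0 (A : 𝒜) : CoVec := fun β x =>
  ∑ μ, ∑ ν, inv bg.g₀ μ ν x * (pd μ (a.F1 A β ν) x - (1 / 2) * pd β (a.F1 A μ ν) x)

/-- `(F^{(1)}_A)_{L_B σ} (F^{(1)}_B)_β^σ`. -/
def crossL (A B : 𝒜) : CoVec := fun β x =>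
  ∑ σ, ∑ τ, inv bg.g₀ σ τ x * bg.contrL B (a.F1 A) σ x * a.F1 B β τ x

/-- `(F^{(1)}_A)_α^ν (F^{(1)}_B)_{νβ}`. -/
def crossF (A B : 𝒜) : Tensor2 := fun α β x =>
  ∑ μ, ∑ ν, inv bg.g₀ μ ν x * a.F1 A α μ x * a.F1 B ν β x

/-- The mixed quadratic interaction `(P^{(0,±)}_{AB})_{αβ}`. -/
def P0pm (A B : 𝒜) (ε : ℤˣ) : Tensor2 := fun α β x =>
  let s : ℝ := ((ε : ℤ) : ℝ)
  let dA := fun μ => pd μ (bg.u A) x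
  let dB := fun μ => pd μ (bg.u B) x
  (1 / 4) *
    (s * (dA α * crossL bg a A B β x + dA β * crossL bg a A B α x)
    + s * (dB α * crossL bg a B A β x + dB β * crossL bg a B A α x)
    + s * (1 / 2) * (dA α * dB β + dA β * dB α) * dot bg.g₀ (a.F1 A) (a.F1 B) x
    + s * (bg.contrL B (a.F1 A) α x * bg.contrL A (a.F1 B) β x
        + bg.contrL B (a.F1 A) β x * bg.contrL A (a.F1 B) α x)
    - s * pair bg.g₀ (bg.u A) (bg.u B) x * (crossF bg a A B α β x + crossF bg a A B β α x))

/-- The mixed interaction `(ℐ^{(0,±)}_{AB})_{αβ}`. -/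
def I0pm (A B : 𝒜) (ε : ℤˣ) : Tensor2 := fun α β x =>
  let s : ℝ := ((ε : ℤ) : ℝ)
  let dv := fun μ => pd μ (bg.phase (pm A B ε)) x
  let Y : Fin 4 → ℝ := fun μ => -(1 / 8) * dv μ * dot bg.g₀ (a.F1 A) (a.F1 B) x
    - (1 / 4) * crossL bg a B A μ x - s * (1 / 4) * crossL bg a A B μ x
  P0pm bg a A B ε α β x
    - (1 / 4) * (bg.LL A (a.F1 B) x * a.F1 A α β x + bg.LL B (a.F1 A) x * a.F1 B α β x)
    + (dv α * Y β + dv β * Y α)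

/-- `2 (R^{(0)}_null)_{αβ}`. -/
def twoR0null (lam : ℝ) : Tensor2 := fun α β x =>
  ∑ A,
    (let du := fun μ => pd μ (bg.u A) x
     let Y := fun μ => pol bg.g₀ (a.F21 A) (bg.u A) μ x + Q0 bg a A μ x
     let Z := fun μ => pol bg.g₀ (a.frakF A) (bg.u A) μ x
     Real.sin (bg.u A x / lam) *
       (bg.transport A (a.F1 A) α β x - (du α * Z β + du β * Z α) - (du α * Y β + du β * Y α)))
  - 4 * ∑ A,
    (let du := fun μ => pd μ (bg.u A) x
     let Y := fun μ => pol bg.g₀ (a.F22 A) (bg.u A) μ x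
       + (3 / 32) * du μ * dot bg.g₀ (a.F1 A) (a.F1 A) x
     Real.cos (2 * bg.u A x / lam) * (du α * Y β + du β * Y α))

/-- `2 (R^{(0)}_mixed)_{αβ}`. -/
def twoR0mixed (lam : ℝ) : Tensor2 := fun α β x =>
  ∑ q ∈ (Finset.univ : Finset 𝒜).offDiag, ∑ ε : ℤˣ,
    Real.cos (bg.phase (pm q.1 q.2 ε) x / lam) *
      (-opP bg.g₀ (bg.phase (pm q.1 q.2 ε)) (a.Fpm q.1 q.2 ε) α β x
        + I0pm bg a q.1 q.2 ε α β x)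

/-- `R^{(0)}_{αβ}`. -/
def R0 (lam : ℝ) : Tensor2 := fun α β x =>
  ∑ A, (bg.F A x ^ 2 - (1 / 8) * dot bg.g₀ (a.F1 A) (a.F1 A) x)
      * pd α (bg.u A) x * pd β (bg.u A) x
    + (1 / 2) * twoR0null bg a lam α β x + (1 / 2) * twoR0mixed bg a lam α β x

/-- `2 (R^{(1)}_null)_{αβ}`, where `r11`, `r12`, `rh` are the values of `R̃^{(1,1)}`, `R̃^{(1,2)}`,
`R̃^{(1,h,T,u)}`. -/
def twoR1null (lam : ℝ) (r11 r12 : 𝒜 → Tensor2) (rh : Bool → (𝒜 → ℤ) → CoVec) : Tensor2 :=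
  fun α β x =>
  -∑ A,
    (let Y : CoVec := pol bg.g₀ (a.frakF A + a.F21 A) (bg.u A)
     Real.cos (bg.u A x / lam) *
      (bg.transport A (a.frakF A) α β x + bg.transport A (a.F21 A) α β x
        + bg.LL A a.h x * a.F1 A α β x
        - (covD1 bg.g₀ Y α β x + covD1 bg.g₀ Y β α x) + r11 A α β x))
  + 2 * ∑ A,
    (let Y : CoVec := pol bg.g₀ (a.F22 A) (bg.u A)
     Real.sin (2 * bg.u A x / lam) *
      (bg.transport A (a.F22 A) α β x
        - (covD1 bg.g₀ Y α β x + covD1 bg.g₀ Y β α x) + r12 A α β x))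
  + ∑ A, (2 * Real.sin (bg.u A x / lam) * Real.sin (2 * bg.u A x / lam)
        - Real.cos (bg.u A x / lam) * Real.cos (2 * bg.u A x / lam))
      * bg.LL A (a.F22 A) x * a.F1 A α β x
  - ∑ A, Real.sin (2 * bg.u A x / lam) * bg.LL A (a.frakF A) x * a.F1 A α β x
  + ∑ n ∈ nullPhases 𝒜, ∑ T,
    (let dv := fun μ => pd μ (bg.phase n) x
     let Y := fun μ => -pol bg.g₀ (a.g3h T n) (bg.phase n) μ x + rh T n μ x
     trig T (bg.phase n x / lam) * (dv α * Y β + dv β * Y α))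

/-- `2 (R^{(1)}_mixed)_{αβ}`, where `re` is the value of `R̃^{(1,e,T,v)}`. -/
def twoR1mixed (lam : ℝ) (re : Bool → (𝒜 → ℤ) → Tensor2) : Tensor2 := fun α β x =>
  ∑ n ∈ mixedPhases 𝒜, ∑ T, trig T (bg.phase n x / lam) *
    (pair bg.g₀ (bg.phase n) (bg.phase n) x * a.g3e T n α β x + re T n α β x)

/-- `(∂_β Υ^ρ)^{(-1)}`. -/
def dUpsilon (lam : ℝ) (β ρ : Fin 4) : Scalar :=
  coeffAt bg lam ((profile bg).d β (upsilon bg a (profile bg) ρ)) (-1)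

/-- `R^{(1)}_{αβ}`. -/
def R1 (lam : ℝ) (r11 r12 : 𝒜 → Tensor2) (rh : Bool → (𝒜 → ℤ) → CoVec)
    (re : Bool → (𝒜 → ℤ) → Tensor2) : Tensor2 := fun α β x =>
  (1 / 2) * twoR1null bg a lam r11 r12 rh α β x + (1 / 2) * twoR1mixed bg a lam re α β x
    + (1 / 2) * ∑ ρ, (bg.g₀ ρ α x * dUpsilon bg a lam β ρ x
        + bg.g₀ ρ β x * dUpsilon bg a lam α ρ x)

/-- `g_λ` on the slab. -/
def gLam (lam : ℝ) : Tensor2 := metric bg a (actual bg lam)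

/-- `2 R^{(≥2)}_{αβ}`, where `r2` is the value of `R̃^{(2)}`. -/
def twoR2 (lam : ℝ) (r2 : Tensor2) : Tensor2 := fun α β x =>
  -boxTilde (gLam bg a lam) (a.h α β) x
  - ∑ A, Real.sin (bg.u A x / lam) * boxTilde (gLam bg a lam) (a.frakF A α β) x
  - lam * ∑ n ∈ nullPhases 𝒜, ∑ T, trig T (bg.phase n x / lam)
      * boxTilde (gLam bg a lam) (a.g3h T n α β) x
  - lam * ∑ n ∈ mixedPhases 𝒜, ∑ T, trig T (bg.phase n x / lam)
      * boxTilde (gLam bg a lam) (a.g3e T n α β) x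
  + r2 α β x
  + tail bg lam 2 (gaugeTerm pd (gLam bg a lam) α β)
      (gaugeTerm (profile bg).d (metric bg a (profile bg)) α β) x

end Terms

end

end MultiphaseRicci

/-! Relative to any torsion-free connection `Γ`, twice the Ricci tensor of a metric `g` is twice the
Ricci tensor of `Γ`, plus a part `lin2` linear in the second covariant derivatives of `g`, plus a
part `quad` quadratic in the first ones. This identity, `IsFrame.two_ricci_eq`, holds for every
family of derivations given by vector fields. It therefore applies both on the slab and on the space
of profiles `(s, x, θ)`, and it is used with two different connections.

The coefficients come from the Levi-Civita connection of `g₀`. The background then drops out of the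
covariant derivatives. On profiles the first derivatives of the metric are polynomials in `s`, and
the second ones are `s⁻¹` times polynomials. With the expansion of the inverse metric,
`hasExp_two_ricci` yields the coefficients of `λ⁻¹`, `λ⁰`, `λ¹` as multilinear sums over the terms
of the ansatz.

At order `-1` only `𝒫_{u_A}(F1_A)` occurs. It vanishes by the eikonal equation and the polarization.
More strongly, `F1_constraints` shows that `F1_A` is trace-free and annihilated by `L_A`, which
removes most words in all later products. At order `0`, `lin2_midDeriv` turns the derivatives of
`F1` into the transport operator, with the help of the wave gauge of `g₀`. The amplitudes with
factor `λ²` give `-𝒫_v`. The products of two `F1` are treated by product-to-sum formulas in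
`sum_products`: equal phases give the constant and the `cos 2θ` terms, distinct ones give `I0pm`.

At order `1` every term is explicit, or lies in a bracket, or belongs to the gauge vector `Υ`. The
predicate `Absorbed` does the bookkeeping: it is closed under linear operations, and product-to-sum
formulas show that only phases of `𝒩` and `ℐ` appear. Self-interactions at the phases `k u_A` have
the required form `∂_{(α}u Y_{β)}` thanks to the constraints, apart from the terms `S_{L_A L_A}
F1_A`, which the theorem lists. The brackets of order `1` contain neither `h` nor derivatives of `𝔉`
nor `𝔤^{(3,e)}`. The terms of this kind that remain are exactly the leading coefficients of `∂Υ`,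
computed in `sum_dUpsilon`.

The remainder comes from the zero connection, for which `2 Ric = -g^{ρσ}∂_ρ∂_σ g + gauge term +
quadratic part`. The quadratic part is a combination of monomials `g⁻¹g⁻¹∂g∂g`, and taking a tail is
linear. The tail of the principal part follows from a Leibniz rule for tails: the second derivatives
of `h`, `𝔉` and the `𝔤` form the operators `□̃`, and all other products fall in the bracket. The
gauge term is kept as a tail, and its expansion is inherited from the other three terms of the
identity. -/

namespace MultiphaseRicci
noncomputable section

/-! ## Derivations given by vector fields on a domain of unique differentiability -/

section Frame

variable {E : Type*} [NormedAddCommGroup E] [NormedSpace ℝ E]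

/-- On differentiable functions, `d μ` is the derivative along the vector field `V μ`. -/
structure IsFrame (d : Fin 4 → (E → ℝ) → E → ℝ) (D : Set E) (V : Fin 4 → E → E) : Prop where
  uniq : UniqueDiffOn ℝ D
  apply : ∀ μ f, ∀ p ∈ D, DifferentiableWithinAt ℝ f D p →
    d μ f p = fderivWithin ℝ f D p (V μ p)
  smooth : ∀ μ, ContDiffOn ℝ 1 (V μ) D

namespace IsFrame

variable {d : Fin 4 → (E → ℝ) → E → ℝ} {D : Set E} {V : Fin 4 → E → E} (H : IsFrame d D V)
include H

/-- The value of `d μ` is prescribed only on functions differentiable within `D`, so one side has to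
be known differentiable. Equality near `p` is enough, which matters because formulas involving the
inverse metric hold only where the determinant is nonzero. -/
lemma congr_of_eventuallyEq {f g : E → ℝ} {p : E} (hp : p ∈ D) (h : f =ᶠ[𝓝[D] p] g)
    (hg : DifferentiableWithinAt ℝ g D p) (μ : Fin 4) : d μ f p = d μ g p := by
  have e : f p = g p := h.self_of_nhdsWithin hp
  rw [H.apply μ f p hp (hg.congr_of_eventuallyEq h e), H.apply μ g p hp hg,
    h.fderivWithin_eq e]

lemma congr_on {f g : E → ℝ} {p : E} (hp : p ∈ D) (h : ∀ q ∈ D, f q = g q)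
    (hg : DifferentiableWithinAt ℝ g D p) (μ : Fin 4) : d μ f p = d μ g p :=
  H.congr_of_eventuallyEq hp (Filter.eventually_of_mem self_mem_nhdsWithin h) hg μ

lemma const (c : ℝ) {p : E} (hp : p ∈ D) (μ : Fin 4) : d μ (fun _ => c) p = 0 := by
  rw [H.apply μ _ p hp (differentiableWithinAt_const _)]; simp

lemma add {f g : E → ℝ} {p : E} (hp : p ∈ D) (hf : DifferentiableWithinAt ℝ f D p)
    (hg : DifferentiableWithinAt ℝ g D p) (μ : Fin 4) :
    d μ (fun q => f q + g q) p = d μ f p + d μ g p := by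
  rw [H.apply μ _ p hp (hf.fun_add hg), H.apply μ f p hp hf, H.apply μ g p hp hg,
    fderivWithin_fun_add (H.uniq p hp) hf hg]; rfl

lemma sub {f g : E → ℝ} {p : E} (hp : p ∈ D) (hf : DifferentiableWithinAt ℝ f D p)
    (hg : DifferentiableWithinAt ℝ g D p) (μ : Fin 4) :
    d μ (fun q => f q - g q) p = d μ f p - d μ g p := by
  rw [H.apply μ _ p hp (hf.fun_sub hg), H.apply μ f p hp hf, H.apply μ g p hp hg,
    fderivWithin_fun_sub (H.uniq p hp) hf hg]; rfl

lemma mul {f g : E → ℝ} {p : E} (hp : p ∈ D) (hf : DifferentiableWithinAt ℝ f D p)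
    (hg : DifferentiableWithinAt ℝ g D p) (μ : Fin 4) :
    d μ (fun q => f q * g q) p = d μ f p * g p + f p * d μ g p := by
  rw [H.apply μ _ p hp (hf.fun_mul hg), H.apply μ f p hp hf, H.apply μ g p hp hg,
    fderivWithin_fun_mul (H.uniq p hp) hf hg]
  simp; ring

lemma const_mul {f : E → ℝ} {p : E} (hp : p ∈ D) (c : ℝ) (hf : DifferentiableWithinAt ℝ f D p)
    (μ : Fin 4) : d μ (fun q => c * f q) p = c * d μ f p := by
  rw [H.mul hp (differentiableWithinAt_const c) hf, H.const c hp]; simp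

lemma sum {ι : Type*} {s : Finset ι} {f : ι → E → ℝ} {p : E} (hp : p ∈ D)
    (hf : ∀ i ∈ s, DifferentiableWithinAt ℝ (f i) D p) (μ : Fin 4) :
    d μ (fun q => ∑ i ∈ s, f i q) p = ∑ i ∈ s, d μ (f i) p := by
  rw [H.apply μ _ p hp (DifferentiableWithinAt.fun_sum hf), fderivWithin_fun_sum (H.uniq p hp) hf,
    sum_apply]
  exact Finset.sum_congr rfl fun i hi => (H.apply μ _ p hp (hf i hi)).symm

/-- Fields of class `C¹` suffice. For profiles the field contains `∂_μ u_A`, and `u_A` is only `C²`.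
-/
lemma contDiffOn {f : E → ℝ} (hf : ContDiffOn ℝ 2 f D) (μ : Fin 4) :
    ContDiffOn ℝ 1 (d μ f) D := by
  have h1 : ContDiffOn ℝ 1 (fderivWithin ℝ f D) D :=
    hf.fderivWithin H.uniq (by norm_num)
  refine (h1.clm_apply (H.smooth μ)).congr fun p hp => ?_
  exact H.apply μ f p hp ((hf p hp).differentiableWithinAt (by norm_num))

end IsFrame

end Frame

/-! ## Regularity and derivative of the inverse metric -/

section Inverse

variable {E : Type*} [NormedAddCommGroup E] [NormedSpace ℝ E] {D : Set E} {n : WithTop ℕ∞} {p : E}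

lemma contDiffWithinAt_det {ι : Type*} [Fintype ι] [DecidableEq ι] {M : ι → ι → E → ℝ}
    (hM : ∀ a b, ContDiffWithinAt ℝ n (M a b) D p) :
    ContDiffWithinAt ℝ n (fun q => (Matrix.of fun a b => M a b q).det) D p := by
  simp only [Matrix.det_apply', Matrix.of_apply]
  refine ContDiffWithinAt.sum fun σ _ => contDiffWithinAt_const.mul ?_
  exact contDiffWithinAt_prod fun i _ => hM _ _

variable {g : Fin 4 → Fin 4 → E → ℝ}

/-- Cramer's rule: an entry of the inverse is the inverse determinant times the determinant of the
matrix in which row `σ` is replaced by the unit vector of index `ρ`. Every smoothness exponent is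
covered, including `0`, where the conclusion is continuity. -/
lemma contDiffWithinAt_inv (hg : ∀ a b, ContDiffWithinAt ℝ n (g a b) D p)
    (hdet : (Matrix.of fun a b => g a b p).det ≠ 0) (ρ σ : Fin 4) :
    ContDiffWithinAt ℝ n (inv g ρ σ) D p := by
  have e : inv g ρ σ = fun q => ((Matrix.of fun a b => g a b q).det)⁻¹
      * (Matrix.of fun a b => if a = σ then (if b = ρ then (1 : ℝ) else 0) else g a b q).det := by
    funext q
    simp only [inv, Matrix.inv_def, Ring.inverse_eq_inv', Matrix.smul_apply, smul_eq_mul,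
      Matrix.adjugate_apply]
    congr 2
    ext a b
    by_cases h : a = σ
    · subst h; simp [Matrix.updateRow_self, Pi.single_apply]
    · simp [h]
  rw [e]
  refine ((contDiffWithinAt_det hg).inv hdet).mul (contDiffWithinAt_det fun a b => ?_)
  split_ifs
  exacts [contDiffWithinAt_const, contDiffWithinAt_const, hg a b]

lemma inv_mul_metric {X : Type*} {g : Fin 4 → Fin 4 → X → ℝ} {p : X}
    (hdet : (Matrix.of fun a b => g a b p).det ≠ 0) (ρ σ : Fin 4) :
    ∑ μ, inv g ρ μ p * g μ σ p = if ρ = σ then 1 else 0 := by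
  have := congrFun (congrFun (Matrix.nonsing_inv_mul (Matrix.of fun a b => g a b p)
    (isUnit_iff_ne_zero.2 hdet)) ρ) σ
  simpa [Matrix.mul_apply, Matrix.one_apply, inv] using this

lemma metric_mul_inv {X : Type*} {g : Fin 4 → Fin 4 → X → ℝ} {p : X}
    (hdet : (Matrix.of fun a b => g a b p).det ≠ 0) (ρ σ : Fin 4) :
    ∑ μ, g ρ μ p * inv g μ σ p = if ρ = σ then 1 else 0 := by
  have := congrFun (congrFun (Matrix.mul_nonsing_inv (Matrix.of fun a b => g a b p)
    (isUnit_iff_ne_zero.2 hdet)) ρ) σ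
  simpa [Matrix.mul_apply, Matrix.one_apply, inv] using this

lemma inv_symm {X : Type*} {g : Fin 4 → Fin 4 → X → ℝ} {p : X}
    (h : ∀ a b, g a b p = g b a p) (ρ σ : Fin 4) : inv g ρ σ p = inv g σ ρ p := by
  have e : (Matrix.of fun a b => g a b p).transpose = Matrix.of fun a b => g a b p := by
    ext a b; exact h b a
  have := congrFun (congrFun (Matrix.transpose_nonsing_inv (Matrix.of fun a b => g a b p)) σ) ρ
  rw [e] at this
  exact this

lemma eventually_det_ne_zero (hg : ∀ a b, ContinuousWithinAt (g a b) D p)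
    (hdet : (Matrix.of fun a b => g a b p).det ≠ 0) :
    ∀ᶠ q in 𝓝[D] p, (Matrix.of fun a b => g a b q).det ≠ 0 := by
  have : ContinuousWithinAt (fun q => (Matrix.of fun a b => g a b q).det) D p := by
    simp only [Matrix.det_apply', Matrix.of_apply]
    refine tendsto_finsetSum _ fun σ _ => Filter.Tendsto.const_mul _ ?_
    exact tendsto_finsetProd _ fun i _ => hg _ _
  exact this.eventually_ne hdet

end Inverse

/-! ## The Ricci tensor relative to a torsion-free connection -/

section Algebra

/-- `½ (k_{μνσ} + k_{νμσ} - k_{σμν})`. -/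
def lower (k : Fin 4 → Fin 4 → Fin 4 → ℝ) (μ ν σ : Fin 4) : ℝ :=
  (1 / 2) * (k μ ν σ + k ν μ σ - k σ μ ν)

/-- `G^{ρσ} (B_{ραβσ} + B_{ρβασ} - B_{ρσαβ} - B_{αβρσ})`: the part of twice the Ricci tensor which
is linear in the second derivatives `B` of the metric. -/
def lin2 (G : Fin 4 → Fin 4 → ℝ) (B : Fin 4 → Fin 4 → Fin 4 → Fin 4 → ℝ) (α β : Fin 4) : ℝ :=
  ∑ ρ, ∑ σ, G ρ σ * (B ρ α β σ + B ρ β α σ - B ρ σ α β - B α β ρ σ)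

/-- The part of twice the Ricci tensor which is quadratic in the first derivatives of the metric,
polarized. -/
def quad (G G' : Fin 4 → Fin 4 → ℝ) (k k' : Fin 4 → Fin 4 → Fin 4 → ℝ) (α β : Fin 4) : ℝ :=
  ∑ ρ, ∑ μ, ∑ σ, ∑ ν, G ρ μ * G' σ ν *
    (-2 * k ρ μ ν * lower k' α β σ + 2 * k α μ ν * lower k' ρ β σ
      + 2 * lower k ρ σ μ * lower k' α β ν - 2 * lower k α σ μ * lower k' ρ β ν)

/-- The Ricci tensor of a connection. -/
def ricciOf {X : Type*} (d : Fin 4 → (X → ℝ) → X → ℝ) (Γ : Fin 4 → Fin 4 → Fin 4 → X → ℝ)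
    (α β : Fin 4) : X → ℝ := fun x =>
  ∑ ρ, (d ρ (Γ ρ α β) x - d α (Γ ρ ρ β) x)
  + ∑ ρ, ∑ σ, (Γ ρ ρ σ x * Γ σ α β x - Γ ρ α σ x * Γ σ ρ β x)

/-- The covariant derivative of a 2-tensor. -/
def nab {X : Type*} (d : Fin 4 → (X → ℝ) → X → ℝ) (Γ : Fin 4 → Fin 4 → Fin 4 → X → ℝ)
    (g : Fin 4 → Fin 4 → X → ℝ) (μ a b : Fin 4) : X → ℝ := fun x =>
  d μ (g a b) x - ∑ ρ, (Γ ρ μ a x * g ρ b x + Γ ρ μ b x * g a ρ x)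

/-- The second covariant derivative of a 2-tensor. -/
def nab2 {X : Type*} (d : Fin 4 → (X → ℝ) → X → ℝ) (Γ : Fin 4 → Fin 4 → Fin 4 → X → ℝ)
    (g : Fin 4 → Fin 4 → X → ℝ) (κ μ a b : Fin 4) : X → ℝ := fun x =>
  d κ (nab d Γ g μ a b) x - ∑ ρ, (Γ ρ κ μ x * nab d Γ g ρ a b x
    + Γ ρ κ a x * nab d Γ g μ ρ b x + Γ ρ κ b x * nab d Γ g μ a ρ x)

/-- The covariant derivative of the difference of two connections. -/
lemma difference_derivative (G : Fin 4 → Fin 4 → ℝ) (Γ T : Fin 4 → Fin 4 → Fin 4 → ℝ)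
    (X : Fin 4 → Fin 4 → ℝ) (DT : Fin 4 → Fin 4 → Fin 4 → ℝ) (κ ρ μ ν : Fin 4) :
    ∑ σ, ((-X ρ σ - ∑ τ, (Γ ρ κ τ * G τ σ + Γ σ κ τ * G ρ τ)) * T μ ν σ
      + G ρ σ * (DT μ ν σ + ∑ τ, (Γ τ κ μ * T τ ν σ + Γ τ κ ν * T μ τ σ + Γ τ κ σ * T μ ν τ)))
    = (∑ σ, G ρ σ * DT μ ν σ - ∑ σ, X ρ σ * T μ ν σ)
      - ∑ τ, Γ ρ κ τ * (∑ σ, G τ σ * T μ ν σ) + ∑ τ, Γ τ κ μ * (∑ σ, G ρ σ * T τ ν σ)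
      + ∑ τ, Γ τ κ ν * (∑ σ, G ρ σ * T μ τ σ) := by
  simp only [Fin.sum_univ_four]; ring

/-- For the connection `Γ + C`, the products `ΓC` in the curvature cancel the connection terms that
turn ordinary derivatives of `C` into the covariant ones `DC`. One pair of connection terms has no
partner among these products and cancels by the symmetry of `Γ`. -/
lemma ricci_difference (Γ C : Fin 4 → Fin 4 → Fin 4 → ℝ) (DC : Fin 4 → Fin 4 → Fin 4 → Fin 4 → ℝ)
    (hΓ : ∀ ρ μ ν, Γ ρ μ ν = Γ ρ ν μ) (α β : Fin 4) :
    ∑ ρ, ((DC ρ ρ α β - ∑ τ, Γ ρ ρ τ * C τ α β + ∑ τ, Γ τ ρ α * C ρ τ β + ∑ τ, Γ τ ρ β * C ρ α τ)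
      - (DC α ρ ρ β - ∑ τ, Γ ρ α τ * C τ ρ β + ∑ τ, Γ τ α ρ * C ρ τ β + ∑ τ, Γ τ α β * C ρ ρ τ))
    + ∑ ρ, ∑ σ, ((Γ ρ ρ σ + C ρ ρ σ) * (Γ σ α β + C σ α β)
        - (Γ ρ α σ + C ρ α σ) * (Γ σ ρ β + C σ ρ β))
    = ∑ ρ, ∑ σ, (Γ ρ ρ σ * Γ σ α β - Γ ρ α σ * Γ σ ρ β)
      + (∑ ρ, (DC ρ ρ α β - DC α ρ ρ β)
        + ∑ ρ, ∑ σ, (C ρ ρ σ * C σ α β - C ρ α σ * C σ ρ β)) := by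
  have h1 : ∑ ρ, ∑ τ, Γ τ ρ α * C ρ τ β = ∑ ρ, ∑ τ, Γ τ α ρ * C ρ τ β := by
    simp only [hΓ _ _ α]
  have h2 : ∑ ρ, ∑ τ, Γ τ ρ β * C ρ α τ = ∑ ρ, ∑ σ, C ρ α σ * Γ σ ρ β := by
    simp only [mul_comm]
  have h3 : ∑ ρ, ∑ τ, Γ τ α β * C ρ ρ τ = ∑ ρ, ∑ σ, C ρ ρ σ * Γ σ α β := by
    simp only [mul_comm]
  simp only [Finset.sum_sub_distrib, Finset.sum_add_distrib, add_mul, mul_add]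
  rw [h1, h2, h3]
  ring

lemma sum_mul_sum_flat (G G' : Fin 4 → Fin 4 → ℝ) (S S' : Fin 4 → Fin 4 → Fin 4 → ℝ) :
    ∑ ρ, ∑ σ, (∑ μ, G ρ μ * S ρ σ μ) * (∑ ν, G' σ ν * S' ρ σ ν)
      = ∑ ρ, ∑ μ, ∑ σ, ∑ ν, G ρ μ * G' σ ν * (S ρ σ μ * S' ρ σ ν) := by
  refine Finset.sum_congr rfl fun ρ _ => ?_
  rw [Finset.sum_comm]
  refine Finset.sum_congr rfl fun σ _ => ?_
  rw [Finset.sum_mul]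
  refine Finset.sum_congr rfl fun μ _ => ?_
  rw [Finset.mul_sum]
  exact Finset.sum_congr rfl fun ν _ => by ring

/-- The difference tensor is `G · lower k`, and `-GkG` is the derivative of the inverse metric. The
second-order part has six terms. The contractions of `kk α ρ β σ` and `kk α σ ρ β` cancel by the
symmetries of `G` and of `kk` in its last two indices, and the other four make up `lin2`. Commuting
derivatives are not required. -/
lemma lin2_add_quad (G : Fin 4 → Fin 4 → ℝ) (hG : ∀ a b, G a b = G b a)
    (k : Fin 4 → Fin 4 → Fin 4 → ℝ) (kk : Fin 4 → Fin 4 → Fin 4 → Fin 4 → ℝ)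
    (hkk : ∀ κ μ a b, kk κ μ a b = kk κ μ b a) (α β : Fin 4) :
    2 * (∑ ρ, ((∑ σ, G ρ σ * lower (kk ρ) α β σ
          - ∑ σ, (∑ μ, ∑ ν, G ρ μ * k ρ μ ν * G ν σ) * lower k α β σ)
        - (∑ σ, G ρ σ * lower (kk α) ρ β σ
          - ∑ σ, (∑ μ, ∑ ν, G ρ μ * k α μ ν * G ν σ) * lower k ρ β σ))
      + ∑ ρ, ∑ σ, ((∑ μ, G ρ μ * lower k ρ σ μ) * (∑ ν, G σ ν * lower k α β ν)
          - (∑ μ, G ρ μ * lower k α σ μ) * (∑ ν, G σ ν * lower k ρ β ν)))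
    = lin2 G kk α β + quad G G k k α β := by
  have flat : ∀ Y Z : Fin 4 → Fin 4 → Fin 4 → ℝ,
      ∑ ρ, ∑ σ, (∑ μ, ∑ ν, G ρ μ * Y ρ μ ν * G ν σ) * Z ρ σ σ
        = ∑ ρ, ∑ μ, ∑ σ, ∑ ν, G ρ μ * G σ ν * (Y ρ μ ν * Z ρ σ σ) := by
    intro Y Z
    refine Finset.sum_congr rfl fun ρ _ => ?_
    rw [Finset.sum_comm]
    refine Finset.sum_congr rfl fun σ _ => ?_
    simp only [Finset.sum_mul]
    refine Finset.sum_congr rfl fun μ _ => Finset.sum_congr rfl fun ν _ => ?_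
    rw [hG ν σ]; ring
  have l1 : 2 * (∑ ρ, ∑ σ, G ρ σ * lower (kk ρ) α β σ - ∑ ρ, ∑ σ, G ρ σ * lower (kk α) ρ β σ)
      = lin2 G kk α β := by
    have e : ∑ ρ, ∑ σ, G ρ σ * kk α ρ β σ = ∑ ρ, ∑ σ, G ρ σ * kk α σ ρ β := by
      rw [Finset.sum_comm]
      refine Finset.sum_congr rfl fun σ _ => Finset.sum_congr rfl fun ρ _ => ?_
      rw [hG, hkk α ρ]
    simp only [lin2, lower, mul_add, mul_sub, Finset.sum_add_distrib, Finset.sum_sub_distrib,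
      mul_left_comm _ (1 / 2 : ℝ), ← Finset.mul_sum] at e ⊢
    linear_combination (-1) * e
  have f1 := flat k (fun _ σ _ => lower k α β σ)
  have f2 := flat (fun _ => k α) (fun ρ σ _ => lower k ρ β σ)
  have f3 := sum_mul_sum_flat G G (fun ρ σ μ => lower k ρ σ μ) (fun _ _ ν => lower k α β ν)
  have f4 := sum_mul_sum_flat G G (fun _ σ μ => lower k α σ μ) (fun ρ _ ν => lower k ρ β ν)
  have q : quad G G k k α β = 2 * (- (∑ ρ, ∑ μ, ∑ σ, ∑ ν, G ρ μ * G σ ν * (k ρ μ ν * lower k α β σ))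
      + (∑ ρ, ∑ μ, ∑ σ, ∑ ν, G ρ μ * G σ ν * (k α μ ν * lower k ρ β σ))
      + (∑ ρ, ∑ μ, ∑ σ, ∑ ν, G ρ μ * G σ ν * (lower k ρ σ μ * lower k α β ν))
      - (∑ ρ, ∑ μ, ∑ σ, ∑ ν, G ρ μ * G σ ν * (lower k α σ μ * lower k ρ β ν))) := by
    simp only [quad, ← Finset.sum_neg_distrib, ← Finset.sum_add_distrib, ← Finset.sum_sub_distrib,
      Finset.mul_sum]
    refine Finset.sum_congr rfl fun ρ _ => Finset.sum_congr rfl fun μ _ =>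
      Finset.sum_congr rfl fun σ _ => Finset.sum_congr rfl fun ν _ => ?_
    ring
  rw [q, ← f1, ← f2, ← f3, ← f4, ← l1]
  simp only [Finset.sum_sub_distrib]
  ring

end Algebra

/-! ### Christoffel symbols and curvature along a frame of derivations -/

section Comparison

variable {E : Type*} [NormedAddCommGroup E] [NormedSpace ℝ E]
  {d : Fin 4 → (E → ℝ) → E → ℝ} {D : Set E} {V : Fin 4 → E → E}
  {g : Fin 4 → Fin 4 → E → ℝ} {Γ : Fin 4 → Fin 4 → Fin 4 → E → ℝ} {p : E}

/-- The derivative of the inverse metric. -/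
lemma IsFrame.deriv_inv (H : IsFrame d D V) (hg : ∀ a b, ContDiffOn ℝ 1 (g a b) D) (hp : p ∈ D)
    (hdet : (Matrix.of fun a b => g a b p).det ≠ 0) (κ ρ σ : Fin 4) :
    d κ (inv g ρ σ) p = -∑ μ, ∑ ν, inv g ρ μ p * d κ (g μ ν) p * inv g ν σ p := by
  have dg : ∀ a b, DifferentiableWithinAt ℝ (g a b) D p := fun a b =>
    (hg a b p hp).differentiableWithinAt (by norm_num)
  have di : ∀ a b, DifferentiableWithinAt ℝ (inv g a b) D p := fun a b =>
    (contDiffWithinAt_inv (fun a b => hg a b p hp) hdet a b).differentiableWithinAt (by norm_num)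
  -- The product `g g⁻¹` is constant near `p` within `D`, so the Leibniz rule gives zero. The result
  -- is then solved for the derivative of `g⁻¹`.
  have key : ∀ μ, ∑ ν, (d κ (g μ ν) p * inv g ν σ p + g μ ν p * d κ (inv g ν σ) p) = 0 := by
    intro μ
    have e : (fun q => ∑ ν, g μ ν q * inv g ν σ q) =ᶠ[𝓝[D] p]
        fun _ => if μ = σ then 1 else 0 := by
      filter_upwards [eventually_det_ne_zero (fun a b => (hg a b p hp).continuousWithinAt) hdet]
        with q hq
      exact metric_mul_inv hq μ σ
    have := H.congr_of_eventuallyEq hp e (differentiableWithinAt_const _) κ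
    rw [H.const _ hp, H.sum hp (fun ν _ => (dg μ ν).fun_mul (di ν σ))] at this
    rw [← this]
    exact Finset.sum_congr rfl fun ν _ => (H.mul hp (dg μ ν) (di ν σ) κ).symm
  have k2 : ∀ μ, ∑ ν, g μ ν p * d κ (inv g ν σ) p = -∑ ν, d κ (g μ ν) p * inv g ν σ p := by
    intro μ
    have := key μ
    rw [Finset.sum_add_distrib] at this
    linarith
  calc d κ (inv g ρ σ) p = ∑ ν, (if ρ = ν then 1 else 0) * d κ (inv g ν σ) p := by simp
    _ = ∑ ν, (∑ μ, inv g ρ μ p * g μ ν p) * d κ (inv g ν σ) p := by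
        simp only [inv_mul_metric hdet]
    _ = ∑ μ, inv g ρ μ p * ∑ ν, g μ ν p * d κ (inv g ν σ) p := by
        simp only [Finset.sum_mul, Finset.mul_sum]
        rw [Finset.sum_comm]
        simp only [mul_assoc]
    _ = _ := by
        simp only [k2, Finset.mul_sum, mul_neg, Finset.sum_neg_distrib, mul_assoc]

/-- The Christoffel symbols relative to a torsion-free connection. -/
lemma christoffel_eq (hgs : ∀ a b, g a b p = g b a p)
    (hΓs : ∀ ρ μ ν, Γ ρ μ ν p = Γ ρ ν μ p)
    (hdet : (Matrix.of fun a b => g a b p).det ≠ 0) (ρ μ ν : Fin 4) :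
    christoffel d g ρ μ ν p
      = Γ ρ μ ν p + ∑ σ, inv g ρ σ p * lower (fun μ a b => nab d Γ g μ a b p) μ ν σ := by
  -- Writing each derivative as `nab` plus connection terms produces six sums. Four of them cancel
  -- in pairs by symmetry, and the remaining two coincide.
  have e : ∀ σ, d μ (g ν σ) p + d ν (g μ σ) p - d σ (g μ ν) p
      = 2 * lower (fun μ a b => nab d Γ g μ a b p) μ ν σ + 2 * ∑ τ, g σ τ p * Γ τ μ ν p := by
    intro σ
    simp only [lower, nab, Finset.sum_add_distrib]
    have e1 : ∑ τ, Γ τ μ ν p * g τ σ p = ∑ τ, g σ τ p * Γ τ μ ν p :=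
      Finset.sum_congr rfl fun τ _ => by rw [hgs]; ring
    have e2 : ∑ τ, Γ τ ν μ p * g τ σ p = ∑ τ, g σ τ p * Γ τ μ ν p :=
      Finset.sum_congr rfl fun τ _ => by rw [hgs, hΓs]; ring
    have e3 : ∑ τ, Γ τ μ σ p * g ν τ p = ∑ τ, Γ τ σ μ p * g τ ν p :=
      Finset.sum_congr rfl fun τ _ => by rw [hgs, hΓs]
    have e4 : ∑ τ, Γ τ ν σ p * g μ τ p = ∑ τ, Γ τ σ ν p * g μ τ p :=
      Finset.sum_congr rfl fun τ _ => by rw [hΓs]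
    rw [e1, e2, e3, e4]
    ring
  have i : ∑ σ, inv g ρ σ p * ∑ τ, g σ τ p * Γ τ μ ν p = Γ ρ μ ν p := by
    calc _ = ∑ τ, (∑ σ, inv g ρ σ p * g σ τ p) * Γ τ μ ν p := by
          simp only [Finset.sum_mul, Finset.mul_sum]
          rw [Finset.sum_comm]
          simp only [mul_assoc]
      _ = _ := by simp [inv_mul_metric hdet]
  simp only [christoffel, e]
  rw [← i]
  simp only [mul_add, Finset.sum_add_distrib, mul_left_comm _ (2 : ℝ), ← Finset.mul_sum]
  ring

/-- The Ricci tensor of a metric relative to a torsion-free connection. -/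
theorem IsFrame.two_ricci_eq (H : IsFrame d D V) (hg : ∀ a b, ContDiffOn ℝ 2 (g a b) D)
    (hgs : ∀ q ∈ D, ∀ a b, g a b q = g b a q)
    (hΓ : ∀ ρ μ ν, ContDiffOn ℝ 1 (Γ ρ μ ν) D)
    (hΓs : ∀ q ∈ D, ∀ ρ μ ν, Γ ρ μ ν q = Γ ρ ν μ q) (hp : p ∈ D)
    (hdet : (Matrix.of fun a b => g a b p).det ≠ 0) (α β : Fin 4) :
    2 * ricci d g α β p = 2 * ricciOf d Γ α β p
      + lin2 (fun ρ σ => inv g ρ σ p) (fun κ μ a b => nab2 d Γ g κ μ a b p) α β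
      + quad (fun ρ σ => inv g ρ σ p) (fun ρ σ => inv g ρ σ p)
          (fun μ a b => nab d Γ g μ a b p) (fun μ a b => nab d Γ g μ a b p) α β := by
  have hg1 : ∀ a b, ContDiffOn ℝ 1 (g a b) D := fun a b => (hg a b).of_le (by norm_num)
  have dg : ∀ a b, ∀ q ∈ D, DifferentiableWithinAt ℝ (g a b) D q := fun a b q hq =>
    (hg a b q hq).differentiableWithinAt (by norm_num)
  have hgs' : ∀ q ∈ D, ∀ μ a b, d μ (g a b) q = d μ (g b a) q := fun q hq μ a b =>
    H.congr_on hq (fun q hq => hgs q hq a b) (dg b a q hq) μ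
  have cK : ∀ μ a b, ContDiffOn ℝ 1 (nab d Γ g μ a b) D := by
    intro μ a b
    refine (H.contDiffOn (hg a b) μ).sub (ContDiffOn.sum fun ρ _ => ?_)
    exact ((hΓ _ _ _).mul (hg1 _ _)).add ((hΓ _ _ _).mul (hg1 _ _))
  have dK : ∀ μ a b, DifferentiableWithinAt ℝ (nab d Γ g μ a b) D p := fun μ a b =>
    (cK μ a b p hp).differentiableWithinAt (by norm_num)
  have dΓ : ∀ ρ μ ν, DifferentiableWithinAt ℝ (Γ ρ μ ν) D p := fun ρ μ ν =>
    (hΓ ρ μ ν p hp).differentiableWithinAt (by norm_num)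
  have Ks : ∀ q ∈ D, ∀ μ a b, nab d Γ g μ a b q = nab d Γ g μ b a q := by
    intro q hq μ a b
    simp only [nab, hgs' q hq μ a b]
    congr 1
    refine Finset.sum_congr rfl fun ρ _ => ?_
    rw [hgs q hq ρ b, hgs q hq a ρ]; ring
  have di : ∀ a b, DifferentiableWithinAt ℝ (inv g a b) D p := fun a b =>
    (contDiffWithinAt_inv (fun a b => hg1 a b p hp) hdet a b).differentiableWithinAt (by norm_num)
  have is : ∀ a b, inv g a b p = inv g b a p := inv_symm (hgs p hp)
  -- the derivative of the inverse metric in terms of the connection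
  have dinv : ∀ κ ρ σ, d κ (inv g ρ σ) p
      = -(∑ μ, ∑ ν, inv g ρ μ p * nab d Γ g κ μ ν p * inv g ν σ p)
        - ∑ τ, (Γ ρ κ τ p * inv g τ σ p + Γ σ κ τ p * inv g ρ τ p) := by
    intro κ ρ σ
    rw [H.deriv_inv hg1 hp hdet]
    have e1 : ∑ μ, ∑ ν, inv g ρ μ p * (∑ τ, Γ τ κ μ p * g τ ν p) * inv g ν σ p
        = ∑ τ, Γ σ κ τ p * inv g ρ τ p := by
      refine Finset.sum_congr rfl fun μ _ => ?_
      calc _ = inv g ρ μ p * ∑ τ, Γ τ κ μ p * ∑ ν, g τ ν p * inv g ν σ p := by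
            simp only [Finset.sum_mul, Finset.mul_sum]
            rw [Finset.sum_comm]
            refine Finset.sum_congr rfl fun _ _ => Finset.sum_congr rfl fun _ _ => by ring
        _ = _ := by simp [metric_mul_inv hdet]; ring
    have e2 : ∑ μ, ∑ ν, inv g ρ μ p * (∑ τ, Γ τ κ ν p * g μ τ p) * inv g ν σ p
        = ∑ τ, Γ ρ κ τ p * inv g τ σ p := by
      rw [Finset.sum_comm]
      refine Finset.sum_congr rfl fun ν _ => ?_
      calc _ = (∑ τ, Γ τ κ ν p * ∑ μ, inv g ρ μ p * g μ τ p) * inv g ν σ p := by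
            simp only [Finset.sum_mul, Finset.mul_sum]
            rw [Finset.sum_comm]
            refine Finset.sum_congr rfl fun _ _ => Finset.sum_congr rfl fun _ _ => by ring
        _ = _ := by simp [inv_mul_metric hdet]
    rw [Finset.sum_add_distrib, ← e1, ← e2]
    simp only [nab, mul_sub, sub_mul, Finset.sum_sub_distrib, Finset.sum_add_distrib, mul_add,
      add_mul]
    ring
  set T : Fin 4 → Fin 4 → Fin 4 → E → ℝ := fun μ ν σ q =>
    lower (fun μ a b => nab d Γ g μ a b q) μ ν σ with hT
  have dT : ∀ μ ν σ, DifferentiableWithinAt ℝ (T μ ν σ) D p := fun μ ν σ =>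
    (((dK _ _ _).fun_add (dK _ _ _)).fun_sub (dK _ _ _)).const_mul _
  have dT' : ∀ κ μ ν σ, d κ (T μ ν σ) p = lower (fun μ a b => nab2 d Γ g κ μ a b p) μ ν σ
      + ∑ τ, (Γ τ κ μ p * T τ ν σ p + Γ τ κ ν p * T μ τ σ p + Γ τ κ σ p * T μ ν τ p) := by
    intro κ μ ν σ
    have : d κ (T μ ν σ) p = lower (fun μ a b => d κ (nab d Γ g μ a b) p) μ ν σ := by
      simp only [hT, lower]
      rw [H.const_mul hp _ (((dK _ _ _).fun_add (dK _ _ _)).fun_sub (dK _ _ _)),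
        H.sub hp ((dK _ _ _).fun_add (dK _ _ _)) (dK _ _ _), H.add hp (dK _ _ _) (dK _ _ _)]
    rw [this]
    simp only [hT, lower, nab2]
    simp only [Fin.sum_univ_four]
    ring
  -- The metric is assumed invertible only at `p`, so the comparison of Christoffel symbols is
  -- available near `p` and is differentiated as a local identity.
  have cE : ∀ ρ μ ν, christoffel d g ρ μ ν =ᶠ[𝓝[D] p]
      fun q => Γ ρ μ ν q + ∑ σ, inv g ρ σ q * T μ ν σ q := by
    intro ρ μ ν
    filter_upwards [eventually_det_ne_zero (fun a b => (hg a b p hp).continuousWithinAt) hdet,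
      self_mem_nhdsWithin] with q hq hqD
    exact christoffel_eq (hgs q hqD) (hΓs q hqD) hq ρ μ ν
  have cP : ∀ ρ μ ν, christoffel d g ρ μ ν p = Γ ρ μ ν p + ∑ σ, inv g ρ σ p * T μ ν σ p :=
    fun ρ μ ν => (cE ρ μ ν).self_of_nhdsWithin hp
  have dC : ∀ κ ρ μ ν, d κ (christoffel d g ρ μ ν) p = d κ (Γ ρ μ ν) p
      + ((∑ σ, inv g ρ σ p * lower (fun μ a b => nab2 d Γ g κ μ a b p) μ ν σ
        - ∑ σ, (∑ m, ∑ n, inv g ρ m p * nab d Γ g κ m n p * inv g n σ p) * T μ ν σ p)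
      - ∑ τ, Γ ρ κ τ p * (∑ σ, inv g τ σ p * T μ ν σ p)
      + ∑ τ, Γ τ κ μ p * (∑ σ, inv g ρ σ p * T τ ν σ p)
      + ∑ τ, Γ τ κ ν p * (∑ σ, inv g ρ σ p * T μ τ σ p)) := by
    intro κ ρ μ ν
    have dS : DifferentiableWithinAt ℝ (fun q => ∑ σ, inv g ρ σ q * T μ ν σ q) D p :=
      DifferentiableWithinAt.fun_sum fun σ _ => (di ρ σ).fun_mul (dT μ ν σ)
    rw [H.congr_of_eventuallyEq hp (cE ρ μ ν) ((dΓ ρ μ ν).fun_add dS) κ, H.add hp (dΓ ρ μ ν) dS,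
      H.sum hp (fun σ _ => (di ρ σ).fun_mul (dT μ ν σ))]
    simp only [H.mul hp (di ρ _) (dT μ ν _), dinv, dT']
    congr 1
    exact difference_derivative (fun a b => inv g a b p) (fun a b c => Γ a b c p)
      (fun a b c => T a b c p)
      (fun ρ σ => ∑ m, ∑ n, inv g ρ m p * nab d Γ g κ m n p * inv g n σ p)
      (fun μ ν σ => lower (fun μ a b => nab2 d Γ g κ μ a b p) μ ν σ) κ ρ μ ν
  have kks : ∀ κ μ a b, nab2 d Γ g κ μ a b p = nab2 d Γ g κ μ b a p := by
    intro κ μ a b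
    simp only [nab2]
    rw [H.congr_on hp (fun q hq => Ks q hq μ a b) (dK μ b a) κ]
    congr 1
    refine Finset.sum_congr rfl fun ρ _ => ?_
    rw [Ks p hp ρ a b, Ks p hp μ ρ b, Ks p hp μ a ρ]; ring
  have fin := ricci_difference (fun a b c => Γ a b c p)
    (fun ρ μ ν => ∑ σ, inv g ρ σ p * T μ ν σ p)
    (fun κ ρ μ ν => ∑ σ, inv g ρ σ p * lower (fun μ a b => nab2 d Γ g κ μ a b p) μ ν σ
        - ∑ σ, (∑ m, ∑ n, inv g ρ m p * nab d Γ g κ m n p * inv g n σ p) * T μ ν σ p)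
    (fun ρ μ ν => hΓs p hp ρ μ ν) α β
  have fin2 := lin2_add_quad (fun a b => inv g a b p) is (fun μ a b => nab d Γ g μ a b p)
    (fun κ μ a b => nab2 d Γ g κ μ a b p) kks α β
  have r := Eq.trans (a := ricci d g α β p - ∑ ρ, (d ρ (Γ ρ α β) p - d α (Γ ρ ρ β) p)) (by
    simp only [ricci, cP, dC, Finset.sum_sub_distrib, Finset.sum_add_distrib]
    ring) fin
  rw [add_assoc, ← fin2, ricciOf, ← mul_add, add_assoc]
  linear_combination 2 * r

end Comparison


/-! ## The Ricci tensor and the wave gauge -/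

section WaveGauge

/-- The first order terms of `2 R_{αβ} + g^{ρσ} ∂_ρ ∂_σ g_{αβ}` modulo the gauge term. -/
def reducedQuad (G : Fin 4 → Fin 4 → ℝ) (K : Fin 4 → Fin 4 → Fin 4 → ℝ) (α β : Fin 4) : ℝ :=
  quad G G K K α β
    + (∑ μ, ∑ ν, (∑ m, ∑ n, G μ m * K β m n * G n ν) * lower K μ ν α
      + ∑ μ, ∑ ν, (∑ m, ∑ n, G μ m * K α m n * G n ν) * lower K μ ν β)
    - ∑ ρ, (∑ μ, ∑ ν, G μ ν * ∑ σ, G ρ σ * lower K μ ν σ) * (K ρ α β - K β ρ α - K α ρ β)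

/-- Contracting `lower` gives a divergence minus half the gradient of a trace. When derivatives
commute, the two half traces add up to the last term of `lin2`, so all of `lin2` except the wave
operator is the second-order part of the gauge term. -/
lemma reduced_second_order (G : Fin 4 → Fin 4 → ℝ) (hG : ∀ a b, G a b = G b a)
    (B : Fin 4 → Fin 4 → Fin 4 → Fin 4 → ℝ) (h1 : ∀ κ μ a b, B κ μ a b = B μ κ a b)
    (h2 : ∀ κ μ a b, B κ μ a b = B κ μ b a) (α β : Fin 4) :
    lin2 G B α β = -∑ ρ, ∑ σ, G ρ σ * B ρ σ α β
      + (∑ μ, ∑ ν, G μ ν * lower (B β) μ ν α + ∑ μ, ∑ ν, G μ ν * lower (B α) μ ν β) := by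
  have e1 : ∑ μ, ∑ ν, G μ ν * B β ν μ α = ∑ μ, ∑ ν, G μ ν * B β μ ν α := by
    rw [Finset.sum_comm]; simp only [hG]
  have e2 : ∑ μ, ∑ ν, G μ ν * B α ν μ β = ∑ μ, ∑ ν, G μ ν * B α μ ν β := by
    rw [Finset.sum_comm]; simp only [hG]
  have e3 : ∑ μ, ∑ ν, G μ ν * B μ α β ν = ∑ μ, ∑ ν, G μ ν * B α μ ν β := by
    simp only [h1 _ α, h2 _ _ β]
  have e4 : ∑ μ, ∑ ν, G μ ν * B μ β α ν = ∑ μ, ∑ ν, G μ ν * B β μ ν α := by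
    simp only [h1 _ β, h2 _ _ α]
  have e5 : ∑ μ, ∑ ν, G μ ν * B β α μ ν = ∑ μ, ∑ ν, G μ ν * B α β μ ν := by
    simp only [h1 β α]
  simp only [lin2, lower, mul_add, mul_sub, Finset.sum_add_distrib, Finset.sum_sub_distrib,
      mul_left_comm _ (1 / 2 : ℝ), ← Finset.mul_sum]
  rw [e1, e2, e3, e4, e5]
  ring

variable {E : Type*} [NormedAddCommGroup E] [NormedSpace ℝ E]
  {d : Fin 4 → (E → ℝ) → E → ℝ} {D : Set E} {V : Fin 4 → E → E}
  {g : Fin 4 → Fin 4 → E → ℝ} {p : E}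

/-- The derivative of the gauge term, with lowered index. -/
lemma IsFrame.lowered_deriv_gaugeH (H : IsFrame d D V) (hg : ∀ a b, ContDiffOn ℝ 2 (g a b) D)
    (hgs : ∀ q ∈ D, ∀ a b, g a b q = g b a q) (hp : p ∈ D)
    (hdet : (Matrix.of fun a b => g a b p).det ≠ 0) (α β : Fin 4) :
    ∑ ρ, g ρ α p * d β (gaugeH d g ρ) p
      = ∑ μ, ∑ ν, inv g μ ν p * lower (fun μ a b => d β (d μ (g a b)) p) μ ν α
        - ∑ μ, ∑ ν, (∑ m, ∑ n, inv g μ m p * d β (g m n) p * inv g n ν p)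
            * lower (fun μ a b => d μ (g a b) p) μ ν α
        - ∑ ρ, d β (g ρ α) p * gaugeH d g ρ p := by
  have hg1 : ∀ a b, ContDiffOn ℝ 1 (g a b) D := fun a b => (hg a b).of_le (by norm_num)
  have dg : ∀ a b, DifferentiableWithinAt ℝ (g a b) D p := fun a b =>
    (hg a b p hp).differentiableWithinAt (by norm_num)
  have dK : ∀ μ a b, DifferentiableWithinAt ℝ (d μ (g a b)) D p := fun μ a b =>
    (H.contDiffOn (hg a b) μ p hp).differentiableWithinAt (by norm_num)
  have di : ∀ a b, DifferentiableWithinAt ℝ (inv g a b) D p := fun a b =>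
    (contDiffWithinAt_inv (fun a b => hg1 a b p hp) hdet a b).differentiableWithinAt (by norm_num)
  have dT : ∀ μ ν σ, DifferentiableWithinAt ℝ
      (fun q => lower (fun μ a b => d μ (g a b) q) μ ν σ) D p := fun μ ν σ =>
    (((dK _ _ _).fun_add (dK _ _ _)).fun_sub (dK _ _ _)).const_mul _
  have dH : ∀ ρ, DifferentiableWithinAt ℝ (gaugeH d g ρ) D p := fun ρ =>
    DifferentiableWithinAt.fun_sum fun μ _ => DifferentiableWithinAt.fun_sum fun ν _ =>
      (di μ ν).fun_mul ((DifferentiableWithinAt.fun_sum fun σ _ => (di ρ σ).fun_mul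
        (((dK _ _ _).fun_add (dK _ _ _)).fun_sub (dK _ _ _))).const_mul _)
  -- Lowering the index before differentiating cancels the outer inverse metric, so that `∂g⁻¹`
  -- enters only once.
  have e : (fun q => ∑ ρ, g ρ α q * gaugeH d g ρ q) =ᶠ[𝓝[D] p]
      fun q => ∑ μ, ∑ ν, inv g μ ν q * lower (fun μ a b => d μ (g a b) q) μ ν α := by
    filter_upwards [eventually_det_ne_zero (fun a b => (hg a b p hp).continuousWithinAt) hdet,
      self_mem_nhdsWithin] with q hq hqD
    have l : ∀ μ ν, ∑ ρ, g ρ α q * christoffel d g ρ μ ν q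
        = lower (fun μ a b => d μ (g a b) q) μ ν α := by
      intro μ ν
      calc _ = ∑ σ, (∑ ρ, g α ρ q * inv g ρ σ q)
              * lower (fun μ a b => d μ (g a b) q) μ ν σ := by
            simp only [christoffel, lower, Finset.mul_sum, Finset.sum_mul]
            rw [Finset.sum_comm]
            refine Finset.sum_congr rfl fun σ _ => Finset.sum_congr rfl fun ρ _ => ?_
            rw [hgs q hqD ρ α]; ring
        _ = _ := by simp [metric_mul_inv hq]
    simp only [← l, gaugeH, Finset.mul_sum]
    rw [Finset.sum_comm]
    refine Finset.sum_congr rfl fun μ _ => ?_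
    rw [Finset.sum_comm]
    refine Finset.sum_congr rfl fun ν _ => Finset.sum_congr rfl fun ρ _ => by ring
  have key := H.congr_of_eventuallyEq hp e
    (DifferentiableWithinAt.fun_sum fun μ _ => DifferentiableWithinAt.fun_sum fun ν _ =>
      (di μ ν).fun_mul (dT μ ν α)) β
  rw [H.sum hp (fun ρ _ => (dg ρ α).fun_mul (dH ρ)), H.sum hp (fun μ _ =>
    DifferentiableWithinAt.fun_sum fun ν _ => (di μ ν).fun_mul (dT μ ν α))] at key
  have dT' : ∀ μ ν, d β (fun q => lower (fun μ a b => d μ (g a b) q) μ ν α) p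
      = lower (fun μ a b => d β (d μ (g a b)) p) μ ν α := by
    intro μ ν
    simp only [lower]
    rw [H.const_mul hp _ (((dK _ _ _).fun_add (dK _ _ _)).fun_sub (dK _ _ _)),
      H.sub hp ((dK _ _ _).fun_add (dK _ _ _)) (dK _ _ _), H.add hp (dK _ _ _) (dK _ _ _)]
  have r : ∀ μ, d β (fun q => ∑ ν, inv g μ ν q * lower (fun μ a b => d μ (g a b) q) μ ν α) p
      = ∑ ν, (-(∑ m, ∑ n, inv g μ m p * d β (g m n) p * inv g n ν p)
          * lower (fun μ a b => d μ (g a b) p) μ ν α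
        + inv g μ ν p * lower (fun μ a b => d β (d μ (g a b)) p) μ ν α) := by
    intro μ
    rw [H.sum hp fun ν _ => (di μ ν).fun_mul (dT μ ν α)]
    refine Finset.sum_congr rfl fun ν _ => ?_
    rw [H.mul hp (di μ ν) (dT μ ν α), H.deriv_inv hg1 hp hdet, dT']
  simp only [r, H.mul hp (dg _ α) (dH _), Finset.sum_add_distrib, neg_mul,
    Finset.sum_neg_distrib] at key
  linarith

/-- Twice the Ricci tensor is `-g^{ρσ} ∂_ρ ∂_σ g_{αβ}` plus the gauge term plus a quadratic form in
the first derivatives of the metric. -/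
theorem IsFrame.two_ricci_eq_gauge (H : IsFrame d D V) (hg : ∀ a b, ContDiffOn ℝ 2 (g a b) D)
    (hgs : ∀ q ∈ D, ∀ a b, g a b q = g b a q) (hp : p ∈ D)
    (hdet : (Matrix.of fun a b => g a b p).det ≠ 0)
    (hcomm : ∀ κ μ a b, d κ (d μ (g a b)) p = d μ (d κ (g a b)) p) (α β : Fin 4) :
    2 * ricci d g α β p = -∑ ρ, ∑ σ, inv g ρ σ p * d ρ (d σ (g α β)) p + gaugeTerm d g α β p
      + reducedQuad (fun ρ σ => inv g ρ σ p) (fun μ a b => d μ (g a b) p) α β := by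
  -- For the zero connection the covariant derivatives are the frame derivatives, and the curvature
  -- term is absent.
  have z1 : ∀ μ a b, nab d (fun _ _ _ _ => 0) g μ a b = d μ (g a b) := by
    intro μ a b; funext q; simp [nab]
  have z2 : ∀ κ μ a b, nab2 d (fun _ _ _ _ => 0) g κ μ a b p = d κ (d μ (g a b)) p := by
    intro κ μ a b; simp [nab2, z1]
  have z3 : ricciOf d (fun _ _ _ _ => 0) α β p = 0 := by
    simp [ricciOf, H.const 0 hp]
  have dg : ∀ a b, ∀ q ∈ D, DifferentiableWithinAt ℝ (g a b) D q := fun a b q hq =>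
    (hg a b q hq).differentiableWithinAt (by norm_num)
  have dK : ∀ μ a b, DifferentiableWithinAt ℝ (d μ (g a b)) D p := fun μ a b =>
    (H.contDiffOn (hg a b) μ p hp).differentiableWithinAt (by norm_num)
  have hgs2 : ∀ κ μ a b, d κ (d μ (g a b)) p = d κ (d μ (g b a)) p := fun κ μ a b =>
    H.congr_on hp (fun q hq => H.congr_on hq (fun q hq => hgs q hq a b) (dg b a q hq) μ)
      (dK μ b a) κ
  have main := H.two_ricci_eq (Γ := fun _ _ _ _ => 0) hg hgs (fun _ _ _ => contDiffOn_const)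
    (fun _ _ _ _ _ => rfl) hp hdet α β
  simp only [z1, z2, z3] at main
  rw [reduced_second_order _ (inv_symm (hgs p hp)) _ hcomm hgs2] at main
  have g1 := H.lowered_deriv_gaugeH hg hgs hp hdet α β
  have g2 := H.lowered_deriv_gaugeH hg hgs hp hdet β α
  -- This accounts for `H^ρ ∂_ρ g_{αβ}` and for the terms in which lowering the index lets the
  -- derivative fall on `g`. Both are quadratic in first derivatives and form the last sum of
  -- `reducedQuad`.
  have q : ∑ ρ, (∑ μ, ∑ ν, inv g μ ν p * ∑ σ, inv g ρ σ p *
        lower (fun μ a b => d μ (g a b) p) μ ν σ)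
        * (d ρ (g α β) p - d β (g ρ α) p - d α (g ρ β) p)
      = ∑ ρ, gaugeH d g ρ p * d ρ (g α β) p - ∑ ρ, d β (g ρ α) p * gaugeH d g ρ p
        - ∑ ρ, d α (g ρ β) p * gaugeH d g ρ p := by
    rw [← Finset.sum_sub_distrib, ← Finset.sum_sub_distrib]
    refine Finset.sum_congr rfl fun ρ _ => ?_
    have : gaugeH d g ρ p = ∑ μ, ∑ ν, inv g μ ν p * ∑ σ, inv g ρ σ p *
        lower (fun μ a b => d μ (g a b) p) μ ν σ := by
      simp only [gaugeH, christoffel, lower, Finset.mul_sum]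
      refine Finset.sum_congr rfl fun μ _ => Finset.sum_congr rfl fun ν _ =>
        Finset.sum_congr rfl fun σ _ => by ring
    rw [this]; ring
  rw [main, reducedQuad, q, gaugeTerm]
  simp only [Finset.sum_add_distrib] at g1 g2 ⊢
  rw [g1, g2]
  ring

end WaveGauge

/-! ## The slab -/

lemma convex_slab : Convex ℝ slab := by
  have : slab = (fun x : Spacetime => x 0) ⁻¹' Set.Icc 0 1 := rfl
  rw [this]
  exact (convex_Icc 0 1).is_linear_preimage ⟨fun _ _ => rfl, fun _ _ => rfl⟩

lemma interior_slab_nonempty : (interior slab).Nonempty := by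
  refine ⟨fun _ => 1 / 2, mem_interior.2 ⟨(fun x : Spacetime => x 0) ⁻¹' Set.Ioo 0 1, ?_, ?_, ?_⟩⟩
  · exact fun x hx => ⟨hx.1.le, hx.2.le⟩
  · exact isOpen_Ioo.preimage (continuous_apply 0)
  · norm_num

lemma uniqueDiffOn_slab : UniqueDiffOn ℝ slab :=
  uniqueDiffOn_convex convex_slab interior_slab_nonempty

/-- The coordinate derivatives on the slab. -/
lemma isFrame_pd : IsFrame pd slab fun μ _ => Pi.single μ 1 where
  uniq := uniqueDiffOn_slab
  apply _ _ _ _ _ := rfl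
  smooth _ := contDiffOn_const

/-- Second derivatives within the slab are symmetric on the two boundary slices as well: a convex
set with nonempty interior lies in the closure of its interior. -/
lemma pd_comm {f : Scalar} (hf : ContDiffOn ℝ 2 f slab) {x : Spacetime} (hx : x ∈ slab)
    (μ ν : Fin 4) : pd μ (pd ν f) x = pd ν (pd μ f) x := by
  have h1 : ContDiffOn ℝ 1 (fderivWithin ℝ f slab) slab :=
    hf.fderivWithin uniqueDiffOn_slab (by norm_num)
  have hd : DifferentiableWithinAt ℝ (fderivWithin ℝ f slab) slab x :=
    (h1 x hx).differentiableWithinAt (by norm_num)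
  have e : ∀ μ ν, pd μ (pd ν f) x
      = fderivWithin ℝ (fderivWithin ℝ f slab) slab x (Pi.single μ 1) (Pi.single ν 1) := by
    intro μ ν
    have : fderivWithin ℝ (fun y => fderivWithin ℝ f slab y (Pi.single ν 1)) slab x
        = (ContinuousLinearMap.apply ℝ ℝ (Pi.single ν (1 : ℝ) : Spacetime)).comp
          (fderivWithin ℝ (fderivWithin ℝ f slab) slab x) :=
      ((ContinuousLinearMap.apply ℝ ℝ (Pi.single ν (1 : ℝ) : Spacetime)).hasFDerivAt.comp_hasFDerivWithinAt x
        hd.hasFDerivWithinAt).fderivWithin (uniqueDiffOn_slab x hx)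
    change fderivWithin ℝ (fun y => fderivWithin ℝ f slab y (Pi.single ν 1)) slab x _ = _
    rw [this]; rfl
  rw [e, e]
  have s : IsSymmSndFDerivWithinAt ℝ f slab x :=
    (hf x hx).isSymmSndFDerivWithinAt (by simp) uniqueDiffOn_slab
      ((convex_slab.closure_interior_eq_closure_of_nonempty_interior interior_slab_nonempty) ▸
        subset_closure hx) hx
  exact s.eq _ _

/-! ## Realizations of the calculus -/

section Realization

variable {𝒜 : Type*} [Fintype 𝒜]

/-- `∑_A n_A θ_A`. -/
def angle (n : 𝒜 → ℤ) (θ : 𝒜 → ℝ) : ℝ := ∑ A, (n A : ℝ) * θ A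

/-- `cos' = -sin` and `sin' = cos`. -/
def trigSign : Bool → ℝ
  | true => -1
  | false => 1

lemma hasDerivAt_trig (b : Bool) (t : ℝ) :
    HasDerivAt (trig b) (trigSign b * trig (!b) t) t := by
  cases b
  · simpa [trig, trigSign] using Real.hasDerivAt_sin t
  · simpa [trig, trigSign] using Real.hasDerivAt_cos t

lemma deriv_trig (b : Bool) : deriv (trig b) = fun t => trigSign b * trig (!b) t :=
  funext fun t => (hasDerivAt_trig b t).deriv

lemma contDiff_trig (b : Bool) {n : WithTop ℕ∞} : ContDiff ℝ n (trig b) := by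
  cases b
  · exact Real.contDiff_sin
  · exact Real.contDiff_cos

lemma trigSign_mul (b : Bool) : trigSign b * trigSign (!b) = -1 := by
  cases b <;> simp [trigSign]

/-- A calculus whose derivatives come from vector fields, and which is related to the slab by a
position and by angles. -/
structure Realization {E : Type*} [NormedAddCommGroup E] [NormedSpace ℝ E] (bg : Background 𝒜)
    (c : Calculus 𝒜 E) (D : Set E) (V : Fin 4 → E → E) (pos : E → Spacetime)
    (ang : E → 𝒜 → ℝ) : Prop where
  frame : IsFrame c.d D V
  pos_mem : ∀ p ∈ D, pos p ∈ slab
  field_apply : ∀ f p, c.field f p = f (pos p)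
  osc_apply : ∀ T n p, c.osc T n p = T (angle n (ang p))
  lam_ne : ∀ p ∈ D, c.lam p ≠ 0
  field_smooth : ∀ (k : WithTop ℕ∞) f, ContDiffOn ℝ k f slab → ContDiffOn ℝ k (c.field f) D
  osc_smooth : ∀ b n, ContDiffOn ℝ 2 (c.osc (trig b) n) D
  lam_smooth : ContDiffOn ℝ 2 c.lam D
  d_field : ∀ μ f, ∀ p ∈ D, c.d μ (c.field f) p = pd μ f (pos p)
  d_osc : ∀ μ b n, ∀ p ∈ D, c.d μ (c.osc (trig b) n) p
    = (c.lam p)⁻¹ * pd μ (bg.phase n) (pos p) * (trigSign b * c.osc (trig !b) n p)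
  d_lam : ∀ μ (φ : ℝ → ℝ), ∀ p ∈ D, c.d μ (fun q => φ (c.lam q)) p = 0

variable {bg : Background 𝒜}

lemma contDiffOn_phase (hu : ∀ A, ContDiffOn ℝ 2 (bg.u A) slab) (n : 𝒜 → ℤ) :
    ContDiffOn ℝ 2 (bg.phase n) slab :=
  ContDiffOn.sum fun A _ => contDiffOn_const.mul (hu A)

lemma pd_phase (hu : ∀ A, ContDiffOn ℝ 2 (bg.u A) slab) (n : 𝒜 → ℤ) (μ : Fin 4) {x : Spacetime}
    (hx : x ∈ slab) : pd μ (bg.phase n) x = ∑ A, (n A : ℝ) * pd μ (bg.u A) x := by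
  have du : ∀ A, DifferentiableWithinAt ℝ (bg.u A) slab x := fun A =>
    (hu A x hx).differentiableWithinAt (by norm_num)
  have := isFrame_pd.sum hx (s := Finset.univ) (f := fun A x => (n A : ℝ) * bg.u A x)
    (fun A _ => (du A).const_mul _) μ
  rw [show bg.phase n = fun x => ∑ A, (n A : ℝ) * bg.u A x from rfl, this]
  exact Finset.sum_congr rfl fun A _ => isFrame_pd.const_mul hx _ (du A) μ

lemma realization_actual (hu : ∀ A, ContDiffOn ℝ 2 (bg.u A) slab) {lam : ℝ} (hl : lam ≠ 0) :
    Realization bg (actual bg lam) slab (fun μ _ => Pi.single μ 1) id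
      (fun x A => bg.u A x / lam) := by
  have oa : ∀ (T : ℝ → ℝ) (n : 𝒜 → ℤ) (x : Spacetime), (actual bg lam).osc T n x
      = T (angle n fun A => bg.u A x / lam) := by
    intro T n x
    simp only [actual, Background.phase, angle, Finset.sum_div, mul_div_assoc]
  have cp : ∀ n : 𝒜 → ℤ, ContDiffOn ℝ 2 (fun x => bg.phase n x / lam) slab := fun n =>
    (contDiffOn_phase hu n).div_const lam
  refine ⟨isFrame_pd, fun p hp => hp, fun _ _ => rfl, oa, fun _ _ => hl, fun _ f hf => hf,
    fun b n => (contDiff_trig b).comp_contDiffOn (cp n), contDiffOn_const, fun _ _ _ _ => rfl,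
    fun μ b n p hp => ?_, fun μ φ p hp => isFrame_pd.const (φ lam) hp μ⟩
  have h1 : HasFDerivWithinAt (fun x => bg.phase n x / lam)
      (fderivWithin ℝ (fun x => bg.phase n x / lam) slab p) slab p :=
    ((cp n p hp).differentiableWithinAt (by norm_num)).hasFDerivWithinAt
  have h2 := (hasDerivAt_trig b (bg.phase n p / lam)).comp_hasFDerivWithinAt p h1
  have h3 : fderivWithin ℝ (fun x => bg.phase n x / lam) slab p (Pi.single μ 1)
      = lam⁻¹ * pd μ (bg.phase n) p := by
    have := isFrame_pd.const_mul hp lam⁻¹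
      ((contDiffOn_phase hu n p hp).differentiableWithinAt (by norm_num)) μ
    rw [← this]
    simp only [pd, div_eq_inv_mul]
  change fderivWithin ℝ (trig b ∘ fun x => bg.phase n x / lam) slab p (Pi.single μ 1) = _
  rw [h2.fderivWithin (uniqueDiffOn_slab p hp)]
  simp only [smul_apply, h3, smul_eq_mul, actual, id]
  ring

/-- The domain of the profiles. -/
def profileDomain (𝒜 : Type*) : Set (ℝ × Spacetime × (𝒜 → ℝ)) :=
  ({0}ᶜ : Set ℝ) ×ˢ (slab ×ˢ (Set.univ : Set (𝒜 → ℝ)))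

/-- The vector fields on the space of profiles which lift the coordinate vector fields. -/
def profileField (bg : Background 𝒜) (μ : Fin 4) (p : ℝ × Spacetime × (𝒜 → ℝ)) :
    ℝ × Spacetime × (𝒜 → ℝ) :=
  (0, Pi.single μ 1, fun A => p.1⁻¹ * pd μ (bg.u A) p.2.1)

/-- The lifted field fixes `s`, moves `x` along a coordinate axis and turns the angle `θ_A` at speed
`s⁻¹ ∂_μ u_A`. On differentiable profiles the sum of partial derivatives in `profile` is the
derivative along this field. The factor `s⁻¹` is the reason for excluding `s = 0`. -/
lemma realization_profile [DecidableEq 𝒜] (hu : ∀ A, ContDiffOn ℝ 2 (bg.u A) slab) :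
    Realization bg (profile bg) (profileDomain 𝒜) (profileField bg) (fun p => p.2.1)
      (fun p => p.2.2) := by
  have ud : UniqueDiffOn ℝ (profileDomain 𝒜) :=
    isOpen_compl_singleton.uniqueDiffOn.prod (uniqueDiffOn_slab.prod uniqueDiffOn_univ)
  have cpos : ∀ k, ContDiffOn ℝ k (fun p : ℝ × Spacetime × (𝒜 → ℝ) => p.2.1)
      (profileDomain 𝒜) := fun k => (contDiff_fst.comp contDiff_snd).contDiffOn
  have mpos : Set.MapsTo (fun p : ℝ × Spacetime × (𝒜 → ℝ) => p.2.1) (profileDomain 𝒜) slab :=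
    fun p hp => hp.2.1
  have cang : ∀ k, ContDiff ℝ k (fun p : ℝ × Spacetime × (𝒜 → ℝ) => p.2.2) := fun k =>
    contDiff_snd.comp contDiff_snd
  have cfield : ∀ (k : WithTop ℕ∞) (f : Scalar), ContDiffOn ℝ k f slab →
      ContDiffOn ℝ k (fun p : ℝ × Spacetime × (𝒜 → ℝ) => f p.2.1) (profileDomain 𝒜) :=
    fun k f hf => hf.comp (cpos k) mpos
  have fr : IsFrame (profile bg).d (profileDomain 𝒜) (profileField bg) := by
    refine ⟨ud, fun μ f p hp hf => ?_, fun μ => ?_⟩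
    · obtain ⟨s, x, θ⟩ := p
      have hx : x ∈ slab := hp.2.1
      have hs : s ≠ 0 := hp.1
      set f' := fderivWithin ℝ f (profileDomain 𝒜) (s, x, θ)
      have hf' : HasFDerivWithinAt f f' (profileDomain 𝒜) (s, x, θ) := hf.hasFDerivWithinAt
      have i1 : HasFDerivWithinAt (fun y : Spacetime => (s, y, θ))
          ((0 : Spacetime →L[ℝ] ℝ).prod ((ContinuousLinearMap.id ℝ Spacetime).prod 0)) slab x :=
        (hasFDerivWithinAt_const _ _ _).prodMk
          ((hasFDerivWithinAt_id _ _).prodMk (hasFDerivWithinAt_const _ _ _))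
      have e1 := (hf'.comp x i1 (show Set.MapsTo (fun y => (s, y, θ)) slab (profileDomain 𝒜) from
        fun y hy => ⟨hs, hy, trivial⟩)).fderivWithin
        (uniqueDiffOn_slab x hx)
      have e2 : ∀ A, deriv (fun t => f (s, x, Function.update θ A t)) (θ A)
          = f' (0, 0, Pi.single A 1) := by
        intro A
        have i2 : HasDerivAt (fun t : ℝ => (s, x, Function.update θ A t))
            ((0, 0, Pi.single A 1) : ℝ × Spacetime × (𝒜 → ℝ)) (θ A) :=
          (hasDerivAt_const _ _).prodMk ((hasDerivAt_const _ _).prodMk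
            (hasDerivAt_update θ A (θ A)))
        have hf2 : HasFDerivWithinAt f f' (profileDomain 𝒜)
            (s, x, Function.update θ A (θ A)) := by rwa [Function.update_eq_self]
        have := hf2.comp_hasDerivWithinAt (s := Set.univ) (θ A) i2.hasDerivWithinAt
          (show Set.MapsTo (fun t => (s, x, Function.update θ A t)) Set.univ (profileDomain 𝒜) from
            fun t _ => ⟨hs, hx, trivial⟩)
        exact (hasDerivWithinAt_univ.1 this).deriv
      have e3 : profileField bg μ (s, x, θ) = (0, Pi.single μ 1, 0)
          + s⁻¹ • ∑ A, pd μ (bg.u A) x • ((0, 0, Pi.single A 1) : ℝ × Spacetime × (𝒜 → ℝ)) := by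
        refine Prod.ext ?_ (Prod.ext ?_ ?_)
        · simp [profileField, Prod.fst_sum]
        · simp [profileField, Prod.snd_sum, Prod.fst_sum]
        · funext B
          simp [profileField, Prod.snd_sum, Finset.sum_apply, Pi.single_apply]
      rw [e3, map_add, map_smul, map_sum]
      simp only [profile, e2, map_smul, smul_eq_mul]
      congr 1
      change fderivWithin ℝ (f ∘ fun y => (s, y, θ)) slab x (Pi.single μ 1) = _
      rw [e1]; rfl
    · refine contDiffOn_const.prodMk (contDiffOn_const.prodMk (contDiffOn_pi.2 fun A => ?_))
      refine (contDiff_fst.contDiffOn.inv fun p hp => hp.1).mul ?_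
      exact cfield 1 _ (isFrame_pd.contDiffOn (hu A) μ)
  have co : ∀ (b : Bool) (n : 𝒜 → ℤ), ContDiff ℝ 2
      (fun p : ℝ × Spacetime × (𝒜 → ℝ) => trig b (∑ A, (n A : ℝ) * p.2.2 A)) := fun b n =>
    (contDiff_trig b).comp (ContDiff.sum fun A _ => contDiff_const.mul
      ((contDiff_apply ℝ ℝ A).comp (cang 2)))
  refine ⟨fr, fun p hp => hp.2.1, fun _ _ => rfl, fun _ _ _ => rfl, fun p hp => hp.1,
    cfield, fun b n => (co b n).contDiffOn, contDiff_fst.contDiffOn, fun μ f p hp => ?_,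
    fun μ b n p hp => ?_, fun μ φ p hp => ?_⟩
  · simp [profile]
  · obtain ⟨s, x, θ⟩ := p
    have hx : x ∈ slab := hp.2.1
    have e2 : ∀ A, deriv (fun t => trig b (∑ B, (n B : ℝ) * Function.update θ A t B)) (θ A)
        = n A * (trigSign b * trig (!b) (∑ B, (n B : ℝ) * θ B)) := by
      intro A
      have h1 : HasDerivAt (fun t => ∑ B, (n B : ℝ) * Function.update θ A t B)
          (∑ B, (n B : ℝ) * (Pi.single A 1 : 𝒜 → ℝ) B) (θ A) :=
        HasDerivAt.fun_sum fun B _ => ((hasDerivAt_pi.1 (hasDerivAt_update θ A (θ A))) B).const_mul _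
      have h2 := (hasDerivAt_trig b (∑ B, (n B : ℝ) * Function.update θ A (θ A) B)).comp (θ A) h1
      rw [Function.update_eq_self] at h2
      have := h2.deriv
      simp only [Function.comp_def] at this
      rw [this]
      simp [Pi.single_apply]; ring
    have e1 : pd μ (fun _ => trig b (∑ A, (n A : ℝ) * θ A)) x = 0 := isFrame_pd.const _ hx μ
    simp only [profile, e1, e2, pd_phase hu n μ hx, zero_add, Finset.mul_sum, Finset.sum_mul]
    exact Finset.sum_congr rfl fun A _ => by ring
  · obtain ⟨s, x, θ⟩ := p
    have e1 : pd μ (fun _ => φ s) x = 0 := isFrame_pd.const _ hp.2.1 μ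
    simp [profile, e1]

end Realization

/-! ## Oscillating terms -/

section Terms

variable {𝒜 : Type*} [Fintype 𝒜]

/-- The term `λ^e T(n·θ) S` of an ansatz. -/
structure OscTerm (𝒜 : Type*) where
  e : ℕ
  b : Bool
  n : 𝒜 → ℤ
  S : Tensor2

/-- The function `λ^e T(n·θ) f`. -/
def mono {X : Type*} (c : Calculus 𝒜 X) (e : ℤ) (b : Bool) (n : 𝒜 → ℤ) (f : Scalar) : X → ℝ :=
  fun p => c.lam p ^ e * (c.osc (trig b) n p * c.field f p)

variable {E : Type*} [NormedAddCommGroup E] [NormedSpace ℝ E] {bg : Background 𝒜}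
  {c : Calculus 𝒜 E} {D : Set E} {V : Fin 4 → E → E} {pos : E → Spacetime} {ang : E → 𝒜 → ℝ}

lemma mono_apply (R : Realization bg c D V pos ang) (e : ℤ) (b : Bool) (n : 𝒜 → ℤ) (f : Scalar)
    (p : E) : mono c e b n f p = c.lam p ^ e * (trig b (angle n (ang p)) * f (pos p)) := by
  rw [mono, R.osc_apply, R.field_apply]

lemma Realization.lam_zpow_smooth (R : Realization bg c D V pos ang) (e : ℤ) :
    ContDiffOn ℝ 2 (fun p => c.lam p ^ e) D := by
  cases e with
  | ofNat k => simpa using R.lam_smooth.pow k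
  | negSucc k =>
    simp only [zpow_negSucc]
    exact (R.lam_smooth.pow (k + 1)).inv fun p hp => pow_ne_zero _ (R.lam_ne p hp)

lemma Realization.mono_smooth (R : Realization bg c D V pos ang) {k : WithTop ℕ∞} (hk : k ≤ 2)
    (e : ℤ) (b : Bool) (n : 𝒜 → ℤ) {f : Scalar} (hf : ContDiffOn ℝ k f slab) :
    ContDiffOn ℝ k (mono c e b n f) D :=
  ((R.lam_zpow_smooth e).of_le hk).mul (((R.osc_smooth b n).of_le hk).mul (R.field_smooth k f hf))

/-- The parameter has zero derivative, so either the amplitude or the phase is differentiated. The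
latter costs one power of the parameter and exchanges sine and cosine. -/
lemma Realization.d_mono (R : Realization bg c D V pos ang) (e : ℤ) (b : Bool) (n : 𝒜 → ℤ)
    {f : Scalar} (hf : ContDiffOn ℝ 1 f slab) {p : E} (hp : p ∈ D) (μ : Fin 4) :
    c.d μ (mono c e b n f) p = mono c e b n (pd μ f) p
      + trigSign b * mono c (e - 1) (!b) n (fun x => pd μ (bg.phase n) x * f x) p := by
  have d1 : DifferentiableWithinAt ℝ (fun p => c.lam p ^ e) D p :=
    (R.lam_zpow_smooth e p hp).differentiableWithinAt (by norm_num)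
  have d2 : DifferentiableWithinAt ℝ (c.osc (trig b) n) D p :=
    (R.osc_smooth b n p hp).differentiableWithinAt (by norm_num)
  have d3 : DifferentiableWithinAt ℝ (c.field f) D p :=
    (R.field_smooth 1 f hf p hp).differentiableWithinAt (by norm_num)
  have e1 := R.frame.mul hp d1 (d2.fun_mul d3) μ
  rw [R.d_lam μ (fun t => t ^ e) p hp, R.frame.mul hp d2 d3, R.d_osc μ b n p hp,
    R.d_field μ f p hp] at e1
  have e2 : c.d μ (mono c e b n f) p = _ := e1
  rw [e2]
  simp only [mono, R.field_apply]
  rw [zpow_sub_one₀ (R.lam_ne p hp)]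
  ring

/-- The second covariant derivative of a function. -/
def hess (Γ : Fin 4 → Fin 4 → Fin 4 → Scalar) (v : Scalar) (κ μ : Fin 4) : Scalar := fun x =>
  pd κ (pd μ v) x - ∑ ρ, Γ ρ κ μ x * pd ρ v x

/-- The amplitude at the intermediate order of the second derivatives of `T(v/λ) S`. -/
def midDeriv (Γ : Fin 4 → Fin 4 → Fin 4 → Scalar) (v : Scalar) (S : Tensor2) (κ μ a b : Fin 4) :
    Scalar := fun x =>
  pd κ v x * nab pd Γ S μ a b x + pd μ v x * nab pd Γ S κ a b x + hess Γ v κ μ x * S a b x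

variable {Γ : Fin 4 → Fin 4 → Fin 4 → Scalar} {ι : Type*} [Fintype ι] {t : ι → OscTerm 𝒜}
  {g : Fin 4 → Fin 4 → E → ℝ}

lemma nab_smooth (hΓ : ∀ ρ μ ν, ContDiffOn ℝ 1 (Γ ρ μ ν) slab) {S : Tensor2}
    (hS : ∀ a b, ContDiffOn ℝ 2 (S a b) slab) (μ a b : Fin 4) :
    ContDiffOn ℝ 1 (nab pd Γ S μ a b) slab := by
  refine (isFrame_pd.contDiffOn (hS a b) μ).sub (ContDiffOn.sum fun ρ _ => ?_)
  exact ((hΓ _ _ _).mul ((hS _ _).of_le (by norm_num))).add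
    ((hΓ _ _ _).mul ((hS _ _).of_le (by norm_num)))

lemma Realization.nab_eq (R : Realization bg c D V pos ang)
    (hS : ∀ i a b, ContDiffOn ℝ 2 ((t i).S a b) slab)
    (hg : ∀ a b, ∀ p ∈ D, g a b p = ∑ i, mono c (t i).e (t i).b (t i).n ((t i).S a b) p)
    {p : E} (hp : p ∈ D) (μ a b : Fin 4) :
    nab c.d (fun ρ μ ν => c.field (Γ ρ μ ν)) g μ a b p
      = ∑ i, (mono c (t i).e (t i).b (t i).n (nab pd Γ (t i).S μ a b) p
        + trigSign (t i).b * mono c ((t i).e - 1) (!(t i).b) (t i).n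
            (fun x => pd μ (bg.phase (t i).n) x * (t i).S a b x) p) := by
  have dm : ∀ i a b, DifferentiableWithinAt ℝ
      (mono c (t i).e (t i).b (t i).n ((t i).S a b)) D p := fun i a b =>
    (R.mono_smooth le_rfl _ _ _ (hS i a b) p hp).differentiableWithinAt (by norm_num)
  have e1 : c.d μ (g a b) p = ∑ i, (mono c (t i).e (t i).b (t i).n (pd μ ((t i).S a b)) p
        + trigSign (t i).b * mono c ((t i).e - 1) (!(t i).b) (t i).n
            (fun x => pd μ (bg.phase (t i).n) x * (t i).S a b x) p) := by
    rw [R.frame.congr_on hp (hg a b) (DifferentiableWithinAt.fun_sum fun i _ => dm i a b),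
      R.frame.sum hp fun i _ => dm i a b]
    exact Finset.sum_congr rfl fun i _ => R.d_mono _ _ _ ((hS i a b).of_le (by norm_num)) hp μ
  rw [nab, e1]
  simp only [hg _ _ p hp, Finset.mul_sum, ← Finset.sum_add_distrib]
  rw [Finset.sum_comm, ← Finset.sum_sub_distrib]
  refine Finset.sum_congr rfl fun i _ => ?_
  simp only [mono, R.field_apply, nab, mul_sub, Finset.mul_sum]
  rw [add_sub_right_comm]
  congr 2
  exact Finset.sum_congr rfl fun ρ _ => by ring

/-- The three terms correspond to zero, one or two derivatives falling on the phase. The sign of the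
last one is `T'' = -T`. -/
lemma Realization.nab2_eq (R : Realization bg c D V pos ang)
    (hu : ∀ A, ContDiffOn ℝ 2 (bg.u A) slab)
    (hΓ : ∀ ρ μ ν, ContDiffOn ℝ 1 (Γ ρ μ ν) slab)
    (hS : ∀ i a b, ContDiffOn ℝ 2 ((t i).S a b) slab)
    (hg : ∀ a b, ∀ p ∈ D, g a b p = ∑ i, mono c (t i).e (t i).b (t i).n ((t i).S a b) p)
    {p : E} (hp : p ∈ D) (κ μ a b : Fin 4) :
    nab2 c.d (fun ρ μ ν => c.field (Γ ρ μ ν)) g κ μ a b p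
      = ∑ i, (mono c (t i).e (t i).b (t i).n (nab2 pd Γ (t i).S κ μ a b) p
        + trigSign (t i).b * mono c ((t i).e - 1) (!(t i).b) (t i).n
            (midDeriv Γ (bg.phase (t i).n) (t i).S κ μ a b) p
        - mono c ((t i).e - 2) (t i).b (t i).n
            (fun x => pd κ (bg.phase (t i).n) x * pd μ (bg.phase (t i).n) x * (t i).S a b x) p) := by
  have hx := R.pos_mem p hp
  have cN : ∀ i, ContDiffOn ℝ 1 (nab pd Γ (t i).S μ a b) slab := fun i =>
    nab_smooth hΓ (hS i) μ a b
  have cv : ∀ i, ContDiffOn ℝ 1 (pd μ (bg.phase (t i).n)) slab := fun i =>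
    isFrame_pd.contDiffOn (contDiffOn_phase hu (t i).n) μ
  have cP : ∀ i, ContDiffOn ℝ 1 (fun x => pd μ (bg.phase (t i).n) x * (t i).S a b x) slab :=
    fun i => (cv i).mul ((hS i a b).of_le (by norm_num))
  have d1 : ∀ i, DifferentiableWithinAt ℝ
      (mono c (t i).e (t i).b (t i).n (nab pd Γ (t i).S μ a b)) D p := fun i =>
    (R.mono_smooth (by norm_num) _ _ _ (cN i) p hp).differentiableWithinAt (by norm_num)
  have d2 : ∀ i, DifferentiableWithinAt ℝ (fun p => trigSign (t i).b *
      mono c ((t i).e - 1) (!(t i).b) (t i).n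
        (fun x => pd μ (bg.phase (t i).n) x * (t i).S a b x) p) D p := fun i =>
    ((R.mono_smooth (by norm_num) _ _ _ (cP i) p hp).differentiableWithinAt
      (by norm_num)).const_mul _
  have e1 : c.d κ (nab c.d (fun ρ μ ν => c.field (Γ ρ μ ν)) g μ a b) p
      = ∑ i, (mono c (t i).e (t i).b (t i).n (pd κ (nab pd Γ (t i).S μ a b)) p
        + trigSign (t i).b * mono c ((t i).e - 1) (!(t i).b) (t i).n
            (fun x => pd κ (bg.phase (t i).n) x * nab pd Γ (t i).S μ a b x) p
        + trigSign (t i).b * (mono c ((t i).e - 1) (!(t i).b) (t i).n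
            (fun x => pd κ (pd μ (bg.phase (t i).n)) x * (t i).S a b x
              + pd μ (bg.phase (t i).n) x * pd κ ((t i).S a b) x) p
          + trigSign (!(t i).b) * mono c ((t i).e - 2) (t i).b (t i).n
            (fun x => pd κ (bg.phase (t i).n) x * (pd μ (bg.phase (t i).n) x * (t i).S a b x)) p)) := by
    rw [R.frame.congr_on hp (fun q hq => R.nab_eq hS hg hq μ a b)
        (DifferentiableWithinAt.fun_sum fun i _ => (d1 i).fun_add (d2 i)),
      R.frame.sum hp fun i _ => (d1 i).fun_add (d2 i)]
    refine Finset.sum_congr rfl fun i _ => ?_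
    rw [R.frame.add hp (d1 i) (d2 i), R.d_mono _ _ _ (cN i) hp, R.frame.const_mul hp _
      ((R.mono_smooth (by norm_num) _ _ _ (cP i) p hp).differentiableWithinAt (by norm_num)),
      R.d_mono _ _ _ (cP i) hp, Bool.not_not, sub_sub, one_add_one_eq_two]
    congr 3
    simp only [mono, R.field_apply]
    rw [isFrame_pd.mul hx ((cv i _ hx).differentiableWithinAt (by norm_num))
      ((hS i a b _ hx).differentiableWithinAt (by norm_num))]
  have e2 : ∀ μ a b, nab c.d (fun ρ μ ν => c.field (Γ ρ μ ν)) g μ a b p = _ := fun μ a b =>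
    R.nab_eq hS hg hp μ a b
  rw [nab2, e1]
  simp only [e2, Finset.mul_sum, ← Finset.sum_add_distrib]
  rw [Finset.sum_comm, ← Finset.sum_sub_distrib]
  refine Finset.sum_congr rfl fun i _ => ?_
  have s := trigSign_mul (t i).b
  simp only [mono, R.field_apply, nab2, midDeriv, hess]
  set w := pd κ (bg.phase (t i).n) (pos p) * (pd μ (bg.phase (t i).n) (pos p) * (t i).S a b (pos p))
    with hw
  rw [mul_assoc (pd κ _ _) (pd μ _ _), ← hw]
  -- The connection terms introduced by this exchange cancel those that `nab2` produces from the
  -- oscillating part of the first derivative.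
  have nS : pd κ ((t i).S a b) (pos p) = nab pd Γ (t i).S κ a b (pos p)
      + ∑ ρ, (Γ ρ κ a (pos p) * (t i).S ρ b (pos p) + Γ ρ κ b (pos p) * (t i).S a ρ (pos p)) := by
    simp only [nab]; ring
  rw [nS]
  simp only [Fin.sum_univ_four]
  linear_combination (c.lam p ^ ((t i).e - 2 : ℤ) * (c.osc (trig (t i).b) (t i).n p * w)) * s

end Terms

/-! ## The terms of the ansatz, ordered by powers of the parameter -/

section Orders

variable {𝒜 : Type*} [Fintype 𝒜] [DecidableEq 𝒜]

/-- An index set for the terms of the ansatz. -/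
abbrev TermIndex (𝒜 : Type*) [Fintype 𝒜] [DecidableEq 𝒜] : Type _ :=
  Unit ⊕ 𝒜 ⊕ ((𝒜 ⊕ 𝒜 ⊕ 𝒜 ⊕ ({q : 𝒜 × 𝒜 // q ∈ (Finset.univ : Finset 𝒜).offDiag} × ℤˣ) ⊕ Unit)
    ⊕ (({n // n ∈ nullPhases 𝒜} × Bool) ⊕ ({n // n ∈ mixedPhases 𝒜} × Bool)))

variable (bg : Background 𝒜) (a : Amplitudes 𝒜)

/-- The terms of the ansatz. -/
def ansatzTerm : TermIndex 𝒜 → OscTerm 𝒜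
  | .inl _ => ⟨0, true, 0, bg.g₀⟩
  | .inr (.inl A) => ⟨1, true, unit A, a.F1 A⟩
  | .inr (.inr (.inl (.inl A))) => ⟨2, false, unit A, a.frakF A⟩
  | .inr (.inr (.inl (.inr (.inl A)))) => ⟨2, false, unit A, a.F21 A⟩
  | .inr (.inr (.inl (.inr (.inr (.inl A))))) => ⟨2, true, (2 : ℤ) • unit A, a.F22 A⟩
  | .inr (.inr (.inl (.inr (.inr (.inr (.inl q)))))) =>
      ⟨2, true, pm q.1.1.1 q.1.1.2 q.2, a.Fpm q.1.1.1 q.1.1.2 q.2⟩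
  | .inr (.inr (.inl (.inr (.inr (.inr (.inr _)))))) => ⟨2, true, 0, a.h⟩
  | .inr (.inr (.inr (.inl q))) => ⟨3, q.2, q.1.1, a.g3h q.2 q.1.1⟩
  | .inr (.inr (.inr (.inr q))) => ⟨3, q.2, q.1.1, a.g3e q.2 q.1.1⟩

/-- The sum of `F` over the terms of the ansatz with factor `λ²`. -/
def orderTwo (F : OscTerm 𝒜 → ℝ) : ℝ :=
  ∑ A, F ⟨2, false, unit A, a.frakF A⟩ + ∑ A, F ⟨2, false, unit A, a.F21 A⟩
    + ∑ A, F ⟨2, true, (2 : ℤ) • unit A, a.F22 A⟩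
    + ∑ q ∈ (Finset.univ : Finset 𝒜).offDiag, ∑ ε : ℤˣ,
        F ⟨2, true, pm q.1 q.2 ε, a.Fpm q.1 q.2 ε⟩
    + F ⟨2, true, 0, a.h⟩

/-- The sum of `F` over the terms of the ansatz with factor `λ³`. -/
def orderThree (F : OscTerm 𝒜 → ℝ) : ℝ :=
  ∑ n ∈ nullPhases 𝒜, ∑ T, F ⟨3, T, n, a.g3h T n⟩
    + ∑ n ∈ mixedPhases 𝒜, ∑ T, F ⟨3, T, n, a.g3e T n⟩

/-- The sum of `F` over the terms of the ansatz with factor `λ^m`. -/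
def orderSum (F : OscTerm 𝒜 → ℝ) : ℕ → ℝ
  | 0 => F ⟨0, true, 0, bg.g₀⟩
  | 1 => ∑ A, F ⟨1, true, unit A, a.F1 A⟩
  | 2 => orderTwo a F
  | 3 => orderThree a F
  | _ => 0

lemma sum_ansatzTerm (F : OscTerm 𝒜 → ℝ) :
    ∑ i, F (ansatzTerm bg a i) = ∑ m ∈ Finset.range 4, orderSum bg a F m := by
  simp only [Finset.sum_range_succ, Finset.sum_range_zero, orderSum, Fintype.sum_sum_type,
    Finset.univ_unique, Finset.sum_singleton, ansatzTerm, Fintype.sum_prod_type, orderTwo,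
    orderThree]
  rw [Finset.sum_coe_sort (nullPhases 𝒜) (fun n => ∑ T, F ⟨3, T, n, a.g3h T n⟩),
    Finset.sum_coe_sort (mixedPhases 𝒜) (fun n => ∑ T, F ⟨3, T, n, a.g3e T n⟩),
    Finset.sum_coe_sort (Finset.univ : Finset 𝒜).offDiag
      (fun q => ∑ ε : ℤˣ, F ⟨2, true, pm q.1 q.2 ε, a.Fpm q.1 q.2 ε⟩)]
  ring

/-- This allows the exponent `t.e` in a summand to be replaced by the common order `m`, after which
the power of the parameter factors out. -/
lemma orderSum_congr {F G : OscTerm 𝒜 → ℝ} (m : ℕ) (h : ∀ t : OscTerm 𝒜, t.e = m → F t = G t) :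
    orderSum bg a F m = orderSum bg a G m := by
  match m, h with
  | 0, h => exact h _ rfl
  | 1, h => exact Finset.sum_congr rfl fun A _ => h _ rfl
  | 2, h =>
    have h' : ∀ b n S, F ⟨2, b, n, S⟩ = G ⟨2, b, n, S⟩ := fun b n S => h _ rfl
    simp only [orderSum, orderTwo, h']
  | 3, h =>
    have h' : ∀ b n S, F ⟨3, b, n, S⟩ = G ⟨3, b, n, S⟩ := fun b n S => h _ rfl
    simp only [orderSum, orderThree, h']
  | _ + 4, _ => rfl

lemma orderSum_add (F G : OscTerm 𝒜 → ℝ) (m : ℕ) :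
    orderSum bg a (fun t => F t + G t) m = orderSum bg a F m + orderSum bg a G m := by
  match m with
  | 0 => rfl
  | 1 => exact Finset.sum_add_distrib
  | 2 => simp only [orderSum, orderTwo, Finset.sum_add_distrib]; ring
  | 3 => simp only [orderSum, orderThree, Finset.sum_add_distrib]; ring
  | _ + 4 => simp [orderSum]

lemma orderSum_mul_left (r : ℝ) (F : OscTerm 𝒜 → ℝ) (m : ℕ) :
    orderSum bg a (fun t => r * F t) m = r * orderSum bg a F m := by
  match m with
  | 0 => rfl
  | 1 => exact (Finset.mul_sum _ _ _).symm
  | 2 => simp only [orderSum, orderTwo, mul_add, Finset.mul_sum]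
  | 3 => simp only [orderSum, orderThree, mul_add, Finset.mul_sum]
  | _ + 4 => simp [orderSum]

variable (Γ : Fin 4 → Fin 4 → Fin 4 → Scalar) (θ : 𝒜 → ℝ) (x : Spacetime)

/-- The coefficient of `λ^m` of the metric at the angles `θ`. -/
def metricCoeff (m : ℕ) (μ ν : Fin 4) : ℝ :=
  orderSum bg a (fun t => trig t.b (angle t.n θ) * t.S μ ν x) m

/-- The coefficient of `λ^m` of the covariant derivative of the metric. -/
def nabCoeff (m : ℕ) (μ α β : Fin 4) : ℝ :=
  orderSum bg a (fun t => trig t.b (angle t.n θ) * nab pd Γ t.S μ α β x) m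
    + orderSum bg a (fun t => trigSign t.b * trig (!t.b) (angle t.n θ)
        * (pd μ (bg.phase t.n) x * t.S α β x)) (m + 1)

/-- The coefficient of `λ^(m-1)` of the second covariant derivative of the metric. -/
def nab2Coeff (m : ℕ) (κ μ α β : Fin 4) : ℝ :=
  (match m with
    | 0 => 0
    | m + 1 => orderSum bg a (fun t => trig t.b (angle t.n θ) * nab2 pd Γ t.S κ μ α β x) m)
  + orderSum bg a (fun t => trigSign t.b * trig (!t.b) (angle t.n θ)
      * midDeriv Γ (bg.phase t.n) t.S κ μ α β x) m
  - orderSum bg a (fun t => trig t.b (angle t.n θ)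
      * (pd κ (bg.phase t.n) x * pd μ (bg.phase t.n) x * t.S α β x)) (m + 1)

omit [DecidableEq 𝒜] in
lemma phase_zero : bg.phase 0 = fun _ => 0 := by funext x; simp [Background.phase]

lemma pd_zero {x : Spacetime} (μ : Fin 4) : pd μ (fun _ => (0 : ℝ)) x = 0 := by
  simp [pd]

lemma angle_unit (A : 𝒜) : angle (unit A) θ = θ A := by
  simp [angle, unit, Pi.single_apply]

omit [DecidableEq 𝒜] in
lemma angle_zero : angle (0 : 𝒜 → ℤ) θ = 0 := by simp [angle]

variable {bg a Γ} {E : Type*} [NormedAddCommGroup E] [NormedSpace ℝ E]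
  {c : Calculus 𝒜 E} {D : Set E} {V : Fin 4 → E → E} {pos : E → Spacetime} {ang : E → 𝒜 → ℝ}

lemma metric_eq_sum (R : Realization bg c D V pos ang) (μ ν : Fin 4) (p : E) :
    metric bg a c μ ν p = ∑ i, mono c (ansatzTerm bg a i).e (ansatzTerm bg a i).b
      (ansatzTerm bg a i).n ((ansatzTerm bg a i).S μ ν) p := by
  rw [sum_ansatzTerm bg a (fun t => mono c t.e t.b t.n (t.S μ ν) p)]
  simp only [Finset.sum_range_succ, Finset.sum_range_zero, orderSum, orderTwo, orderThree, mono,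
    metric, trig, ← Finset.mul_sum, R.osc_apply, angle_zero, Real.cos_zero, Finset.sum_add_distrib,
    mul_add]
  simp only [Nat.cast_zero, Nat.cast_one, Nat.cast_ofNat, zpow_ofNat]
  ring

lemma metric_eq_poly (R : Realization bg c D V pos ang) (μ ν : Fin 4) (p : E) :
    metric bg a c μ ν p
      = ∑ m ∈ Finset.range 4, c.lam p ^ m * metricCoeff bg a (ang p) (pos p) m μ ν := by
  rw [metric_eq_sum R, sum_ansatzTerm bg a (fun t => mono c t.e t.b t.n (t.S μ ν) p)]
  refine Finset.sum_congr rfl fun m _ => ?_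
  rw [metricCoeff, ← orderSum_mul_left]
  refine orderSum_congr bg a m fun t ht => ?_
  rw [mono_apply R, ht, zpow_natCast]

lemma ansatz_smooth (hbg : bg.IsNullDust) (ha : a.Admissible bg) (i : TermIndex 𝒜) (μ ν : Fin 4) :
    ContDiffOn ℝ 2 ((ansatzTerm bg a i).S μ ν) slab := by
  rcases i with _ | A | ((A | A | A | q | _) | (q | q))
  · exact hbg.smooth_metric μ ν
  · exact (ha.F1 A).2 μ ν
  · exact (ha.frakF A).2 μ ν
  · exact (ha.F21 A).2 μ ν
  · exact (ha.F22 A).2 μ ν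
  · exact (ha.Fpm _ _ _ (Finset.mem_offDiag.1 q.1.2).2.2).2 μ ν
  · exact ha.h.2 μ ν
  · exact (ha.g3h _ _ q.1.2).2 μ ν
  · exact (ha.g3e _ _ q.1.2).2 μ ν

omit [DecidableEq 𝒜] in
lemma g₀_symm (hbg : bg.IsNullDust) {x : Spacetime} (hx : x ∈ slab) (μ ν : Fin 4) :
    bg.g₀ μ ν x = bg.g₀ ν μ x := by
  obtain ⟨P, -, h⟩ := hbg.lorentzian x hx
  have : (Matrix.of fun μ ν => bg.g₀ μ ν x).transpose = Matrix.of fun μ ν => bg.g₀ μ ν x := by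
    rw [h]; simp [Matrix.transpose_mul, Matrix.mul_assoc]
  exact congrFun (congrFun this ν) μ

omit [DecidableEq 𝒜] in
lemma g₀_det (hbg : bg.IsNullDust) {x : Spacetime} (hx : x ∈ slab) :
    (Matrix.of fun μ ν => bg.g₀ μ ν x).det ≠ 0 := by
  obtain ⟨P, hP, h⟩ := hbg.lorentzian x hx
  rw [h, Matrix.det_mul, Matrix.det_mul, Matrix.det_transpose, Matrix.det_diagonal]
  have := hP.ne_zero
  simp [Fin.prod_univ_four, this]

lemma ansatz_symm (hbg : bg.IsNullDust) (ha : a.Admissible bg) (i : TermIndex 𝒜) (μ ν : Fin 4)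
    {x : Spacetime} (hx : x ∈ slab) :
    (ansatzTerm bg a i).S μ ν x = (ansatzTerm bg a i).S ν μ x := by
  rcases i with _ | A | ((A | A | A | q | _) | (q | q))
  · exact g₀_symm hbg hx μ ν
  · exact congrFun ((ha.F1 A).1 μ ν) x
  · exact congrFun ((ha.frakF A).1 μ ν) x
  · exact congrFun ((ha.F21 A).1 μ ν) x
  · exact congrFun ((ha.F22 A).1 μ ν) x
  · exact congrFun ((ha.Fpm _ _ _ (Finset.mem_offDiag.1 q.1.2).2.2).1 μ ν) x
  · exact congrFun (ha.h.1 μ ν) x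
  · exact congrFun ((ha.g3h _ _ q.1.2).1 μ ν) x
  · exact congrFun ((ha.g3e _ _ q.1.2).1 μ ν) x

lemma metric_smooth (R : Realization bg c D V pos ang) (hbg : bg.IsNullDust)
    (ha : a.Admissible bg) (μ ν : Fin 4) : ContDiffOn ℝ 2 (metric bg a c μ ν) D := by
  have : metric bg a c μ ν = fun p => ∑ i, mono c (ansatzTerm bg a i).e (ansatzTerm bg a i).b
      (ansatzTerm bg a i).n ((ansatzTerm bg a i).S μ ν) p := funext fun p => metric_eq_sum R μ ν p
  rw [this]
  exact ContDiffOn.sum fun i _ => R.mono_smooth le_rfl _ _ _ (ansatz_smooth hbg ha i μ ν)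

lemma metric_symm (R : Realization bg c D V pos ang) (hbg : bg.IsNullDust)
    (ha : a.Admissible bg) {p : E} (hp : p ∈ D) (μ ν : Fin 4) :
    metric bg a c μ ν p = metric bg a c ν μ p := by
  rw [metric_eq_sum R, metric_eq_sum R]
  refine Finset.sum_congr rfl fun i _ => ?_
  rw [mono_apply R, mono_apply R, ansatz_symm hbg ha i μ ν (R.pos_mem p hp)]

/-- Differentiating a phase lowers the exponent by one. No negative power results, because the only
term of exponent `0` is the background, whose phase is zero. The coefficient of order `3` has no
phase part, because the ansatz stops at `λ³`. -/
lemma nab_metric (R : Realization bg c D V pos ang) (hbg : bg.IsNullDust) (ha : a.Admissible bg)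
    {p : E} (hp : p ∈ D) (μ α β : Fin 4) :
    nab c.d (fun ρ μ ν => c.field (Γ ρ μ ν)) (metric bg a c) μ α β p
      = ∑ m ∈ Finset.range 4, c.lam p ^ m * nabCoeff bg a Γ (ang p) (pos p) m μ α β := by
  have l0 := R.lam_ne p hp
  rw [R.nab_eq (ansatz_smooth hbg ha) (fun a b p _ => metric_eq_sum R a b p) hp,
    sum_ansatzTerm bg a (fun t => mono c t.e t.b t.n (nab pd Γ t.S μ α β) p
        + trigSign t.b * mono c (t.e - 1) (!t.b) t.n
            (fun x => pd μ (bg.phase t.n) x * t.S α β x) p)]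
  have e : ∀ m, orderSum bg a (fun t => mono c t.e t.b t.n (nab pd Γ t.S μ α β) p
        + trigSign t.b * mono c (t.e - 1) (!t.b) t.n
            (fun x => pd μ (bg.phase t.n) x * t.S α β x) p) m
      = c.lam p ^ m * orderSum bg a (fun t => trig t.b (angle t.n (ang p))
          * nab pd Γ t.S μ α β (pos p)) m
        + c.lam p ^ (m - 1 : ℤ) * orderSum bg a (fun t => trigSign t.b *
            trig (!t.b) (angle t.n (ang p)) * (pd μ (bg.phase t.n) (pos p) * t.S α β (pos p))) m := by
    intro m
    rw [← orderSum_mul_left, ← orderSum_mul_left, ← orderSum_add]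
    refine orderSum_congr bg a m fun t ht => ?_
    rw [mono_apply R, mono_apply R, ht, zpow_natCast]
    ring
  have z0 : orderSum bg a (fun t => trigSign t.b *
      trig (!t.b) (angle t.n (ang p)) * (pd μ (bg.phase t.n) (pos p) * t.S α β (pos p))) 0 = 0 := by
    simp [orderSum, phase_zero, pd_zero]
  have z4 : ∀ F, orderSum bg a F 4 = 0 := fun _ => rfl
  simp only [e, nabCoeff, Finset.sum_range_succ, Finset.sum_range_zero, z0, z4, zero_add]
  norm_num
  ring

/-- The lowest power is `λ⁻¹`, reached when both derivatives fall on the phase of a term with factor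
`λ`. This explains the prefactor and the shift by one in `nab2Coeff`. -/
lemma nab2_metric (R : Realization bg c D V pos ang) (hbg : bg.IsNullDust) (ha : a.Admissible bg)
    (hΓ : ∀ ρ μ ν, ContDiffOn ℝ 1 (Γ ρ μ ν) slab) {p : E} (hp : p ∈ D) (κ μ α β : Fin 4) :
    nab2 c.d (fun ρ μ ν => c.field (Γ ρ μ ν)) (metric bg a c) κ μ α β p
      = (c.lam p)⁻¹
        * ∑ m ∈ Finset.range 5, c.lam p ^ m * nab2Coeff bg a Γ (ang p) (pos p) m κ μ α β := by
  have l0 := R.lam_ne p hp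
  rw [R.nab2_eq hbg.smooth_phase hΓ (ansatz_smooth hbg ha) (fun a b p _ => metric_eq_sum R a b p) hp,
    sum_ansatzTerm bg a (fun t => mono c t.e t.b t.n (nab2 pd Γ t.S κ μ α β) p
        + trigSign t.b * mono c (t.e - 1) (!t.b) t.n (midDeriv Γ (bg.phase t.n) t.S κ μ α β) p
        - mono c (t.e - 2) t.b t.n
            (fun x => pd κ (bg.phase t.n) x * pd μ (bg.phase t.n) x * t.S α β x) p)]
  have e : ∀ m, orderSum bg a (fun t => mono c t.e t.b t.n (nab2 pd Γ t.S κ μ α β) p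
        + trigSign t.b * mono c (t.e - 1) (!t.b) t.n (midDeriv Γ (bg.phase t.n) t.S κ μ α β) p
        - mono c (t.e - 2) t.b t.n
            (fun x => pd κ (bg.phase t.n) x * pd μ (bg.phase t.n) x * t.S α β x) p) m
      = c.lam p ^ m * orderSum bg a (fun t => trig t.b (angle t.n (ang p))
          * nab2 pd Γ t.S κ μ α β (pos p)) m
        + c.lam p ^ (m - 1 : ℤ) * orderSum bg a (fun t => trigSign t.b *
            trig (!t.b) (angle t.n (ang p)) * midDeriv Γ (bg.phase t.n) t.S κ μ α β (pos p)) m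
        + (-c.lam p ^ (m - 2 : ℤ)) * orderSum bg a (fun t => trig t.b (angle t.n (ang p))
          * (pd κ (bg.phase t.n) (pos p) * pd μ (bg.phase t.n) (pos p) * t.S α β (pos p))) m := by
    intro m
    rw [← orderSum_mul_left, ← orderSum_mul_left, ← orderSum_mul_left, ← orderSum_add,
      ← orderSum_add]
    refine orderSum_congr bg a m fun t ht => ?_
    rw [mono_apply R, mono_apply R, mono_apply R, ht, zpow_natCast]
    ring
  have z0 : orderSum bg a (fun t => trig t.b (angle t.n (ang p))
      * (pd κ (bg.phase t.n) (pos p) * pd μ (bg.phase t.n) (pos p) * t.S α β (pos p))) 0 = 0 := by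
    simp [orderSum, phase_zero, pd_zero]
  have z1 : orderSum bg a (fun t => trigSign t.b * trig (!t.b) (angle t.n (ang p))
      * midDeriv Γ (bg.phase t.n) t.S κ μ α β (pos p)) 0 = 0 := by
    have : pd μ (fun _ => (0 : ℝ)) = fun _ => 0 := funext fun _ => pd_zero μ
    simp [orderSum, phase_zero, midDeriv, hess, this, pd_zero]
  have z4 : ∀ F, orderSum bg a F 4 = 0 := fun _ => rfl
  have z5 : ∀ F, orderSum bg a F 5 = 0 := fun _ => rfl
  simp only [e, nab2Coeff, Finset.sum_range_succ, Finset.sum_range_zero, z0, z1, z4, z5, zero_add]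
  norm_num
  field_simp
  ring

end Orders

/-! ## Expansions at `0⁺` -/

/-- `f s = c 0 + c 1 s + ⋯ + c (n-1) s^(n-1) + O(s^n)` as `s → 0⁺`. -/
def HasExp : ℕ → (ℝ → ℝ) → (ℕ → ℝ) → Prop
  | 0, f, _ => f =O[𝓝[>] (0 : ℝ)] fun _ => (1 : ℝ)
  | n + 1, f, c => HasExp n (fun s => s⁻¹ * (f s - c 0)) fun i => c (i + 1)

namespace HasExp

lemma eventually_ne : ∀ᶠ s : ℝ in 𝓝[>] (0 : ℝ), s ≠ 0 :=
  Filter.eventually_of_mem self_mem_nhdsWithin fun _ hs => (ne_of_gt hs)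

lemma congr {n : ℕ} {f f' : ℝ → ℝ} {c c' : ℕ → ℝ} (h : HasExp n f c)
    (hf : f' =ᶠ[𝓝[>] (0 : ℝ)] f) (hc : ∀ i < n, c i = c' i) : HasExp n f' c' := by
  induction n generalizing f f' c c' with
  | zero => exact (Asymptotics.isBigO_congr hf.symm Filter.EventuallyEq.rfl).1 h
  | succ n ih =>
    refine ih h ?_ fun i hi => hc (i + 1) (by omega)
    filter_upwards [hf] with s hs
    rw [hs, hc 0 (by omega)]

lemma of_succ {n : ℕ} {f : ℝ → ℝ} {c : ℕ → ℝ} (h : HasExp (n + 1) f c) : HasExp n f c := by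
  induction n generalizing f c with
  | zero =>
    have h1 : (fun s : ℝ => s * (s⁻¹ * (f s - c 0))) =O[𝓝[>] (0 : ℝ)] fun _ => (1 : ℝ) := by
      have hid : (fun s : ℝ => s) =O[𝓝[>] (0 : ℝ)] fun _ => (1 : ℝ) :=
        ((continuous_id.tendsto (0 : ℝ)).mono_left nhdsWithin_le_nhds).isBigO_one ℝ
      simpa using hid.mul h
    have h2 := h1.add (Asymptotics.isBigO_refl (fun _ : ℝ => (1 : ℝ)) (𝓝[>] (0 : ℝ)) |>.const_mul_left (c 0))
    refine (Asymptotics.isBigO_congr ?_ Filter.EventuallyEq.rfl).1 h2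
    filter_upwards [eventually_ne] with s hs
    field_simp; ring
  | succ n ih => exact ih h

lemma of_le {m n : ℕ} (hmn : m ≤ n) {f : ℝ → ℝ} {c : ℕ → ℝ} (h : HasExp n f c) :
    HasExp m f c := by
  induction n, hmn using Nat.le_induction with
  | base => exact h
  | succ n _ ih => exact ih h.of_succ

lemma add {n : ℕ} {f g : ℝ → ℝ} {c d : ℕ → ℝ} (hf : HasExp n f c) (hg : HasExp n g d) :
    HasExp n (fun s => f s + g s) fun i => c i + d i := by
  induction n generalizing f g c d with
  | zero => exact Asymptotics.IsBigO.add hf hg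
  | succ n ih =>
    refine (ih hf hg).congr (Filter.Eventually.of_forall fun s => ?_) fun _ _ => rfl
    ring

lemma const_mul {n : ℕ} {f : ℝ → ℝ} {c : ℕ → ℝ} (r : ℝ) (hf : HasExp n f c) :
    HasExp n (fun s => r * f s) fun i => r * c i := by
  induction n generalizing f c with
  | zero => exact Asymptotics.IsBigO.const_mul_left hf r
  | succ n ih =>
    refine (ih hf).congr (Filter.Eventually.of_forall fun s => ?_) fun _ _ => rfl
    ring

lemma neg {n : ℕ} {f : ℝ → ℝ} {c : ℕ → ℝ} (hf : HasExp n f c) :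
    HasExp n (fun s => -f s) fun i => -c i :=
  (hf.const_mul (-1)).congr (Filter.Eventually.of_forall fun s => by simp) fun i _ => by ring

lemma sub {n : ℕ} {f g : ℝ → ℝ} {c d : ℕ → ℝ} (hf : HasExp n f c) (hg : HasExp n g d) :
    HasExp n (fun s => f s - g s) fun i => c i - d i :=
  (hf.add hg.neg).congr (Filter.Eventually.of_forall fun s => by ring) fun i _ => by ring

lemma zero (n : ℕ) : HasExp n (fun _ => 0) fun _ => 0 := by
  induction n with
  | zero => exact Asymptotics.isBigO_zero _ _
  | succ n ih => exact ih.congr (Filter.Eventually.of_forall fun s => by simp) fun _ _ => rfl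

lemma const (n : ℕ) (r : ℝ) : HasExp n (fun _ => r) fun i => if i = 0 then r else 0 := by
  cases n with
  | zero => exact Asymptotics.isBigO_const_const _ one_ne_zero _
  | succ n =>
    exact (zero n).congr (Filter.Eventually.of_forall fun s => by simp) fun _ _ => by simp

lemma sum {ι : Type*} (t : Finset ι) {n : ℕ} {f : ι → ℝ → ℝ} {c : ι → ℕ → ℝ}
    (h : ∀ i ∈ t, HasExp n (f i) (c i)) :
    HasExp n (fun s => ∑ i ∈ t, f i s) fun k => ∑ i ∈ t, c i k := by
  classical
  induction t using Finset.induction_on with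
  | empty => simpa using zero n
  | insert i t hi ih =>
    simp only [Finset.sum_insert hi]
    exact (h i (Finset.mem_insert_self _ _)).add
      (ih fun j hj => h j (Finset.mem_insert_of_mem hj))

/-- Induction on `s⁻¹(fg - c₀d₀) = c₀ · s⁻¹(g - d₀) + s⁻¹(f - c₀) · g`. The last product needs only
the shortened expansion of `g`. -/
lemma mul {n : ℕ} {f g : ℝ → ℝ} {c d : ℕ → ℝ} (hf : HasExp n f c) (hg : HasExp n g d) :
    HasExp n (fun s => f s * g s) fun k => ∑ ij ∈ Finset.HasAntidiagonal.antidiagonal k, c ij.1 * d ij.2 := by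
  induction n generalizing f g c d with
  | zero => simpa [HasExp] using Asymptotics.IsBigO.mul hf hg
  | succ n ih =>
    have h1 := ih (f := fun s => s⁻¹ * (f s - c 0)) hf hg.of_succ
    have h2 : HasExp n (fun s => c 0 * (s⁻¹ * (g s - d 0))) fun i => c 0 * d (i + 1) :=
      HasExp.const_mul (f := fun s => s⁻¹ * (g s - d 0)) (c := fun i => d (i + 1)) (c 0) hg
    refine (h2.add h1).congr (Filter.Eventually.of_forall fun s => ?_) fun i _ => ?_
    · simp; ring
    · simp only [Finset.Nat.sum_antidiagonal_succ]

lemma id_mul {n : ℕ} {f : ℝ → ℝ} {c : ℕ → ℝ} (hf : HasExp n f c) :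
    HasExp (n + 1) (fun s => s * f s) fun
      | 0 => 0
      | k + 1 => c k := by
  refine hf.congr ?_ fun _ _ => rfl
  filter_upwards [eventually_ne] with s hs
  simp [hs]

lemma polynomial (n k : ℕ) (p : ℕ → ℝ) :
    HasExp n (fun s => ∑ m ∈ Finset.range k, s ^ m * p m) fun m => if m < k then p m else 0 := by
  induction k generalizing n p with
  | zero => simpa using zero n
  | succ k ih =>
    cases n with
    | zero =>
      have : Continuous fun s : ℝ => ∑ m ∈ Finset.range (k + 1), s ^ m * p m := by fun_prop
      exact ((this.tendsto 0).mono_left nhdsWithin_le_nhds).isBigO_one ℝ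
    | succ n =>
      refine (ih n fun m => p (m + 1)).congr ?_ fun i _ => by simp
      filter_upwards [eventually_ne] with s hs
      rw [Finset.sum_range_succ']
      simp only [pow_zero, one_mul, Nat.zero_lt_succ, if_true, add_sub_cancel_right, pow_succ,
        Finset.mul_sum]
      exact Finset.sum_congr rfl fun m _ => by field_simp

/-- The strict inequality leaves at least one spare factor `s` in front of a bounded remainder, so
the quotient converges. This is the limit by which `laurentCoeff` is defined. -/
lemma tendsto {n j : ℕ} (hj : j < n) {f : ℝ → ℝ} {c : ℕ → ℝ} (h : HasExp n f c) :
    Filter.Tendsto (fun s => (f s - ∑ i ∈ Finset.range j, c i * s ^ i) * (s ^ j)⁻¹)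
      (𝓝[>] (0 : ℝ)) (𝓝 (c j)) := by
  induction j generalizing n f c with
  | zero =>
    have h1 : HasExp 1 f c := h.of_le (by omega)
    have hid : Filter.Tendsto (fun s : ℝ => s) (𝓝[>] (0 : ℝ)) (𝓝 0) :=
      (continuous_id.tendsto (0 : ℝ)).mono_left nhdsWithin_le_nhds
    have h2 : Filter.Tendsto (fun s : ℝ => s * (s⁻¹ * (f s - c 0))) (𝓝[>] (0 : ℝ)) (𝓝 0) := by
      have hb : (fun s : ℝ => s * (s⁻¹ * (f s - c 0))) =O[𝓝[>] (0 : ℝ)] fun s => s * 1 :=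
        (Asymptotics.isBigO_refl _ _).mul h1
      refine hb.trans_tendsto ?_
      simpa using hid
    have h3 := h2.add_const (c 0)
    rw [zero_add] at h3
    refine h3.congr' ?_
    filter_upwards [eventually_ne] with s hs
    simp only [Finset.range_zero, Finset.sum_empty, pow_zero]
    field_simp; ring
  | succ j ih =>
    obtain ⟨n, rfl⟩ : ∃ m, n = m + 1 := ⟨n - 1, by omega⟩
    refine (ih (n := n) (by omega) h).congr' ?_
    filter_upwards [eventually_ne] with s hs
    rw [Finset.sum_range_succ']
    simp only [pow_succ, pow_zero, mul_one, ← mul_assoc, ← Finset.sum_mul]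
    field_simp
    ring

end HasExp

/-- `laurentCoeff` counts from the power `s⁻¹`, so its entry `j` for `f` is the entry `j` of the
expansion of `s f`. The limit defining it subtracts all earlier coefficients, which have to be
identified beforehand; hence the strong induction. -/
lemma laurentCoeff_eq {n : ℕ} {f φ : ℝ → ℝ} {c : ℕ → ℝ} (h : HasExp n φ c)
    (hf : ∀ᶠ s in 𝓝[>] (0 : ℝ), f s = s⁻¹ * φ s) {j : ℕ} (hj : j < n) :
    laurentCoeff f j = c j := by
  induction j using Nat.strong_induction_on with
  | _ j ih =>
    rw [laurentCoeff]
    refine Filter.Tendsto.limUnder_eq ((h.tendsto hj).congr' ?_)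
    filter_upwards [hf, HasExp.eventually_ne] with s hs hs0
    rw [hs, ← Fin.sum_univ_eq_sum_range (fun i => c i * s ^ i) j]
    have e : ∑ i : Fin j, s ^ ((i : ℤ) - 1) * laurentCoeff f i
        = s⁻¹ * ∑ i : Fin j, c i * s ^ (i : ℕ) := by
      rw [Finset.mul_sum]
      refine Finset.sum_congr rfl fun i _ => ?_
      rw [ih i i.2 (by omega), zpow_sub_one₀ hs0, zpow_natCast]
      ring
    rw [e, sub_eq_add_neg (1 : ℤ), zpow_add₀ hs0, zpow_one, zpow_neg, zpow_natCast]
    field_simp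

/-! ### Expansions of the inverse matrix and of the linear and quadratic parts -/

section Matrices

variable {g : Fin 4 → Fin 4 → ℝ → ℝ}

/-- The resolvent identity `A⁻¹ - B⁻¹ = -B⁻¹(A - B)A⁻¹`. The factor `A - B` is of order `s`, so an
expansion of the inverse of length `n` yields one of length `n + 1`. -/
lemma inv_sub_inv (h0 : (Matrix.of fun a b => g a b 0).det ≠ 0) {s : ℝ}
    (hs : (Matrix.of fun a b => g a b s).det ≠ 0) (ρ σ : Fin 4) :
    inv g ρ σ s - inv g ρ σ 0
      = -∑ μ, ∑ ν, inv g ρ μ 0 * ((g μ ν s - g μ ν 0) * inv g ν σ s) := by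
  have e1 : ∑ μ, ∑ ν, inv g ρ μ 0 * (g μ ν s * inv g ν σ s) = inv g ρ σ 0 := by
    simp only [← Finset.mul_sum, metric_mul_inv hs]; simp
  have e2 : ∑ μ, ∑ ν, inv g ρ μ 0 * (g μ ν 0 * inv g ν σ s) = inv g ρ σ s := by
    rw [Finset.sum_comm]
    simp only [← mul_assoc, ← Finset.sum_mul, inv_mul_metric h0]; simp
  simp only [sub_mul, mul_sub, Finset.sum_sub_distrib, e1, e2]
  ring

/-- The expansion of the inverse of a matrix to second order. -/
lemma hasExp_inv (hg : ∀ a b, Continuous (g a b)) {gc : ℕ → Fin 4 → Fin 4 → ℝ}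
    (hc : ∀ a b, HasExp 3 (g a b) fun m => gc m a b) (h00 : ∀ a b, g a b 0 = gc 0 a b)
    (h0 : (Matrix.of fun a b => g a b 0).det ≠ 0) {G₁ G₂ : Fin 4 → Fin 4 → ℝ}
    (h1 : ∀ ρ σ, G₁ ρ σ = -∑ μ, ∑ ν, inv g ρ μ 0 * (gc 1 μ ν * inv g ν σ 0))
    (h2 : ∀ ρ σ, G₂ ρ σ
      = -∑ μ, ∑ ν, inv g ρ μ 0 * (gc 1 μ ν * G₁ ν σ + gc 2 μ ν * inv g ν σ 0))
    (ρ σ : Fin 4) :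
    HasExp 3 (inv g ρ σ) fun
      | 0 => inv g ρ σ 0
      | 1 => G₁ ρ σ
      | 2 => G₂ ρ σ
      | _ => 0 := by
  have hdet : ∀ᶠ s in 𝓝[>] (0 : ℝ), (Matrix.of fun a b => g a b s).det ≠ 0 :=
    (eventually_det_ne_zero (D := Set.univ) (fun a b => (hg a b).continuousWithinAt) h0
      ).filter_mono (nhdsWithin_mono _ (Set.subset_univ _))
  -- The bootstrap starts from continuity: an expansion of length `0` is boundedness, and its
  -- coefficient sequence is irrelevant.
  have b0 : ∀ ρ σ, HasExp 0 (inv g ρ σ) fun _ => 0 := fun ρ σ =>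
    ((contDiffWithinAt_inv (n := 0) (D := Set.univ) (fun a b =>
      (contDiff_zero.2 (hg a b)).contDiffWithinAt) h0 ρ σ).continuousWithinAt.mono_left
        (nhdsWithin_mono _ (Set.subset_univ _))).isBigO_one ℝ
  -- Each use of the resolvent identity gains one order, and the new coefficients are Cauchy
  -- products of those of the metric with the old ones. Three rounds give the expansion to second
  -- order.
  have step : ∀ n < 3, ∀ C : Fin 4 → Fin 4 → ℕ → ℝ, (∀ ρ σ, HasExp n (inv g ρ σ) (C ρ σ)) →
      ∀ ρ σ, HasExp (n + 1) (inv g ρ σ) fun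
        | 0 => inv g ρ σ 0
        | k + 1 => -∑ μ, ∑ ν, inv g ρ μ 0 *
            ∑ ij ∈ Finset.HasAntidiagonal.antidiagonal k, gc (ij.1 + 1) μ ν * C ν σ ij.2 := by
    intro n hn C hC ρ σ
    have hq : ∀ μ ν, HasExp n (fun s => s⁻¹ * (g μ ν s - gc 0 μ ν)) fun i => gc (i + 1) μ ν :=
      fun μ ν => (hc μ ν).of_le (by omega : n + 1 ≤ 3)
    refine (HasExp.neg (HasExp.sum Finset.univ fun μ _ => HasExp.sum Finset.univ fun ν _ =>
      ((hq μ ν).mul (hC ν σ)).const_mul (inv g ρ μ 0))).congr ?_ fun i _ => rfl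
    filter_upwards [hdet] with s hs
    rw [inv_sub_inv h0 hs, mul_neg, Finset.mul_sum]
    simp only [Finset.mul_sum, h00]
    refine congrArg _ (Finset.sum_congr rfl fun μ _ => Finset.sum_congr rfl fun ν _ => by ring)
  have s1 := step 0 (by norm_num) _ b0
  have s2 := step 1 (by norm_num) _ s1
  have s3 := step 2 (by norm_num) _ s2
  refine (s3 ρ σ).congr Filter.EventuallyEq.rfl fun i hi => ?_
  interval_cases i
  · rfl
  · simp [h1]
  · simp [h1, h2, Finset.Nat.antidiagonal_succ]

lemma HasExp.lin2 {n : ℕ} {G : ℝ → Fin 4 → Fin 4 → ℝ} {Gc : ℕ → Fin 4 → Fin 4 → ℝ}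
    {B : ℝ → Fin 4 → Fin 4 → Fin 4 → Fin 4 → ℝ} {Bc : ℕ → Fin 4 → Fin 4 → Fin 4 → Fin 4 → ℝ}
    (hG : ∀ ρ σ, HasExp n (fun s => G s ρ σ) fun m => Gc m ρ σ)
    (hB : ∀ κ μ a b, HasExp n (fun s => B s κ μ a b) fun m => Bc m κ μ a b) (α β : Fin 4) :
    HasExp n (fun s => MultiphaseRicci.lin2 (G s) (B s) α β) fun k =>
      ∑ ij ∈ Finset.HasAntidiagonal.antidiagonal k, MultiphaseRicci.lin2 (Gc ij.1) (Bc ij.2) α β := by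
  refine (HasExp.sum Finset.univ fun ρ _ => HasExp.sum Finset.univ fun σ _ =>
    (hG ρ σ).mul ((((hB ρ α β σ).add (hB ρ β α σ)).sub (hB ρ σ α β)).sub (hB α β ρ σ))).congr
      Filter.EventuallyEq.rfl fun i _ => ?_
  simp only [MultiphaseRicci.lin2]
  rw [Finset.sum_comm (s := Finset.HasAntidiagonal.antidiagonal i)]
  refine Finset.sum_congr rfl fun ρ _ => ?_
  rw [Finset.sum_comm (s := Finset.HasAntidiagonal.antidiagonal i)]

lemma HasExp.lower {n : ℕ} {k : ℝ → Fin 4 → Fin 4 → Fin 4 → ℝ}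
    {kc : ℕ → Fin 4 → Fin 4 → Fin 4 → ℝ}
    (hk : ∀ μ a b, HasExp n (fun s => k s μ a b) fun m => kc m μ a b) (μ ν σ : Fin 4) :
    HasExp n (fun s => MultiphaseRicci.lower (k s) μ ν σ) fun m =>
      MultiphaseRicci.lower (kc m) μ ν σ :=
  (((hk μ ν σ).add (hk ν μ σ)).sub (hk σ μ ν)).const_mul (1 / 2)

/-- Two coefficients are enough. The Ricci tensor is expanded after multiplication by `s`, which
shifts this part by one place. -/
lemma HasExp.quad {G : ℝ → Fin 4 → Fin 4 → ℝ} {Gc : ℕ → Fin 4 → Fin 4 → ℝ}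
    {k : ℝ → Fin 4 → Fin 4 → Fin 4 → ℝ} {kc : ℕ → Fin 4 → Fin 4 → Fin 4 → ℝ}
    (hG : ∀ ρ σ, HasExp 2 (fun s => G s ρ σ) fun m => Gc m ρ σ)
    (hk : ∀ μ a b, HasExp 2 (fun s => k s μ a b) fun m => kc m μ a b) (α β : Fin 4) :
    HasExp 2 (fun s => MultiphaseRicci.quad (G s) (G s) (k s) (k s) α β) fun
      | 0 => MultiphaseRicci.quad (Gc 0) (Gc 0) (kc 0) (kc 0) α β
      | 1 => MultiphaseRicci.quad (Gc 1) (Gc 0) (kc 0) (kc 0) α β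
          + MultiphaseRicci.quad (Gc 0) (Gc 1) (kc 0) (kc 0) α β
          + MultiphaseRicci.quad (Gc 0) (Gc 0) (kc 1) (kc 0) α β
          + MultiphaseRicci.quad (Gc 0) (Gc 0) (kc 0) (kc 1) α β
      | _ => 0 := by
  have l := HasExp.lower hk
  refine (HasExp.sum Finset.univ fun ρ _ => HasExp.sum Finset.univ fun μ _ =>
    HasExp.sum Finset.univ fun σ _ => HasExp.sum Finset.univ fun ν _ =>
    ((hG ρ μ).mul (hG σ ν)).mul (((((hk ρ μ ν).const_mul (-2)).mul (l α β σ)).add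
      (((hk α μ ν).const_mul 2).mul (l ρ β σ))).add (((l ρ σ μ).const_mul 2).mul (l α β ν)) |>.sub
        (((l α σ μ).const_mul 2).mul (l ρ β ν)))).congr Filter.EventuallyEq.rfl fun i hi => ?_
  interval_cases i
  · simp [MultiphaseRicci.quad]
  · simp only [MultiphaseRicci.quad, ← Finset.sum_add_distrib]
    refine Finset.sum_congr rfl fun ρ _ => Finset.sum_congr rfl fun μ _ =>
      Finset.sum_congr rfl fun σ _ => Finset.sum_congr rfl fun ν _ => ?_
    simp [Finset.Nat.antidiagonal_succ, MultiphaseRicci.lower]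
    ring

end Matrices

/-! ## Expansion of the Ricci tensor of the profile -/

section Background

variable {𝒜 : Type*} [Fintype 𝒜] {bg : Background 𝒜}

lemma inv_g₀_smooth (hbg : bg.IsNullDust) (ρ σ : Fin 4) :
    ContDiffOn ℝ 2 (inv bg.g₀ ρ σ) slab := fun x hx =>
  contDiffWithinAt_inv (fun a b => hbg.smooth_metric a b x hx) (g₀_det hbg hx) ρ σ

lemma Gam_smooth (hbg : bg.IsNullDust) (ρ μ ν : Fin 4) :
    ContDiffOn ℝ 1 (Gam bg.g₀ ρ μ ν) slab := by
  have h := fun μ a b => isFrame_pd.contDiffOn (hbg.smooth_metric a b) μ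
  refine contDiffOn_const.mul (ContDiffOn.sum fun σ _ => ?_)
  exact ((inv_g₀_smooth hbg ρ σ).of_le (by norm_num)).mul (((h _ _ _).add (h _ _ _)).sub (h _ _ _))

lemma pd_g₀_symm (hbg : bg.IsNullDust) {x : Spacetime} (hx : x ∈ slab) (μ a b : Fin 4) :
    pd μ (bg.g₀ a b) x = pd μ (bg.g₀ b a) x :=
  isFrame_pd.congr_on hx (fun _ hq => g₀_symm hbg hq a b)
    ((hbg.smooth_metric b a x hx).differentiableWithinAt (by norm_num)) μ

lemma Gam_symm (hbg : bg.IsNullDust) {x : Spacetime} (hx : x ∈ slab) (ρ μ ν : Fin 4) :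
    Gam bg.g₀ ρ μ ν x = Gam bg.g₀ ρ ν μ x := by
  simp only [Gam, christoffel]
  congr 1
  refine Finset.sum_congr rfl fun σ _ => ?_
  rw [pd_g₀_symm hbg hx σ μ ν]; ring

/-- The background metric is covariantly constant. -/
lemma nab_g₀ (hbg : bg.IsNullDust) {x : Spacetime} (hx : x ∈ slab) (μ a b : Fin 4) :
    nab pd (Gam bg.g₀) bg.g₀ μ a b x = 0 := by
  have l : ∀ μ a b, ∑ ρ, Gam bg.g₀ ρ μ a x * bg.g₀ ρ b x
      = (1 / 2) * (pd μ (bg.g₀ a b) x + pd a (bg.g₀ μ b) x - pd b (bg.g₀ μ a) x) := by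
    intro μ a b
    calc _ = (1 / 2) * ∑ σ, (∑ ρ, bg.g₀ b ρ x * inv bg.g₀ ρ σ x)
            * (pd μ (bg.g₀ a σ) x + pd a (bg.g₀ μ σ) x - pd σ (bg.g₀ μ a) x) := by
          simp only [Gam, christoffel, Finset.mul_sum, Finset.sum_mul]
          rw [Finset.sum_comm]
          refine Finset.sum_congr rfl fun σ _ => Finset.sum_congr rfl fun ρ _ => ?_
          rw [g₀_symm hbg hx ρ b]; ring
      _ = _ := by simp [metric_mul_inv (g₀_det hbg hx)]
  have e : ∑ ρ, Gam bg.g₀ ρ μ b x * bg.g₀ a ρ x = ∑ ρ, Gam bg.g₀ ρ μ b x * bg.g₀ ρ a x :=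
    Finset.sum_congr rfl fun ρ _ => by rw [g₀_symm hbg hx a ρ]
  rw [nab, Finset.sum_add_distrib, e, l, l, pd_g₀_symm hbg hx μ b a, pd_g₀_symm hbg hx a μ b,
    pd_g₀_symm hbg hx b μ a]
  rw [pd_g₀_symm hbg hx a b μ]
  ring

end Background

/-! ### The coefficients of orders `-1`, `0`, `1` on profiles -/

section Expansion

variable {𝒜 : Type*} [Fintype 𝒜] [DecidableEq 𝒜] (bg : Background 𝒜) (a : Amplitudes 𝒜)
  (θ : 𝒜 → ℝ) (x : Spacetime)

/-- The coefficient of first order of the inverse metric. -/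
def invCoeffOne (ρ σ : Fin 4) : ℝ :=
  -∑ μ, ∑ ν, inv bg.g₀ ρ μ x * (metricCoeff bg a θ x 1 μ ν * inv bg.g₀ ν σ x)

/-- The coefficient of second order of the inverse metric. -/
def invCoeffTwo (ρ σ : Fin 4) : ℝ :=
  -∑ μ, ∑ ν, inv bg.g₀ ρ μ x * (metricCoeff bg a θ x 1 μ ν * invCoeffOne bg a θ x ν σ
    + metricCoeff bg a θ x 2 μ ν * inv bg.g₀ ν σ x)

/-- The coefficients of the inverse metric, up to second order. -/
def invCoeff : ℕ → Fin 4 → Fin 4 → ℝ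
  | 0 => fun ρ σ => inv bg.g₀ ρ σ x
  | 1 => invCoeffOne bg a θ x
  | 2 => invCoeffTwo bg a θ x
  | _ => fun _ _ => 0

/-- The coefficients of `λ⁻¹`, `λ⁰`, `λ¹` of twice the Ricci tensor. -/
def twoRicciCoeff (α β : Fin 4) : ℕ → ℝ
  | 0 => lin2 (invCoeff bg a θ x 0) (nab2Coeff bg a (Gam bg.g₀) θ x 0) α β
  | 1 => 2 * ricci pd bg.g₀ α β x
      + (lin2 (invCoeff bg a θ x 0) (nab2Coeff bg a (Gam bg.g₀) θ x 1) α β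
        + lin2 (invCoeff bg a θ x 1) (nab2Coeff bg a (Gam bg.g₀) θ x 0) α β)
      + quad (invCoeff bg a θ x 0) (invCoeff bg a θ x 0) (nabCoeff bg a (Gam bg.g₀) θ x 0)
          (nabCoeff bg a (Gam bg.g₀) θ x 0) α β
  | 2 => lin2 (invCoeff bg a θ x 0) (nab2Coeff bg a (Gam bg.g₀) θ x 2) α β
      + lin2 (invCoeff bg a θ x 1) (nab2Coeff bg a (Gam bg.g₀) θ x 1) α β
      + lin2 (invCoeff bg a θ x 2) (nab2Coeff bg a (Gam bg.g₀) θ x 0) α β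
      + (quad (invCoeff bg a θ x 1) (invCoeff bg a θ x 0) (nabCoeff bg a (Gam bg.g₀) θ x 0)
          (nabCoeff bg a (Gam bg.g₀) θ x 0) α β
        + quad (invCoeff bg a θ x 0) (invCoeff bg a θ x 1) (nabCoeff bg a (Gam bg.g₀) θ x 0)
          (nabCoeff bg a (Gam bg.g₀) θ x 0) α β
        + quad (invCoeff bg a θ x 0) (invCoeff bg a θ x 0) (nabCoeff bg a (Gam bg.g₀) θ x 1)
          (nabCoeff bg a (Gam bg.g₀) θ x 0) α β
        + quad (invCoeff bg a θ x 0) (invCoeff bg a θ x 0) (nabCoeff bg a (Gam bg.g₀) θ x 0)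
          (nabCoeff bg a (Gam bg.g₀) θ x 1) α β)
  | _ => 0

variable {bg a θ x}

lemma metric_profile (hbg : bg.IsNullDust) (μ ν : Fin 4) (s : ℝ) :
    metric bg a (profile bg) μ ν (s, x, θ)
      = ∑ m ∈ Finset.range 4, s ^ m * metricCoeff bg a θ x m μ ν :=
  metric_eq_poly (realization_profile hbg.smooth_phase) μ ν (s, x, θ)

lemma metricCoeff_zero (μ ν : Fin 4) : metricCoeff bg a θ x 0 μ ν = bg.g₀ μ ν x := by
  simp [metricCoeff, orderSum, angle_zero, trig]

lemma metric_profile_zero (hbg : bg.IsNullDust) (μ ν : Fin 4) :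
    metric bg a (profile bg) μ ν (0, x, θ) = bg.g₀ μ ν x := by
  rw [metric_profile hbg, Finset.sum_range_succ']
  simp [metricCoeff_zero]

lemma continuous_metric_profile (hbg : bg.IsNullDust) (μ ν : Fin 4) :
    Continuous fun s : ℝ => metric bg a (profile bg) μ ν (s, x, θ) := by
  simp only [metric_profile hbg]
  fun_prop

lemma eventually_det_profile (hbg : bg.IsNullDust) (hx : x ∈ slab) : ∀ᶠ s in 𝓝[>] (0 : ℝ),
    (Matrix.of fun μ ν => metric bg a (profile bg) μ ν (s, x, θ)).det ≠ 0 := by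
  refine (eventually_det_ne_zero (D := Set.univ)
    (g := fun μ ν s => metric bg a (profile bg) μ ν (s, x, θ))
    (fun μ ν => (continuous_metric_profile hbg μ ν).continuousWithinAt) ?_
      ).filter_mono (nhdsWithin_mono _ (Set.subset_univ _))
  simp only [metric_profile_zero hbg]
  exact g₀_det hbg hx

omit [Fintype 𝒜] [DecidableEq 𝒜] in
lemma eventually_mem_profileDomain (hx : x ∈ slab) :
    ∀ᶠ s in 𝓝[>] (0 : ℝ), ((s, x, θ) : ℝ × Spacetime × (𝒜 → ℝ)) ∈ profileDomain 𝒜 := by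
  filter_upwards [HasExp.eventually_ne] with s hs
  exact ⟨hs, hx, trivial⟩

lemma hasExp_inv_profile (hbg : bg.IsNullDust) (hx : x ∈ slab) (ρ σ : Fin 4) :
    HasExp 3 (fun s => inv (metric bg a (profile bg)) ρ σ (s, x, θ))
      fun m => invCoeff bg a θ x m ρ σ := by
  have z : ∀ ρ σ, inv (fun μ ν s => metric bg a (profile bg) μ ν (s, x, θ)) ρ σ 0
      = inv bg.g₀ ρ σ x := by
    intro ρ σ
    simp only [inv, metric_profile_zero hbg]
  refine (hasExp_inv (g := fun μ ν s => metric bg a (profile bg) μ ν (s, x, θ))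
    (gc := fun m => if m < 4 then metricCoeff bg a θ x m else 0)
    (fun μ ν => continuous_metric_profile hbg μ ν) (fun μ ν => ?_) (fun μ ν => ?_) ?_
    (G₁ := invCoeffOne bg a θ x) (G₂ := invCoeffTwo bg a θ x) (fun ρ σ => ?_) (fun ρ σ => ?_)
    ρ σ).congr (Filter.Eventually.of_forall fun s => rfl) fun i hi => ?_
  · refine (HasExp.polynomial 3 4 fun m => metricCoeff bg a θ x m μ ν).congr
      (Filter.Eventually.of_forall fun s => metric_profile hbg μ ν s) fun i hi => ?_
    have : i < 4 := by omega
    simp [this]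
  · simp [metric_profile_zero hbg, metricCoeff_zero]
  · simp only [metric_profile_zero hbg]
    exact g₀_det hbg hx
  · simp [invCoeffOne, z]
  · simp [invCoeffTwo, z]
  · interval_cases i
    · exact z ρ σ
    · rfl
    · rfl

-- The pulled-back background connection depends neither on `s` nor on the angles, so its curvature
-- is that of `g₀`.
omit [DecidableEq 𝒜] in
lemma ricciOf_field {E : Type*} [NormedAddCommGroup E] [NormedSpace ℝ E] {c : Calculus 𝒜 E}
    {D : Set E} {V : Fin 4 → E → E} {pos : E → Spacetime} {ang : E → 𝒜 → ℝ}
    (R : Realization bg c D V pos ang) {p : E} (hp : p ∈ D) (α β : Fin 4) :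
    ricciOf c.d (fun ρ μ ν => c.field (Gam bg.g₀ ρ μ ν)) α β p = ricci pd bg.g₀ α β (pos p) := by
  simp only [ricciOf, R.d_field _ _ p hp, R.field_apply]
  rfl

/-- The expansion of the second covariant derivatives of the profile of the metric. -/
lemma hasExp_nab2 (n : ℕ) (Γ : Fin 4 → Fin 4 → Fin 4 → Scalar) (κ μ α β : Fin 4) :
    HasExp n (fun s => ∑ m ∈ Finset.range 5, s ^ m * nab2Coeff bg a Γ θ x m κ μ α β)
      fun m => if m < 5 then nab2Coeff bg a Γ θ x m κ μ α β else 0 :=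
  HasExp.polynomial n 5 fun m => nab2Coeff bg a Γ θ x m κ μ α β

lemma hasExp_nab (n : ℕ) (Γ : Fin 4 → Fin 4 → Fin 4 → Scalar) (μ α β : Fin 4) :
    HasExp n (fun s => ∑ m ∈ Finset.range 4, s ^ m * nabCoeff bg a Γ θ x m μ α β)
      fun m => if m < 4 then nabCoeff bg a Γ θ x m μ α β else 0 :=
  HasExp.polynomial n 4 fun m => nabCoeff bg a Γ θ x m μ α β

lemma lin2_mul_left (r : ℝ) (G : Fin 4 → Fin 4 → ℝ) (B : Fin 4 → Fin 4 → Fin 4 → Fin 4 → ℝ)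
    (α β : Fin 4) : lin2 G (fun κ μ a b => r * B κ μ a b) α β = r * lin2 G B α β := by
  simp only [lin2, Finset.mul_sum]
  exact Finset.sum_congr rfl fun ρ _ => Finset.sum_congr rfl fun σ _ => by ring

/-- The reference connection is the pulled-back Levi-Civita connection of `g₀`, for which the
background metric is parallel. After multiplication by `s`, the linear part is a product of two
expansions starting at order `0`, while the background curvature and the quadratic part are moved up
by one order. -/
theorem hasExp_two_ricci (hbg : bg.IsNullDust) (ha : a.Admissible bg) (hx : x ∈ slab)
    (α β : Fin 4) :
    HasExp 3 (fun s => s * (2 * ricci (profile bg).d (metric bg a (profile bg)) α β (s, x, θ)))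
      (twoRicciCoeff bg a θ x α β) := by
  have R := realization_profile hbg.smooth_phase
  have hG := hasExp_inv_profile (a := a) (θ := θ) hbg hx
  have h1 := HasExp.lin2 (G := fun s ρ σ => inv (metric bg a (profile bg)) ρ σ (s, x, θ)) hG
    (B := fun s κ μ α β => ∑ m ∈ Finset.range 5, s ^ m
      * nab2Coeff bg a (Gam bg.g₀) θ x m κ μ α β)
    (Bc := fun m κ μ α β => if m < 5 then nab2Coeff bg a (Gam bg.g₀) θ x m κ μ α β else 0)
    (fun κ μ α β => hasExp_nab2 3 _ κ μ α β) α β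
  have h2 := HasExp.quad (G := fun s ρ σ => inv (metric bg a (profile bg)) ρ σ (s, x, θ))
    (fun ρ σ => (hG ρ σ).of_succ)
    (k := fun s μ α β => ∑ m ∈ Finset.range 4, s ^ m * nabCoeff bg a (Gam bg.g₀) θ x m μ α β)
    (kc := fun m μ α β => if m < 4 then nabCoeff bg a (Gam bg.g₀) θ x m μ α β else 0)
    (fun μ α β => hasExp_nab 2 _ μ α β) α β
  have h3 := (HasExp.const 2 (2 * ricci pd bg.g₀ α β x)).id_mul
  refine ((h3.add h1).add h2.id_mul).congr ?_ fun i hi => ?_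
  -- The profile metric is invertible for small `s` because it tends to `g₀`. Nothing more is
  -- visible to an expansion at `0⁺`.
  · filter_upwards [eventually_det_profile (a := a) (θ := θ) hbg hx,
      eventually_mem_profileDomain (θ := θ) hx] with s hs hp
    have hs0 : s ≠ 0 := hp.1
    rw [R.frame.two_ricci_eq (fun μ ν => metric_smooth R hbg ha μ ν)
      (fun q hq μ ν => metric_symm R hbg ha hq μ ν)
      (fun ρ μ ν => R.field_smooth 1 _ (Gam_smooth hbg ρ μ ν))
      (fun q hq ρ μ ν => by
        rw [R.field_apply, R.field_apply]; exact Gam_symm hbg (R.pos_mem q hq) ρ μ ν)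
      hp hs α β, ricciOf_field R hp]
    simp only [nab_metric R hbg ha hp, nab2_metric R hbg ha (Gam_smooth hbg) hp]
    rw [lin2_mul_left]
    simp only [profile]
    field_simp
  · interval_cases i
    · simp [twoRicciCoeff]
    · simp [twoRicciCoeff, Finset.Nat.antidiagonal_succ]
    · simp [twoRicciCoeff, Finset.Nat.antidiagonal_succ]
      ring

lemma laurentCoeff_of_hasExp {n : ℕ} {f : ℝ → ℝ} {c : ℕ → ℝ}
    (h : HasExp n (fun s => s * f s) c) {j : ℕ} (hj : j < n) : laurentCoeff f j = c j := by
  refine laurentCoeff_eq h ?_ hj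
  filter_upwards [HasExp.eventually_ne] with s hs
  field_simp

end Expansion

/-! ## Evaluation of the linear and quadratic parts on rank one tensors -/

section Words

variable (G G' : Fin 4 → Fin 4 → ℝ) (l l' : Fin 4 → ℝ) (f f' : Fin 4 → Fin 4 → ℝ)

/-- `G l`. -/
def up (ρ : Fin 4) : ℝ := ∑ μ, G ρ μ * l μ

/-- `G f`. -/
def mix (ρ σ : Fin 4) : ℝ := ∑ μ, G ρ μ * f μ σ

/-- `G f G'`. -/
def sandwich (ρ σ : Fin 4) : ℝ := ∑ μ, ∑ ν, G ρ μ * f μ ν * G' ν σ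

/-- `f l^♯`. -/
def contr (α : Fin 4) : ℝ := ∑ ρ, up G l ρ * f ρ α

variable {G G' l l' f f'}

lemma sandwich_eq (ρ σ : Fin 4) : sandwich G G' f ρ σ = ∑ ν, mix G f ρ ν * G' ν σ := by
  simp only [sandwich, mix, Finset.sum_mul]
  rw [Finset.sum_comm]

lemma sandwich_symm (hG : ∀ a b, G a b = G b a) (hf : ∀ a b, f a b = f b a) (ρ σ : Fin 4) :
    sandwich G G f ρ σ = sandwich G G f σ ρ := by
  simp only [sandwich]
  rw [Finset.sum_comm]
  refine Finset.sum_congr rfl fun μ _ => Finset.sum_congr rfl fun ν _ => ?_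
  rw [hG ρ, hG μ, hf ν]; ring

lemma sum_mul_mix (hG : ∀ a b, G a b = G b a) (σ : Fin 4) :
    ∑ ρ, l ρ * mix G f ρ σ = contr G l f σ := by
  simp only [mix, contr, up, Finset.mul_sum, Finset.sum_mul]
  rw [Finset.sum_comm]
  refine Finset.sum_congr rfl fun μ _ => Finset.sum_congr rfl fun ρ _ => ?_
  rw [hG]; ring

lemma sum_mul_sandwich (hG : ∀ a b, G a b = G b a) (σ : Fin 4) :
    ∑ ρ, l ρ * sandwich G G' f ρ σ = ∑ ν, contr G l f ν * G' ν σ := by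
  simp only [sandwich_eq, Finset.mul_sum]
  rw [Finset.sum_comm]
  refine Finset.sum_congr rfl fun ν _ => ?_
  rw [← sum_mul_mix hG, Finset.sum_mul]
  exact Finset.sum_congr rfl fun ρ _ => by ring

/-- This is the source of `𝒫_v`: with `l = dv`, the two contractions and the trace assemble into
`∂_{(α}v Pol_{β)}`, and the square of `l` multiplies `f`. -/
lemma lin2_rank_one (hG : ∀ a b, G a b = G b a) (hf : ∀ a b, f a b = f b a) (α β : Fin 4) :
    lin2 G (fun κ μ a b => l κ * l μ * f a b) α β
      = l α * contr G l f β + l β * contr G l f α - (∑ ρ, ∑ σ, G ρ σ * l ρ * l σ) * f α β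
        - l α * l β * ∑ ρ, ∑ σ, G ρ σ * f ρ σ := by
  have e : ∀ β, contr G l f β = ∑ ρ, ∑ σ, G ρ σ * l ρ * f β σ := by
    intro β
    simp only [contr, up, Finset.sum_mul]
    rw [Finset.sum_comm]
    refine Finset.sum_congr rfl fun μ _ => Finset.sum_congr rfl fun ρ _ => ?_
    rw [hG, hf]
  simp only [e, lin2, Finset.mul_sum, Finset.sum_mul, ← Finset.sum_add_distrib,
    ← Finset.sum_sub_distrib]
  refine Finset.sum_congr rfl fun ρ _ => Finset.sum_congr rfl fun σ _ => ?_
  rw [hf α σ, hf β σ]; ring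

lemma sum_mul_lower (hf : ∀ a b, f a b = f b a) (α σ ρ : Fin 4) :
    ∑ μ, G ρ μ * lower (fun μ a b => l μ * f a b) α σ μ
      = (1 / 2) * (l α * mix G f ρ σ + l σ * mix G f ρ α - up G l ρ * f α σ) := by
  simp only [lower, mix, up, Finset.mul_sum, Finset.sum_mul, ← Finset.sum_add_distrib,
    ← Finset.sum_sub_distrib]
  refine Finset.sum_congr rfl fun μ _ => ?_
  rw [hf σ μ, hf α μ]; ring

/-- The quadratic part on rank one tensors, partially contracted. -/
lemma quad_eq_contractions (hG' : ∀ a b, G' a b = G' b a) (hf : ∀ a b, f a b = f b a)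
    (hf' : ∀ a b, f' a b = f' b a) (α β : Fin 4) :
    quad G G' (fun μ a b => l μ * f a b) (fun μ a b => l' μ * f' a b) α β
      = -(∑ ρ, ∑ σ, l ρ * sandwich G G' f ρ σ
            * (l' α * f' β σ + l' β * f' α σ - l' σ * f' α β))
        + l α * ∑ ρ, ∑ σ, sandwich G G' f ρ σ
            * (l' ρ * f' β σ + l' β * f' ρ σ - l' σ * f' ρ β)
        + (1 / 2) * ∑ ρ, ∑ σ, (l ρ * mix G f ρ σ + l σ * mix G f ρ ρ - up G l ρ * f ρ σ)
            * (l' α * mix G' f' σ β + l' β * mix G' f' σ α - up G' l' σ * f' α β)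
        - (1 / 2) * ∑ ρ, ∑ σ, (l α * mix G f ρ σ + l σ * mix G f ρ α - up G l ρ * f α σ)
            * (l' ρ * mix G' f' σ β + l' β * mix G' f' σ ρ - up G' l' σ * f' ρ β) := by
  have f12 : ∀ (p : Fin 4 → ℝ) (Z : Fin 4 → Fin 4 → ℝ),
      ∑ ρ, ∑ μ, ∑ σ, ∑ ν, G ρ μ * G' σ ν * (p ρ * f μ ν * Z ρ σ)
        = ∑ ρ, ∑ σ, p ρ * sandwich G G' f ρ σ * Z ρ σ := by
    intro p Z
    refine Finset.sum_congr rfl fun ρ _ => ?_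
    rw [Finset.sum_comm]
    refine Finset.sum_congr rfl fun σ _ => ?_
    simp only [sandwich, Finset.mul_sum, Finset.sum_mul]
    refine Finset.sum_congr rfl fun μ _ => Finset.sum_congr rfl fun ν _ => ?_
    rw [hG' σ ν]; ring
  have f1 := f12 l (fun ρ σ => l' α * f' β σ + l' β * f' α σ - l' σ * f' α β)
  have f2 := f12 (fun _ => 1) (fun ρ σ => l' ρ * f' β σ + l' β * f' ρ σ - l' σ * f' ρ β)
  have f3 := sum_mul_sum_flat G G' (fun ρ σ μ => lower (fun μ a b => l μ * f a b) ρ σ μ)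
    (fun _ _ ν => lower (fun μ a b => l' μ * f' a b) α β ν)
  have f4 := sum_mul_sum_flat G G' (fun _ σ μ => lower (fun μ a b => l μ * f a b) α σ μ)
    (fun ρ _ ν => lower (fun μ a b => l' μ * f' a b) ρ β ν)
  simp only [sum_mul_lower hf, sum_mul_lower hf', one_mul] at f2 f3 f4
  have e3 : ∀ u v : Fin 4 → Fin 4 → ℝ, ∑ ρ, ∑ σ, (1 / 2) * u ρ σ * ((1 / 2) * v ρ σ)
      = (1 / 4) * ∑ ρ, ∑ σ, u ρ σ * v ρ σ := by
    intro u v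
    simp only [Finset.mul_sum]
    exact Finset.sum_congr rfl fun ρ _ => Finset.sum_congr rfl fun σ _ => by ring
  rw [e3] at f3 f4
  have q : quad G G' (fun μ a b => l μ * f a b) (fun μ a b => l' μ * f' a b) α β
      = -(∑ ρ, ∑ μ, ∑ σ, ∑ ν, G ρ μ * G' σ ν * (l ρ * f μ ν
            * (l' α * f' β σ + l' β * f' α σ - l' σ * f' α β)))
        + l α * (∑ ρ, ∑ μ, ∑ σ, ∑ ν, G ρ μ * G' σ ν * (f μ ν
            * (l' ρ * f' β σ + l' β * f' ρ σ - l' σ * f' ρ β)))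
        + 2 * (∑ ρ, ∑ μ, ∑ σ, ∑ ν, G ρ μ * G' σ ν * (lower (fun μ a b => l μ * f a b) ρ σ μ
            * lower (fun μ a b => l' μ * f' a b) α β ν))
        - 2 * (∑ ρ, ∑ μ, ∑ σ, ∑ ν, G ρ μ * G' σ ν * (lower (fun μ a b => l μ * f a b) α σ μ
            * lower (fun μ a b => l' μ * f' a b) ρ β ν)) := by
    simp only [quad, ← Finset.sum_neg_distrib, ← Finset.sum_add_distrib,
      ← Finset.sum_sub_distrib, Finset.mul_sum]
    refine Finset.sum_congr rfl fun ρ _ => Finset.sum_congr rfl fun μ _ =>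
      Finset.sum_congr rfl fun σ _ => Finset.sum_congr rfl fun ν _ => ?_
    rw [show lower (fun μ a b => l' μ * f' a b) α β σ
        = (1 / 2) * (l' α * f' β σ + l' β * f' α σ - l' σ * f' α β) from rfl,
      show lower (fun μ a b => l' μ * f' a b) ρ β σ
        = (1 / 2) * (l' ρ * f' β σ + l' β * f' ρ σ - l' σ * f' ρ β) from rfl]
    ring
  rw [q, f1, f2, ← f3, ← f4]
  ring

/-- The quadratic part on rank one tensors. -/
lemma quad_rank_one (hG : ∀ a b, G a b = G b a) (hG' : ∀ a b, G' a b = G' b a)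
    (hf : ∀ a b, f a b = f b a) (hf' : ∀ a b, f' a b = f' b a) (α β : Fin 4) :
    quad G G' (fun μ a b => l μ * f a b) (fun μ a b => l' μ * f' a b) α β
      = -(l' α * (∑ σ, (∑ ν, contr G l f ν * G' ν σ) * f' β σ)
          + l' β * (∑ σ, (∑ ν, contr G l f ν * G' ν σ) * f' α σ)
          - (∑ σ, (∑ ν, contr G l f ν * G' ν σ) * l' σ) * f' α β)
        + l α * ((∑ σ, (∑ ν, contr G l' f ν * G' ν σ) * f' β σ)
          + l' β * (∑ ρ, ∑ σ, sandwich G G' f ρ σ * f' ρ σ)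
          - ∑ ρ, (∑ σ, mix G f ρ σ * up G' l' σ) * f' ρ β)
        + (1 / 2) * (∑ ρ, mix G f ρ ρ)
            * (l' α * contr G' l f' β + l' β * contr G' l f' α - (∑ σ, l σ * up G' l' σ) * f' α β)
        - (1 / 2) * (l α * (∑ σ, contr G l' f σ * mix G' f' σ β)
          + l α * l' β * (∑ ρ, ∑ σ, mix G f ρ σ * mix G' f' σ ρ)
          - l α * (∑ ρ, (∑ σ, mix G f ρ σ * up G' l' σ) * f' ρ β)
          + contr G l' f α * contr G' l f' β
          + l' β * (∑ ρ, contr G' l f' ρ * mix G f ρ α)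
          - (∑ σ, l σ * up G' l' σ) * (∑ ρ, mix G f ρ α * f' ρ β)
          - (∑ ρ, up G l ρ * l' ρ) * (∑ σ, f α σ * mix G' f' σ β)
          - l' β * (∑ σ, f α σ * ∑ ρ, mix G' f' σ ρ * up G l ρ)
          + (∑ σ, f α σ * up G' l' σ) * (∑ ρ, up G l ρ * f' ρ β)) := by
  have c1 : ∀ σ, ∑ ρ, l ρ * sandwich G G' f ρ σ = ∑ ν, contr G l f ν * G' ν σ :=
    sum_mul_sandwich hG
  have c2 : ∀ σ, ∑ ρ, l' ρ * sandwich G G' f ρ σ = ∑ ν, contr G l' f ν * G' ν σ :=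
    sum_mul_sandwich hG
  have c3 : ∀ σ, ∑ ρ, l ρ * mix G' f' ρ σ = contr G' l f' σ := sum_mul_mix hG'
  have c4 : ∀ σ, ∑ ρ, l' ρ * mix G f ρ σ = contr G l' f σ := sum_mul_mix hG
  have c5 : ∀ σ, ∑ ρ, l ρ * mix G f ρ σ = contr G l f σ := sum_mul_mix hG
  have c6 : ∀ ρ, ∑ σ, sandwich G G' f ρ σ * l' σ = ∑ σ, mix G f ρ σ * up G' l' σ := by
    intro ρ
    simp only [sandwich_eq, up, Finset.mul_sum, Finset.sum_mul]
    rw [Finset.sum_comm]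
    exact Finset.sum_congr rfl fun μ _ => Finset.sum_congr rfl fun ν _ => by ring
  have c7 : ∀ σ, ∑ ρ, up G l ρ * f ρ σ = contr G l f σ := fun _ => rfl
  rw [quad_eq_contractions hG' hf hf']
  have t1 : ∑ ρ, ∑ σ, l ρ * sandwich G G' f ρ σ
        * (l' α * f' β σ + l' β * f' α σ - l' σ * f' α β)
      = l' α * (∑ σ, (∑ ν, contr G l f ν * G' ν σ) * f' β σ)
          + l' β * (∑ σ, (∑ ν, contr G l f ν * G' ν σ) * f' α σ)
          - (∑ σ, (∑ ν, contr G l f ν * G' ν σ) * l' σ) * f' α β := by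
    simp only [← c1]
    rw [Finset.sum_comm]
    simp only [Finset.sum_mul, Finset.mul_sum, ← Finset.sum_add_distrib,
      ← Finset.sum_sub_distrib]
    exact Finset.sum_congr rfl fun σ _ => Finset.sum_congr rfl fun ρ _ => by ring
  have t2 : ∑ ρ, ∑ σ, sandwich G G' f ρ σ * (l' ρ * f' β σ + l' β * f' ρ σ - l' σ * f' ρ β)
      = (∑ σ, (∑ ν, contr G l' f ν * G' ν σ) * f' β σ)
          + l' β * (∑ ρ, ∑ σ, sandwich G G' f ρ σ * f' ρ σ)
          - ∑ ρ, (∑ σ, mix G f ρ σ * up G' l' σ) * f' ρ β := by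
    have : ∑ σ, (∑ ν, contr G l' f ν * G' ν σ) * f' β σ
        = ∑ ρ, ∑ σ, l' ρ * sandwich G G' f ρ σ * f' β σ := by
      simp only [← c2, Finset.sum_mul]
      rw [Finset.sum_comm]
    rw [this]
    simp only [← c6, Finset.sum_mul, Finset.mul_sum, ← Finset.sum_add_distrib,
      ← Finset.sum_sub_distrib]
    exact Finset.sum_congr rfl fun σ _ => Finset.sum_congr rfl fun ρ _ => by ring
  have t3 : ∑ ρ, ∑ σ, (l ρ * mix G f ρ σ + l σ * mix G f ρ ρ - up G l ρ * f ρ σ)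
        * (l' α * mix G' f' σ β + l' β * mix G' f' σ α - up G' l' σ * f' α β)
      = (∑ ρ, mix G f ρ ρ)
          * (l' α * contr G' l f' β + l' β * contr G' l f' α - (∑ σ, l σ * up G' l' σ) * f' α β) := by
    rw [Finset.sum_comm]
    have : ∀ σ, ∑ ρ, (l ρ * mix G f ρ σ + l σ * mix G f ρ ρ - up G l ρ * f ρ σ)
        = l σ * ∑ ρ, mix G f ρ ρ := by
      intro σ
      rw [Finset.sum_sub_distrib, Finset.sum_add_distrib, c5, c7, Finset.mul_sum]
      ring
    simp only [← Finset.sum_mul, this, ← c3]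
    simp only [mul_add, mul_sub, Finset.mul_sum, Finset.sum_mul, ← Finset.sum_add_distrib,
      ← Finset.sum_sub_distrib]
    refine Finset.sum_congr rfl fun σ _ => ?_
    refine Finset.sum_congr rfl fun ρ _ => ?_
    ring
  have t4 : ∑ ρ, ∑ σ, (l α * mix G f ρ σ + l σ * mix G f ρ α - up G l ρ * f α σ)
        * (l' ρ * mix G' f' σ β + l' β * mix G' f' σ ρ - up G' l' σ * f' ρ β)
      = l α * (∑ σ, contr G l' f σ * mix G' f' σ β)
          + l α * l' β * (∑ ρ, ∑ σ, mix G f ρ σ * mix G' f' σ ρ)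
          - l α * (∑ ρ, (∑ σ, mix G f ρ σ * up G' l' σ) * f' ρ β)
          + contr G l' f α * contr G' l f' β
          + l' β * (∑ ρ, contr G' l f' ρ * mix G f ρ α)
          - (∑ σ, l σ * up G' l' σ) * (∑ ρ, mix G f ρ α * f' ρ β)
          - (∑ ρ, up G l ρ * l' ρ) * (∑ σ, f α σ * mix G' f' σ β)
          - l' β * (∑ σ, f α σ * ∑ ρ, mix G' f' σ ρ * up G l ρ)
          + (∑ σ, f α σ * up G' l' σ) * (∑ ρ, up G l ρ * f' ρ β) := by
    simp only [← c3, ← c4]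
    set m := mix G f
    set m' := mix G' f'
    set u := up G l
    set u' := up G' l'
    clear_value m m' u u'
    simp only [Fin.sum_univ_four]
    ring
  rw [t1, t2, t3, t4, ← mul_assoc (1 / 2 : ℝ)]

lemma contr_mix (hf' : ∀ a b, f' a b = f' b a) (β : Fin 4) :
    ∑ σ, contr G l f σ * mix G' f' σ β = ∑ σ, (∑ ν, contr G l f ν * G' ν σ) * f' β σ := by
  simp only [mix, Finset.mul_sum, Finset.sum_mul]
  rw [Finset.sum_comm]
  refine Finset.sum_congr rfl fun σ _ => Finset.sum_congr rfl fun ν _ => ?_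
  rw [hf' σ]; ring

lemma mix_up (hf : ∀ a b, f a b = f b a) (ρ : Fin 4) :
    ∑ σ, mix G f ρ σ * up G' l' σ = ∑ μ, G ρ μ * contr G' l' f μ := by
  simp only [mix, contr, Finset.mul_sum, Finset.sum_mul]
  rw [Finset.sum_comm]
  refine Finset.sum_congr rfl fun σ _ => Finset.sum_congr rfl fun ν _ => ?_
  rw [hf σ]; ring

/-- The quadratic part on rank one tensors, for a single inverse metric. -/
lemma quad_rank_one_self (hG : ∀ a b, G a b = G b a)
    (hf : ∀ a b, f a b = f b a) (hf' : ∀ a b, f' a b = f' b a) (α β : Fin 4) :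
    quad G G (fun μ a b => l μ * f a b) (fun μ a b => l' μ * f' a b) α β
      = -(l' α * (∑ σ, (∑ ν, contr G l f ν * G ν σ) * f' β σ)
          + l' β * (∑ σ, (∑ ν, contr G l f ν * G ν σ) * f' α σ)
          - (∑ σ, (∑ ν, contr G l f ν * G ν σ) * l' σ) * f' α β)
        + (1 / 2) * (∑ ρ, mix G f ρ ρ)
            * (l' α * contr G l f' β + l' β * contr G l f' α - (∑ σ, l σ * up G l' σ) * f' α β)
        + (1 / 2) * (l α * l' β) * (∑ ρ, ∑ σ, sandwich G G f ρ σ * f' ρ σ)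
        - contr G l' f α * contr G l f' β
        + (∑ σ, l σ * up G l' σ) * (∑ μ, ∑ ν, G μ ν * f α μ * f' ν β) := by
  rw [quad_rank_one hG hG hf hf']
  -- With a single inverse metric, words that differ only in how the two copies of `G` are placed
  -- coincide, and most of them cancel.
  have e1 : ∑ ρ, (∑ σ, mix G f ρ σ * up G l' σ) * f' ρ β
      = ∑ σ, (∑ ν, contr G l' f ν * G ν σ) * f' β σ := by
    refine Finset.sum_congr rfl fun ρ _ => ?_
    rw [mix_up hf, hf' ρ]
    congr 1
    exact Finset.sum_congr rfl fun μ _ => by rw [hG]; ring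
  have e2 : ∑ ρ, ∑ σ, mix G f ρ σ * mix G f' σ ρ = ∑ ρ, ∑ σ, sandwich G G f ρ σ * f' ρ σ := by
    simp only [sandwich_eq]
    refine Finset.sum_congr rfl fun ρ _ => ?_
    simp only [mix, Finset.mul_sum, Finset.sum_mul]
    rw [Finset.sum_comm]
    refine Finset.sum_congr rfl fun σ _ => Finset.sum_congr rfl fun ν _ =>
      Finset.sum_congr rfl fun μ _ => ?_
    rw [hf' σ]; ring
  have e3 : ∑ ρ, contr G l f' ρ * mix G f ρ α
      = ∑ σ, f α σ * ∑ ρ, mix G f' σ ρ * up G l ρ := by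
    simp only [mix_up hf']
    rw [contr_mix hf]
    refine Finset.sum_congr rfl fun σ _ => ?_
    rw [mul_comm]
    congr 1
    exact Finset.sum_congr rfl fun μ _ => by rw [hG]; ring
  have e4 : ∑ ρ, mix G f ρ α * f' ρ β = ∑ μ, ∑ ν, G μ ν * f α μ * f' ν β := by
    simp only [mix, Finset.sum_mul]
    rw [Finset.sum_comm]
    refine Finset.sum_congr rfl fun σ _ => Finset.sum_congr rfl fun ν _ => ?_
    rw [hf σ, hG ν]
  have e5 : ∑ σ, f α σ * mix G f' σ β = ∑ μ, ∑ ν, G μ ν * f α μ * f' ν β := by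
    simp only [mix, Finset.mul_sum]
    refine Finset.sum_congr rfl fun σ _ => Finset.sum_congr rfl fun ν _ => ?_
    ring
  have e6 : ∑ ρ, up G l ρ * l' ρ = ∑ σ, l σ * up G l' σ := by
    simp only [up, Finset.mul_sum, Finset.sum_mul]
    rw [Finset.sum_comm]
    refine Finset.sum_congr rfl fun σ _ => Finset.sum_congr rfl fun ν _ => ?_
    rw [hG ν]; ring
  have e7 : ∑ σ, f α σ * up G l' σ = contr G l' f α :=
    Finset.sum_congr rfl fun σ _ => by rw [hf α]; ring
  have e8 : ∑ ρ, up G l ρ * f' ρ β = contr G l f' β := rfl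
  rw [e1, e2, e3, e4, e5, e6, e7, e8, contr_mix hf']
  ring

/-- The quadratic part on rank one tensors, when the contractions with the covector vanish. -/
lemma quad_rank_one_constrained (hG : ∀ a b, G a b = G b a) (hG' : ∀ a b, G' a b = G' b a)
    (hf : ∀ a b, f a b = f b a) (h1 : ∀ α, contr G l f α = 0) (h2 : ∀ α, contr G' l f α = 0)
    (n1 : ∑ ρ, up G l ρ * l ρ = 0) (n2 : ∑ ρ, l ρ * up G' l ρ = 0) (α β : Fin 4) :
    quad G G' (fun μ a b => l μ * f a b) (fun μ a b => l μ * f a b) α β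
      = l α * l β * (∑ ρ, ∑ σ, sandwich G G' f ρ σ * f ρ σ
          - (1 / 2) * ∑ ρ, ∑ σ, mix G f ρ σ * mix G' f σ ρ) := by
  have h1' : ∀ β, ∑ ρ, up G l ρ * f ρ β = 0 := h1
  -- Since `f` annihilates `l` and `l` is null for both inverse metrics, only the full contractions
  -- of `f` with itself survive, and these multiply `l α * l β`.
  rw [quad_rank_one hG hG' hf hf]
  simp only [mix_up hf, h1, h2, h1', n1, n2]
  simp
  ring

end Words

/-! ## Linearity of the linear and quadratic parts -/

section Linearity

variable {ι : Type*} (s : Finset ι) (r : ι → ℝ)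

lemma lin2_sum_left (G : ι → Fin 4 → Fin 4 → ℝ) (B : Fin 4 → Fin 4 → Fin 4 → Fin 4 → ℝ)
    (α β : Fin 4) :
    lin2 (fun ρ σ => ∑ i ∈ s, r i * G i ρ σ) B α β = ∑ i ∈ s, r i * lin2 (G i) B α β := by
  simp only [lin2, Finset.sum_mul, Finset.mul_sum]
  simp only [Finset.sum_comm (s := (Finset.univ : Finset (Fin 4))) (t := s)]
  exact Finset.sum_congr rfl fun i _ => Finset.sum_congr rfl fun ρ _ =>
    Finset.sum_congr rfl fun σ _ => by ring

lemma lin2_sum_right (G : Fin 4 → Fin 4 → ℝ) (B : ι → Fin 4 → Fin 4 → Fin 4 → Fin 4 → ℝ)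
    (α β : Fin 4) :
    lin2 G (fun κ μ a b => ∑ i ∈ s, r i * B i κ μ a b) α β = ∑ i ∈ s, r i * lin2 G (B i) α β := by
  simp only [lin2, ← Finset.sum_add_distrib, ← Finset.sum_sub_distrib, Finset.mul_sum]
  simp only [Finset.sum_comm (s := (Finset.univ : Finset (Fin 4))) (t := s)]
  exact Finset.sum_congr rfl fun i _ => Finset.sum_congr rfl fun ρ _ =>
    Finset.sum_congr rfl fun σ _ => by ring

lemma quad_sum_fst (G : ι → Fin 4 → Fin 4 → ℝ) (G' : Fin 4 → Fin 4 → ℝ)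
    (k k' : Fin 4 → Fin 4 → Fin 4 → ℝ) (α β : Fin 4) :
    quad (fun ρ σ => ∑ i ∈ s, r i * G i ρ σ) G' k k' α β
      = ∑ i ∈ s, r i * quad (G i) G' k k' α β := by
  simp only [quad, Finset.sum_mul, Finset.mul_sum]
  simp only [Finset.sum_comm (s := (Finset.univ : Finset (Fin 4))) (t := s)]
  exact Finset.sum_congr rfl fun i _ => Finset.sum_congr rfl fun ρ _ =>
    Finset.sum_congr rfl fun μ _ => Finset.sum_congr rfl fun σ _ =>
    Finset.sum_congr rfl fun ν _ => by ring

lemma quad_sum_snd (G : Fin 4 → Fin 4 → ℝ) (G' : ι → Fin 4 → Fin 4 → ℝ)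
    (k k' : Fin 4 → Fin 4 → Fin 4 → ℝ) (α β : Fin 4) :
    quad G (fun ρ σ => ∑ i ∈ s, r i * G' i ρ σ) k k' α β
      = ∑ i ∈ s, r i * quad G (G' i) k k' α β := by
  simp only [quad, Finset.sum_mul, Finset.mul_sum]
  simp only [Finset.sum_comm (s := (Finset.univ : Finset (Fin 4))) (t := s)]
  exact Finset.sum_congr rfl fun i _ => Finset.sum_congr rfl fun ρ _ =>
    Finset.sum_congr rfl fun μ _ => Finset.sum_congr rfl fun σ _ =>
    Finset.sum_congr rfl fun ν _ => by ring

lemma lower_sum (k : ι → Fin 4 → Fin 4 → Fin 4 → ℝ) (μ ν σ : Fin 4) :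
    lower (fun μ a b => ∑ i ∈ s, r i * k i μ a b) μ ν σ = ∑ i ∈ s, r i * lower (k i) μ ν σ := by
  simp only [lower, ← Finset.sum_add_distrib, ← Finset.sum_sub_distrib, Finset.mul_sum]
  exact Finset.sum_congr rfl fun i _ => by ring

lemma quad_sum_left (G G' : Fin 4 → Fin 4 → ℝ) (k : ι → Fin 4 → Fin 4 → Fin 4 → ℝ)
    (k' : Fin 4 → Fin 4 → Fin 4 → ℝ) (α β : Fin 4) :
    quad G G' (fun μ a b => ∑ i ∈ s, r i * k i μ a b) k' α β
      = ∑ i ∈ s, r i * quad G G' (k i) k' α β := by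
  simp only [quad, lower_sum, Finset.mul_sum, Finset.sum_mul, ← Finset.sum_add_distrib,
    ← Finset.sum_sub_distrib]
  simp only [Finset.sum_comm (s := (Finset.univ : Finset (Fin 4))) (t := s)]
  exact Finset.sum_congr rfl fun i _ => Finset.sum_congr rfl fun ρ _ =>
    Finset.sum_congr rfl fun μ _ => Finset.sum_congr rfl fun σ _ =>
    Finset.sum_congr rfl fun ν _ => by ring

lemma quad_sum_right (G G' : Fin 4 → Fin 4 → ℝ) (k : Fin 4 → Fin 4 → Fin 4 → ℝ)
    (k' : ι → Fin 4 → Fin 4 → Fin 4 → ℝ) (α β : Fin 4) :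
    quad G G' k (fun μ a b => ∑ i ∈ s, r i * k' i μ a b) α β
      = ∑ i ∈ s, r i * quad G G' k (k' i) α β := by
  simp only [quad, lower_sum, Finset.mul_sum, ← Finset.sum_add_distrib,
    ← Finset.sum_sub_distrib]
  simp only [Finset.sum_comm (s := (Finset.univ : Finset (Fin 4))) (t := s)]
  exact Finset.sum_congr rfl fun i _ => Finset.sum_congr rfl fun ρ _ =>
    Finset.sum_congr rfl fun μ _ => Finset.sum_congr rfl fun σ _ =>
    Finset.sum_congr rfl fun ν _ => by ring

lemma sandwich_sum (G : Fin 4 → Fin 4 → ℝ) (f : ι → Fin 4 → Fin 4 → ℝ) (ρ σ : Fin 4) :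
    sandwich G G (fun μ ν => ∑ i ∈ s, r i * f i μ ν) ρ σ
      = ∑ i ∈ s, r i * sandwich G G (f i) ρ σ := by
  simp only [sandwich, Finset.mul_sum, Finset.sum_mul]
  simp only [Finset.sum_comm (s := (Finset.univ : Finset (Fin 4))) (t := s)]
  exact Finset.sum_congr rfl fun i _ => Finset.sum_congr rfl fun ρ _ =>
    Finset.sum_congr rfl fun μ _ => by ring

lemma lin2_add_left (G G' : Fin 4 → Fin 4 → ℝ) (B : Fin 4 → Fin 4 → Fin 4 → Fin 4 → ℝ)
    (α β : Fin 4) :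
    lin2 (fun ρ σ => G ρ σ + G' ρ σ) B α β = lin2 G B α β + lin2 G' B α β := by
  simp only [lin2, add_mul, Finset.sum_add_distrib]

lemma lin2_add_right (G : Fin 4 → Fin 4 → ℝ) (B B' : Fin 4 → Fin 4 → Fin 4 → Fin 4 → ℝ)
    (α β : Fin 4) :
    lin2 G (fun κ μ a b => B κ μ a b + B' κ μ a b) α β = lin2 G B α β + lin2 G B' α β := by
  simp only [lin2, ← Finset.sum_add_distrib]
  exact Finset.sum_congr rfl fun ρ _ => Finset.sum_congr rfl fun σ _ => by ring

lemma quad_add_left (G G' : Fin 4 → Fin 4 → ℝ) (k₁ k₂ k' : Fin 4 → Fin 4 → Fin 4 → ℝ)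
    (α β : Fin 4) : quad G G' (fun μ a b => k₁ μ a b + k₂ μ a b) k' α β
      = quad G G' k₁ k' α β + quad G G' k₂ k' α β := by
  simp only [quad, lower, ← Finset.sum_add_distrib]
  exact Finset.sum_congr rfl fun ρ _ => Finset.sum_congr rfl fun μ _ =>
    Finset.sum_congr rfl fun σ _ => Finset.sum_congr rfl fun ν _ => by ring

lemma quad_add_right (G G' : Fin 4 → Fin 4 → ℝ) (k k₁ k₂ : Fin 4 → Fin 4 → Fin 4 → ℝ)
    (α β : Fin 4) : quad G G' k (fun μ a b => k₁ μ a b + k₂ μ a b) α β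
      = quad G G' k k₁ α β + quad G G' k k₂ α β := by
  simp only [quad, lower, ← Finset.sum_add_distrib]
  exact Finset.sum_congr rfl fun ρ _ => Finset.sum_congr rfl fun μ _ =>
    Finset.sum_congr rfl fun σ _ => Finset.sum_congr rfl fun ν _ => by ring

end Linearity

/-! ## The coefficients of the Ricci tensor as sums over the terms of the ansatz -/

section RawCoefficients

variable {𝒜 : Type*} [Fintype 𝒜] [DecidableEq 𝒜]

/-- An index set for the terms of the ansatz with factor `λ²`. -/
abbrev SecondIndex (𝒜 : Type*) [Fintype 𝒜] [DecidableEq 𝒜] : Type _ :=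
  𝒜 ⊕ 𝒜 ⊕ 𝒜 ⊕ ({q : 𝒜 × 𝒜 // q ∈ (Finset.univ : Finset 𝒜).offDiag} × ℤˣ) ⊕ Unit

/-- An index set for the terms of the ansatz with factor `λ³`. -/
abbrev ThirdIndex (𝒜 : Type*) [Fintype 𝒜] [DecidableEq 𝒜] : Type _ :=
  ({n // n ∈ nullPhases 𝒜} × Bool) ⊕ ({n // n ∈ mixedPhases 𝒜} × Bool)

variable (a : Amplitudes 𝒜)

/-- The terms of the ansatz with factor `λ²`. -/
def secondTerm : SecondIndex 𝒜 → OscTerm 𝒜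
  | .inl A => ⟨2, false, unit A, a.frakF A⟩
  | .inr (.inl A) => ⟨2, false, unit A, a.F21 A⟩
  | .inr (.inr (.inl A)) => ⟨2, true, (2 : ℤ) • unit A, a.F22 A⟩
  | .inr (.inr (.inr (.inl q))) => ⟨2, true, pm q.1.1.1 q.1.1.2 q.2, a.Fpm q.1.1.1 q.1.1.2 q.2⟩
  | .inr (.inr (.inr (.inr _))) => ⟨2, true, 0, a.h⟩

/-- The terms of the ansatz with factor `λ³`. -/
def thirdTerm : ThirdIndex 𝒜 → OscTerm 𝒜
  | .inl q => ⟨3, q.2, q.1.1, a.g3h q.2 q.1.1⟩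
  | .inr q => ⟨3, q.2, q.1.1, a.g3e q.2 q.1.1⟩

lemma sum_secondTerm (F : OscTerm 𝒜 → ℝ) : ∑ i, F (secondTerm a i) = orderTwo a F := by
  simp only [Fintype.sum_sum_type, Finset.univ_unique, Finset.sum_singleton, secondTerm,
    Fintype.sum_prod_type, orderTwo]
  rw [Finset.sum_coe_sort (Finset.univ : Finset 𝒜).offDiag
      (fun q => ∑ ε : ℤˣ, F ⟨2, true, pm q.1 q.2 ε, a.Fpm q.1 q.2 ε⟩)]
  ring

lemma sum_thirdTerm (F : OscTerm 𝒜 → ℝ) : ∑ i, F (thirdTerm a i) = orderThree a F := by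
  simp only [Fintype.sum_sum_type, thirdTerm, Fintype.sum_prod_type, orderThree]
  rw [Finset.sum_coe_sort (nullPhases 𝒜) (fun n => ∑ T, F ⟨3, T, n, a.g3h T n⟩),
    Finset.sum_coe_sort (mixedPhases 𝒜) (fun n => ∑ T, F ⟨3, T, n, a.g3e T n⟩)]

lemma phase_unit (bg : Background 𝒜) (A : 𝒜) : bg.phase (unit A) = bg.u A := by
  funext x; simp [Background.phase, unit, Pi.single_apply]

variable {bg : Background 𝒜} {a} {θ : 𝒜 → ℝ} {x : Spacetime}

/-- Covariant constancy of `g₀` leaves only the derivatives of the phases of the terms with factor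
`λ`. -/
lemma nabCoeff_zero (hbg : bg.IsNullDust) (hx : x ∈ slab) (μ α β : Fin 4) :
    nabCoeff bg a (Gam bg.g₀) θ x 0 μ α β
      = ∑ A, -Real.sin (θ A) * (pd μ (bg.u A) x * a.F1 A α β x) := by
  simp [nabCoeff, orderSum, nab_g₀ hbg hx, phase_unit, angle_unit, trig, trigSign]

lemma nabCoeff_one (μ α β : Fin 4) :
    nabCoeff bg a (Gam bg.g₀) θ x 1 μ α β
      = ∑ A, Real.cos (θ A) * nab pd (Gam bg.g₀) (a.F1 A) μ α β x
        + ∑ i, (trigSign (secondTerm a i).b * trig (!(secondTerm a i).b)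
            (angle (secondTerm a i).n θ))
          * (pd μ (bg.phase (secondTerm a i).n) x * (secondTerm a i).S α β x) := by
  rw [sum_secondTerm a (fun t => (trigSign t.b * trig (!t.b) (angle t.n θ))
          * (pd μ (bg.phase t.n) x * t.S α β x))]
  simp only [nabCoeff, orderSum, angle_unit, trig]

omit [DecidableEq 𝒜] in
lemma nab2_g₀ (hbg : bg.IsNullDust) (hx : x ∈ slab) (κ μ a b : Fin 4) :
    nab2 pd (Gam bg.g₀) bg.g₀ κ μ a b x = 0 := by
  have : pd κ (nab pd (Gam bg.g₀) bg.g₀ μ a b) x = 0 := by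
    rw [isFrame_pd.congr_on hx (fun q hq => nab_g₀ hbg hq μ a b)
      (differentiableWithinAt_const 0)]
    exact pd_zero κ
  rw [nab2, this]
  simp [nab_g₀ hbg hx]

omit [DecidableEq 𝒜] in
lemma midDeriv_zero (Γ : Fin 4 → Fin 4 → Fin 4 → Scalar) (S : Tensor2) (κ μ α β : Fin 4) :
    midDeriv Γ (bg.phase 0) S κ μ α β x = 0 := by
  have : pd μ (fun _ => (0 : ℝ)) = fun _ => 0 := funext fun _ => pd_zero μ
  simp [phase_zero, midDeriv, hess, this, pd_zero]

lemma nab2Coeff_zero (κ μ α β : Fin 4) :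
    nab2Coeff bg a (Gam bg.g₀) θ x 0 κ μ α β
      = ∑ A, -Real.cos (θ A) * (pd κ (bg.u A) x * pd μ (bg.u A) x * a.F1 A α β x) := by
  simp [nab2Coeff, orderSum, midDeriv_zero, phase_unit, angle_unit, trig]

lemma nab2Coeff_one (hbg : bg.IsNullDust) (hx : x ∈ slab) (κ μ α β : Fin 4) :
    nab2Coeff bg a (Gam bg.g₀) θ x 1 κ μ α β
      = ∑ A, -Real.sin (θ A) * midDeriv (Gam bg.g₀) (bg.u A) (a.F1 A) κ μ α β x
        + ∑ i, -trig (secondTerm a i).b (angle (secondTerm a i).n θ)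
          * (pd κ (bg.phase (secondTerm a i).n) x * pd μ (bg.phase (secondTerm a i).n) x
            * (secondTerm a i).S α β x) := by
  simp only [neg_mul, Finset.sum_neg_distrib]
  rw [sum_secondTerm a (fun t => trig t.b (angle t.n θ)
      * (pd κ (bg.phase t.n) x * pd μ (bg.phase t.n) x * t.S α β x))]
  simp [nab2Coeff, orderSum, nab2_g₀ hbg hx, phase_unit, angle_unit, trig, trigSign]
  ring

lemma nab2Coeff_two (κ μ α β : Fin 4) :
    nab2Coeff bg a (Gam bg.g₀) θ x 2 κ μ α β
      = ∑ A, Real.cos (θ A) * nab2 pd (Gam bg.g₀) (a.F1 A) κ μ α β x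
        + ∑ i, (trigSign (secondTerm a i).b * trig (!(secondTerm a i).b)
            (angle (secondTerm a i).n θ))
          * midDeriv (Gam bg.g₀) (bg.phase (secondTerm a i).n) (secondTerm a i).S κ μ α β x
        + ∑ i, -trig (thirdTerm a i).b (angle (thirdTerm a i).n θ)
          * (pd κ (bg.phase (thirdTerm a i).n) x * pd μ (bg.phase (thirdTerm a i).n) x
            * (thirdTerm a i).S α β x) := by
  simp only [neg_mul, Finset.sum_neg_distrib]
  rw [sum_secondTerm a (fun t => (trigSign t.b * trig (!t.b) (angle t.n θ))
      * midDeriv (Gam bg.g₀) (bg.phase t.n) t.S κ μ α β x), sum_thirdTerm a (fun t =>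
      trig t.b (angle t.n θ) * (pd κ (bg.phase t.n) x * pd μ (bg.phase t.n) x * t.S α β x))]
  simp only [nab2Coeff, orderSum, angle_unit, trig]
  ring

lemma invCoeffOne_eq (ρ σ : Fin 4) :
    invCoeffOne bg a θ x ρ σ
      = ∑ A, -Real.cos (θ A) * sandwich (invCoeff bg a θ x 0) (invCoeff bg a θ x 0)
          (fun μ ν => a.F1 A μ ν x) ρ σ := by
  have := sandwich_sum Finset.univ (fun A => Real.cos (θ A)) (invCoeff bg a θ x 0)
    (fun A μ ν => a.F1 A μ ν x) ρ σ
  simp only [neg_mul, Finset.sum_neg_distrib]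
  rw [← this]
  simp only [invCoeffOne, metricCoeff, orderSum, angle_unit, trig, sandwich, invCoeff, mul_assoc]

/-- `G f G f' G`. -/
def sandwichTwo (G f f' : Fin 4 → Fin 4 → ℝ) (ρ σ : Fin 4) : ℝ :=
  ∑ μ, ∑ ν, G ρ μ * f μ ν * sandwich G G f' ν σ

lemma invCoeffTwo_eq (ρ σ : Fin 4) :
    invCoeffTwo bg a θ x ρ σ
      = ∑ i, -trig (secondTerm a i).b (angle (secondTerm a i).n θ)
          * sandwich (invCoeff bg a θ x 0) (invCoeff bg a θ x 0)
            (fun μ ν => (secondTerm a i).S μ ν x) ρ σ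
        + ∑ p : 𝒜 × 𝒜, (Real.cos (θ p.1) * Real.cos (θ p.2)) * sandwichTwo (invCoeff bg a θ x 0)
          (fun μ ν => a.F1 p.1 μ ν x) (fun μ ν => a.F1 p.2 μ ν x) ρ σ := by
  have e1 := sandwich_sum Finset.univ
    (fun i => trig (secondTerm a i).b (angle (secondTerm a i).n θ)) (invCoeff bg a θ x 0)
    (fun i μ ν => (secondTerm a i).S μ ν x) ρ σ
  have e2 : ∑ p : 𝒜 × 𝒜, (Real.cos (θ p.1) * Real.cos (θ p.2))
        * sandwichTwo (invCoeff bg a θ x 0) (fun μ ν => a.F1 p.1 μ ν x)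
          (fun μ ν => a.F1 p.2 μ ν x) ρ σ
      = -∑ μ, ∑ ν, inv bg.g₀ ρ μ x * (metricCoeff bg a θ x 1 μ ν * invCoeffOne bg a θ x ν σ) := by
    simp only [invCoeffOne_eq, metricCoeff, orderSum, angle_unit, trig, sandwichTwo,
      Fintype.sum_prod_type, Finset.mul_sum, Finset.sum_mul, ← Finset.sum_neg_distrib]
    simp only [Finset.sum_comm (s := (Finset.univ : Finset (Fin 4)))
      (t := (Finset.univ : Finset 𝒜))]
    rw [Finset.sum_comm]
    refine Finset.sum_congr rfl fun A _ => Finset.sum_congr rfl fun B _ =>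
      Finset.sum_congr rfl fun μ _ => Finset.sum_congr rfl fun ν _ => ?_
    simp only [invCoeff]
    ring
  rw [e2]
  simp only [neg_mul, Finset.sum_neg_distrib]
  rw [← e1]
  have e3 : ∀ μ ν, ∑ i, trig (secondTerm a i).b (angle (secondTerm a i).n θ)
      * (secondTerm a i).S μ ν x = metricCoeff bg a θ x 2 μ ν := fun μ ν =>
    sum_secondTerm a (fun t => trig t.b (angle t.n θ) * t.S μ ν x)
  simp only [sandwich, e3, invCoeffTwo, mul_add, Finset.sum_add_distrib, invCoeff, neg_add,
    mul_assoc]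
  ring

end RawCoefficients

/-! ### Multilinear form of the Ricci coefficients -/

section RawRicci

variable {𝒜 : Type*}

/-- The inverse background metric at a point. -/
def Background.G (bg : Background 𝒜) (x : Spacetime) (ρ σ : Fin 4) : ℝ := inv bg.g₀ ρ σ x

/-- The differential of `u_A` at a point. -/
def Background.du (bg : Background 𝒜) (x : Spacetime) (A : 𝒜) (μ : Fin 4) : ℝ := pd μ (bg.u A) x

/-- The components of a tensor at a point. -/
def Tensor2.val (S : Tensor2) (x : Spacetime) (μ ν : Fin 4) : ℝ := S μ ν x

/-- The linear part on `l ⊗ l ⊗ f`. -/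
def linPart (G : Fin 4 → Fin 4 → ℝ) (l : Fin 4 → ℝ) (f : Fin 4 → Fin 4 → ℝ) (α β : Fin 4) : ℝ :=
  lin2 G (fun κ μ a b => l κ * l μ * f a b) α β

/-- The quadratic part on `l ⊗ f` and `l' ⊗ f'`. -/
def quadPart (G G' : Fin 4 → Fin 4 → ℝ) (l : Fin 4 → ℝ) (f : Fin 4 → Fin 4 → ℝ) (l' : Fin 4 → ℝ)
    (f' : Fin 4 → Fin 4 → ℝ) (α β : Fin 4) : ℝ :=
  quad G G' (fun μ a b => l μ * f a b) (fun μ a b => l' μ * f' a b) α β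

variable [Fintype 𝒜]

/-- The differential of a phase at a point. -/
def Background.dv (bg : Background 𝒜) (x : Spacetime) (n : 𝒜 → ℤ) (μ : Fin 4) : ℝ :=
  pd μ (bg.phase n) x

variable [DecidableEq 𝒜]

lemma Background.dv_unit (bg : Background 𝒜) (x : Spacetime) (A : 𝒜) :
    bg.dv x (unit A) = bg.du x A := by
  funext μ; rw [dv, phase_unit, du]

variable {bg : Background 𝒜} {a : Amplitudes 𝒜} {θ : 𝒜 → ℝ} {x : Spacetime}

lemma twoRicciCoeff_zero (α β : Fin 4) :
    twoRicciCoeff bg a θ x α β 0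
      = ∑ A, -Real.cos (θ A) * linPart (bg.G x) (bg.du x A) ((a.F1 A).val x) α β := by
  have e : nab2Coeff bg a (Gam bg.g₀) θ x 0 = fun κ μ α β =>
      ∑ A, -Real.cos (θ A) * (pd κ (bg.u A) x * pd μ (bg.u A) x * a.F1 A α β x) := by
    funext κ μ α β; exact nab2Coeff_zero κ μ α β
  rw [twoRicciCoeff, e, lin2_sum_right]
  rfl

/-- The interaction of a term of the ansatz with factor `λ²` with a term with factor `λ`. -/
def interaction (bg : Background 𝒜) (a : Amplitudes 𝒜) (θ : 𝒜 → ℝ) (x : Spacetime)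
    (t : OscTerm 𝒜) (A : 𝒜) (α β : Fin 4) : ℝ :=
  trig t.b (angle t.n θ) * Real.cos (θ A)
      * (linPart (sandwich (bg.G x) (bg.G x) (t.S.val x)) (bg.du x A) ((a.F1 A).val x) α β
        + linPart (sandwich (bg.G x) (bg.G x) ((a.F1 A).val x)) (bg.dv x t.n) (t.S.val x) α β)
    - trigSign t.b * trig (!t.b) (angle t.n θ) * Real.sin (θ A)
      * (quadPart (bg.G x) (bg.G x) (bg.dv x t.n) (t.S.val x) (bg.du x A) ((a.F1 A).val x) α β
        + quadPart (bg.G x) (bg.G x) (bg.du x A) ((a.F1 A).val x) (bg.dv x t.n) (t.S.val x) α β)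

/-- The terms `F^{(1)} ∂F^{(1)}` at first order. -/
def derivInteraction (bg : Background 𝒜) (a : Amplitudes 𝒜) (x : Spacetime) (A B : 𝒜)
    (α β : Fin 4) : ℝ :=
  lin2 (sandwich (bg.G x) (bg.G x) ((a.F1 A).val x))
      (fun κ μ α β => midDeriv (Gam bg.g₀) (bg.u B) (a.F1 B) κ μ α β x) α β
    - (quad (bg.G x) (bg.G x) (fun μ α β => nab pd (Gam bg.g₀) (a.F1 A) μ α β x)
        (fun μ a' b => bg.du x B μ * (a.F1 B).val x a' b) α β
      + quad (bg.G x) (bg.G x) (fun μ a' b => bg.du x B μ * (a.F1 B).val x a' b)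
        (fun μ α β => nab pd (Gam bg.g₀) (a.F1 A) μ α β x) α β)

/-- The cubic terms at first order. -/
def cubicInteraction (bg : Background 𝒜) (a : Amplitudes 𝒜) (θ : 𝒜 → ℝ) (x : Spacetime)
    (A B C : 𝒜) (α β : Fin 4) : ℝ :=
  -(Real.cos (θ A) * Real.cos (θ B) * Real.cos (θ C))
      * linPart (sandwichTwo (bg.G x) ((a.F1 A).val x) ((a.F1 B).val x)) (bg.du x C)
          ((a.F1 C).val x) α β
    - Real.cos (θ A) * Real.sin (θ B) * Real.sin (θ C)
      * (quadPart (sandwich (bg.G x) (bg.G x) ((a.F1 A).val x)) (bg.G x) (bg.du x B)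
          ((a.F1 B).val x) (bg.du x C) ((a.F1 C).val x) α β
        + quadPart (bg.G x) (sandwich (bg.G x) (bg.G x) ((a.F1 A).val x)) (bg.du x B)
          ((a.F1 B).val x) (bg.du x C) ((a.F1 C).val x) α β)

lemma twoRicciCoeff_one (hbg : bg.IsNullDust) (hx : x ∈ slab) (α β : Fin 4) :
    twoRicciCoeff bg a θ x α β 1
      = 2 * ricci pd bg.g₀ α β x
        + ∑ A, -Real.sin (θ A) * lin2 (bg.G x)
            (fun κ μ α β => midDeriv (Gam bg.g₀) (bg.u A) (a.F1 A) κ μ α β x) α β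
        + ∑ i, -trig (secondTerm a i).b (angle (secondTerm a i).n θ)
          * linPart (bg.G x) (bg.dv x (secondTerm a i).n) ((secondTerm a i).S.val x) α β
        + ∑ A, ∑ B, (Real.cos (θ A) * Real.cos (θ B)
            * linPart (sandwich (bg.G x) (bg.G x) ((a.F1 A).val x)) (bg.du x B)
              ((a.F1 B).val x) α β
          + Real.sin (θ A) * Real.sin (θ B) * quadPart (bg.G x) (bg.G x) (bg.du x A)
              ((a.F1 A).val x) (bg.du x B) ((a.F1 B).val x) α β) := by
  have e0 : nab2Coeff bg a (Gam bg.g₀) θ x 0 = _ :=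
    funext fun κ => funext fun μ => funext fun α => funext fun β => nab2Coeff_zero κ μ α β
  have e1 : nab2Coeff bg a (Gam bg.g₀) θ x 1 = _ :=
    funext fun κ => funext fun μ => funext fun α => funext fun β => nab2Coeff_one hbg hx κ μ α β
  have k0 : nabCoeff bg a (Gam bg.g₀) θ x 0 = _ :=
    funext fun μ => funext fun α => funext fun β => nabCoeff_zero hbg hx μ α β
  have i1 : invCoeff bg a θ x 1 = _ :=
    funext fun ρ => funext fun σ => invCoeffOne_eq (bg := bg) (a := a) (θ := θ) (x := x) ρ σ
  rw [twoRicciCoeff, e0, e1, k0, i1, lin2_add_right, lin2_sum_right, lin2_sum_right,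
    lin2_sum_left, quad_sum_left]
  simp only [lin2_sum_right, quad_sum_right, Finset.mul_sum, Finset.sum_add_distrib]
  have t1 : ∀ A B, -Real.cos (θ A) * (-Real.cos (θ B) * lin2 (sandwich (invCoeff bg a θ x 0)
        (invCoeff bg a θ x 0) fun μ ν => a.F1 A μ ν x)
        (fun κ μ a_1 b => pd κ (bg.u B) x * pd μ (bg.u B) x * a.F1 B a_1 b x) α β)
      = Real.cos (θ A) * Real.cos (θ B)
            * linPart (sandwich (bg.G x) (bg.G x) ((a.F1 A).val x)) (bg.du x B)
              ((a.F1 B).val x) α β := by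
    intro A B
    rw [← mul_assoc, neg_mul_neg]
    rfl
  have t2 : ∀ A B, -Real.sin (θ A) * (-Real.sin (θ B) * quad (invCoeff bg a θ x 0)
        (invCoeff bg a θ x 0) (fun μ a_1 b => pd μ (bg.u A) x * a.F1 A a_1 b x)
        (fun μ a_1 b => pd μ (bg.u B) x * a.F1 B a_1 b x) α β)
      = Real.sin (θ A) * Real.sin (θ B) * quadPart (bg.G x) (bg.G x) (bg.du x A)
              ((a.F1 A).val x) (bg.du x B) ((a.F1 B).val x) α β := by
    intro A B
    rw [← mul_assoc, neg_mul_neg]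
    rfl
  simp only [t1, t2]
  simp only [add_assoc]
  rfl

lemma twoRicciCoeff_two (hbg : bg.IsNullDust) (hx : x ∈ slab) (α β : Fin 4) :
    twoRicciCoeff bg a θ x α β 2
      = ∑ A, Real.cos (θ A) * lin2 (bg.G x)
          (fun κ μ α β => nab2 pd (Gam bg.g₀) (a.F1 A) κ μ α β x) α β
        + ∑ i, (trigSign (secondTerm a i).b * trig (!(secondTerm a i).b)
            (angle (secondTerm a i).n θ)) * lin2 (bg.G x)
              (fun κ μ α β => midDeriv (Gam bg.g₀) (bg.phase (secondTerm a i).n)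
                (secondTerm a i).S κ μ α β x) α β
        + ∑ i, -trig (thirdTerm a i).b (angle (thirdTerm a i).n θ)
          * linPart (bg.G x) (bg.dv x (thirdTerm a i).n) ((thirdTerm a i).S.val x) α β
        + ∑ i, ∑ A, interaction bg a θ x (secondTerm a i) A α β
        + ∑ A, ∑ B, Real.cos (θ A) * Real.sin (θ B) * derivInteraction bg a x A B α β
        + ∑ A, ∑ B, ∑ C, cubicInteraction bg a θ x A B C α β := by
  have e0 : nab2Coeff bg a (Gam bg.g₀) θ x 0 = fun κ μ α β => ∑ A, -Real.cos (θ A)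
      * (bg.du x A κ * bg.du x A μ * (a.F1 A).val x α β) :=
    funext fun κ => funext fun μ => funext fun α => funext fun β => nab2Coeff_zero κ μ α β
  have e1 : nab2Coeff bg a (Gam bg.g₀) θ x 1 = fun κ μ α β =>
      ∑ A, -Real.sin (θ A) * midDeriv (Gam bg.g₀) (bg.u A) (a.F1 A) κ μ α β x
        + ∑ i, -trig (secondTerm a i).b (angle (secondTerm a i).n θ)
          * (bg.dv x (secondTerm a i).n κ * bg.dv x (secondTerm a i).n μ
            * (secondTerm a i).S.val x α β) :=
    funext fun κ => funext fun μ => funext fun α => funext fun β => nab2Coeff_one hbg hx κ μ α β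
  have e2 : nab2Coeff bg a (Gam bg.g₀) θ x 2 = _ :=
    funext fun κ => funext fun μ => funext fun α => funext fun β => nab2Coeff_two κ μ α β
  have k0 : nabCoeff bg a (Gam bg.g₀) θ x 0 = fun μ α β => ∑ A, -Real.sin (θ A)
      * (bg.du x A μ * (a.F1 A).val x α β) :=
    funext fun μ => funext fun α => funext fun β => nabCoeff_zero hbg hx μ α β
  have k1 : nabCoeff bg a (Gam bg.g₀) θ x 1 = fun μ α β =>
      ∑ A, Real.cos (θ A) * nab pd (Gam bg.g₀) (a.F1 A) μ α β x
        + ∑ i, (trigSign (secondTerm a i).b * trig (!(secondTerm a i).b)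
            (angle (secondTerm a i).n θ))
          * (bg.dv x (secondTerm a i).n μ * (secondTerm a i).S.val x α β) :=
    funext fun μ => funext fun α => funext fun β => nabCoeff_one μ α β
  have i0 : invCoeff bg a θ x 0 = bg.G x := rfl
  have i1 : invCoeff bg a θ x 1 = fun ρ σ => ∑ A, -Real.cos (θ A)
      * sandwich (bg.G x) (bg.G x) ((a.F1 A).val x) ρ σ :=
    funext fun ρ => funext fun σ => invCoeffOne_eq ρ σ
  have i2 : invCoeff bg a θ x 2 = fun ρ σ =>
      ∑ i, -trig (secondTerm a i).b (angle (secondTerm a i).n θ)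
          * sandwich (bg.G x) (bg.G x) ((secondTerm a i).S.val x) ρ σ
        + ∑ p : 𝒜 × 𝒜, (Real.cos (θ p.1) * Real.cos (θ p.2))
          * sandwichTwo (bg.G x) ((a.F1 p.1).val x) ((a.F1 p.2).val x) ρ σ :=
    funext fun ρ => funext fun σ => invCoeffTwo_eq ρ σ
  -- Seven pieces follow: three from `lin2`, according to the order taken from the inverse metric,
  -- and four from `quad`, according to which of its factors is taken at order one.
  have p1 : lin2 (bg.G x) (nab2Coeff bg a (Gam bg.g₀) θ x 2) α β
      = ∑ A, Real.cos (θ A) * lin2 (bg.G x)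
          (fun κ μ α β => nab2 pd (Gam bg.g₀) (a.F1 A) κ μ α β x) α β
        + ∑ i, (trigSign (secondTerm a i).b * trig (!(secondTerm a i).b)
            (angle (secondTerm a i).n θ)) * lin2 (bg.G x)
              (fun κ μ α β => midDeriv (Gam bg.g₀) (bg.phase (secondTerm a i).n)
                (secondTerm a i).S κ μ α β x) α β
        + ∑ i, -trig (thirdTerm a i).b (angle (thirdTerm a i).n θ)
          * linPart (bg.G x) (bg.dv x (thirdTerm a i).n) ((thirdTerm a i).S.val x) α β := by
    rw [e2, lin2_add_right, lin2_add_right, lin2_sum_right, lin2_sum_right, lin2_sum_right]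
    rfl
  have p2 : lin2 (invCoeff bg a θ x 1) (nab2Coeff bg a (Gam bg.g₀) θ x 1) α β
      = ∑ A, ∑ B, Real.cos (θ A) * Real.sin (θ B)
          * lin2 (sandwich (bg.G x) (bg.G x) ((a.F1 A).val x))
              (fun κ μ α β => midDeriv (Gam bg.g₀) (bg.u B) (a.F1 B) κ μ α β x) α β
        + ∑ i, ∑ A, trig (secondTerm a i).b (angle (secondTerm a i).n θ) * Real.cos (θ A)
          * linPart (sandwich (bg.G x) (bg.G x) ((a.F1 A).val x)) (bg.dv x (secondTerm a i).n)
              ((secondTerm a i).S.val x) α β := by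
    rw [e1, i1, lin2_add_right, lin2_sum_right, lin2_sum_right]
    simp only [lin2_sum_left, Finset.mul_sum, linPart]
    congr 1
    · rw [Finset.sum_comm]
      exact Finset.sum_congr rfl fun A _ => Finset.sum_congr rfl fun B _ => by ring
    · exact Finset.sum_congr rfl fun A _ => Finset.sum_congr rfl fun B _ => by ring
  have p3 : lin2 (invCoeff bg a θ x 2) (nab2Coeff bg a (Gam bg.g₀) θ x 0) α β
      = ∑ i, ∑ A, trig (secondTerm a i).b (angle (secondTerm a i).n θ) * Real.cos (θ A)
          * linPart (sandwich (bg.G x) (bg.G x) ((secondTerm a i).S.val x)) (bg.du x A)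
              ((a.F1 A).val x) α β
        - ∑ A, ∑ B, ∑ C, Real.cos (θ A) * Real.cos (θ B) * Real.cos (θ C)
          * linPart (sandwichTwo (bg.G x) ((a.F1 A).val x) ((a.F1 B).val x)) (bg.du x C)
              ((a.F1 C).val x) α β := by
    rw [e0, i2, lin2_add_left, lin2_sum_left, lin2_sum_left, Fintype.sum_prod_type]
    simp only [lin2_sum_right, Finset.mul_sum, linPart]
    rw [sub_eq_add_neg]
    simp only [← Finset.sum_neg_distrib]
    congr 1
    · exact Finset.sum_congr rfl fun A _ => Finset.sum_congr rfl fun B _ => by ring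
    · exact Finset.sum_congr rfl fun A _ => Finset.sum_congr rfl fun B _ =>
        Finset.sum_congr rfl fun C _ => by ring
  have p4 : quad (invCoeff bg a θ x 1) (bg.G x) (nabCoeff bg a (Gam bg.g₀) θ x 0)
        (nabCoeff bg a (Gam bg.g₀) θ x 0) α β
      = -∑ A, ∑ B, ∑ C, Real.cos (θ A) * Real.sin (θ B) * Real.sin (θ C)
        * quadPart (sandwich (bg.G x) (bg.G x) ((a.F1 A).val x)) (bg.G x) (bg.du x B)
          ((a.F1 B).val x) (bg.du x C) ((a.F1 C).val x) α β := by
    rw [i1, k0, quad_sum_fst]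
    simp only [quad_sum_left, quad_sum_right, Finset.mul_sum, quadPart, ← Finset.sum_neg_distrib]
    refine Finset.sum_congr rfl fun A _ => ?_
    rw [Finset.sum_comm]
    exact Finset.sum_congr rfl fun B _ => Finset.sum_congr rfl fun C _ => by ring
  have p5 : quad (bg.G x) (invCoeff bg a θ x 1) (nabCoeff bg a (Gam bg.g₀) θ x 0)
        (nabCoeff bg a (Gam bg.g₀) θ x 0) α β
      = -∑ A, ∑ B, ∑ C, Real.cos (θ A) * Real.sin (θ B) * Real.sin (θ C)
        * quadPart (bg.G x) (sandwich (bg.G x) (bg.G x) ((a.F1 A).val x)) (bg.du x B)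
          ((a.F1 B).val x) (bg.du x C) ((a.F1 C).val x) α β := by
    rw [i1, k0, quad_sum_snd]
    simp only [quad_sum_left, quad_sum_right, Finset.mul_sum, quadPart, ← Finset.sum_neg_distrib]
    refine Finset.sum_congr rfl fun A _ => ?_
    rw [Finset.sum_comm]
    exact Finset.sum_congr rfl fun B _ => Finset.sum_congr rfl fun C _ => by ring
  have p6 : quad (bg.G x) (bg.G x) (nabCoeff bg a (Gam bg.g₀) θ x 1)
        (nabCoeff bg a (Gam bg.g₀) θ x 0) α β
      = -∑ A, ∑ B, Real.cos (θ A) * Real.sin (θ B) * quad (bg.G x) (bg.G x)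
          (fun μ α β => nab pd (Gam bg.g₀) (a.F1 A) μ α β x)
          (fun μ a' b => bg.du x B μ * (a.F1 B).val x a' b) α β
        - ∑ i, ∑ A, trigSign (secondTerm a i).b * trig (!(secondTerm a i).b)
            (angle (secondTerm a i).n θ) * Real.sin (θ A) * quadPart (bg.G x) (bg.G x)
              (bg.dv x (secondTerm a i).n) ((secondTerm a i).S.val x) (bg.du x A)
              ((a.F1 A).val x) α β := by
    rw [k1, k0, quad_add_left, quad_sum_left, quad_sum_left, sub_eq_add_neg]
    simp only [quad_sum_right, Finset.mul_sum, quadPart, ← Finset.sum_neg_distrib]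
    congr 1
    · exact Finset.sum_congr rfl fun A _ => Finset.sum_congr rfl fun B _ => by ring
    · exact Finset.sum_congr rfl fun A _ => Finset.sum_congr rfl fun B _ => by ring
  have p7 : quad (bg.G x) (bg.G x) (nabCoeff bg a (Gam bg.g₀) θ x 0)
        (nabCoeff bg a (Gam bg.g₀) θ x 1) α β
      = -∑ A, ∑ B, Real.cos (θ A) * Real.sin (θ B) * quad (bg.G x) (bg.G x)
          (fun μ a' b => bg.du x B μ * (a.F1 B).val x a' b)
          (fun μ α β => nab pd (Gam bg.g₀) (a.F1 A) μ α β x) α β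
        - ∑ i, ∑ A, trigSign (secondTerm a i).b * trig (!(secondTerm a i).b)
            (angle (secondTerm a i).n θ) * Real.sin (θ A) * quadPart (bg.G x) (bg.G x)
              (bg.du x A) ((a.F1 A).val x) (bg.dv x (secondTerm a i).n)
              ((secondTerm a i).S.val x) α β := by
    rw [k1, k0, quad_add_right, quad_sum_right, quad_sum_right, sub_eq_add_neg]
    simp only [quad_sum_left, Finset.mul_sum, quadPart, ← Finset.sum_neg_distrib]
    congr 1
    · exact Finset.sum_congr rfl fun A _ => Finset.sum_congr rfl fun B _ => by ring
    · exact Finset.sum_congr rfl fun A _ => Finset.sum_congr rfl fun B _ => by ring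
  rw [twoRicciCoeff, i0, p1, p2, p3, p4, p5, p6, p7]
  simp only [interaction, derivInteraction, cubicInteraction, mul_add, mul_sub, neg_mul,
    Finset.sum_add_distrib, Finset.sum_sub_distrib, Finset.sum_neg_distrib]
  ring

end RawRicci

/-! ## The linear part of the Ricci tensor on the terms of the ansatz -/

section LinearTerms

variable {𝒜 : Type*} [Fintype 𝒜] {bg : Background 𝒜} {x : Spacetime}

lemma G_symm (hbg : bg.IsNullDust) (hx : x ∈ slab) (ρ σ : Fin 4) : bg.G x ρ σ = bg.G x σ ρ :=
  inv_symm (fun a b => g₀_symm hbg hx a b) ρ σ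

omit [Fintype 𝒜] in
lemma linPart_eq_opP (hG : ∀ ρ σ, bg.G x ρ σ = bg.G x σ ρ) {S : Tensor2}
    (hS : ∀ α β, S α β x = S β α x) (v : Scalar) (α β : Fin 4) :
    linPart (bg.G x) (fun μ => pd μ v x) (S.val x) α β = opP bg.g₀ v S α β x := by
  have c : ∀ β, contr (bg.G x) (fun μ => pd μ v x) (S.val x) β
      = ∑ μ, ∑ ν, inv bg.g₀ μ ν x * S β μ x * pd ν v x := by
    intro β
    simp only [contr, up, Finset.sum_mul]
    refine Finset.sum_congr rfl fun μ _ => Finset.sum_congr rfl fun ν _ => ?_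
    simp only [Background.G, Tensor2.val, hS μ β]; ring
  have hS' : ∀ α β, S.val x α β = S.val x β α := hS
  have e := lin2_rank_one (l := fun μ => pd μ v x) hG hS' α β
  rw [c, c] at e
  rw [linPart, e]
  simp only [opP, pol, pair, trace, Background.G, Tensor2.val]
  ring

/-- Covariant constancy passes from `g₀` to its inverse. In the derivative of the polarization
tensor this makes all traces commute with `D`. -/
lemma pd_inv_g₀ (hbg : bg.IsNullDust) (hx : x ∈ slab) (κ ρ σ : Fin 4) :
    pd κ (inv bg.g₀ ρ σ) x
      = -∑ τ, (Gam bg.g₀ ρ κ τ x * bg.G x τ σ + Gam bg.g₀ σ κ τ x * bg.G x ρ τ) := by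
  rw [isFrame_pd.deriv_inv (fun a b => (hbg.smooth_metric a b).of_le (by norm_num)) hx
    (g₀_det hbg hx)]
  congr 1
  have h : ∀ μ ν, pd κ (bg.g₀ μ ν) x
      = ∑ τ, (Gam bg.g₀ τ κ μ x * bg.g₀ τ ν x + Gam bg.g₀ τ κ ν x * bg.g₀ μ τ x) := fun μ ν =>
    sub_eq_zero.1 (nab_g₀ hbg hx κ μ ν)
  have e1 : ∑ μ, ∑ ν, inv bg.g₀ ρ μ x * (∑ τ, Gam bg.g₀ τ κ μ x * bg.g₀ τ ν x) * inv bg.g₀ ν σ x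
      = ∑ τ, Gam bg.g₀ σ κ τ x * bg.G x ρ τ := by
    refine Finset.sum_congr rfl fun μ _ => ?_
    calc _ = ∑ τ, inv bg.g₀ ρ μ x * Gam bg.g₀ τ κ μ x * ∑ ν, bg.g₀ τ ν x * inv bg.g₀ ν σ x := by
          simp only [Finset.mul_sum, Finset.sum_mul]
          rw [Finset.sum_comm]
          exact Finset.sum_congr rfl fun τ _ => Finset.sum_congr rfl fun ν _ => by ring
      _ = _ := by
          simp only [metric_mul_inv (g₀_det hbg hx), mul_ite, mul_one, mul_zero,
            Finset.sum_ite_eq', Finset.mem_univ, if_true, Background.G]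
          ring
  have e2 : ∑ μ, ∑ ν, inv bg.g₀ ρ μ x * (∑ τ, Gam bg.g₀ τ κ ν x * bg.g₀ μ τ x) * inv bg.g₀ ν σ x
      = ∑ τ, Gam bg.g₀ ρ κ τ x * bg.G x τ σ := by
    rw [Finset.sum_comm]
    refine Finset.sum_congr rfl fun ν _ => ?_
    calc _ = ∑ τ, (∑ μ, inv bg.g₀ ρ μ x * bg.g₀ μ τ x) * (Gam bg.g₀ τ κ ν x * inv bg.g₀ ν σ x) := by
          simp only [Finset.mul_sum, Finset.sum_mul]
          rw [Finset.sum_comm]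
          exact Finset.sum_congr rfl fun τ _ => Finset.sum_congr rfl fun μ _ => by ring
      _ = _ := by
          simp only [inv_mul_metric (g₀_det hbg hx), ite_mul, one_mul, zero_mul,
            Finset.sum_ite_eq, Finset.mem_univ, if_true, Background.G]
  simp only [h, Finset.sum_add_distrib, mul_add, add_mul, e1, e2]
  ring

/-- The covariant derivative of the polarization tensor. -/
lemma covD1_pol (hbg : bg.IsNullDust) (hx : x ∈ slab) {S : Tensor2}
    (hS : ∀ α β, ContDiffOn ℝ 2 (S α β) slab) {v : Scalar} (hv : ContDiffOn ℝ 2 v slab)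
    (κ α : Fin 4) :
    covD1 bg.g₀ (pol bg.g₀ S v) κ α x
      = ∑ μ, ∑ ν, bg.G x μ ν * (nab pd (Gam bg.g₀) S κ α μ x * pd ν v x
          + S α μ x * hess (Gam bg.g₀) v κ ν x)
        - (1 / 2) * ((∑ μ, ∑ ν, bg.G x μ ν * nab pd (Gam bg.g₀) S κ μ ν x) * pd α v x
          + trace bg.g₀ S x * hess (Gam bg.g₀) v κ α x) := by
  have dI : ∀ μ ν, DifferentiableWithinAt ℝ (inv bg.g₀ μ ν) slab x := fun μ ν =>
    (inv_g₀_smooth hbg μ ν x hx).differentiableWithinAt (by norm_num)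
  have dS : ∀ μ ν, DifferentiableWithinAt ℝ (S μ ν) slab x := fun μ ν =>
    (hS μ ν x hx).differentiableWithinAt (by norm_num)
  have dv : ∀ μ, DifferentiableWithinAt ℝ (pd μ v) slab x := fun μ =>
    (isFrame_pd.contDiffOn hv μ x hx).differentiableWithinAt (by norm_num)
  have dIS : ∀ μ ν α β, DifferentiableWithinAt ℝ (fun x => inv bg.g₀ μ ν x * S α β x) slab x :=
    fun μ ν α β => (dI μ ν).fun_mul (dS α β)
  have dISv : ∀ μ ν, DifferentiableWithinAt ℝ (fun x => inv bg.g₀ μ ν x * S α μ x * pd ν v x)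
    slab x := fun μ ν => (dIS μ ν α μ).fun_mul (dv ν)
  have dT : DifferentiableWithinAt ℝ (trace bg.g₀ S) slab x :=
    DifferentiableWithinAt.fun_sum fun μ _ => DifferentiableWithinAt.fun_sum fun ν _ => dIS μ ν μ ν
  have dT' : DifferentiableWithinAt ℝ (fun x => 1 / 2 * trace bg.g₀ S x) slab x := dT.const_mul _
  have e1 : pd κ (pol bg.g₀ S v α) x
      = ∑ μ, ∑ ν, ((pd κ (inv bg.g₀ μ ν) x * S α μ x + inv bg.g₀ μ ν x * pd κ (S α μ) x) * pd ν v x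
          + inv bg.g₀ μ ν x * S α μ x * pd κ (pd ν v) x)
        - ((1 / 2) * (∑ μ, ∑ ν, (pd κ (inv bg.g₀ μ ν) x * S μ ν x
            + inv bg.g₀ μ ν x * pd κ (S μ ν) x)) * pd α v x
          + (1 / 2) * trace bg.g₀ S x * pd κ (pd α v) x) := by
    have t : pd κ (trace bg.g₀ S) x = ∑ μ, ∑ ν, (pd κ (inv bg.g₀ μ ν) x * S μ ν x
            + inv bg.g₀ μ ν x * pd κ (S μ ν) x) := by
      rw [show trace bg.g₀ S = fun x => ∑ μ, ∑ ν, inv bg.g₀ μ ν x * S μ ν x from rfl,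
        isFrame_pd.sum hx fun μ _ => DifferentiableWithinAt.fun_sum fun ν _ => dIS μ ν μ ν]
      refine Finset.sum_congr rfl fun μ _ => ?_
      rw [isFrame_pd.sum hx fun ν _ => dIS μ ν μ ν]
      exact Finset.sum_congr rfl fun ν _ => isFrame_pd.mul hx (dI μ ν) (dS μ ν) κ
    rw [show pol bg.g₀ S v α = fun x => ∑ μ, ∑ ν, inv bg.g₀ μ ν x * S α μ x * pd ν v x
        - 1 / 2 * trace bg.g₀ S x * pd α v x from rfl,
      isFrame_pd.sub hx (DifferentiableWithinAt.fun_sum fun μ _ =>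
        DifferentiableWithinAt.fun_sum fun ν _ => dISv μ ν) (dT'.fun_mul (dv α)),
      isFrame_pd.mul hx dT' (dv α), isFrame_pd.const_mul hx _ dT, t,
      isFrame_pd.sum hx fun μ _ => DifferentiableWithinAt.fun_sum fun ν _ => dISv μ ν]
    congr 1
    refine Finset.sum_congr rfl fun μ _ => ?_
    rw [isFrame_pd.sum hx fun ν _ => dISv μ ν]
    refine Finset.sum_congr rfl fun ν _ => ?_
    rw [isFrame_pd.mul hx (dIS μ ν α μ) (dv ν), isFrame_pd.mul hx (dI μ ν) (dS α μ)]
  have eS : ∀ a b, pd κ (S a b) x = nab pd (Gam bg.g₀) S κ a b x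
      + ∑ ρ, (Gam bg.g₀ ρ κ a x * S ρ b x + Gam bg.g₀ ρ κ b x * S a ρ x) := by
    intro a b; simp only [nab]; ring
  have ev : ∀ μ, pd κ (pd μ v) x = hess (Gam bg.g₀) v κ μ x
      + ∑ ρ, Gam bg.g₀ ρ κ μ x * pd ρ v x := by
    intro μ; simp only [hess]; ring
  have eI : ∀ μ ν, inv bg.g₀ μ ν x = bg.G x μ ν := fun _ _ => rfl
  -- Every ordinary derivative becomes a covariant one plus connection terms. These cancel in all
  -- contracted indices, and `covD1` removes those of the free index.
  rw [covD1, e1]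
  simp only [pol, trace, eS, ev, pd_inv_g₀ hbg hx, eI]
  set I := bg.G x
  clear_value I
  generalize hΓ : (fun ρ a => Gam bg.g₀ ρ κ a x) = Γ
  have hΓ' : ∀ ρ a, Gam bg.g₀ ρ κ a x = Γ ρ a := fun ρ a => by rw [← hΓ]
  generalize hV : (fun μ => pd μ v x) = V
  have hV' : ∀ μ, pd μ v x = V μ := fun μ => by rw [← hV]
  generalize hZ : (fun a b => S a b x) = Z
  have hZ' : ∀ a b, S a b x = Z a b := fun a b => by rw [← hZ]
  generalize (fun a b => nab pd (Gam bg.g₀) S κ a b x) = N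
  simp only [hΓ', hV', hZ', Fin.sum_univ_four]
  ring

/-- The gauge quantity `g₀^{μν} (∂_μ S_{βν} - ½ ∂_β S_{μν})`. -/
def divTerm (bg : Background 𝒜) (S : Tensor2) : CoVec := fun β x =>
  ∑ μ, ∑ ν, inv bg.g₀ μ ν x * (pd μ (S β ν) x - (1 / 2) * pd β (S μ ν) x)

/-- The connection term traced over both lower indices of `Γ` vanishes by the wave gauge of `g₀`.
The other one from `D_ρ S_{βσ}` equals each of the two from `D_β S_{ρσ}`, and the factor `1/2` makes
them cancel. -/
lemma divTerm_eq (hbg : bg.IsNullDust) (hx : x ∈ slab) {S : Tensor2}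
    (hS : ∀ α β, S α β x = S β α x) (β : Fin 4) :
    ∑ ρ, ∑ σ, bg.G x ρ σ * (nab pd (Gam bg.g₀) S ρ β σ x
        - (1 / 2) * nab pd (Gam bg.g₀) S β ρ σ x) = divTerm bg S β x := by
  have w : ∑ ρ, ∑ σ, bg.G x ρ σ * (∑ τ, Gam bg.g₀ τ ρ σ x * S β τ x) = 0 := by
    have h : ∑ τ, (∑ ρ, ∑ σ, bg.G x ρ σ * Gam bg.g₀ τ ρ σ x) * S β τ x = 0 := by
      have w : ∀ τ, ∑ ρ, ∑ σ, bg.G x ρ σ * Gam bg.g₀ τ ρ σ x = 0 := fun τ => hbg.wave_gauge x hx τ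
      simp [w]
    rw [← h]
    simp only [Finset.sum_mul, Finset.mul_sum]
    rw [Finset.sum_comm' (t' := Finset.univ) (s' := fun _ => Finset.univ) (by simp)]
    rw [Finset.sum_comm]
    conv_rhs => rw [Finset.sum_comm]
    refine Finset.sum_congr rfl fun σ _ => ?_
    rw [Finset.sum_comm]
    exact Finset.sum_congr rfl fun ρ _ => Finset.sum_congr rfl fun τ _ => by ring
  have x1 : ∑ ρ, ∑ σ, bg.G x ρ σ * (∑ τ, Gam bg.g₀ τ ρ β x * S τ σ x)
      = ∑ ρ, ∑ σ, bg.G x ρ σ * (∑ τ, Gam bg.g₀ τ β ρ x * S τ σ x) := by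
    simp only [Gam_symm hbg hx _ _ β]
  have x2 : ∑ ρ, ∑ σ, bg.G x ρ σ * (∑ τ, Gam bg.g₀ τ β σ x * S ρ τ x)
      = ∑ ρ, ∑ σ, bg.G x ρ σ * (∑ τ, Gam bg.g₀ τ β ρ x * S τ σ x) := by
    rw [Finset.sum_comm]
    refine Finset.sum_congr rfl fun ρ _ => Finset.sum_congr rfl fun σ _ => ?_
    rw [G_symm hbg hx]
    congr 1
    exact Finset.sum_congr rfl fun τ _ => by rw [hS σ τ]
  have e : ∑ ρ, ∑ σ, bg.G x ρ σ * (nab pd (Gam bg.g₀) S ρ β σ x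
        - (1 / 2) * nab pd (Gam bg.g₀) S β ρ σ x)
      = divTerm bg S β x
        - ∑ ρ, ∑ σ, bg.G x ρ σ * (∑ τ, Gam bg.g₀ τ ρ β x * S τ σ x)
        - ∑ ρ, ∑ σ, bg.G x ρ σ * (∑ τ, Gam bg.g₀ τ ρ σ x * S β τ x)
        + (1 / 2) * (∑ ρ, ∑ σ, bg.G x ρ σ * (∑ τ, Gam bg.g₀ τ β ρ x * S τ σ x)
          + ∑ ρ, ∑ σ, bg.G x ρ σ * (∑ τ, Gam bg.g₀ τ β σ x * S ρ τ x)) := by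
    have half : ∀ F : Fin 4 → Fin 4 → ℝ, 1 / 2 * ∑ ρ, ∑ σ, F ρ σ = ∑ ρ, ∑ σ, 1 / 2 * F ρ σ :=
      fun F => by simp only [Finset.mul_sum]
    rw [mul_add, half, half, divTerm]
    simp only [← Finset.sum_add_distrib, ← Finset.sum_sub_distrib]
    refine Finset.sum_congr rfl fun ρ _ => Finset.sum_congr rfl fun σ _ => ?_
    simp only [nab, Finset.sum_add_distrib, Background.G]
    ring
  rw [e, x1, x2, w]
  ring

/-- The linear part of the Ricci tensor on the intermediate derivatives of a term of the ansatz. -/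
lemma lin2_midDeriv (hbg : bg.IsNullDust) (hx : x ∈ slab) {S : Tensor2}
    (hS : IsSymmC2 S) {v : Scalar} (hv : ContDiffOn ℝ 2 v slab) (α β : Fin 4) :
    lin2 (bg.G x) (fun κ μ α β => midDeriv (Gam bg.g₀) v S κ μ α β x) α β
      = covD1 bg.g₀ (pol bg.g₀ S v) α β x + covD1 bg.g₀ (pol bg.g₀ S v) β α x
        + (pd α v x * divTerm bg S β x + pd β v x * divTerm bg S α x)
        - (2 * ∑ ρ, ∑ σ, bg.G x ρ σ * pd ρ v x * nab pd (Gam bg.g₀) S σ α β x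
          + box bg.g₀ v x * S α β x) := by
  have hSx : ∀ α β, S α β x = S β α x := fun α β => congrFun (hS.1 α β) x
  have hN : ∀ κ α β, nab pd (Gam bg.g₀) S κ α β x = nab pd (Gam bg.g₀) S κ β α x := by
    intro κ α β
    simp only [nab, hS.1 α β]
    congr 1
    exact Finset.sum_congr rfl fun ρ _ => by rw [hSx ρ β, hSx α ρ]; ring
  have hh : ∀ κ μ, hess (Gam bg.g₀) v κ μ x = hess (Gam bg.g₀) v μ κ x := by
    intro κ μ
    simp only [hess, Gam_symm hbg hx _ κ μ, pd_comm hv hx κ μ]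
  have gs := G_symm hbg hx
  rw [covD1_pol hbg hx hS.2 hv, covD1_pol hbg hx hS.2 hv, ← divTerm_eq hbg hx hSx,
    ← divTerm_eq hbg hx hSx]
  have eb : box bg.g₀ v x = ∑ ρ, ∑ σ, bg.G x ρ σ * hess (Gam bg.g₀) v ρ σ x := rfl
  have et : trace bg.g₀ S x = ∑ ρ, ∑ σ, bg.G x ρ σ * S ρ σ x := rfl
  have sw : ∀ F : Fin 4 → Fin 4 → ℝ, ∑ ρ, ∑ σ, bg.G x ρ σ * F ρ σ
      = ∑ ρ, ∑ σ, bg.G x ρ σ * F σ ρ := by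
    intro F
    rw [Finset.sum_comm]
    exact Finset.sum_congr rfl fun ρ _ => Finset.sum_congr rfl fun σ _ => by rw [gs]
  have q1 := sw fun ρ σ => nab pd (Gam bg.g₀) S α β σ x * pd ρ v x
  have q2 := sw fun ρ σ => nab pd (Gam bg.g₀) S β α σ x * pd ρ v x
  have q3 : ∑ ρ, ∑ σ, bg.G x ρ σ * (S β σ x * hess (Gam bg.g₀) v ρ α x)
      = ∑ ρ, ∑ σ, bg.G x ρ σ * (S β ρ x * hess (Gam bg.g₀) v α σ x) := by
    rw [sw]
    exact Finset.sum_congr rfl fun ρ _ => Finset.sum_congr rfl fun σ _ => by rw [hh σ]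
  have q4 : ∑ ρ, ∑ σ, bg.G x ρ σ * (S α σ x * hess (Gam bg.g₀) v ρ β x)
      = ∑ ρ, ∑ σ, bg.G x ρ σ * (S α ρ x * hess (Gam bg.g₀) v β σ x) := by
    rw [sw]
    exact Finset.sum_congr rfl fun ρ _ => Finset.sum_congr rfl fun σ _ => by rw [hh σ]
  have q5 := sw fun ρ σ => pd ρ v x * nab pd (Gam bg.g₀) S σ α β x
  -- The four index placements of `lin2` act on the three terms of `midDeriv`. The gradient of the
  -- trace along `∂v` is shared equally between the derivative of the polarization tensor and
  -- `divTerm`. The terms with both derivative indices contracted give the transport part.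
  have E : lin2 (bg.G x) (fun κ μ α β => midDeriv (Gam bg.g₀) v S κ μ α β x) α β
      = (∑ ρ, ∑ σ, bg.G x ρ σ * (nab pd (Gam bg.g₀) S α β σ x * pd ρ v x)
          + ∑ ρ, ∑ σ, bg.G x ρ σ * (nab pd (Gam bg.g₀) S β α σ x * pd ρ v x))
        + (∑ ρ, ∑ σ, bg.G x ρ σ * (S β σ x * hess (Gam bg.g₀) v ρ α x)
          + ∑ ρ, ∑ σ, bg.G x ρ σ * (S α σ x * hess (Gam bg.g₀) v ρ β x))
        + pd α v x * ∑ ρ, ∑ σ, bg.G x ρ σ * nab pd (Gam bg.g₀) S ρ β σ x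
        + pd β v x * ∑ ρ, ∑ σ, bg.G x ρ σ * nab pd (Gam bg.g₀) S ρ α σ x
        - (∑ ρ, ∑ σ, bg.G x ρ σ * (pd ρ v x * nab pd (Gam bg.g₀) S σ α β x)
          + ∑ ρ, ∑ σ, bg.G x ρ σ * (pd σ v x * nab pd (Gam bg.g₀) S ρ α β x)
          + (∑ ρ, ∑ σ, bg.G x ρ σ * hess (Gam bg.g₀) v ρ σ x) * S α β x)
        - (pd α v x * ∑ ρ, ∑ σ, bg.G x ρ σ * nab pd (Gam bg.g₀) S β ρ σ x
          + pd β v x * ∑ ρ, ∑ σ, bg.G x ρ σ * nab pd (Gam bg.g₀) S α ρ σ x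
          + hess (Gam bg.g₀) v α β x * ∑ ρ, ∑ σ, bg.G x ρ σ * S ρ σ x) := by
    simp only [lin2, Finset.mul_sum, Finset.sum_mul, ← Finset.sum_add_distrib,
      ← Finset.sum_sub_distrib]
    refine Finset.sum_congr rfl fun ρ _ => Finset.sum_congr rfl fun σ _ => ?_
    simp only [midDeriv]
    ring
  rw [E, q1, q2, q3, q4, ← q5, eb, et, hh β α]
  simp only [mul_add, mul_sub, Finset.sum_add_distrib, Finset.sum_sub_distrib]
  have m : ∀ β, ∑ ρ, ∑ σ, bg.G x ρ σ * (1 / 2 * nab pd (Gam bg.g₀) S β ρ σ x)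
      = (1 / 2) * ∑ ρ, ∑ σ, bg.G x ρ σ * nab pd (Gam bg.g₀) S β ρ σ x := by
    intro β
    simp only [Finset.mul_sum]
    exact Finset.sum_congr rfl fun ρ _ => Finset.sum_congr rfl fun σ _ => by ring
  simp only [m, mul_assoc]
  ring

/-- Since `L_A` is minus the gradient of `u_A`, the operator `2 ∂^ρ u_A D_ρ + □ u_A` is `ℒ_A`. -/
lemma lin2_midDeriv_phase (hbg : bg.IsNullDust) (hx : x ∈ slab) {S : Tensor2}
    (hS : IsSymmC2 S) (A : 𝒜) (α β : Fin 4) :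
    lin2 (bg.G x) (fun κ μ α β => midDeriv (Gam bg.g₀) (bg.u A) S κ μ α β x) α β
      = covD1 bg.g₀ (pol bg.g₀ S (bg.u A)) α β x + covD1 bg.g₀ (pol bg.g₀ S (bg.u A)) β α x
        + (bg.du x A α * divTerm bg S β x + bg.du x A β * divTerm bg S α x)
        - bg.transport A S α β x := by
  rw [lin2_midDeriv hbg hx hS (hbg.smooth_phase A)]
  simp only [Background.transport, Background.du, Background.L]
  have : ∑ μ, (-∑ ν, inv bg.g₀ μ ν x * pd ν (bg.u A) x) * covD2 bg.g₀ S μ α β x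
      = -∑ ρ, ∑ σ, bg.G x ρ σ * pd ρ (bg.u A) x * nab pd (Gam bg.g₀) S σ α β x := by
    rw [Finset.sum_comm]
    simp only [Finset.sum_mul, neg_mul, Finset.sum_neg_distrib]
    refine congrArg _ (Finset.sum_congr rfl fun ρ _ => Finset.sum_congr rfl fun σ _ => ?_)
    rw [G_symm hbg hx]
    rfl
  rw [this]
  ring

end LinearTerms

/-! ## The coefficients of order `-1` and `0` -/

section Phases

variable {𝒜 : Type*} [Fintype 𝒜] {bg : Background 𝒜} {x : Spacetime}

lemma dv_eq (hbg : bg.IsNullDust) (hx : x ∈ slab) (n : 𝒜 → ℤ) (μ : Fin 4) :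
    bg.dv x n μ = ∑ A, (n A : ℝ) * bg.du x A μ :=
  pd_phase hbg.smooth_phase n μ hx

lemma dv_add (hbg : bg.IsNullDust) (hx : x ∈ slab) (n m : 𝒜 → ℤ) (μ : Fin 4) :
    bg.dv x (n + m) μ = bg.dv x n μ + bg.dv x m μ := by
  simp only [dv_eq hbg hx, Pi.add_apply, Int.cast_add, add_mul, Finset.sum_add_distrib]

lemma dv_smul (hbg : bg.IsNullDust) (hx : x ∈ slab) (k : ℤ) (n : 𝒜 → ℤ) (μ : Fin 4) :
    bg.dv x (k • n) μ = k * bg.dv x n μ := by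
  simp only [dv_eq hbg hx, Pi.smul_apply, smul_eq_mul, Int.cast_mul, Finset.mul_sum, mul_assoc]

variable [DecidableEq 𝒜]

lemma dv_pm (hbg : bg.IsNullDust) (hx : x ∈ slab) (A B : 𝒜) (ε : ℤˣ) (μ : Fin 4) :
    bg.dv x (pm A B ε) μ = bg.du x A μ + ((ε : ℤ) : ℝ) * bg.du x B μ := by
  rw [pm, dv_add hbg hx, dv_smul hbg hx, Background.dv_unit, Background.dv_unit]

omit [DecidableEq 𝒜] in
lemma angle_add (n m : 𝒜 → ℤ) (θ : 𝒜 → ℝ) : angle (n + m) θ = angle n θ + angle m θ := by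
  simp only [angle, Pi.add_apply, Int.cast_add, add_mul, Finset.sum_add_distrib]

omit [DecidableEq 𝒜] in
lemma angle_smul (k : ℤ) (n : 𝒜 → ℤ) (θ : 𝒜 → ℝ) : angle (k • n) θ = k * angle n θ := by
  simp only [angle, Pi.smul_apply, smul_eq_mul, Int.cast_mul, Finset.mul_sum, mul_assoc]

lemma angle_pm (A B : 𝒜) (ε : ℤˣ) (θ : 𝒜 → ℝ) :
    angle (pm A B ε) θ = θ A + ((ε : ℤ) : ℝ) * θ B := by
  rw [pm, angle_add, angle_smul, angle_unit, angle_unit]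

omit [DecidableEq 𝒜] in
lemma angle_phase (n : 𝒜 → ℤ) (lam : ℝ) :
    angle n (fun A => bg.u A x / lam) = bg.phase n x / lam := by
  simp only [angle, Background.phase, Finset.sum_div, mul_div_assoc]

end Phases

/-! ### Consequences of the polarization assumptions -/

section Polarization

variable {𝒜 : Type*} [Fintype 𝒜] [DecidableEq 𝒜] {bg : Background 𝒜} {a : Amplitudes 𝒜}
  {x : Spacetime}

lemma F1_symm (ha : a.Admissible bg) (A : 𝒜) (α β : Fin 4) :
    (a.F1 A).val x α β = (a.F1 A).val x β α :=
  congrFun ((ha.F1 A).1 α β) x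

omit [Fintype 𝒜] [DecidableEq 𝒜] in
lemma contrL_eq (A : 𝒜) (S : Tensor2) (α : Fin 4) :
    bg.contrL A S α x = -contr (bg.G x) (bg.du x A) (S.val x) α := by
  simp only [Background.contrL, Background.L, contr, up, Background.G, Background.du, Tensor2.val,
    neg_mul, Finset.sum_neg_distrib]

/-- Vanishing polarization makes the contraction of `F1_A` with the gradient of `u_A` equal to half
the trace times `du_A`. Evaluated on `L̲_A`, where `du_A(L̲_A) = 2`, this is the trace itself, and
the frame condition says that the value is zero. The contraction then vanishes too. -/
lemma F1_constraints (hbg : bg.IsNullDust) (ha : a.Admissible bg) (hx : x ∈ slab) (A : 𝒜) :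
    trace bg.g₀ (a.F1 A) x = 0 ∧ ∀ α, contr (bg.G x) (bg.du x A) ((a.F1 A).val x) α = 0 := by
  have hp : ∀ α, contr (bg.G x) (bg.du x A) ((a.F1 A).val x) α
      = (1 / 2) * trace bg.g₀ (a.F1 A) x * bg.du x A α := by
    intro α
    have := ha.polarized x hx A α
    rw [pol] at this
    rw [Background.du, ← sub_eq_zero, ← this]
    congr 1
    simp only [contr, up, Finset.sum_mul]
    refine Finset.sum_congr rfl fun μ _ => Finset.sum_congr rfl fun ν _ => ?_
    rw [F1_symm ha]
    simp only [Background.G, Tensor2.val, Background.du]; ring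
  have gL : ∀ ν, ∑ μ, bg.g₀ μ ν x * bg.L A μ x = -bg.du x A ν := by
    intro ν
    calc _ = -∑ τ, (∑ μ, bg.g₀ ν μ x * inv bg.g₀ μ τ x) * bg.du x A τ := by
          simp only [Background.L, Finset.sum_mul, mul_neg, Finset.mul_sum,
            Finset.sum_neg_distrib]
          rw [Finset.sum_comm]
          refine congrArg _ (Finset.sum_congr rfl fun τ _ => Finset.sum_congr rfl fun μ _ => ?_)
          rw [g₀_symm hbg hx μ ν, Background.du]; ring
      _ = _ := by simp [metric_mul_inv (g₀_det hbg hx)]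
  have hl : ∑ ν, bg.du x A ν * bg.Lbar A ν x = 2 := by
    have := hbg.frame_pair x hx A
    rw [Finset.sum_comm] at this
    simp only [← Finset.sum_mul, gL] at this
    simp only [neg_mul, Finset.sum_neg_distrib] at this
    linarith
  have hf : ∑ ν, contr (bg.G x) (bg.du x A) ((a.F1 A).val x) ν * bg.Lbar A ν x = 0 := by
    have := ha.polarized_frame x hx A
    rw [Finset.sum_comm] at this
    simp only [← Finset.sum_mul] at this
    have e : ∀ ν, ∑ μ, a.F1 A μ ν x * bg.L A μ x
        = -contr (bg.G x) (bg.du x A) ((a.F1 A).val x) ν := by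
      intro ν
      rw [← contrL_eq, Background.contrL]
      exact Finset.sum_congr rfl fun μ _ => mul_comm _ _
    simp only [e, neg_mul, Finset.sum_neg_distrib, neg_eq_zero] at this
    exact this
  have t : trace bg.g₀ (a.F1 A) x = 0 := by
    simp only [hp, mul_assoc, ← Finset.mul_sum, hl] at hf
    linarith
  exact ⟨t, fun α => by rw [hp, t]; ring⟩

lemma sum_mix_F1 (hbg : bg.IsNullDust) (ha : a.Admissible bg) (hx : x ∈ slab) (A : 𝒜) :
    ∑ ρ, mix (bg.G x) ((a.F1 A).val x) ρ ρ = 0 := by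
  rw [← (F1_constraints hbg ha hx A).1]
  simp only [mix, trace]
  refine Finset.sum_congr rfl fun μ _ => Finset.sum_congr rfl fun ν _ => ?_
  rw [F1_symm ha]; rfl

omit [Fintype 𝒜] [DecidableEq 𝒜] in
lemma sum_du_up (A B : 𝒜) :
    ∑ σ, bg.du x A σ * up (bg.G x) (bg.du x B) σ = pair bg.g₀ (bg.u A) (bg.u B) x := by
  simp only [up, Finset.mul_sum, pair]
  exact Finset.sum_congr rfl fun μ _ => Finset.sum_congr rfl fun ν _ => by
    simp only [Background.G, Background.du]; ring

lemma covD1_pol_F1 (ha : a.Admissible bg) (hx : x ∈ slab) (A : 𝒜)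
    (κ α : Fin 4) : covD1 bg.g₀ (pol bg.g₀ (a.F1 A) (bg.u A)) κ α x = 0 := by
  have : pd κ (pol bg.g₀ (a.F1 A) (bg.u A) α) x = 0 := by
    rw [isFrame_pd.congr_on hx (fun q hq => ha.polarized q hq A α) (differentiableWithinAt_const 0)]
    exact pd_zero κ
  simp [covD1, this, ha.polarized x hx]

omit [DecidableEq 𝒜] in
lemma opP_null (hbg : bg.IsNullDust) (hx : x ∈ slab) (A : 𝒜) (S : Tensor2) (α β : Fin 4) :
    opP bg.g₀ (bg.u A) S α β x = bg.du x A α * pol bg.g₀ S (bg.u A) β x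
      + bg.du x A β * pol bg.g₀ S (bg.u A) α x := by
  rw [opP, hbg.eikonal x hx A, Background.du, Background.du]; ring

/-- Each summand is a multiple of `𝒫_{u_A}(F1_A)`. For a null phase `𝒫` is built from the
polarization tensor alone, and that of `F1_A` is zero. -/
theorem twoRicciCoeff_zero_eq (hbg : bg.IsNullDust) (ha : a.Admissible bg) (hx : x ∈ slab)
    (θ : 𝒜 → ℝ) (α β : Fin 4) : twoRicciCoeff bg a θ x α β 0 = 0 := by
  rw [twoRicciCoeff_zero]
  refine Finset.sum_eq_zero fun A _ => ?_
  rw [show bg.du x A = fun μ => pd μ (bg.u A) x from rfl,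
    linPart_eq_opP (G_symm hbg hx) (F1_symm ha A), opP_null hbg hx, ha.polarized x hx,
    ha.polarized x hx]
  ring

end Polarization

/-! ### Products of first amplitudes and the coefficient of order `0` -/

section OrderZero

variable {𝒜 : Type*} [Fintype 𝒜] [DecidableEq 𝒜] {bg : Background 𝒜} {a : Amplitudes 𝒜}
  {x : Spacetime}

omit [DecidableEq 𝒜] in
lemma sum_sandwich_mul (hbg : bg.IsNullDust) (hx : x ∈ slab) (A B : 𝒜) :
    ∑ ρ, ∑ σ, sandwich (bg.G x) (bg.G x) ((a.F1 A).val x) ρ σ * (a.F1 B).val x ρ σ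
      = dot bg.g₀ (a.F1 A) (a.F1 B) x := by
  simp only [sandwich, dot, Finset.sum_mul]
  conv_rhs => rw [Finset.sum_comm]
  refine Finset.sum_congr rfl fun ρ _ => ?_
  rw [Finset.sum_comm]
  refine Finset.sum_congr rfl fun μ _ => ?_
  rw [Finset.sum_comm]
  refine Finset.sum_congr rfl fun ν _ => Finset.sum_congr rfl fun σ _ => ?_
  rw [G_symm hbg hx ρ]
  simp only [Background.G, Tensor2.val]; ring

omit [DecidableEq 𝒜] in
lemma dot_comm (hbg : bg.IsNullDust) (hx : x ∈ slab) (S T : Tensor2) :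
    dot bg.g₀ S T x = dot bg.g₀ T S x := by
  simp only [dot]
  rw [Finset.sum_comm]
  refine Finset.sum_congr rfl fun α _ => Finset.sum_congr rfl fun β _ => ?_
  rw [Finset.sum_comm]
  refine Finset.sum_congr rfl fun μ _ => Finset.sum_congr rfl fun ν _ => ?_
  have := G_symm hbg hx
  simp only [Background.G] at this
  rw [this β, this ν]; ring

omit [DecidableEq 𝒜] in
lemma pair_comm (hbg : bg.IsNullDust) (hx : x ∈ slab) (v w : Scalar) :
    pair bg.g₀ v w x = pair bg.g₀ w v x := by
  simp only [pair]
  rw [Finset.sum_comm]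
  refine Finset.sum_congr rfl fun μ _ => Finset.sum_congr rfl fun ν _ => ?_
  have := G_symm hbg hx
  simp only [Background.G] at this
  rw [this ν]; ring

lemma crossF_comm (hbg : bg.IsNullDust) (ha : a.Admissible bg) (hx : x ∈ slab) (A B : 𝒜)
    (α β : Fin 4) : crossF bg a A B α β x = crossF bg a B A β α x := by
  have gs := G_symm hbg hx
  have hA := F1_symm (x := x) ha A
  have hB := F1_symm (x := x) ha B
  simp only [Background.G, Tensor2.val] at gs hA hB
  simp only [crossF]
  rw [Finset.sum_comm]
  refine Finset.sum_congr rfl fun μ _ => Finset.sum_congr rfl fun ν _ => ?_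
  rw [gs ν, hA α, hB μ]; ring

lemma sum_contr_mul (hbg : bg.IsNullDust) (ha : a.Admissible bg) (hx : x ∈ slab) (A B : 𝒜)
    (β : Fin 4) :
    contr (sandwich (bg.G x) (bg.G x) ((a.F1 A).val x)) (bg.du x B) ((a.F1 B).val x) β
      = -crossL bg a A B β x := by
  have e : ∀ ρ, up (sandwich (bg.G x) (bg.G x) ((a.F1 A).val x)) (bg.du x B) ρ
      = ∑ ν, contr (bg.G x) (bg.du x B) ((a.F1 A).val x) ν * bg.G x ν ρ := by
    intro ρ
    rw [← sum_mul_sandwich (G_symm hbg hx)]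
    exact Finset.sum_congr rfl fun μ _ => by
      rw [sandwich_symm (G_symm hbg hx) (F1_symm ha A)]; ring
  simp only [contr, e, crossL, contrL_eq]
  simp only [Finset.sum_mul, neg_mul, mul_neg, Finset.sum_neg_distrib, neg_neg]
  rw [Finset.sum_comm]
  refine Finset.sum_congr rfl fun μ _ => Finset.sum_congr rfl fun ν _ => ?_
  rw [F1_symm ha B]
  simp only [Background.G, Tensor2.val, Finset.sum_mul, Finset.mul_sum]
  exact Finset.sum_congr rfl fun ρ _ => by ring

omit [Fintype 𝒜] [DecidableEq 𝒜] in
lemma LL_eq_sum (A : 𝒜) (S : Tensor2) :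
    bg.LL A S x = ∑ ν, bg.contrL A S ν x * bg.L A ν x := by
  simp only [Background.LL, Background.contrL, Finset.sum_mul]
  rw [Finset.sum_comm]
  exact Finset.sum_congr rfl fun ν _ => Finset.sum_congr rfl fun μ _ => by ring

omit [DecidableEq 𝒜] in
lemma LL_eq (hbg : bg.IsNullDust) (hx : x ∈ slab) (A : 𝒜) (S : Tensor2) :
    ∑ ρ, ∑ σ, sandwich (bg.G x) (bg.G x) (S.val x) ρ σ * bg.du x A ρ * bg.du x A σ
      = bg.LL A S x := by
  have e : ∀ σ, ∑ ρ, sandwich (bg.G x) (bg.G x) (S.val x) ρ σ * bg.du x A ρ * bg.du x A σ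
      = (∑ ν, contr (bg.G x) (bg.du x A) (S.val x) ν * bg.G x ν σ) * bg.du x A σ := by
    intro σ
    rw [← sum_mul_sandwich (G_symm hbg hx), Finset.sum_mul]
    exact Finset.sum_congr rfl fun μ _ => by ring
  rw [Finset.sum_comm, LL_eq_sum]
  simp only [e, contrL_eq, Finset.sum_mul, Background.L]
  rw [Finset.sum_comm]
  refine Finset.sum_congr rfl fun ν _ => ?_
  rw [neg_mul_neg, Finset.mul_sum]
  refine Finset.sum_congr rfl fun σ _ => ?_
  simp only [Background.G, Background.du]; ring

lemma linPart_F1 (hbg : bg.IsNullDust) (ha : a.Admissible bg) (hx : x ∈ slab) (A B : 𝒜)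
    (α β : Fin 4) :
    linPart (sandwich (bg.G x) (bg.G x) ((a.F1 A).val x)) (bg.du x B) ((a.F1 B).val x) α β
      = -(bg.du x B α * crossL bg a A B β x + bg.du x B β * crossL bg a A B α x)
        - bg.LL B (a.F1 A) x * a.F1 B α β x
        - bg.du x B α * bg.du x B β * dot bg.g₀ (a.F1 A) (a.F1 B) x := by
  rw [linPart, lin2_rank_one (sandwich_symm (G_symm hbg hx) (F1_symm ha A)) (F1_symm ha B),
    sum_contr_mul hbg ha hx, sum_contr_mul hbg ha hx, LL_eq hbg hx, sum_sandwich_mul hbg hx]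
  simp only [Tensor2.val]
  ring

/-- All words containing the trace of `F1_A` or its contraction with its own phase disappear from
`quad_rank_one_self`; three remain. -/
lemma quadPart_F1 (hbg : bg.IsNullDust) (ha : a.Admissible bg) (hx : x ∈ slab) (A B : 𝒜)
    (α β : Fin 4) :
    quadPart (bg.G x) (bg.G x) (bg.du x A) ((a.F1 A).val x) (bg.du x B) ((a.F1 B).val x) α β
      = (1 / 2) * (bg.du x A α * bg.du x B β) * dot bg.g₀ (a.F1 A) (a.F1 B) x
        - bg.contrL B (a.F1 A) α x * bg.contrL A (a.F1 B) β x
        + pair bg.g₀ (bg.u A) (bg.u B) x * crossF bg a A B α β x := by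
  rw [quadPart, quad_rank_one_self (G_symm hbg hx) (F1_symm ha A) (F1_symm ha B),
    sum_sandwich_mul hbg hx, sum_mix_F1 hbg ha hx, sum_du_up, contrL_eq, contrL_eq]
  simp only [(F1_constraints hbg ha hx A).2, crossF]
  simp [Background.G, Tensor2.val]

lemma contrL_self (hbg : bg.IsNullDust) (ha : a.Admissible bg) (hx : x ∈ slab) (A : 𝒜)
    (α : Fin 4) : bg.contrL A (a.F1 A) α x = 0 := by
  rw [contrL_eq, (F1_constraints hbg ha hx A).2, neg_zero]

lemma linPart_F1_self (hbg : bg.IsNullDust) (ha : a.Admissible bg) (hx : x ∈ slab) (A : 𝒜)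
    (α β : Fin 4) :
    linPart (sandwich (bg.G x) (bg.G x) ((a.F1 A).val x)) (bg.du x A) ((a.F1 A).val x) α β
      = -(bg.du x A α * bg.du x A β * dot bg.g₀ (a.F1 A) (a.F1 A) x) := by
  have h : bg.LL A (a.F1 A) x = 0 := by
    simp [LL_eq_sum, contrL_self hbg ha hx]
  rw [linPart_F1 hbg ha hx, h]
  simp [crossL, contrL_self hbg ha hx]

lemma quadPart_F1_self (hbg : bg.IsNullDust) (ha : a.Admissible bg) (hx : x ∈ slab) (A : 𝒜)
    (α β : Fin 4) :
    quadPart (bg.G x) (bg.G x) (bg.du x A) ((a.F1 A).val x) (bg.du x A) ((a.F1 A).val x) α β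
      = (1 / 2) * (bg.du x A α * bg.du x A β) * dot bg.g₀ (a.F1 A) (a.F1 A) x := by
  rw [quadPart_F1 hbg ha hx, contrL_self hbg ha hx, hbg.eikonal x hx]
  ring

/-- The mixed quadratic interaction at order `0`. -/
lemma mixed_identity (hbg : bg.IsNullDust) (ha : a.Admissible bg) (hx : x ∈ slab) (A B : 𝒜)
    (ε : ℤˣ) (α β : Fin 4) :
    (1 / 2) * (linPart (sandwich (bg.G x) (bg.G x) ((a.F1 A).val x)) (bg.du x B)
          ((a.F1 B).val x) α β
        + linPart (sandwich (bg.G x) (bg.G x) ((a.F1 B).val x)) (bg.du x A)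
          ((a.F1 A).val x) α β)
      - ((ε : ℤ) : ℝ) / 2 * (quadPart (bg.G x) (bg.G x) (bg.du x A) ((a.F1 A).val x) (bg.du x B)
          ((a.F1 B).val x) α β
        + quadPart (bg.G x) (bg.G x) (bg.du x B) ((a.F1 B).val x) (bg.du x A)
          ((a.F1 A).val x) α β)
      = I0pm bg a A B ε α β x + I0pm bg a B A ε α β x := by
  -- The identity is polynomial in the sign and relies on `ε² = 1`, which enters through the two
  -- cases.
  have hε : ((ε : ℤ) : ℝ) = 1 ∨ ((ε : ℤ) : ℝ) = -1 := by
    rcases Int.units_eq_one_or ε with h | h <;> simp [h]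
  have hdv : ∀ A B μ, pd μ (bg.phase (pm A B ε)) x = bg.du x A μ + ((ε : ℤ) : ℝ) * bg.du x B μ :=
    fun A B μ => dv_pm hbg hx A B ε μ
  have hdu : ∀ A μ, pd μ (bg.u A) x = bg.du x A μ := fun _ _ => rfl
  simp only [linPart_F1 hbg ha hx, quadPart_F1 hbg ha hx, I0pm, P0pm, hdv, hdu,
    dot_comm hbg hx (a.F1 B) (a.F1 A), pair_comm hbg hx (bg.u B) (bg.u A),
    crossF_comm hbg ha hx B A]
  rcases hε with h | h <;> rw [h] <;> ring

lemma sum_units {M : Type*} [AddCommMonoid M] (f : ℤˣ → M) : ∑ ε : ℤˣ, f ε = f 1 + f (-1) := by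
  rw [show (Finset.univ : Finset ℤˣ) = {1, -1} from rfl, Finset.sum_pair (by decide)]

/-- Indexing the product-to-sum formula by a sign matches the indexing of the phases `u_A ± u_B` by
`pm`. -/
lemma cos_mul_cos_units (s t : ℝ) :
    Real.cos s * Real.cos t = ∑ ε : ℤˣ, (1 / 2) * Real.cos (s + ((ε : ℤ) : ℝ) * t) := by
  rw [sum_units]
  simp [Real.cos_add]
  ring

lemma sin_mul_sin_units (s t : ℝ) : Real.sin s * Real.sin t
    = ∑ ε : ℤˣ, -(((ε : ℤ) : ℝ) / 2) * Real.cos (s + ((ε : ℤ) : ℝ) * t) := by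
  rw [sum_units]
  simp [Real.cos_add]
  ring

omit [DecidableEq 𝒜] in
lemma sum_offDiag_swap (F : 𝒜 → 𝒜 → ℝ) :
    ∑ q ∈ (Finset.univ : Finset 𝒜).offDiag, F q.2 q.1
      = ∑ q ∈ (Finset.univ : Finset 𝒜).offDiag, F q.1 q.2 :=
  Finset.sum_equiv (Equiv.prodComm 𝒜 𝒜) (by simp [ne_comm]) fun q _ => rfl

lemma sum_sum_eq_diag_add_offDiag (F : 𝒜 → 𝒜 → ℝ) :
    ∑ A, ∑ B, F A B = ∑ A, F A A + ∑ q ∈ (Finset.univ : Finset 𝒜).offDiag, F q.1 q.2 := by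
  rw [← Finset.sum_product', ← Finset.diag_union_offDiag, Finset.sum_union
    (Finset.disjoint_diag_offDiag _), Finset.sum_diag]

lemma linPart_smul (G : Fin 4 → Fin 4 → ℝ) (k : ℝ) (l : Fin 4 → ℝ) (f : Fin 4 → Fin 4 → ℝ)
    (α β : Fin 4) : linPart G (fun μ => k * l μ) f α β = k ^ 2 * linPart G l f α β := by
  rw [linPart, linPart, ← lin2_mul_left]
  congr 1
  funext κ μ a b
  ring

/-- The terms with factor `λ²` at order `0`. -/
lemma sum_linPart_secondTerm (hbg : bg.IsNullDust) (ha : a.Admissible bg) (hx : x ∈ slab)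
    (θ : 𝒜 → ℝ) (α β : Fin 4) :
    ∑ i, -trig (secondTerm a i).b (angle (secondTerm a i).n θ)
        * linPart (bg.G x) (bg.dv x (secondTerm a i).n) ((secondTerm a i).S.val x) α β
      = -(∑ A, Real.sin (θ A) * opP bg.g₀ (bg.u A) (a.frakF A) α β x)
        - ∑ A, Real.sin (θ A) * opP bg.g₀ (bg.u A) (a.F21 A) α β x
        - 4 * ∑ A, Real.cos (2 * θ A) * opP bg.g₀ (bg.u A) (a.F22 A) α β x
        - ∑ q ∈ (Finset.univ : Finset 𝒜).offDiag, ∑ ε : ℤˣ, Real.cos (angle (pm q.1 q.2 ε) θ)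
            * opP bg.g₀ (bg.phase (pm q.1 q.2 ε)) (a.Fpm q.1 q.2 ε) α β x := by
  have hG := G_symm hbg hx
  rw [sum_secondTerm a (fun t => -trig t.b (angle t.n θ)
    * linPart (bg.G x) (bg.dv x t.n) (t.S.val x) α β)]
  have e1 : ∀ A (S : Tensor2), (∀ α β, S α β = S β α) →
      linPart (bg.G x) (bg.du x A) (S.val x) α β = opP bg.g₀ (bg.u A) S α β x :=
    fun A S hS => linPart_eq_opP hG (fun α β => congrFun (hS α β) x) _ α β
  -- The linear part is homogeneous of degree two in the differential of the phase. The doubled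
  -- phase gives the factor `4`, and the zero phase of `h` gives `0`.
  have e2 : ∀ A, bg.dv x ((2 : ℤ) • unit A) = fun μ => 2 * bg.du x A μ := by
    intro A; funext μ; rw [dv_smul hbg hx, Background.dv_unit]; simp
  have e3 : bg.dv x (0 : 𝒜 → ℤ) = fun μ => 0 * bg.dv x (0 : 𝒜 → ℤ) μ := by
    funext μ; simp [Background.dv, phase_zero, pd_zero]
  have e4 : ∀ q ∈ (Finset.univ : Finset 𝒜).offDiag, ∀ ε,
      linPart (bg.G x) (bg.dv x (pm q.1 q.2 ε)) ((a.Fpm q.1 q.2 ε).val x) α β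
        = opP bg.g₀ (bg.phase (pm q.1 q.2 ε)) (a.Fpm q.1 q.2 ε) α β x := by
    intro q hq ε
    exact linPart_eq_opP hG (fun α β => congrFun
      ((ha.Fpm q.1 q.2 ε (Finset.mem_offDiag.1 hq).2.2).1 α β) x) _ α β
  have e5 : ∑ q ∈ (Finset.univ : Finset 𝒜).offDiag, ∑ ε : ℤˣ,
        -trig true (angle (pm q.1 q.2 ε) θ) * linPart (bg.G x) (bg.dv x (pm q.1 q.2 ε))
          ((a.Fpm q.1 q.2 ε).val x) α β
      = -∑ q ∈ (Finset.univ : Finset 𝒜).offDiag, ∑ ε : ℤˣ, Real.cos (angle (pm q.1 q.2 ε) θ)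
            * opP bg.g₀ (bg.phase (pm q.1 q.2 ε)) (a.Fpm q.1 q.2 ε) α β x := by
    simp only [← Finset.sum_neg_distrib]
    refine Finset.sum_congr rfl fun q hq => Finset.sum_congr rfl fun ε _ => ?_
    rw [e4 q hq, trig]; ring
  simp only [orderTwo, Background.dv_unit, e2, linPart_smul, e5]
  rw [e3, linPart_smul]
  simp only [e1 _ _ (ha.frakF _).1, e1 _ _ (ha.F21 _).1, e1 _ _ (ha.F22 _).1, trig, angle_unit,
    angle_smul, neg_mul, Finset.sum_neg_distrib, Finset.mul_sum]
  have : ∀ A, Real.cos (((2 : ℤ) : ℝ) * θ A) * (2 ^ 2 * opP bg.g₀ (bg.u A) (a.F22 A) α β x)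
      = 4 * (Real.cos (2 * θ A) * opP bg.g₀ (bg.u A) (a.F22 A) α β x) := by
    intro A; push_cast; ring
  simp only [this]
  ring

/-- The products of terms with factor `λ` at order `0`. -/
lemma sum_products (hbg : bg.IsNullDust) (ha : a.Admissible bg) (hx : x ∈ slab)
    (θ : 𝒜 → ℝ) (α β : Fin 4) :
    ∑ A, ∑ B, (Real.cos (θ A) * Real.cos (θ B)
            * linPart (sandwich (bg.G x) (bg.G x) ((a.F1 A).val x)) (bg.du x B)
              ((a.F1 B).val x) α β
          + Real.sin (θ A) * Real.sin (θ B) * quadPart (bg.G x) (bg.G x) (bg.du x A)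
              ((a.F1 A).val x) (bg.du x B) ((a.F1 B).val x) α β)
      = -∑ A, (1 / 4 + 3 / 4 * Real.cos (2 * θ A))
            * (bg.du x A α * bg.du x A β * dot bg.g₀ (a.F1 A) (a.F1 A) x)
        + ∑ q ∈ (Finset.univ : Finset 𝒜).offDiag, ∑ ε : ℤˣ,
            Real.cos (angle (pm q.1 q.2 ε) θ) * I0pm bg a q.1 q.2 ε α β x := by
  rw [sum_sum_eq_diag_add_offDiag]
  congr 1
  · rw [← Finset.sum_neg_distrib]
    refine Finset.sum_congr rfl fun A _ => ?_
    -- The weights `-cos² θ` of the linear part and `½ sin² θ` of the quadratic part add up to `-1/4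
    -- - 3/4 cos 2θ`.
    rw [linPart_F1_self hbg ha hx, quadPart_F1_self hbg ha hx, Real.cos_two_mul,
      ← sq, ← sq, Real.sin_sq]
    ring
  · set X := fun A B => linPart (sandwich (bg.G x) (bg.G x) ((a.F1 A).val x)) (bg.du x B)
              ((a.F1 B).val x) α β with hX
    set Y := fun A B => quadPart (bg.G x) (bg.G x) (bg.du x A)
              ((a.F1 A).val x) (bg.du x B) ((a.F1 B).val x) α β with hY
    have hc : ∀ A B ε, Real.cos (angle (pm B A ε) θ) = Real.cos (angle (pm A B ε) θ) := by
      intro A B ε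
      rw [angle_pm, angle_pm]
      rcases Int.units_eq_one_or ε with h | h
      · subst h; congr 1; push_cast; ring
      · subst h; rw [← Real.cos_neg]; congr 1; push_cast; ring
    have l : ∀ A B, Real.cos (θ A) * Real.cos (θ B) * X A B + Real.sin (θ A) * Real.sin (θ B) * Y A B
        = ∑ ε : ℤˣ, Real.cos (angle (pm A B ε) θ)
            * ((1 / 2) * X A B - ((ε : ℤ) : ℝ) / 2 * Y A B) := by
      intro A B
      rw [cos_mul_cos_units, sin_mul_sin_units, Finset.sum_mul, Finset.sum_mul,
        ← Finset.sum_add_distrib]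
      refine Finset.sum_congr rfl fun ε _ => ?_
      rw [angle_pm]; ring
    have sw1 := sum_offDiag_swap (𝒜 := 𝒜) fun A B => ∑ ε : ℤˣ, Real.cos (angle (pm A B ε) θ)
            * ((1 / 2) * X A B - ((ε : ℤ) : ℝ) / 2 * Y A B)
    have sw2 := sum_offDiag_swap (𝒜 := 𝒜) fun A B => ∑ ε : ℤˣ, Real.cos (angle (pm A B ε) θ)
            * I0pm bg a A B ε α β x
    -- The raw products agree with `I0pm` only after `(A, B)` and `(B, A)` are added, which is
    -- possible because their cosines coincide. A sum over ordered pairs is invariant under the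
    -- swap, so the doubled identity implies the identity.
    have key : ∑ q ∈ (Finset.univ : Finset 𝒜).offDiag, (∑ ε : ℤˣ, Real.cos (angle (pm q.1 q.2 ε) θ)
            * ((1 / 2) * X q.1 q.2 - ((ε : ℤ) : ℝ) / 2 * Y q.1 q.2)
          + ∑ ε : ℤˣ, Real.cos (angle (pm q.2 q.1 ε) θ)
            * ((1 / 2) * X q.2 q.1 - ((ε : ℤ) : ℝ) / 2 * Y q.2 q.1))
        = ∑ q ∈ (Finset.univ : Finset 𝒜).offDiag, (∑ ε : ℤˣ, Real.cos (angle (pm q.1 q.2 ε) θ)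
            * I0pm bg a q.1 q.2 ε α β x
          + ∑ ε : ℤˣ, Real.cos (angle (pm q.2 q.1 ε) θ) * I0pm bg a q.2 q.1 ε α β x) := by
      refine Finset.sum_congr rfl fun q _ => ?_
      rw [← Finset.sum_add_distrib, ← Finset.sum_add_distrib]
      refine Finset.sum_congr rfl fun ε _ => ?_
      rw [hc q.1 q.2, ← mul_add, ← mul_add, ← mixed_identity hbg ha hx]
      simp only [hX, hY]
      ring
    simp only [Finset.sum_add_distrib] at key
    rw [Finset.sum_congr rfl fun q _ => l q.1 q.2]
    linarith

theorem twoRicciCoeff_one_eq (hbg : bg.IsNullDust) (ha : a.Admissible bg) (hx : x ∈ slab)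
    (lam : ℝ) (α β : Fin 4) :
    twoRicciCoeff bg a (fun A => bg.u A x / lam) x α β 1 = 2 * R0 bg a lam α β x := by
  rw [twoRicciCoeff_one hbg hx, sum_linPart_secondTerm hbg ha hx, sum_products hbg ha hx,
    hbg.einstein x hx]
  simp only [lin2_midDeriv_phase hbg hx (ha.F1 _), covD1_pol_F1 ha hx, opP_null hbg hx,
    angle_phase]
  have hdu : ∀ A μ, pd μ (bg.u A) x = bg.du x A μ := fun _ _ => rfl
  have hQ : ∀ A μ, Q0 bg a A μ x = divTerm bg (a.F1 A) μ x := fun _ _ => rfl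
  simp only [R0, twoR0null, twoR0mixed, hdu, hQ, mul_div_assoc]
  -- The constant `-1/4` becomes the correction `-1/8` to `F_A²` inside a factor `2`, and `3/4` is
  -- `4 · 2 · 3/32`, where the middle `2` comes from symmetrization.
  have key : ∀ A : 𝒜, _ = _ := fun A => show
      2 * (bg.F A x ^ 2 * bg.du x A α * bg.du x A β)
        + -Real.sin (bg.u A x / lam) * (0 + 0 + (bg.du x A α * divTerm bg (a.F1 A) β x
            + bg.du x A β * divTerm bg (a.F1 A) α x) - bg.transport A (a.F1 A) α β x)
        - Real.sin (bg.u A x / lam) * (bg.du x A α * pol bg.g₀ (a.frakF A) (bg.u A) β x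
            + bg.du x A β * pol bg.g₀ (a.frakF A) (bg.u A) α x)
        - Real.sin (bg.u A x / lam) * (bg.du x A α * pol bg.g₀ (a.F21 A) (bg.u A) β x
            + bg.du x A β * pol bg.g₀ (a.F21 A) (bg.u A) α x)
        - 4 * (Real.cos (2 * (bg.u A x / lam)) * (bg.du x A α * pol bg.g₀ (a.F22 A) (bg.u A) β x
            + bg.du x A β * pol bg.g₀ (a.F22 A) (bg.u A) α x))
        - (1 / 4 + 3 / 4 * Real.cos (2 * (bg.u A x / lam)))
            * (bg.du x A α * bg.du x A β * dot bg.g₀ (a.F1 A) (a.F1 A) x)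
      = 2 * ((bg.F A x ^ 2 - 1 / 8 * dot bg.g₀ (a.F1 A) (a.F1 A) x) * bg.du x A α * bg.du x A β)
        + Real.sin (bg.u A x / lam) * (bg.transport A (a.F1 A) α β x
            - (bg.du x A α * pol bg.g₀ (a.frakF A) (bg.u A) β x
              + bg.du x A β * pol bg.g₀ (a.frakF A) (bg.u A) α x)
            - (bg.du x A α * (pol bg.g₀ (a.F21 A) (bg.u A) β x + divTerm bg (a.F1 A) β x)
              + bg.du x A β * (pol bg.g₀ (a.F21 A) (bg.u A) α x + divTerm bg (a.F1 A) α x)))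
        - 4 * (Real.cos (2 * (bg.u A x / lam)) * (bg.du x A α * (pol bg.g₀ (a.F22 A) (bg.u A) β x
              + 3 / 32 * bg.du x A β * dot bg.g₀ (a.F1 A) (a.F1 A) x)
            + bg.du x A β * (pol bg.g₀ (a.F22 A) (bg.u A) α x
              + 3 / 32 * bg.du x A α * dot bg.g₀ (a.F1 A) (a.F1 A) x))) by ring
  have hs := Finset.sum_congr (rfl : (Finset.univ : Finset 𝒜) = Finset.univ) fun A _ => key A
  simp only [Finset.sum_add_distrib, Finset.sum_sub_distrib, ← Finset.mul_sum] at hs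
  have hm : ∑ q ∈ (Finset.univ : Finset 𝒜).offDiag, ∑ ε : ℤˣ,
        Real.cos (bg.phase (pm q.1 q.2 ε) x / lam)
          * (-opP bg.g₀ (bg.phase (pm q.1 q.2 ε)) (a.Fpm q.1 q.2 ε) α β x
            + I0pm bg a q.1 q.2 ε α β x)
      = -(∑ q ∈ (Finset.univ : Finset 𝒜).offDiag, ∑ ε : ℤˣ,
          Real.cos (bg.phase (pm q.1 q.2 ε) x / lam)
            * opP bg.g₀ (bg.phase (pm q.1 q.2 ε)) (a.Fpm q.1 q.2 ε) α β x)
        + ∑ q ∈ (Finset.univ : Finset 𝒜).offDiag, ∑ ε : ℤˣ,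
          Real.cos (bg.phase (pm q.1 q.2 ε) x / lam) * I0pm bg a q.1 q.2 ε α β x := by
    simp only [mul_add, mul_neg, Finset.sum_add_distrib, Finset.sum_neg_distrib]
  rw [hm]
  linear_combination hs

end OrderZero

/-! ## Closure properties of brackets -/

section Bracket

variable {𝒜 : Type*} {S S' : Set (Functional 𝒜)} {Φ Ψ : Functional 𝒜}

lemma mem_bracket {ι : Type*} [Fintype ι] (c : ι → Scalar) (m : ι → Functional 𝒜)
    (hc : ∀ i, ContinuousOn (c i) slab) (hm : ∀ i, m i ∈ S)
    (h : ∀ a, ∀ x ∈ slab, Φ a x = ∑ i, c i x * m i a x) : Φ ∈ bracket S := by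
  let e := Fintype.equivFin ι
  refine ⟨Fintype.card ι, fun k => c (e.symm k), fun k => m (e.symm k), fun k => hc _,
    fun k => hm _, fun a x hx => ?_⟩
  rw [h a x hx]
  exact (e.symm.sum_comp fun i => c i x * m i a x).symm

lemma bracket_congr (hΨ : Ψ ∈ bracket S) (h : ∀ a, ∀ x ∈ slab, Φ a x = Ψ a x) :
    Φ ∈ bracket S := by
  obtain ⟨N, c, m, hc, hm, e⟩ := hΨ
  exact ⟨N, c, m, hc, hm, fun a x hx => by rw [h a x hx, e a x hx]⟩

lemma bracket_mono (h : S ⊆ S') (hΦ : Φ ∈ bracket S) : Φ ∈ bracket S' := by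
  obtain ⟨N, c, m, hc, hm, e⟩ := hΦ
  exact ⟨N, c, m, hc, fun i => h (hm i), e⟩

lemma subset_bracket : S ⊆ bracket S := fun m hm =>
  mem_bracket (fun _ : Unit => fun _ => 1) (fun _ => m) (fun _ => continuousOn_const)
    (fun _ => hm) fun a x _ => by simp

lemma bracket_scalar_mul {c : Scalar} (hc : ContinuousOn c slab) (hΦ : Φ ∈ bracket S) :
    (fun a x => c x * Φ a x) ∈ bracket S := by
  obtain ⟨N, d, m, hd, hm, e⟩ := hΦ
  refine ⟨N, fun i x => c x * d i x, m, fun i => hc.mul (hd i), hm, fun a x hx => ?_⟩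
  simp only [e a x hx, Finset.mul_sum]
  exact Finset.sum_congr rfl fun i _ => by ring

lemma bracket_const_mul (r : ℝ) (hΦ : Φ ∈ bracket S) : (fun a x => r * Φ a x) ∈ bracket S :=
  bracket_scalar_mul continuousOn_const hΦ

lemma bracket_add (hΦ : Φ ∈ bracket S) (hΨ : Ψ ∈ bracket S) :
    (fun a x => Φ a x + Ψ a x) ∈ bracket S := by
  obtain ⟨N, c, m, hc, hm, e⟩ := hΦ
  obtain ⟨N', c', m', hc', hm', e'⟩ := hΨ
  refine mem_bracket (Sum.elim c c') (Sum.elim m m') ?_ ?_ fun a x hx => ?_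
  · rintro (i | i); exacts [hc i, hc' i]
  · rintro (i | i); exacts [hm i, hm' i]
  · rw [e a x hx, e' a x hx, Fintype.sum_sum_type]; rfl

lemma bracket_zero : (fun _ _ => (0 : ℝ)) ∈ bracket S :=
  mem_bracket (fun i : Empty => nomatch i) (fun i => nomatch i) (fun i => nomatch i)
    (fun i => nomatch i) fun a x _ => by simp

lemma bracket_sum {ι : Type*} (t : Finset ι) {Φ : ι → Functional 𝒜}
    (h : ∀ i ∈ t, Φ i ∈ bracket S) : (fun a x => ∑ i ∈ t, Φ i a x) ∈ bracket S := by
  classical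
  induction t using Finset.induction_on with
  | empty => simpa using bracket_zero
  | insert i t hi ih =>
    refine bracket_congr (bracket_add (h i (Finset.mem_insert_self i t))
      (ih fun j hj => h j (Finset.mem_insert_of_mem hj))) fun a x _ => ?_
    rw [Finset.sum_insert hi]

lemma bracket_sub (hΦ : Φ ∈ bracket S) (hΨ : Ψ ∈ bracket S) :
    (fun a x => Φ a x - Ψ a x) ∈ bracket S :=
  bracket_congr (bracket_add hΦ (bracket_const_mul (-1) hΨ)) fun a x _ => by ring

lemma bracket_mul (hΦ : Φ ∈ bracket S) (hΨ : Ψ ∈ bracket S') :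
    (fun a x => Φ a x * Ψ a x) ∈ bracket (S * S') := by
  obtain ⟨N, c, m, hc, hm, e⟩ := hΦ
  obtain ⟨N', c', m', hc', hm', e'⟩ := hΨ
  refine mem_bracket (fun p : Fin N × Fin N' => fun x => c p.1 x * c' p.2 x)
    (fun p => m p.1 * m' p.2) (fun p => (hc p.1).mul (hc' p.2))
    (fun p => Set.mul_mem_mul (hm p.1) (hm' p.2)) fun a x hx => ?_
  rw [e a x hx, e' a x hx, Finset.sum_mul_sum, Fintype.sum_prod_type]
  refine Finset.sum_congr rfl fun i _ => Finset.sum_congr rfl fun j _ => ?_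
  simp only [Pi.mul_apply]; ring

lemma bracket_one {c : Scalar} (hc : ContinuousOn c slab) :
    (fun _ x => c x) ∈ bracket (1 : Set (Functional 𝒜)) :=
  mem_bracket (fun _ : Unit => c) (fun _ => 1) (fun _ => hc) (fun _ => Set.one_mem_one)
    fun a x _ => by simp

lemma lin2_mem {G : Fin 4 → Fin 4 → Functional 𝒜}
    {B : Fin 4 → Fin 4 → Fin 4 → Fin 4 → Functional 𝒜} (hG : ∀ ρ σ, G ρ σ ∈ bracket S)
    (hB : ∀ κ μ α β, B κ μ α β ∈ bracket S') (α β : Fin 4) :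
    (fun a x => lin2 (fun ρ σ => G ρ σ a x) (fun κ μ α β => B κ μ α β a x) α β)
      ∈ bracket (S * S') :=
  bracket_sum _ fun ρ _ => bracket_sum _ fun σ _ => bracket_mul (hG ρ σ)
    (bracket_sub (bracket_sub (bracket_add (hB _ _ _ _) (hB _ _ _ _)) (hB _ _ _ _)) (hB _ _ _ _))

lemma lower_mem {k : Fin 4 → Fin 4 → Fin 4 → Functional 𝒜} (hk : ∀ μ α β, k μ α β ∈ bracket S)
    (μ ν σ : Fin 4) : (fun a x => lower (fun μ α β => k μ α β a x) μ ν σ) ∈ bracket S :=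
  bracket_const_mul _ (bracket_sub (bracket_add (hk _ _ _) (hk _ _ _)) (hk _ _ _))

lemma quad_mem {S₁ S₂ : Set (Functional 𝒜)} {G G' : Fin 4 → Fin 4 → Functional 𝒜}
    {k k' : Fin 4 → Fin 4 → Fin 4 → Functional 𝒜} (hG : ∀ ρ σ, G ρ σ ∈ bracket S₁)
    (hG' : ∀ ρ σ, G' ρ σ ∈ bracket S₂) (hk : ∀ μ α β, k μ α β ∈ bracket S)
    (hk' : ∀ μ α β, k' μ α β ∈ bracket S') (α β : Fin 4) :
    (fun a x => quad (fun ρ σ => G ρ σ a x) (fun ρ σ => G' ρ σ a x) (fun μ α β => k μ α β a x)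
      (fun μ α β => k' μ α β a x) α β) ∈ bracket (S₁ * S₂ * (S * S')) := by
  have l := lower_mem hk
  have l' := lower_mem hk'
  refine bracket_sum _ fun ρ _ => bracket_sum _ fun μ _ => bracket_sum _ fun σ _ =>
    bracket_sum _ fun ν _ => bracket_mul (bracket_mul (hG ρ μ) (hG' σ ν)) ?_
  exact bracket_sub (bracket_add (bracket_add (bracket_mul (bracket_const_mul _ (hk _ _ _))
    (l' _ _ _)) (bracket_mul (bracket_const_mul _ (hk _ _ _)) (l' _ _ _)))
    (bracket_mul (bracket_const_mul _ (l _ _ _)) (l' _ _ _)))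
    (bracket_mul (bracket_const_mul _ (l _ _ _)) (l' _ _ _))

lemma sandwich_mem {G : Fin 4 → Fin 4 → Scalar} (hG : ∀ ρ σ, ContinuousOn (G ρ σ) slab)
    {f : Fin 4 → Fin 4 → Functional 𝒜} (hf : ∀ μ ν, f μ ν ∈ bracket S) (ρ σ : Fin 4) :
    (fun a x => sandwich (fun ρ σ => G ρ σ x) (fun ρ σ => G ρ σ x) (fun μ ν => f μ ν a x) ρ σ)
      ∈ bracket S := by
  refine bracket_sum _ fun μ _ => bracket_sum _ fun ν _ => ?_
  refine bracket_congr (bracket_scalar_mul ((hG ρ μ).mul (hG ν σ)) (hf μ ν)) fun a x _ => ?_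
  simp only [Pi.mul_apply]; ring

end Bracket

/-! ### Brackets containing the derivatives of the amplitudes -/

section BackgroundCoefficients

variable {𝒜 : Type*} [Fintype 𝒜] {bg : Background 𝒜}

lemma G_continuous (hbg : bg.IsNullDust) (ρ σ : Fin 4) :
    ContinuousOn (fun x => bg.G x ρ σ) slab := (inv_g₀_smooth hbg ρ σ).continuousOn

lemma dv_continuous (hbg : bg.IsNullDust) (n : 𝒜 → ℤ) (μ : Fin 4) :
    ContinuousOn (fun x => bg.dv x n μ) slab :=
  (isFrame_pd.contDiffOn (contDiffOn_phase hbg.smooth_phase n) μ).continuousOn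

lemma du_continuous (hbg : bg.IsNullDust) (A : 𝒜) (μ : Fin 4) :
    ContinuousOn (fun x => bg.du x A μ) slab :=
  (isFrame_pd.contDiffOn (hbg.smooth_phase A) μ).continuousOn

lemma pd_continuousOn {f : Scalar} (hf : ContDiffOn ℝ 1 f slab) (μ : Fin 4) :
    ContinuousOn (pd μ f) slab :=
  (hf.continuousOn_fderivWithin uniqueDiffOn_slab (by norm_num)).clm_apply continuousOn_const

lemma Gam_continuous (hbg : bg.IsNullDust) (ρ μ ν : Fin 4) :
    ContinuousOn (Gam bg.g₀ ρ μ ν) slab := (Gam_smooth hbg ρ μ ν).continuousOn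

lemma hess_continuous (hbg : bg.IsNullDust) {v : Scalar} (hv : ContDiffOn ℝ 2 v slab)
    (κ μ : Fin 4) : ContinuousOn (hess (Gam bg.g₀) v κ μ) slab :=
  (pd_continuousOn (isFrame_pd.contDiffOn hv μ) κ).sub (continuousOn_finsetSum _ fun ρ _ =>
    (Gam_continuous hbg ρ κ μ).mul (pd_continuousOn (hv.of_le (by norm_num)) ρ))

variable {C : Set (Functional 𝒜)} {S : Amplitudes 𝒜 → Tensor2}

omit [Fintype 𝒜] in
lemma derivsLE_le {S : Set (Functional 𝒜)} (k : ℕ) : derivsLE k S ⊆ derivsLE (k + 1) S := by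
  induction k with
  | zero => exact Set.subset_union_left
  | succ k ih =>
    refine Set.union_subset_union le_rfl ?_
    rintro _ ⟨m, hm, μ, rfl⟩
    exact ⟨m, ih hm, μ, rfl⟩

lemma nab_mem (hbg : bg.IsNullDust) (hS : ∀ μ ν, (fun a => S a μ ν) ∈ C) (μ α β : Fin 4) :
    (fun a x => nab pd (Gam bg.g₀) (S a) μ α β x) ∈ bracket (derivsLE 1 C) := by
  have h0 : ∀ μ ν, (fun a => S a μ ν) ∈ bracket (derivsLE 1 C) := fun μ ν =>
    subset_bracket (Or.inl (hS μ ν))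
  have h1 : ∀ κ μ ν, (fun a => pd κ (S a μ ν)) ∈ bracket (derivsLE 1 C) := fun κ μ ν =>
    subset_bracket (Or.inr ⟨_, hS μ ν, κ, rfl⟩)
  exact bracket_sub (h1 μ α β) (bracket_sum _ fun ρ _ => bracket_add
    (bracket_scalar_mul (Gam_continuous hbg _ _ _) (h0 _ _))
    (bracket_scalar_mul (Gam_continuous hbg _ _ _) (h0 _ _)))

lemma midDeriv_mem (hbg : bg.IsNullDust) (hS : ∀ μ ν, (fun a => S a μ ν) ∈ C) {v : Scalar}
    (hv : ContDiffOn ℝ 2 v slab) (κ μ α β : Fin 4) :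
    (fun a x => midDeriv (Gam bg.g₀) v (S a) κ μ α β x) ∈ bracket (derivsLE 1 C) := by
  have h0 : ∀ μ ν, (fun a => S a μ ν) ∈ bracket (derivsLE 1 C) := fun μ ν =>
    subset_bracket (Or.inl (hS μ ν))
  have c := fun μ => pd_continuousOn (hv.of_le (by norm_num : (1 : WithTop ℕ∞) ≤ 2)) μ
  exact bracket_add (bracket_add (bracket_scalar_mul (c κ) (nab_mem hbg hS _ _ _))
    (bracket_scalar_mul (c μ) (nab_mem hbg hS _ _ _)))
    (bracket_scalar_mul (hess_continuous hbg hv _ _) (h0 _ _))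

/-- The second covariant derivative, expanded in coordinate derivatives. -/
lemma exists_nab2_mem (hbg : bg.IsNullDust) (hS : ∀ μ ν, (fun a => S a μ ν) ∈ C)
    (κ μ α β : Fin 4) : ∃ Φ ∈ bracket (derivsLE 2 C), ∀ a,
      (∀ μ ν, ContDiffOn ℝ 2 (S a μ ν) slab) → ∀ x ∈ slab,
        nab2 pd (Gam bg.g₀) (S a) κ μ α β x = Φ a x := by
  have h0 : ∀ μ ν, (fun a => S a μ ν) ∈ bracket (derivsLE 2 C) := fun μ ν =>
    subset_bracket (Or.inl (hS μ ν))
  have h1 : ∀ κ μ ν, (fun a => pd κ (S a μ ν)) ∈ bracket (derivsLE 2 C) := fun κ μ ν =>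
    subset_bracket (Or.inr ⟨_, Or.inl (hS μ ν), κ, rfl⟩)
  have h2 : ∀ κ μ α β, (fun a => pd κ (pd μ (S a α β))) ∈ bracket (derivsLE 2 C) :=
    fun κ μ α β => subset_bracket (Or.inr ⟨_, Or.inr ⟨_, hS α β, μ, rfl⟩, κ, rfl⟩)
  have hn := fun μ α β => bracket_mono (derivsLE_le 1) (nab_mem hbg hS μ α β)
  have cΓ := Gam_continuous hbg
  have cdΓ := fun κ ρ μ ν => pd_continuousOn (Gam_smooth hbg ρ μ ν) κ
  -- The witness is the Leibniz expansion in coordinate derivatives. Membership in a bracket is an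
  -- identity for all amplitudes, regular or not, whereas the Leibniz rule is applied to `C²` ones;
  -- hence a separate functional that agrees with `nab2` on the latter.
  refine ⟨_, bracket_sub (bracket_sub (h2 κ μ α β) (bracket_sum Finset.univ fun ρ _ => bracket_add
      (bracket_add (bracket_scalar_mul (cdΓ κ ρ μ α) (h0 ρ β))
        (bracket_scalar_mul (cΓ ρ μ α) (h1 κ ρ β)))
      (bracket_add (bracket_scalar_mul (cdΓ κ ρ μ β) (h0 α ρ))
        (bracket_scalar_mul (cΓ ρ μ β) (h1 κ α ρ)))))
    (bracket_sum Finset.univ fun ρ _ => bracket_add (bracket_add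
      (bracket_scalar_mul (cΓ ρ κ μ) (hn ρ α β)) (bracket_scalar_mul (cΓ ρ κ α) (hn μ ρ β)))
      (bracket_scalar_mul (cΓ ρ κ β) (hn μ α ρ))), fun a ha x hx => ?_⟩
  have dS : ∀ α β, DifferentiableWithinAt ℝ (S a α β) slab x := fun α β =>
    (ha α β x hx).differentiableWithinAt (by norm_num)
  have dΓ : ∀ ρ μ ν, DifferentiableWithinAt ℝ (Gam bg.g₀ ρ μ ν) slab x := fun ρ μ ν =>
    (Gam_smooth hbg ρ μ ν x hx).differentiableWithinAt (by norm_num)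
  have dd : DifferentiableWithinAt ℝ (pd μ (S a α β)) slab x :=
    (isFrame_pd.contDiffOn (ha α β) μ x hx).differentiableWithinAt (by norm_num)
  have e : pd κ (nab pd (Gam bg.g₀) (S a) μ α β) x = pd κ (pd μ (S a α β)) x
      - ∑ ρ, ((pd κ (Gam bg.g₀ ρ μ α) x * S a ρ β x + Gam bg.g₀ ρ μ α x * pd κ (S a ρ β) x)
        + (pd κ (Gam bg.g₀ ρ μ β) x * S a α ρ x + Gam bg.g₀ ρ μ β x * pd κ (S a α ρ) x)) := by
    have ds : ∀ ρ, DifferentiableWithinAt ℝ (fun x => Gam bg.g₀ ρ μ α x * S a ρ β x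
        + Gam bg.g₀ ρ μ β x * S a α ρ x) slab x := fun ρ =>
      ((dΓ _ _ _).fun_mul (dS _ _)).fun_add ((dΓ _ _ _).fun_mul (dS _ _))
    rw [show nab pd (Gam bg.g₀) (S a) μ α β = fun x => pd μ (S a α β) x
        - ∑ ρ, (Gam bg.g₀ ρ μ α x * S a ρ β x + Gam bg.g₀ ρ μ β x * S a α ρ x) from rfl,
      isFrame_pd.sub hx dd (DifferentiableWithinAt.fun_sum fun ρ _ => ds ρ),
      isFrame_pd.sum hx fun ρ _ => ds ρ]
    congr 1
    refine Finset.sum_congr rfl fun ρ _ => ?_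
    rw [isFrame_pd.add hx ((dΓ _ _ _).fun_mul (dS _ _)) ((dΓ _ _ _).fun_mul (dS _ _)),
      isFrame_pd.mul hx (dΓ _ _ _) (dS _ _), isFrame_pd.mul hx (dΓ _ _ _) (dS _ _)]
  rw [nab2, e]

end BackgroundCoefficients

/-! ## Quantities which are absorbed by the remainders of order `1` -/

section Absorbed

/-- The remainders of order `1`. -/
structure Remainders (𝒜 : Type*) where
  r11 : 𝒜 → Fin 4 → Fin 4 → Functional 𝒜
  r12 : 𝒜 → Fin 4 → Fin 4 → Functional 𝒜
  rh : Bool → (𝒜 → ℤ) → Fin 4 → Functional 𝒜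
  re : Bool → (𝒜 → ℤ) → Fin 4 → Fin 4 → Functional 𝒜

variable {𝒜 : Type*}

/-- The remainders belong to their brackets. -/
structure Remainders.IsSchematic (r : Remainders 𝒜) : Prop where
  r11 : ∀ A α β, r.r11 A α β ∈ class11
  r12 : ∀ A α β, r.r12 A α β ∈ class12
  rh : ∀ T n β, r.rh T n β ∈ class1h
  re : ∀ T n α β, r.re T n α β ∈ class1e

variable [Fintype 𝒜] [DecidableEq 𝒜]

/-- The contribution of the remainders to twice the coefficient of order `1`. -/
def Remainders.total (bg : Background 𝒜) (r : Remainders 𝒜) (θ : 𝒜 → ℝ) (a : Amplitudes 𝒜)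
    (x : Spacetime) (α β : Fin 4) : ℝ :=
  -(∑ A, Real.cos (θ A) * r.r11 A α β a x) + 2 * ∑ A, Real.sin (2 * θ A) * r.r12 A α β a x
  + ∑ n ∈ nullPhases 𝒜, ∑ T, trig T (angle n θ)
      * (bg.dv x n α * r.rh T n β a x + bg.dv x n β * r.rh T n α a x)
  + ∑ n ∈ mixedPhases 𝒜, ∑ T, trig T (angle n θ) * r.re T n α β a x

/-- `Φ` is the contribution of some remainders. -/
def Absorbed (bg : Background 𝒜)
    (Φ : (𝒜 → ℝ) → Amplitudes 𝒜 → Spacetime → Fin 4 → Fin 4 → ℝ) : Prop :=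
  ∃ r : Remainders 𝒜, r.IsSchematic ∧ ∀ a, a.Admissible bg → ∀ θ, ∀ x ∈ slab, ∀ α β,
    Φ θ a x α β = r.total bg θ a x α β

variable {bg : Background 𝒜}
  {Φ Ψ : (𝒜 → ℝ) → Amplitudes 𝒜 → Spacetime → Fin 4 → Fin 4 → ℝ}

namespace Absorbed

lemma congr (h : Absorbed bg Ψ) (e : ∀ a, a.Admissible bg → ∀ θ, ∀ x ∈ slab, ∀ α β,
    Φ θ a x α β = Ψ θ a x α β) : Absorbed bg Φ := by
  obtain ⟨r, hr, h⟩ := h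
  exact ⟨r, hr, fun a ha θ x hx α β => by rw [e a ha θ x hx, h a ha θ x hx]⟩

lemma zero : Absorbed bg fun _ _ _ _ _ => 0 :=
  ⟨⟨fun _ _ _ _ _ => 0, fun _ _ _ _ _ => 0, fun _ _ _ _ _ => 0, fun _ _ _ _ _ _ => 0⟩,
    ⟨fun _ _ _ => bracket_zero, fun _ _ _ => bracket_zero, fun _ _ _ => bracket_zero,
      fun _ _ _ _ => bracket_zero⟩, fun a _ θ x _ α β => by simp [Remainders.total]⟩

lemma add (h : Absorbed bg Φ) (h' : Absorbed bg Ψ) :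
    Absorbed bg fun θ a x α β => Φ θ a x α β + Ψ θ a x α β := by
  obtain ⟨r, hr, e⟩ := h
  obtain ⟨r', hr', e'⟩ := h'
  refine ⟨⟨fun A α β a x => r.r11 A α β a x + r'.r11 A α β a x,
    fun A α β a x => r.r12 A α β a x + r'.r12 A α β a x,
    fun T n β a x => r.rh T n β a x + r'.rh T n β a x,
    fun T n α β a x => r.re T n α β a x + r'.re T n α β a x⟩,
    ⟨fun _ _ _ => bracket_add (hr.r11 _ _ _) (hr'.r11 _ _ _),
      fun _ _ _ => bracket_add (hr.r12 _ _ _) (hr'.r12 _ _ _),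
      fun _ _ _ => bracket_add (hr.rh _ _ _) (hr'.rh _ _ _),
      fun _ _ _ _ => bracket_add (hr.re _ _ _ _) (hr'.re _ _ _ _)⟩, fun a ha θ x hx α β => ?_⟩
  simp only [e a ha θ x hx, e' a ha θ x hx, Remainders.total, mul_add, Finset.sum_add_distrib]
  ring

lemma const_mul (k : ℝ) (h : Absorbed bg Φ) : Absorbed bg fun θ a x α β => k * Φ θ a x α β := by
  obtain ⟨r, hr, e⟩ := h
  refine ⟨⟨fun A α β a x => k * r.r11 A α β a x, fun A α β a x => k * r.r12 A α β a x,
    fun T n β a x => k * r.rh T n β a x, fun T n α β a x => k * r.re T n α β a x⟩,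
    ⟨fun _ _ _ => bracket_const_mul k (hr.r11 _ _ _),
      fun _ _ _ => bracket_const_mul k (hr.r12 _ _ _),
      fun _ _ _ => bracket_const_mul k (hr.rh _ _ _),
      fun _ _ _ _ => bracket_const_mul k (hr.re _ _ _ _)⟩, fun a ha θ x hx α β => ?_⟩
  simp only [e a ha θ x hx, Remainders.total, mul_add, mul_neg, Finset.mul_sum, mul_left_comm k]

lemma sub (h : Absorbed bg Φ) (h' : Absorbed bg Ψ) :
    Absorbed bg fun θ a x α β => Φ θ a x α β - Ψ θ a x α β :=
  (h.add (h'.const_mul (-1))).congr fun a _ θ x _ α β => by ring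

lemma sum {ι : Type*} (t : Finset ι)
    {Φ : ι → (𝒜 → ℝ) → Amplitudes 𝒜 → Spacetime → Fin 4 → Fin 4 → ℝ}
    (h : ∀ i ∈ t, Absorbed bg (Φ i)) : Absorbed bg fun θ a x α β => ∑ i ∈ t, Φ i θ a x α β := by
  classical
  induction t using Finset.induction_on with
  | empty => simpa using zero
  | insert i t hi ih =>
    refine ((h i (Finset.mem_insert_self i t)).add
      (ih fun j hj => h j (Finset.mem_insert_of_mem hj))).congr fun a _ θ x _ α β => ?_
    rw [Finset.sum_insert hi]

lemma cos_unit (A : 𝒜) {m : Fin 4 → Fin 4 → Functional 𝒜} (hm : ∀ α β, m α β ∈ class11) :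
    Absorbed bg fun θ a x α β => Real.cos (θ A) * m α β a x := by
  -- The sign compensates the minus in front of the cosine sum in `total`.
  refine ⟨⟨fun B α β a x => (if B = A then -1 else 0) * m α β a x, fun _ _ _ _ _ => 0,
    fun _ _ _ _ _ => 0, fun _ _ _ _ _ _ => 0⟩,
    ⟨fun _ _ _ => bracket_const_mul _ (hm _ _), fun _ _ _ => bracket_zero,
      fun _ _ _ => bracket_zero, fun _ _ _ _ => bracket_zero⟩, fun a _ θ x _ α β => ?_⟩
  simp [Remainders.total]

lemma sin_two_unit (A : 𝒜) {m : Fin 4 → Fin 4 → Functional 𝒜} (hm : ∀ α β, m α β ∈ class12) :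
    Absorbed bg fun θ a x α β => Real.sin (2 * θ A) * m α β a x := by
  -- The factor `1/2` compensates the `2` in front of the sine sum in `total`.
  refine ⟨⟨fun _ _ _ _ _ => 0, fun B α β a x => (if B = A then 1 / 2 else 0) * m α β a x,
    fun _ _ _ _ _ => 0, fun _ _ _ _ _ _ => 0⟩,
    ⟨fun _ _ _ => bracket_zero, fun _ _ _ => bracket_const_mul _ (hm _ _),
      fun _ _ _ => bracket_zero, fun _ _ _ _ => bracket_zero⟩, fun a _ θ x _ α β => ?_⟩
  simp [Remainders.total]
  ring

lemma null_phase (T : Bool) {n : 𝒜 → ℤ} (hn : n ∈ nullPhases 𝒜) {m : Fin 4 → Functional 𝒜}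
    (hm : ∀ β, m β ∈ class1h) :
    Absorbed bg fun θ a x α β => trig T (angle n θ)
      * (bg.dv x n α * m β a x + bg.dv x n β * m α a x) := by
  refine ⟨⟨fun _ _ _ _ _ => 0, fun _ _ _ _ _ => 0,
    fun T' n' β a x => (if n' = n then if T' = T then 1 else 0 else 0) * m β a x,
    fun _ _ _ _ _ _ => 0⟩,
    ⟨fun _ _ _ => bracket_zero, fun _ _ _ => bracket_zero,
      fun _ _ _ => bracket_const_mul _ (hm _), fun _ _ _ _ => bracket_zero⟩,
    fun a _ θ x _ α β => ?_⟩
  simp only [Remainders.total]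
  rw [Finset.sum_eq_single_of_mem n hn, Finset.sum_eq_single_of_mem T (Finset.mem_univ _)]
  · simp
  · intro T' _ h; simp [h]
  · intro n' _ h; simp [h]

lemma mixed_phase (T : Bool) {n : 𝒜 → ℤ} (hn : n ∈ mixedPhases 𝒜)
    {m : Fin 4 → Fin 4 → Functional 𝒜} (hm : ∀ α β, m α β ∈ class1e) :
    Absorbed bg fun θ a x α β => trig T (angle n θ) * m α β a x := by
  refine ⟨⟨fun _ _ _ _ _ => 0, fun _ _ _ _ _ => 0, fun _ _ _ _ _ => 0,
    fun T' n' α β a x => (if n' = n then if T' = T then 1 else 0 else 0) * m α β a x⟩,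
    ⟨fun _ _ _ => bracket_zero, fun _ _ _ => bracket_zero, fun _ _ _ => bracket_zero,
      fun _ _ _ _ => bracket_const_mul _ (hm _ _)⟩, fun a _ θ x _ α β => ?_⟩
  simp only [Remainders.total]
  rw [Finset.sum_eq_single_of_mem n hn, Finset.sum_eq_single_of_mem T (Finset.mem_univ _)]
  · simp
  · intro T' _ h; simp [h]
  · intro n' _ h; simp [h]

end Absorbed

lemma unit_mem_nullPhases (A : 𝒜) (k : ℤ) (hk : k = 1 ∨ k = 2 ∨ k = 3) :
    k • unit A ∈ nullPhases 𝒜 := by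
  simp only [nullPhases, nullPhasesOf, Finset.mem_union, Finset.mem_image, Finset.mem_univ,
    true_and]
  rcases hk with rfl | rfl | rfl
  · exact Or.inl (Or.inl ⟨A, rfl⟩)
  · exact Or.inl (Or.inr ⟨A, rfl⟩)
  · exact Or.inr ⟨A, rfl⟩

lemma pm_mem_mixedPhases {A B : 𝒜} (h : A ≠ B) (ε : ℤˣ) : pm A B ε ∈ mixedPhases 𝒜 := by
  refine Finset.mem_union_left _ (Finset.mem_image.2 ⟨(A, B, ε), ?_, ?_⟩)
  · simpa using h
  · simp [pm]

lemma pm_two_mem_mixedPhases {A B : 𝒜} (h : A ≠ B) (ε : ℤˣ) :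
    unit A + ((ε : ℤ) * 2) • unit B ∈ mixedPhases 𝒜 := by
  refine Finset.mem_union_right _ (Finset.mem_union_left _ (Finset.mem_image.2 ⟨(A, B, ε), ?_, ?_⟩))
  · simpa using h
  · rfl

lemma triple_mem_mixedPhases {A B C : 𝒜} (h : A ≠ B) (h' : A ≠ C) (h'' : B ≠ C) (ε ε' : ℤˣ) :
    unit A + (ε : ℤ) • unit B + (ε' : ℤ) • unit C ∈ mixedPhases 𝒜 := by
  refine Finset.mem_union_right _ (Finset.mem_union_right _
    (Finset.mem_image.2 ⟨(A, B, C, ε, ε'), ?_, ?_⟩))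
  · simpa using ⟨h, h', h''⟩
  · rfl

/-- The phases `2 u_A ± u_B`. -/
lemma Absorbed.cos_two_pm {A B : 𝒜} (h : A ≠ B) (ε : ℤˣ)
    {m : Fin 4 → Fin 4 → Functional 𝒜} (hm : ∀ α β, m α β ∈ class1e) :
    Absorbed bg fun θ a x α β => Real.cos (2 * θ A + ((ε : ℤ) : ℝ) * θ B) * m α β a x := by
  -- The set `ℐ` lists `u_B ± 2u_A`. The sign is moved to the other phase, the cosine being even.
  refine (mixed_phase true (pm_two_mem_mixedPhases h.symm ε) hm).congr fun a _ θ x _ α β => ?_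
  rw [angle_add, angle_smul, angle_unit, angle_unit, trig]
  congr 1
  rcases Int.units_eq_one_or ε with rfl | rfl
  · congr 1; push_cast; ring
  · rw [← Real.cos_neg]; congr 1; push_cast; ring

/-- The phases `u_A ± u_B ± u_C`, with `A`, `B`, `C` not all equal. -/
lemma Absorbed.cos_triple {A B C : 𝒜} (h : ¬ (A = B ∧ A = C)) (ε ε' : ℤˣ)
    {m : Fin 4 → Fin 4 → Functional 𝒜} (h1 : ∀ α β, m α β ∈ class11)
    (he : ∀ α β, m α β ∈ class1e) :
    Absorbed bg fun θ a x α β =>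
      Real.cos (θ A + ((ε : ℤ) : ℝ) * θ B + ((ε' : ℤ) : ℝ) * θ C) * m α β a x := by
  -- Two equal phases with opposite signs cancel and leave a single `u`, for which the bracket is
  -- `class11`. In all other cases the phase lies in `ℐ`, up to an overall sign. Membership in both
  -- brackets is therefore required, and only the case of three equal indices, which may produce
  -- `3u_A`, is excluded.
  by_cases hAB : A = B
  · have hAC : A ≠ C := fun h' => h ⟨hAB, h'⟩
    subst hAB
    rcases Int.units_eq_one_or ε with rfl | rfl
    · refine (cos_two_pm hAC ε' he).congr fun a _ θ x _ α β => ?_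
      congr 2; push_cast; ring
    · refine (cos_unit C h1).congr fun a _ θ x _ α β => ?_
      rcases Int.units_eq_one_or ε' with rfl | rfl
      · congr 2; push_cast; ring
      · rw [← Real.cos_neg]; congr 2; push_cast; ring
  by_cases hAC : A = C
  · subst hAC
    rcases Int.units_eq_one_or ε' with rfl | rfl
    · refine (cos_two_pm hAB ε he).congr fun a _ θ x _ α β => ?_
      congr 2; push_cast; ring
    · refine (cos_unit B h1).congr fun a _ θ x _ α β => ?_
      rcases Int.units_eq_one_or ε with rfl | rfl
      · congr 2; push_cast; ring
      · rw [← Real.cos_neg]; congr 2; push_cast; ring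
  by_cases hBC : B = C
  · subst hBC
    by_cases hε : ε = ε'
    · subst hε
      refine (mixed_phase true (pm_two_mem_mixedPhases hAB ε) he).congr fun a _ θ x _ α β => ?_
      rw [angle_add, angle_smul, angle_unit, angle_unit, trig]
      congr 2; push_cast; ring
    · refine (cos_unit A h1).congr fun a _ θ x _ α β => ?_
      have : ε' = -ε := by
        rcases Int.units_eq_one_or ε with rfl | rfl <;>
          rcases Int.units_eq_one_or ε' with rfl | rfl <;> simp_all
      subst this
      congr 2; push_cast; ring
  · refine (mixed_phase true (triple_mem_mixedPhases hAB hAC hBC ε ε') he).congr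
      fun a _ θ x _ α β => ?_
    rw [angle_add, angle_add, angle_smul, angle_smul, angle_unit, angle_unit, angle_unit, trig]

lemma Absorbed.sin_pm {A B : 𝒜} (h : A ≠ B) (ε : ℤˣ)
    {m : Fin 4 → Fin 4 → Functional 𝒜} (hm : ∀ α β, m α β ∈ class1e) :
    Absorbed bg fun θ a x α β => Real.sin (θ A + ((ε : ℤ) : ℝ) * θ B) * m α β a x :=
  (mixed_phase false (pm_mem_mixedPhases h ε) hm).congr fun a _ θ x _ α β => by
    rw [angle_pm, trig]

end Absorbed

/-! ## Words in the order `1` -/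

section Words

variable {G G' : Fin 4 → Fin 4 → ℝ} {l : Fin 4 → ℝ} {f f' : Fin 4 → Fin 4 → ℝ}

/-- `G'^{ρμ} l_μ f_{ρβ} - ½ l_β G'^{ρσ} f_{ρσ}`. -/
def polVec (G' : Fin 4 → Fin 4 → ℝ) (l : Fin 4 → ℝ) (f : Fin 4 → Fin 4 → ℝ) (β : Fin 4) : ℝ :=
  contr G' l f β - (1 / 2) * (l β * ∑ ρ, ∑ σ, G' ρ σ * f ρ σ)

/-- `S^{ρσ} l_ρ f_{σβ} - ¼ l_β S^{ρσ} f_{ρσ}`. -/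
def polVecTwo (G : Fin 4 → Fin 4 → ℝ) (l : Fin 4 → ℝ) (f f' : Fin 4 → Fin 4 → ℝ) (β : Fin 4) : ℝ :=
  (∑ σ, (∑ ν, contr G l f ν * G ν σ) * f' β σ)
    - (1 / 4) * (l β * ∑ ρ, ∑ σ, sandwich G G f ρ σ * f' ρ σ)

lemma linPart_eq_polVec (hG : ∀ a b, G a b = G b a) (hf : ∀ a b, f a b = f b a) (α β : Fin 4) :
    linPart G l f α β = l α * polVec G l f β + l β * polVec G l f α
      - (∑ ρ, ∑ σ, G ρ σ * l ρ * l σ) * f α β := by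
  rw [linPart, lin2_rank_one hG hf]
  simp only [polVec]
  ring

/-- The quadratic part on `l ⊗ f`, `l ⊗ f'`, when the contractions of `f` with `l` vanish. -/
lemma quadPart_constrained_left (hG : ∀ a b, G a b = G b a) (hf : ∀ a b, f a b = f b a)
    (hf' : ∀ a b, f' a b = f' b a) (h1 : ∀ α, contr G l f α = 0) (h2 : ∑ ρ, mix G f ρ ρ = 0)
    (n : ∑ σ, l σ * up G l σ = 0) (α β : Fin 4) :
    quadPart G G l f l f' α β
      = (1 / 2) * (l α * l β) * ∑ ρ, ∑ σ, sandwich G G f ρ σ * f' ρ σ := by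
  rw [quadPart, quad_rank_one_self hG hf hf']
  simp only [h1, h2, n]
  simp

lemma quadPart_constrained_right (hG : ∀ a b, G a b = G b a) (hf : ∀ a b, f a b = f b a)
    (hf' : ∀ a b, f' a b = f' b a) (h1 : ∀ α, contr G l f' α = 0)
    (n : ∑ σ, l σ * up G l σ = 0) (α β : Fin 4) :
    quadPart G G l f l f' α β
      = -(l α * polVecTwo G l f f' β + l β * polVecTwo G l f f' α)
        + (∑ σ, (∑ ν, contr G l f ν * G ν σ) * l σ) * f' α β := by
  rw [quadPart, quad_rank_one_self hG hf hf']
  simp only [h1, n, polVecTwo]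
  ring

lemma quadPart_smul (k k' : ℝ) (l l' : Fin 4 → ℝ) (α β : Fin 4) :
    quadPart G G' (fun μ => k * l μ) f (fun μ => k' * l' μ) f' α β
      = k * k' * quadPart G G' l f l' f' α β := by
  have e := quad_sum_left (Finset.univ : Finset Unit) (fun _ => k) G G'
    (fun _ μ a b => l μ * f a b) (fun μ a b => k' * l' μ * f' a b) α β
  have e' := quad_sum_right (Finset.univ : Finset Unit) (fun _ => k') G G'
    (fun μ a b => l μ * f a b) (fun _ μ a b => l' μ * f' a b) α β
  simp only [Finset.univ_unique, Finset.sum_singleton, ← mul_assoc] at e e'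
  rw [quadPart, e, e', quadPart, mul_assoc]

end Words

/-! ### Absorption of products of oscillations -/

section TrigProducts

lemma sin_mul_cos_units (s t : ℝ) : Real.sin s * Real.cos t
    = ∑ ε : ℤˣ, (1 / 2) * Real.sin (s + ((ε : ℤ) : ℝ) * t) := by
  rw [sum_units]
  simp [Real.sin_add]
  ring

variable {𝒜 : Type*} [Fintype 𝒜] [DecidableEq 𝒜] {bg : Background 𝒜}

namespace Absorbed

lemma sin_cos {A B : 𝒜} (h : A ≠ B) {m : Fin 4 → Fin 4 → Functional 𝒜}
    (hm : ∀ α β, m α β ∈ class1e) :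
    Absorbed bg fun θ a x α β => Real.sin (θ A) * Real.cos (θ B) * m α β a x :=
  (sum Finset.univ fun ε _ => (sin_pm h ε hm).const_mul (1 / 2)).congr fun a _ θ x _ α β => by
    rw [sin_mul_cos_units, Finset.sum_mul]
    exact Finset.sum_congr rfl fun ε _ => by ring

lemma cos_two_cos {A B : 𝒜} (h : A ≠ B) {m : Fin 4 → Fin 4 → Functional 𝒜}
    (hm : ∀ α β, m α β ∈ class1e) :
    Absorbed bg fun θ a x α β => Real.cos (2 * θ A) * Real.cos (θ B) * m α β a x :=
  (sum Finset.univ fun ε _ => (cos_two_pm h ε hm).const_mul (1 / 2)).congr fun a _ θ x _ α β => by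
    rw [cos_mul_cos_units, Finset.sum_mul]
    exact Finset.sum_congr rfl fun ε _ => by ring

lemma sin_two_sin {A B : 𝒜} (h : A ≠ B) {m : Fin 4 → Fin 4 → Functional 𝒜}
    (hm : ∀ α β, m α β ∈ class1e) :
    Absorbed bg fun θ a x α β => Real.sin (2 * θ A) * Real.sin (θ B) * m α β a x :=
  (sum Finset.univ fun ε _ => (cos_two_pm h ε hm).const_mul (-(((ε : ℤ) : ℝ) / 2))).congr
    fun a _ θ x _ α β => by
    rw [sin_mul_sin_units, Finset.sum_mul]
    exact Finset.sum_congr rfl fun ε _ => by ring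

lemma cos_pm_cos {A B C : 𝒜} (h : ¬ (A = B ∧ A = C)) (ε : ℤˣ)
    {m : Fin 4 → Fin 4 → Functional 𝒜} (h1 : ∀ α β, m α β ∈ class11)
    (he : ∀ α β, m α β ∈ class1e) :
    Absorbed bg fun θ a x α β =>
      Real.cos (θ A + ((ε : ℤ) : ℝ) * θ B) * Real.cos (θ C) * m α β a x :=
  (sum Finset.univ fun ε' _ => (cos_triple h ε ε' h1 he).const_mul (1 / 2)).congr
    fun a _ θ x _ α β => by
    rw [cos_mul_cos_units, Finset.sum_mul]
    exact Finset.sum_congr rfl fun ε _ => by ring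

lemma sin_pm_sin {A B C : 𝒜} (h : ¬ (A = B ∧ A = C)) (ε : ℤˣ)
    {m : Fin 4 → Fin 4 → Functional 𝒜} (h1 : ∀ α β, m α β ∈ class11)
    (he : ∀ α β, m α β ∈ class1e) :
    Absorbed bg fun θ a x α β =>
      Real.sin (θ A + ((ε : ℤ) : ℝ) * θ B) * Real.sin (θ C) * m α β a x :=
  (sum Finset.univ fun ε' _ => (cos_triple h ε ε' h1 he).const_mul (-(((ε' : ℤ) : ℝ) / 2))).congr
    fun a _ θ x _ α β => by
    rw [sin_mul_sin_units, Finset.sum_mul]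
    exact Finset.sum_congr rfl fun ε _ => by ring

lemma cos_cos_cos {A B C : 𝒜} (h : ¬ (A = B ∧ A = C))
    {m : Fin 4 → Fin 4 → Functional 𝒜} (h1 : ∀ α β, m α β ∈ class11)
    (he : ∀ α β, m α β ∈ class1e) :
    Absorbed bg fun θ a x α β =>
      Real.cos (θ A) * Real.cos (θ B) * Real.cos (θ C) * m α β a x :=
  (sum Finset.univ fun ε _ => (cos_pm_cos h ε h1 he).const_mul (1 / 2)).congr
    fun a _ θ x _ α β => by
    rw [cos_mul_cos_units, Finset.sum_mul, Finset.sum_mul]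
    exact Finset.sum_congr rfl fun ε _ => by ring

lemma cos_sin_sin {A B C : 𝒜} (h : ¬ (A = B ∧ A = C))
    {m : Fin 4 → Fin 4 → Functional 𝒜} (h1 : ∀ α β, m α β ∈ class11)
    (he : ∀ α β, m α β ∈ class1e) :
    Absorbed bg fun θ a x α β =>
      Real.cos (θ A) * Real.sin (θ B) * Real.sin (θ C) * m α β a x := by
  have h' : ¬ (B = A ∧ B = C) := fun ⟨e, e'⟩ => h ⟨e.symm, e.symm.trans e'⟩
  refine (sum Finset.univ fun ε _ => (sin_pm_sin h' ε h1 he).const_mul (1 / 2)).congr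
    fun a _ θ x _ α β => ?_
  rw [mul_comm (Real.cos (θ A)), sin_mul_cos_units, Finset.sum_mul, Finset.sum_mul]
  exact Finset.sum_congr rfl fun ε _ => by ring

end Absorbed

end TrigProducts

/-! ### Membership of tensor words in the brackets -/

section Memberships

variable {𝒜 : Type*} {C C' C'' : Set (Functional 𝒜)} {Φ : Functional 𝒜}
  {S S' S'' : Amplitudes 𝒜 → Tensor2}

/-- The bracket has a factor `1 + F1`, of which the summand `F1` is selected. -/
lemma mem_class1e_of_mul (hC : C ⊆ compFrakF ∪ compF21 ∪ compF22 ∪ compFpm ∪ compF1 * compF1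
    ∪ derivsLE 1 compF1) (h : Φ ∈ bracket (C * compF1)) : Φ ∈ class1e :=
  bracket_mono ((Set.mul_subset_mul hC Set.subset_union_right).trans Set.subset_union_right) h

lemma mem_class1h_of_mul (hC : C ⊆ compFrakF ∪ compF21 ∪ compF22 ∪ compFpm ∪ compF1 * compF1
    ∪ derivs compF1) (h : Φ ∈ bracket (C * compF1)) : Φ ∈ class1h :=
  bracket_mono ((Set.mul_subset_mul hC Set.subset_union_right).trans Set.subset_union_right) h

lemma mem_class11_of_mul (hC : C ⊆ compFpm ∪ compF1 * compF1) (h : Φ ∈ bracket (C * compF1)) :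
    Φ ∈ class11 :=
  bracket_mono ((Set.mul_subset_mul_right hC).trans
    (Set.subset_union_left.trans Set.subset_union_left)) h

lemma bracket_mul_comm (h : Φ ∈ bracket (C * C')) : Φ ∈ bracket (C' * C) := by
  rwa [mul_comm]

variable [Fintype 𝒜] {bg : Background 𝒜}

lemma val_mem (hS : ∀ μ ν, (fun a => S a μ ν) ∈ C) (μ ν : Fin 4) :
    (fun a x => (S a).val x μ ν) ∈ bracket C := subset_bracket (hS μ ν)

lemma G_mem_one (hbg : bg.IsNullDust) (ρ σ : Fin 4) :
    (fun _ x => bg.G x ρ σ) ∈ bracket (1 : Set (Functional 𝒜)) :=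
  bracket_one (G_continuous hbg ρ σ)

lemma raised_mem (hbg : bg.IsNullDust) (hS : ∀ μ ν, (fun a => S a μ ν) ∈ C) (ρ σ : Fin 4) :
    (fun a x => sandwich (bg.G x) (bg.G x) ((S a).val x) ρ σ) ∈ bracket C :=
  sandwich_mem (G_continuous hbg) (val_mem hS) ρ σ

lemma dv_tensor_mem (hbg : bg.IsNullDust) (hS : ∀ μ ν, (fun a => S a μ ν) ∈ C) (n : 𝒜 → ℤ)
    (μ α β : Fin 4) : (fun a x => bg.dv x n μ * (S a).val x α β) ∈ bracket C :=
  bracket_scalar_mul (dv_continuous hbg n μ) (val_mem hS α β)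

lemma linPart_raised_mem (hbg : bg.IsNullDust) (hS : ∀ μ ν, (fun a => S a μ ν) ∈ C)
    (hS' : ∀ μ ν, (fun a => S' a μ ν) ∈ C') (n : 𝒜 → ℤ) (α β : Fin 4) :
    (fun a x => linPart (sandwich (bg.G x) (bg.G x) ((S a).val x)) (bg.dv x n) ((S' a).val x) α β)
      ∈ bracket (C * C') :=
  lin2_mem (raised_mem hbg hS) (fun κ μ α β => bracket_scalar_mul
    ((dv_continuous hbg n κ).mul (dv_continuous hbg n μ)) (val_mem hS' α β)) α β

lemma quadPart_mem (hbg : bg.IsNullDust) (hS : ∀ μ ν, (fun a => S a μ ν) ∈ C)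
    (hS' : ∀ μ ν, (fun a => S' a μ ν) ∈ C') (n n' : 𝒜 → ℤ) (α β : Fin 4) :
    (fun a x => quadPart (bg.G x) (bg.G x) (bg.dv x n) ((S a).val x) (bg.dv x n') ((S' a).val x)
      α β) ∈ bracket (C * C') := by
  have := quad_mem (G_mem_one hbg) (G_mem_one hbg) (dv_tensor_mem hbg hS n)
    (dv_tensor_mem hbg hS' n') α β
  rwa [one_mul, one_mul] at this

lemma contr_raised_mem (hbg : bg.IsNullDust) (hS : ∀ μ ν, (fun a => S a μ ν) ∈ C)
    (hS' : ∀ μ ν, (fun a => S' a μ ν) ∈ C') (n : 𝒜 → ℤ) (β : Fin 4) :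
    (fun a x => contr (sandwich (bg.G x) (bg.G x) ((S a).val x)) (bg.dv x n) ((S' a).val x) β)
      ∈ bracket (C * C') :=
  bracket_sum _ fun ρ _ => bracket_mul (bracket_sum _ fun μ _ => bracket_congr
    (bracket_scalar_mul (dv_continuous hbg n μ) (raised_mem hbg hS ρ μ)) fun a x _ => mul_comm _ _)
    (val_mem hS' ρ β)

lemma contraction_mem (hbg : bg.IsNullDust) (hS : ∀ μ ν, (fun a => S a μ ν) ∈ C)
    (hS' : ∀ μ ν, (fun a => S' a μ ν) ∈ C') :
    (fun a x => ∑ ρ, ∑ σ, sandwich (bg.G x) (bg.G x) ((S a).val x) ρ σ * (S' a).val x ρ σ)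
      ∈ bracket (C * C') :=
  bracket_sum _ fun ρ _ => bracket_sum _ fun σ _ => bracket_mul (raised_mem hbg hS ρ σ)
    (val_mem hS' ρ σ)

lemma polVec_mem (hbg : bg.IsNullDust) (hS : ∀ μ ν, (fun a => S a μ ν) ∈ C)
    (hS' : ∀ μ ν, (fun a => S' a μ ν) ∈ C') (n : 𝒜 → ℤ) (β : Fin 4) :
    (fun a x => polVec (sandwich (bg.G x) (bg.G x) ((S a).val x)) (bg.dv x n) ((S' a).val x) β)
      ∈ bracket (C * C') :=
  bracket_sub (contr_raised_mem hbg hS hS' n β) (bracket_const_mul _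
    (bracket_scalar_mul (dv_continuous hbg n β) (contraction_mem hbg hS hS')))

lemma polVecTwo_mem (hbg : bg.IsNullDust) (hS : ∀ μ ν, (fun a => S a μ ν) ∈ C)
    (hS' : ∀ μ ν, (fun a => S' a μ ν) ∈ C') (n : 𝒜 → ℤ) (β : Fin 4) :
    (fun a x => polVecTwo (bg.G x) (bg.dv x n) ((S a).val x) ((S' a).val x) β)
      ∈ bracket (C * C') :=
  bracket_sub (bracket_sum _ fun σ _ => bracket_mul (bracket_sum _ fun ν _ => bracket_congr
    (bracket_scalar_mul (G_continuous hbg ν σ) (bracket_sum Finset.univ fun ρ _ =>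
      bracket_scalar_mul (continuousOn_finsetSum Finset.univ fun μ _ =>
        (G_continuous hbg ρ μ).mul (dv_continuous hbg n μ)) (val_mem hS ρ ν)))
      fun a x _ => by rw [mul_comm, Finset.mul_sum]; simp [contr, up, Finset.mul_sum])
      (val_mem hS' β σ)) (bracket_const_mul _
    (bracket_scalar_mul (dv_continuous hbg n β) (contraction_mem hbg hS hS')))

lemma sandwichTwo_mem (hbg : bg.IsNullDust) (hS : ∀ μ ν, (fun a => S a μ ν) ∈ C)
    (hS' : ∀ μ ν, (fun a => S' a μ ν) ∈ C') (ρ σ : Fin 4) :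
    (fun a x => sandwichTwo (bg.G x) ((S a).val x) ((S' a).val x) ρ σ) ∈ bracket (C * C') :=
  bracket_sum _ fun μ _ => bracket_sum _ fun ν _ => bracket_mul
    (bracket_scalar_mul (G_continuous hbg ρ μ) (val_mem hS μ ν)) (raised_mem hbg hS' ν σ)

lemma linPart_sandwichTwo_mem (hbg : bg.IsNullDust) (hS : ∀ μ ν, (fun a => S a μ ν) ∈ C)
    (hS' : ∀ μ ν, (fun a => S' a μ ν) ∈ C') (hS'' : ∀ μ ν, (fun a => S'' a μ ν) ∈ C'')
    (n : 𝒜 → ℤ) (α β : Fin 4) :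
    (fun a x => linPart (sandwichTwo (bg.G x) ((S a).val x) ((S' a).val x)) (bg.dv x n)
      ((S'' a).val x) α β) ∈ bracket (C * C' * C'') :=
  lin2_mem (sandwichTwo_mem hbg hS hS') (fun κ μ α β => bracket_scalar_mul
    ((dv_continuous hbg n κ).mul (dv_continuous hbg n μ)) (val_mem hS'' α β)) α β

lemma quadPart_raised_left_mem (hbg : bg.IsNullDust) (hS : ∀ μ ν, (fun a => S a μ ν) ∈ C)
    (hS' : ∀ μ ν, (fun a => S' a μ ν) ∈ C') (hS'' : ∀ μ ν, (fun a => S'' a μ ν) ∈ C'')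
    (n n' : 𝒜 → ℤ) (α β : Fin 4) :
    (fun a x => quadPart (sandwich (bg.G x) (bg.G x) ((S a).val x)) (bg.G x) (bg.dv x n)
      ((S' a).val x) (bg.dv x n') ((S'' a).val x) α β) ∈ bracket (C * C' * C'') := by
  have := quad_mem (raised_mem hbg hS) (G_mem_one hbg) (dv_tensor_mem hbg hS' n)
    (dv_tensor_mem hbg hS'' n') α β
  rwa [mul_one, ← mul_assoc] at this

lemma quadPart_raised_right_mem (hbg : bg.IsNullDust) (hS : ∀ μ ν, (fun a => S a μ ν) ∈ C)
    (hS' : ∀ μ ν, (fun a => S' a μ ν) ∈ C') (hS'' : ∀ μ ν, (fun a => S'' a μ ν) ∈ C'')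
    (n n' : 𝒜 → ℤ) (α β : Fin 4) :
    (fun a x => quadPart (bg.G x) (sandwich (bg.G x) (bg.G x) ((S a).val x)) (bg.dv x n)
      ((S' a).val x) (bg.dv x n') ((S'' a).val x) α β) ∈ bracket (C * C' * C'') := by
  have := quad_mem (G_mem_one hbg) (raised_mem hbg hS) (dv_tensor_mem hbg hS' n)
    (dv_tensor_mem hbg hS'' n') α β
  rwa [one_mul, ← mul_assoc] at this

lemma divTerm_mem (hbg : bg.IsNullDust) (hS : ∀ μ ν, (fun a => S a μ ν) ∈ C) (β : Fin 4) :
    (fun a x => divTerm bg (S a) β x) ∈ bracket (derivs C) := by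
  have h : ∀ κ μ ν, (fun a => pd κ (S a μ ν)) ∈ bracket (derivs C) := fun κ μ ν =>
    subset_bracket ⟨_, hS μ ν, κ, rfl⟩
  exact bracket_sum _ fun μ _ => bracket_sum _ fun ν _ => bracket_scalar_mul (G_continuous hbg μ ν)
    (bracket_sub (h _ _ _) (bracket_const_mul _ (h _ _ _)))

end Memberships

/-! ## The interactions in the order `1` -/

section SelfInteraction

variable {𝒜 : Type*} [Fintype 𝒜] [DecidableEq 𝒜] {bg : Background 𝒜} {a : Amplitudes 𝒜}
  {x : Spacetime} {S : Tensor2}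

-- The square of `du_A` in the raised metric is `S_{L_A L_A}`. All other terms are symmetrized
-- products with `du_A`, the form required for null phases, so the `LL` term is the only one to be
-- followed separately.
omit [DecidableEq 𝒜] in
lemma linPart_raised (hbg : bg.IsNullDust) (hx : x ∈ slab) {S' : Tensor2}
    (hS : ∀ α β, S.val x α β = S.val x β α) (hS' : ∀ α β, S'.val x α β = S'.val x β α)
    (A : 𝒜) (α β : Fin 4) :
    linPart (sandwich (bg.G x) (bg.G x) (S.val x)) (bg.du x A) (S'.val x) α β
      = bg.du x A α * polVec (sandwich (bg.G x) (bg.G x) (S.val x)) (bg.du x A) (S'.val x) β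
        + bg.du x A β * polVec (sandwich (bg.G x) (bg.G x) (S.val x)) (bg.du x A) (S'.val x) α
        - bg.LL A S x * S' α β x := by
  rw [linPart_eq_polVec (sandwich_symm (G_symm hbg hx) hS) hS', LL_eq hbg hx]
  rfl

lemma LL_F1 (hbg : bg.IsNullDust) (ha : a.Admissible bg) (hx : x ∈ slab) (A : 𝒜) :
    bg.LL A (a.F1 A) x = 0 := by
  simp [LL_eq_sum, contrL_self hbg ha hx]

omit [DecidableEq 𝒜] in
lemma sum_du_up_self (hbg : bg.IsNullDust) (hx : x ∈ slab) (A : 𝒜) :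
    ∑ σ, bg.du x A σ * up (bg.G x) (bg.du x A) σ = 0 := by
  rw [sum_du_up, hbg.eikonal x hx]

lemma quadPart_F1_left (hbg : bg.IsNullDust) (ha : a.Admissible bg) (hx : x ∈ slab)
    (hS : ∀ α β, S.val x α β = S.val x β α) (A : 𝒜) (α β : Fin 4) :
    quadPart (bg.G x) (bg.G x) (bg.du x A) ((a.F1 A).val x) (bg.du x A) (S.val x) α β
      = (1 / 2) * (bg.du x A α * bg.du x A β)
        * ∑ ρ, ∑ σ, sandwich (bg.G x) (bg.G x) ((a.F1 A).val x) ρ σ * S.val x ρ σ :=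
  quadPart_constrained_left (G_symm hbg hx) (F1_symm ha A) hS (F1_constraints hbg ha hx A).2
    (sum_mix_F1 hbg ha hx A) (sum_du_up_self hbg hx A) α β

lemma quadPart_F1_right (hbg : bg.IsNullDust) (ha : a.Admissible bg) (hx : x ∈ slab)
    (hS : ∀ α β, S.val x α β = S.val x β α) (A : 𝒜) (α β : Fin 4) :
    quadPart (bg.G x) (bg.G x) (bg.du x A) (S.val x) (bg.du x A) ((a.F1 A).val x) α β
      = -(bg.du x A α * polVecTwo (bg.G x) (bg.du x A) (S.val x) ((a.F1 A).val x) β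
          + bg.du x A β * polVecTwo (bg.G x) (bg.du x A) (S.val x) ((a.F1 A).val x) α)
        + bg.LL A S x * a.F1 A α β x := by
  rw [quadPart_constrained_right (G_symm hbg hx) hS (F1_symm ha A) (F1_constraints hbg ha hx A).2
    (sum_du_up_self hbg hx A), ← LL_eq hbg hx, Finset.sum_comm]
  congr 2
  refine Finset.sum_congr rfl fun σ _ => ?_
  rw [← sum_mul_sandwich (G_symm hbg hx), Finset.sum_mul]
  exact Finset.sum_congr rfl fun ρ _ => by ring

end SelfInteraction

/-! ### Absorption of the interactions at order `1` -/

section Interactions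

variable {𝒜 : Type*} [Fintype 𝒜] [DecidableEq 𝒜] {bg : Background 𝒜}
  {S : Amplitudes 𝒜 → Tensor2} {C : Set (Functional 𝒜)}

omit [Fintype 𝒜] [DecidableEq 𝒜] in
lemma F1_mem (A : 𝒜) (μ ν : Fin 4) : (fun a : Amplitudes 𝒜 => a.F1 A μ ν) ∈ compF1 :=
  ⟨A, μ, ν, rfl⟩

/-- The contribution in `total` carries the differential of `k u_A`, which is `k du_A`; the
remainder is divided by `k` accordingly. -/
lemma Absorbed.null_unit (hbg : bg.IsNullDust) (T : Bool) (A : 𝒜) (k : ℤ)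
    (hk : k = 1 ∨ k = 2 ∨ k = 3) {m : Fin 4 → Functional 𝒜} (hm : ∀ β, m β ∈ class1h) :
    Absorbed bg fun θ a x α β => trig T (k * θ A)
      * (bg.du x A α * m β a x + bg.du x A β * m α a x) := by
  refine ((null_phase T (unit_mem_nullPhases A k hk) hm).const_mul (1 / (k : ℝ))).congr
    fun a _ θ x hx α β => ?_
  have hk0 : (k : ℝ) ≠ 0 := by rcases hk with rfl | rfl | rfl <;> norm_num
  simp only [angle_smul, angle_unit, dv_smul hbg hx, Background.dv_unit]
  field_simp

/-- The linear words of an interaction. -/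
lemma interaction_lin_mem (hbg : bg.IsNullDust) (hS : ∀ μ ν, (fun a => S a μ ν) ∈ C) (n : 𝒜 → ℤ)
    (B : 𝒜) (α β : Fin 4) : (fun a x =>
      linPart (sandwich (bg.G x) (bg.G x) ((S a).val x)) (bg.du x B) ((a.F1 B).val x) α β
        + linPart (sandwich (bg.G x) (bg.G x) ((a.F1 B).val x)) (bg.dv x n) ((S a).val x) α β)
      ∈ bracket (C * compF1) := by
  have h := linPart_raised_mem hbg hS (F1_mem B) (unit B) α β
  simp only [Background.dv_unit] at h
  exact bracket_add h (bracket_mul_comm (linPart_raised_mem hbg (F1_mem B) hS n α β))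

/-- The quadratic words of an interaction. -/
lemma interaction_quad_mem (hbg : bg.IsNullDust) (hS : ∀ μ ν, (fun a => S a μ ν) ∈ C) (n : 𝒜 → ℤ)
    (B : 𝒜) (α β : Fin 4) : (fun a x =>
      quadPart (bg.G x) (bg.G x) (bg.dv x n) ((S a).val x) (bg.du x B) ((a.F1 B).val x) α β
        + quadPart (bg.G x) (bg.G x) (bg.du x B) ((a.F1 B).val x) (bg.dv x n) ((S a).val x) α β)
      ∈ bracket (C * compF1) := by
  have h := quadPart_mem hbg hS (F1_mem B) n (unit B) α β
  have h' := quadPart_mem hbg (F1_mem B) hS (unit B) n α β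
  simp only [Background.dv_unit] at h h'
  exact bracket_add h (bracket_mul_comm h')

/-- For distinct indices no tensorial structure is needed: only the phases `u_A ± u_B` occur, and
`class1e` accepts arbitrary products of components. -/
lemma absorbed_interaction_unit (hbg : bg.IsNullDust) (hS : ∀ μ ν, (fun a => S a μ ν) ∈ C)
    (hC : C ⊆ compFrakF ∪ compF21 ∪ compF22 ∪ compFpm ∪ compF1 * compF1 ∪ derivsLE 1 compF1)
    {A B : 𝒜} (h : A ≠ B) : Absorbed bg fun θ a x α β =>
      interaction bg a θ x ⟨2, false, unit A, S a⟩ B α β := by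
  refine ((Absorbed.sin_cos h fun α β => mem_class1e_of_mul hC
    (interaction_lin_mem hbg hS (unit A) B α β)).sub (Absorbed.sin_cos h.symm fun α β =>
    mem_class1e_of_mul hC (interaction_quad_mem hbg hS (unit A) B α β))).congr
    fun a _ θ x _ α β => ?_
  simp only [interaction, trig, trigSign, angle_unit, Bool.not_false]
  ring

/-- Both trigonometric products equal `½ sin 2θ_A`, and `class12` accepts any product of `F21` with
`F1`. Polarization plays no role here. -/
lemma absorbed_interaction_F21_self (hbg : bg.IsNullDust) (A : 𝒜) :
    Absorbed bg fun θ a x α β => interaction bg a θ x ⟨2, false, unit A, a.F21 A⟩ A α β := by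
  have hS : ∀ μ ν, (fun a : Amplitudes 𝒜 => a.F21 A μ ν) ∈ compF21 := fun μ ν => ⟨A, μ, ν, rfl⟩
  have hm : ∀ {Φ}, Φ ∈ bracket (compF21 * compF1) → Φ ∈ class12 (𝒜 := 𝒜) := fun h =>
    bracket_mono (Set.mul_subset_mul_right Set.subset_union_left) h
  refine (Absorbed.sin_two_unit A fun α β => hm (bracket_const_mul (1 / 2) (bracket_sub
    (interaction_lin_mem hbg hS (unit A) A α β)
    (interaction_quad_mem hbg hS (unit A) A α β)))).congr fun a _ θ x _ α β => ?_
  simp only [interaction, trig, trigSign, angle_unit, Bool.not_false, Real.sin_two_mul]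
  ring

lemma absorbed_interaction_F22 (hbg : bg.IsNullDust) {A B : 𝒜} (h : A ≠ B) :
    Absorbed bg fun θ a x α β =>
      interaction bg a θ x ⟨2, true, (2 : ℤ) • unit A, a.F22 A⟩ B α β := by
  have hS : ∀ μ ν, (fun a : Amplitudes 𝒜 => a.F22 A μ ν) ∈ compF22 := fun μ ν => ⟨A, μ, ν, rfl⟩
  have hC : (compF22 : Set (Functional 𝒜)) ⊆ compFrakF ∪ compF21 ∪ compF22 ∪ compFpm
      ∪ compF1 * compF1 ∪ derivsLE 1 compF1 := fun m hm => by simp [hm]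
  refine ((Absorbed.cos_two_cos h fun α β => mem_class1e_of_mul hC
    (interaction_lin_mem hbg hS ((2 : ℤ) • unit A) B α β)).add (Absorbed.sin_two_sin h fun α β =>
    mem_class1e_of_mul hC (interaction_quad_mem hbg hS ((2 : ℤ) • unit A) B α β))).congr
    fun a _ θ x _ α β => ?_
  simp only [interaction, trig, trigSign, angle_smul, angle_unit, Bool.not_true]
  push_cast
  ring

lemma absorbed_interaction_Fpm (hbg : bg.IsNullDust) {A B : 𝒜} (h : A ≠ B) (ε : ℤˣ) (D : 𝒜) :
    Absorbed bg fun θ a x α β =>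
      interaction bg a θ x ⟨2, true, pm A B ε, a.Fpm A B ε⟩ D α β := by
  have hS : ∀ μ ν, (fun a : Amplitudes 𝒜 => a.Fpm A B ε μ ν) ∈ compFpm :=
    fun μ ν => ⟨A, B, ε, μ, ν, h, rfl⟩
  have hC : (compFpm : Set (Functional 𝒜)) ⊆ compFrakF ∪ compF21 ∪ compF22 ∪ compFpm
      ∪ compF1 * compF1 ∪ derivsLE 1 compF1 := fun m hm => by simp [hm]
  have h' : ¬ (A = B ∧ A = D) := fun h' => h h'.1
  have l := interaction_lin_mem hbg hS (pm A B ε) D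
  have q := interaction_quad_mem hbg hS (pm A B ε) D
  refine ((Absorbed.cos_pm_cos h' ε (fun α β => mem_class11_of_mul Set.subset_union_left (l α β))
    fun α β => mem_class1e_of_mul hC (l α β)).add (Absorbed.sin_pm_sin h' ε
    (fun α β => mem_class11_of_mul Set.subset_union_left (q α β))
    fun α β => mem_class1e_of_mul hC (q α β))).congr fun a _ θ x _ α β => ?_
  simp only [interaction, trig, trigSign, angle_pm, Bool.not_true]
  ring

/-- The covectors of the self interaction belong to the bracket of `𝓡^{(1,h)}`. -/
lemma self_words_mem (hbg : bg.IsNullDust) (hS : ∀ μ ν, (fun a => S a μ ν) ∈ C)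
    (hC : C ⊆ compFrakF ∪ compF21 ∪ compF22 ∪ compFpm ∪ compF1 * compF1 ∪ derivs compF1)
    (A : 𝒜) (β : Fin 4) :
    (fun a x => polVec (sandwich (bg.G x) (bg.G x) ((S a).val x)) (bg.du x A)
      ((a.F1 A).val x) β) ∈ class1h ∧
    (fun a x => polVec (sandwich (bg.G x) (bg.G x) ((a.F1 A).val x)) (bg.du x A)
      ((S a).val x) β) ∈ class1h ∧
    (fun a x => polVecTwo (bg.G x) (bg.du x A) ((S a).val x) ((a.F1 A).val x) β) ∈ class1h ∧
    (fun a x => bg.du x A β * ∑ ρ, ∑ σ, sandwich (bg.G x) (bg.G x) ((a.F1 A).val x) ρ σ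
      * (S a).val x ρ σ) ∈ class1h := by
  have h1 := polVec_mem hbg hS (F1_mem A) (unit A) β
  have h2 := polVec_mem hbg (F1_mem A) hS (unit A) β
  have h3 := polVecTwo_mem hbg hS (F1_mem A) (unit A) β
  simp only [Background.dv_unit] at h1 h2 h3
  exact ⟨mem_class1h_of_mul hC h1, mem_class1h_of_mul hC (bracket_mul_comm h2),
    mem_class1h_of_mul hC h3, mem_class1h_of_mul hC (bracket_mul_comm
      (bracket_scalar_mul (du_continuous hbg A β) (contraction_mem hbg (F1_mem A) hS)))⟩

/-- At the phase `2u_A` a product of `𝔉` and `F1` is acceptable only in the form `∂_{(α}u Y_{β)}`.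
The linear and the quadratic part each contribute `-sin θ cos θ` times the `LL` term, and the added
`sin 2θ` term compensates both. -/
lemma absorbed_interaction_frakF_self (hbg : bg.IsNullDust) (A : 𝒜) :
    Absorbed bg fun θ a x α β => interaction bg a θ x ⟨2, false, unit A, a.frakF A⟩ A α β
      + Real.sin (2 * θ A) * bg.LL A (a.frakF A) x * a.F1 A α β x := by
  have hS : ∀ μ ν, (fun a : Amplitudes 𝒜 => a.frakF A μ ν) ∈ compFrakF :=
    fun μ ν => ⟨A, μ, ν, rfl⟩
  have hC : (compFrakF : Set (Functional 𝒜)) ⊆ compFrakF ∪ compF21 ∪ compF22 ∪ compFpm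
      ∪ compF1 * compF1 ∪ derivs compF1 := fun m hm => by simp [hm]
  have w := self_words_mem hbg hS hC A
  refine (Absorbed.null_unit hbg false A 2 (by simp) fun β => bracket_const_mul (1 / 2)
    (bracket_sub (bracket_add (bracket_add (w β).1 (w β).2.1) (w β).2.2.1)
      (bracket_const_mul (1 / 4) (w β).2.2.2))).congr fun a ha θ x hx α β => ?_
  have s : ∀ α β, (a.frakF A).val x α β = (a.frakF A).val x β α := fun α β =>
    congrFun ((ha.frakF A).1 α β) x
  simp only [interaction, trig, trigSign, angle_unit, Bool.not_false, Background.dv_unit]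
  rw [linPart_raised hbg hx s (F1_symm ha A), linPart_raised hbg hx (F1_symm ha A) s,
    quadPart_F1_left hbg ha hx s, quadPart_F1_right hbg ha hx s, LL_F1 hbg ha hx]
  push_cast
  rw [Real.sin_two_mul]
  ring

/-- The doubled phase weights the linear word by `4` and the quadratic ones by `2`. Products of the
frequencies `2` and `1` have frequencies `1` and `3`, one of the reasons for `3u_A` in `𝒩`. The
subtracted term removes the two `LL` contributions. -/
lemma absorbed_interaction_F22_self (hbg : bg.IsNullDust) (A : 𝒜) :
    Absorbed bg fun θ a x α β =>
      interaction bg a θ x ⟨2, true, (2 : ℤ) • unit A, a.F22 A⟩ A α β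
      - (2 * Real.sin (θ A) * Real.sin (2 * θ A) - Real.cos (θ A) * Real.cos (2 * θ A))
        * bg.LL A (a.F22 A) x * a.F1 A α β x := by
  have hS : ∀ μ ν, (fun a : Amplitudes 𝒜 => a.F22 A μ ν) ∈ compF22 := fun μ ν => ⟨A, μ, ν, rfl⟩
  have hC : (compF22 : Set (Functional 𝒜)) ⊆ compFrakF ∪ compF21 ∪ compF22 ∪ compFpm
      ∪ compF1 * compF1 ∪ derivs compF1 := fun m hm => by simp [hm]
  have w := self_words_mem hbg hS hC A
  have e := fun β => bracket_add (w β).1 (bracket_const_mul 4 (w β).2.1)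
  have e' := fun β => bracket_sub (bracket_const_mul (1 / 2) (w β).2.2.2)
    (bracket_const_mul 2 (w β).2.2.1)
  refine ((Absorbed.null_unit hbg true A 1 (by simp) fun β => bracket_const_mul (1 / 2)
    (bracket_add (e β) (e' β))).add (Absorbed.null_unit hbg true A 3 (by simp) fun β =>
      bracket_const_mul (1 / 2) (bracket_sub (e β) (e' β)))).congr fun a ha θ x hx α β => ?_
  have s : ∀ α β, (a.F22 A).val x α β = (a.F22 A).val x β α := fun α β =>
    congrFun ((ha.F22 A).1 α β) x
  have e2 : bg.dv x ((2 : ℤ) • unit A) = fun μ => 2 * bg.du x A μ := by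
    funext μ; rw [dv_smul hbg hx, Background.dv_unit]; simp
  have q1 := quadPart_smul (G := bg.G x) (G' := bg.G x) (f := (a.F22 A).val x)
    (f' := (a.F1 A).val x) 2 1 (bg.du x A) (bg.du x A) α β
  have q2 := quadPart_smul (G := bg.G x) (G' := bg.G x) (f := (a.F1 A).val x)
    (f' := (a.F22 A).val x) 1 2 (bg.du x A) (bg.du x A) α β
  simp only [one_mul, mul_one] at q1 q2
  simp only [interaction, trig, trigSign, angle_smul, angle_unit, Bool.not_true, e2, linPart_smul]
  rw [q1, q2, linPart_raised hbg hx s (F1_symm ha A), linPart_raised hbg hx (F1_symm ha A) s,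
    quadPart_F1_left hbg ha hx s, quadPart_F1_right hbg ha hx s, LL_F1 hbg ha hx]
  have c1 : Real.cos (((1 : ℤ) : ℝ) * θ A)
      = Real.cos (2 * θ A) * Real.cos (θ A) + Real.sin (2 * θ A) * Real.sin (θ A) := by
    rw [← Real.cos_sub]; congr 1; push_cast; ring
  have c3 : Real.cos (((3 : ℤ) : ℝ) * θ A)
      = Real.cos (2 * θ A) * Real.cos (θ A) - Real.sin (2 * θ A) * Real.sin (θ A) := by
    rw [← Real.cos_add]; congr 1; push_cast; ring
  rw [c1, c3]
  push_cast
  ring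

/-- `h` has no phase, so at this order it acts only through the inverse metric. The `LL` term is
explicit in the result, whereas the covectors `polVec` contain `h`, which no bracket of order `1`
admits. They are recovered from `Υ`. -/
lemma interaction_h (hbg : bg.IsNullDust) {a : Amplitudes 𝒜} (ha : a.Admissible bg)
    {x : Spacetime} (hx : x ∈ slab) (θ : 𝒜 → ℝ) (A : 𝒜) (α β : Fin 4) :
    interaction bg a θ x ⟨2, true, 0, a.h⟩ A α β
      = Real.cos (θ A) * (bg.du x A α * polVec (sandwich (bg.G x) (bg.G x) (a.h.val x)) (bg.du x A)
            ((a.F1 A).val x) β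
          + bg.du x A β * polVec (sandwich (bg.G x) (bg.G x) (a.h.val x)) (bg.du x A)
            ((a.F1 A).val x) α - bg.LL A a.h x * a.F1 A α β x) := by
  have s : ∀ α β, a.h.val x α β = a.h.val x β α := fun α β => congrFun (ha.h.1 α β) x
  have e : bg.dv x (0 : 𝒜 → ℤ) = fun μ => 0 * bg.dv x (0 : 𝒜 → ℤ) μ := by
    funext μ; simp [Background.dv, phase_zero, pd_zero]
  have e0 : angle (0 : 𝒜 → ℤ) θ = 0 := by simp [angle]
  simp only [interaction, trig, trigSign, e0, Bool.not_true, Real.sin_zero, Real.cos_zero]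
  rw [e, linPart_smul, linPart_raised hbg hx s (F1_symm ha A)]
  ring

lemma derivInteraction_mem (hbg : bg.IsNullDust) (A B : 𝒜) (α β : Fin 4) :
    (fun a x => derivInteraction bg a x A B α β) ∈ bracket (derivsLE 1 compF1 * compF1) := by
  have m := midDeriv_mem hbg (F1_mem B) (hbg.smooth_phase B)
  have n := nab_mem hbg (F1_mem A)
  have t := dv_tensor_mem hbg (F1_mem B) (unit B)
  simp only [Background.dv_unit] at t
  have q := quad_mem (G_mem_one hbg) (G_mem_one hbg) n t α β
  have q' := quad_mem (G_mem_one hbg) (G_mem_one hbg) t n α β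
  rw [one_mul, one_mul] at q q'
  exact bracket_sub (bracket_mul_comm (lin2_mem (raised_mem hbg (F1_mem A)) m α β))
    (bracket_add q (bracket_mul_comm q'))

lemma absorbed_derivInteraction (hbg : bg.IsNullDust) (A B : 𝒜) : Absorbed bg fun θ a x α β =>
    Real.cos (θ A) * Real.sin (θ B) * derivInteraction bg a x A B α β := by
  have m := derivInteraction_mem hbg A B
  by_cases h : A = B
  · subst h
    refine (Absorbed.sin_two_unit A fun α β => bracket_const_mul (1 / 2) (bracket_mono
      (Set.mul_subset_mul_right Set.subset_union_right) (m α β))).congr fun a _ θ x _ α β => ?_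
    simp only [Real.sin_two_mul]
    ring
  · refine (Absorbed.sin_cos (Ne.symm h) fun α β => mem_class1e_of_mul Set.subset_union_right
      (m α β)).congr fun a _ θ x _ α β => ?_
    ring

lemma sandwichTwo_eq (G f f' : Fin 4 → Fin 4 → ℝ) (ρ σ : Fin 4) :
    sandwichTwo G f f' ρ σ = ∑ ν, mix G f ρ ν * sandwich G G f' ν σ := by
  simp only [sandwichTwo, mix, Finset.sum_mul]
  rw [Finset.sum_comm]

/-- The word `G f G f G` is a palindrome in symmetric matrices, hence equal to its transpose. -/
lemma sandwichTwo_symm {G f : Fin 4 → Fin 4 → ℝ} (hG : ∀ a b, G a b = G b a)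
    (hf : ∀ a b, f a b = f b a) (ρ σ : Fin 4) :
    sandwichTwo G f f ρ σ = sandwichTwo G f f σ ρ := by
  have e : ∀ ρ σ, sandwichTwo G f f ρ σ = (Matrix.of G * Matrix.of f
      * (Matrix.of G * Matrix.of f * Matrix.of G)) ρ σ := by
    intro ρ σ
    rw [sandwichTwo_eq]
    simp only [sandwich_eq]
    rfl
  have hG' : (Matrix.of G).transpose = Matrix.of G := Matrix.ext fun a b => hG b a
  have hf' : (Matrix.of f).transpose = Matrix.of f := Matrix.ext fun a b => hf b a
  rw [e, e, ← Matrix.transpose_apply (Matrix.of G * Matrix.of f * _) ρ σ]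
  simp only [Matrix.transpose_mul, hG', hf', Matrix.mul_assoc]

lemma up_sandwich_eq_zero {G f : Fin 4 → Fin 4 → ℝ} {l : Fin 4 → ℝ} (hG : ∀ a b, G a b = G b a)
    (hf : ∀ a b, f a b = f b a) (h : ∀ α, contr G l f α = 0) (ρ : Fin 4) :
    up (sandwich G G f) l ρ = 0 := by
  have : up (sandwich G G f) l ρ = ∑ σ, l σ * sandwich G G f σ ρ :=
    Finset.sum_congr rfl fun σ _ => by rw [sandwich_symm hG hf]; ring
  rw [this, sum_mul_sandwich hG]
  simp [h]

lemma up_sandwichTwo_eq_zero {G f : Fin 4 → Fin 4 → ℝ} {l : Fin 4 → ℝ}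
    (hG : ∀ a b, G a b = G b a) (hf : ∀ a b, f a b = f b a) (h : ∀ α, contr G l f α = 0)
    (ρ : Fin 4) : up (sandwichTwo G f f) l ρ = 0 := by
  have : up (sandwichTwo G f f) l ρ = ∑ ν, mix G f ρ ν * up (sandwich G G f) l ν := by
    simp only [up, sandwichTwo_eq, Finset.sum_mul, Finset.mul_sum]
    rw [Finset.sum_comm]
    exact Finset.sum_congr rfl fun _ _ => Finset.sum_congr rfl fun _ _ => by ring
  rw [this]
  simp [up_sandwich_eq_zero hG hf h]

/-- The cubic self interaction. -/
lemma cubicInteraction_self (hbg : bg.IsNullDust) {a : Amplitudes 𝒜} (ha : a.Admissible bg)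
    {x : Spacetime} (hx : x ∈ slab) (θ : 𝒜 → ℝ) (A : 𝒜) (α β : Fin 4) :
    cubicInteraction bg a θ x A A A α β = bg.du x A α * bg.du x A β
      * (Real.cos (θ A) ^ 3 * (∑ ρ, ∑ σ, sandwichTwo (bg.G x) ((a.F1 A).val x) ((a.F1 A).val x) ρ σ
            * (a.F1 A).val x ρ σ)
        - Real.cos (θ A) * Real.sin (θ A) ^ 2
          * ((∑ ρ, ∑ σ, sandwich (sandwich (bg.G x) (bg.G x) ((a.F1 A).val x)) (bg.G x)
                ((a.F1 A).val x) ρ σ * (a.F1 A).val x ρ σ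
              - (1 / 2) * ∑ ρ, ∑ σ, mix (sandwich (bg.G x) (bg.G x) ((a.F1 A).val x))
                ((a.F1 A).val x) ρ σ * mix (bg.G x) ((a.F1 A).val x) σ ρ)
            + (∑ ρ, ∑ σ, sandwich (bg.G x) (sandwich (bg.G x) (bg.G x) ((a.F1 A).val x))
                ((a.F1 A).val x) ρ σ * (a.F1 A).val x ρ σ
              - (1 / 2) * ∑ ρ, ∑ σ, mix (bg.G x) ((a.F1 A).val x) ρ σ
                * mix (sandwich (bg.G x) (bg.G x) ((a.F1 A).val x)) ((a.F1 A).val x) σ ρ))) := by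
  have hG := G_symm hbg hx
  have hf := F1_symm (x := x) ha A
  have h := (F1_constraints hbg ha hx A).2
  -- `F1_A` annihilates the gradient of `u_A`, so the raised matrices `GfG` and `GfGfG` annihilate
  -- `du_A`, which is thereby null for them as it is for `G`. Only multiples of `du_A ⊗ du_A`
  -- survive.
  have u1 := up_sandwich_eq_zero hG hf h
  have u2 := up_sandwichTwo_eq_zero hG hf h
  have c1 : ∀ α, contr (sandwich (bg.G x) (bg.G x) ((a.F1 A).val x)) (bg.du x A)
      ((a.F1 A).val x) α = 0 := fun α => by simp [contr, u1]
  have n := sum_du_up_self hbg hx A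
  have n' : ∑ ρ, up (bg.G x) (bg.du x A) ρ * bg.du x A ρ = 0 := by
    rw [← n]; exact Finset.sum_congr rfl fun _ _ => mul_comm _ _
  have z : ∑ ρ, ∑ σ, sandwichTwo (bg.G x) ((a.F1 A).val x) ((a.F1 A).val x) ρ σ * bg.du x A ρ
      * bg.du x A σ = 0 := by
    have : ∀ ρ, ∑ σ, sandwichTwo (bg.G x) ((a.F1 A).val x) ((a.F1 A).val x) ρ σ * bg.du x A ρ
        * bg.du x A σ = bg.du x A ρ * up (sandwichTwo (bg.G x) ((a.F1 A).val x)
          ((a.F1 A).val x)) (bg.du x A) ρ := fun ρ => by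
      rw [up, Finset.mul_sum]; exact Finset.sum_congr rfl fun σ _ => by ring
    simp [this, u2]
  simp only [cubicInteraction]
  rw [linPart_eq_polVec (sandwichTwo_symm hG hf) hf, z, quadPart, quadPart,
    quad_rank_one_constrained (sandwich_symm hG hf) hG hf c1 h (by simp [u1]) n,
    quad_rank_one_constrained hG (sandwich_symm hG hf) hf h c1 n' (by simp [u1])]
  simp only [polVec, contr, u2, zero_mul, Finset.sum_const_zero]
  ring

lemma absorbed_cubic_self (hbg : bg.IsNullDust) (A : 𝒜) :
    Absorbed bg fun θ a x α β => cubicInteraction bg a θ x A A A α β := by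
  have f := val_mem (F1_mem A)
  have s := raised_mem hbg (F1_mem A)
  have g := G_mem_one hbg
  have k1 : (fun a x => ∑ ρ, ∑ σ, sandwichTwo (bg.G x) ((a.F1 A).val x) ((a.F1 A).val x) ρ σ
      * (a.F1 A).val x ρ σ) ∈ bracket (compF1 * compF1 * compF1) :=
    bracket_sum _ fun ρ _ => bracket_sum _ fun σ _ =>
      bracket_mul (sandwichTwo_mem hbg (F1_mem A) (F1_mem A) ρ σ) (f ρ σ)
  have m : ∀ ρ σ, (fun a x => mix (bg.G x) ((a.F1 A).val x) ρ σ) ∈ bracket compF1 :=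
    fun ρ σ => bracket_sum _ fun μ _ => bracket_scalar_mul (G_continuous hbg ρ μ) (f μ σ)
  have m' : ∀ ρ σ, (fun a x => mix (sandwich (bg.G x) (bg.G x) ((a.F1 A).val x))
      ((a.F1 A).val x) ρ σ) ∈ bracket (compF1 * compF1) :=
    fun ρ σ => bracket_sum _ fun μ _ => bracket_mul (s ρ μ) (f μ σ)
  have k2 : (fun a x => ∑ ρ, ∑ σ, sandwich (sandwich (bg.G x) (bg.G x) ((a.F1 A).val x)) (bg.G x)
      ((a.F1 A).val x) ρ σ * (a.F1 A).val x ρ σ) ∈ bracket (compF1 * compF1 * compF1) := by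
    refine bracket_sum _ fun ρ _ => bracket_sum _ fun σ _ => bracket_mul
      (bracket_sum _ fun μ _ => bracket_sum _ fun ν _ => ?_) (f ρ σ)
    have := bracket_mul (bracket_mul (s ρ μ) (f μ ν)) (g ν σ)
    rwa [mul_one] at this
  have k3 : (fun a x => ∑ ρ, ∑ σ, sandwich (bg.G x) (sandwich (bg.G x) (bg.G x) ((a.F1 A).val x))
      ((a.F1 A).val x) ρ σ * (a.F1 A).val x ρ σ) ∈ bracket (compF1 * compF1 * compF1) := by
    refine bracket_sum _ fun ρ _ => bracket_sum _ fun σ _ => bracket_mul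
      (bracket_sum _ fun μ _ => bracket_sum _ fun ν _ => bracket_mul
        (bracket_scalar_mul (G_continuous hbg ρ μ) (f μ ν)) (s ν σ)) (f ρ σ)
  have k4 : (fun a x => ∑ ρ, ∑ σ, mix (sandwich (bg.G x) (bg.G x) ((a.F1 A).val x))
      ((a.F1 A).val x) ρ σ * mix (bg.G x) ((a.F1 A).val x) σ ρ)
      ∈ bracket (compF1 * compF1 * compF1) :=
    bracket_sum _ fun ρ _ => bracket_sum _ fun σ _ => bracket_mul (m' ρ σ) (m σ ρ)
  have k5 : (fun a x => ∑ ρ, ∑ σ, mix (bg.G x) ((a.F1 A).val x) ρ σ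
      * mix (sandwich (bg.G x) (bg.G x) ((a.F1 A).val x)) ((a.F1 A).val x) σ ρ)
      ∈ bracket (compF1 * compF1 * compF1) :=
    bracket_sum _ fun ρ _ => bracket_sum _ fun σ _ => bracket_mul_comm (bracket_mul (m ρ σ)
      (m' σ ρ))
  have k := bracket_add (bracket_sub k2 (bracket_const_mul (1 / 2) k4))
    (bracket_sub k3 (bracket_const_mul (1 / 2) k5))
  have hC : (compF1 * compF1 : Set (Functional 𝒜)) ⊆ compFrakF ∪ compF21 ∪ compF22 ∪ compFpm
      ∪ compF1 * compF1 ∪ derivs compF1 :=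
    Set.subset_union_right.trans Set.subset_union_left
  -- The coefficients come from `cos³ θ = (3 cos θ + cos 3θ)/4` and `cos θ sin² θ = (cos θ - cos
  -- 3θ)/4`. A further factor `1/2` is due to symmetrization, which doubles `du_A ⊗ du_A`.
  have w := fun β => mem_class1h_of_mul hC (bracket_scalar_mul (du_continuous hbg A β)
    (bracket_const_mul (1 / 8) (bracket_sub (bracket_const_mul 3 k1) k)))
  have w' := fun β => mem_class1h_of_mul hC (bracket_scalar_mul (du_continuous hbg A β)
    (bracket_const_mul (1 / 8) (bracket_add k1 k)))
  refine ((Absorbed.null_unit hbg true A 1 (by simp) w).add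
    (Absorbed.null_unit hbg true A 3 (by simp) w')).congr fun a ha θ x hx α β => ?_
  simp only [cubicInteraction_self hbg ha hx, trig, Int.cast_one, Int.cast_ofNat, one_mul,
    Real.cos_three_mul, Real.sin_sq]
  ring

lemma absorbed_cubic (hbg : bg.IsNullDust) (A B D : 𝒜) :
    Absorbed bg fun θ a x α β => cubicInteraction bg a θ x A B D α β := by
  by_cases h : A = B ∧ A = D
  · obtain ⟨rfl, rfl⟩ := h
    exact absorbed_cubic_self hbg A
  have l := linPart_sandwichTwo_mem hbg (F1_mem A) (F1_mem B) (F1_mem D) (unit D)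
  have q := quadPart_raised_left_mem hbg (F1_mem A) (F1_mem B) (F1_mem D) (unit B) (unit D)
  have q' := quadPart_raised_right_mem hbg (F1_mem A) (F1_mem B) (F1_mem D) (unit B) (unit D)
  simp only [Background.dv_unit] at l q q'
  have p := fun α β => bracket_add (q α β) (q' α β)
  have h1 : ∀ {Φ}, Φ ∈ bracket (compF1 * compF1 * compF1) → Φ ∈ class11 (𝒜 := 𝒜) :=
    mem_class11_of_mul Set.subset_union_right
  have he : ∀ {Φ}, Φ ∈ bracket (compF1 * compF1 * compF1) → Φ ∈ class1e (𝒜 := 𝒜) :=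
    mem_class1e_of_mul (Set.subset_union_right.trans Set.subset_union_left)
  refine (((Absorbed.cos_cos_cos h (fun α β => h1 (l α β)) fun α β => he (l α β)).const_mul
    (-1)).sub (Absorbed.cos_sin_sin h (fun α β => h1 (p α β)) fun α β => he (p α β))).congr
    fun a _ θ x _ α β => ?_
  simp only [cubicInteraction]
  ring

end Interactions

/-! ## The order `1` -/

section OrderOne

variable {𝒜 : Type*} [Fintype 𝒜] {bg : Background 𝒜} {x : Spacetime}

lemma covD1_pol_add (hbg : bg.IsNullDust) (hx : x ∈ slab) {S S' : Tensor2}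
    (hS : ∀ α β, ContDiffOn ℝ 2 (S α β) slab) (hS' : ∀ α β, ContDiffOn ℝ 2 (S' α β) slab)
    (A : 𝒜) (κ α : Fin 4) :
    covD1 bg.g₀ (pol bg.g₀ (S + S') (bg.u A)) κ α x
      = covD1 bg.g₀ (pol bg.g₀ S (bg.u A)) κ α x + covD1 bg.g₀ (pol bg.g₀ S' (bg.u A)) κ α x := by
  have n : ∀ μ α β, nab pd (Gam bg.g₀) (S + S') μ α β x
      = nab pd (Gam bg.g₀) S μ α β x + nab pd (Gam bg.g₀) S' μ α β x := by
    intro μ α β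
    have := isFrame_pd.add hx ((hS α β x hx).differentiableWithinAt (by norm_num))
      ((hS' α β x hx).differentiableWithinAt (by norm_num)) μ
    simp only [nab, Pi.add_apply, mul_add, Finset.sum_add_distrib]
    rw [show S α β + S' α β = fun q => S α β q + S' α β q from rfl, this]
    ring
  have t : trace bg.g₀ (S + S') x = trace bg.g₀ S x + trace bg.g₀ S' x := by
    simp only [trace, Pi.add_apply, mul_add, Finset.sum_add_distrib]
  rw [covD1_pol (S := S + S') hbg hx (fun α β => (hS α β).add (hS' α β)) (hbg.smooth_phase A),
    covD1_pol hbg hx hS (hbg.smooth_phase A), covD1_pol hbg hx hS' (hbg.smooth_phase A), t]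
  simp only [n, Pi.add_apply, add_mul, mul_add, Finset.sum_add_distrib]
  ring

lemma midDeriv_smul (hbg : bg.IsNullDust) (hx : x ∈ slab) (k : ℤ) (n : 𝒜 → ℤ) (S : Tensor2)
    (κ μ α β : Fin 4) :
    midDeriv (Gam bg.g₀) (bg.phase (k • n)) S κ μ α β x
      = k * midDeriv (Gam bg.g₀) (bg.phase n) S κ μ α β x := by
  have h1 : ∀ x ∈ slab, ∀ μ, pd μ (bg.phase (k • n)) x = k * pd μ (bg.phase n) x :=
    fun x hx μ => dv_smul hbg hx k n μ
  have d := (isFrame_pd.contDiffOn (contDiffOn_phase hbg.smooth_phase n) μ x hx).differentiableWithinAt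
    (by norm_num : (1 : WithTop ℕ∞) ≠ 0)
  have h2 : pd κ (pd μ (bg.phase (k • n))) x = k * pd κ (pd μ (bg.phase n)) x := by
    rw [← isFrame_pd.const_mul hx k d]
    exact isFrame_pd.congr_on hx (fun q hq => h1 q hq μ) (d.const_mul _) κ
  simp only [midDeriv, hess, h2, h1 x hx, mul_left_comm _ (k : ℝ), ← Finset.mul_sum]
  ring

variable [DecidableEq 𝒜] {a : Amplitudes 𝒜}

/-- The terms of order `1` which are not part of a remainder or of the gauge term. -/
def orderOneMain (bg : Background 𝒜) (a : Amplitudes 𝒜) (θ : 𝒜 → ℝ) (x : Spacetime)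
    (α β : Fin 4) : ℝ :=
  -(∑ A, Real.cos (θ A) * (bg.transport A (a.frakF A) α β x + bg.transport A (a.F21 A) α β x
      + bg.LL A a.h x * a.F1 A α β x
      - (covD1 bg.g₀ (pol bg.g₀ (a.frakF A + a.F21 A) (bg.u A)) α β x
        + covD1 bg.g₀ (pol bg.g₀ (a.frakF A + a.F21 A) (bg.u A)) β α x)))
  + 2 * ∑ A, Real.sin (2 * θ A) * (bg.transport A (a.F22 A) α β x
      - (covD1 bg.g₀ (pol bg.g₀ (a.F22 A) (bg.u A)) α β x
        + covD1 bg.g₀ (pol bg.g₀ (a.F22 A) (bg.u A)) β α x))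
  + ∑ A, (2 * Real.sin (θ A) * Real.sin (2 * θ A) - Real.cos (θ A) * Real.cos (2 * θ A))
      * bg.LL A (a.F22 A) x * a.F1 A α β x
  - ∑ A, Real.sin (2 * θ A) * bg.LL A (a.frakF A) x * a.F1 A α β x
  + ∑ n ∈ nullPhases 𝒜, ∑ T, trig T (angle n θ)
      * (bg.dv x n α * (-pol bg.g₀ (a.g3h T n) (bg.phase n) β x)
        + bg.dv x n β * (-pol bg.g₀ (a.g3h T n) (bg.phase n) α x))
  + ∑ n ∈ mixedPhases 𝒜, ∑ T, trig T (angle n θ)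
      * (pair bg.g₀ (bg.phase n) (bg.phase n) x * a.g3e T n α β x)

/-- The contribution of a null phase to the gauge term. -/
def gaugeVec (bg : Background 𝒜) (a : Amplitudes 𝒜) (x : Spacetime) (A : 𝒜) (β : Fin 4) : ℝ :=
  divTerm bg (a.frakF A) β x
    + polVec (sandwich (bg.G x) (bg.G x) (a.h.val x)) (bg.du x A) ((a.F1 A).val x) β

/-- The terms of order `1` which are part of the gauge term. -/
def orderOneGauge (bg : Background 𝒜) (a : Amplitudes 𝒜) (θ : 𝒜 → ℝ) (x : Spacetime)
    (α β : Fin 4) : ℝ :=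
  ∑ A, Real.cos (θ A) * (bg.du x A α * gaugeVec bg a x A β + bg.du x A β * gaugeVec bg a x A α)
  - ∑ n ∈ mixedPhases 𝒜, ∑ T, trig T (angle n θ)
      * (bg.dv x n α * pol bg.g₀ (a.g3e T n) (bg.phase n) β x
        + bg.dv x n β * pol bg.g₀ (a.g3e T n) (bg.phase n) α x)

/-- The phase is `u_A`, and `class11` is the one bracket of order `1` that admits two derivatives of
`F1`. -/
lemma absorbed_nab2 (hbg : bg.IsNullDust) (A : 𝒜) : Absorbed bg fun θ a x α β =>
    Real.cos (θ A) * lin2 (bg.G x)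
      (fun κ μ α β => nab2 pd (Gam bg.g₀) (a.F1 A) κ μ α β x) α β := by
  choose Φ hΦ e using exists_nab2_mem (C := compF1) hbg (F1_mem A)
  have m := fun α β => lin2_mem (G_mem_one hbg) hΦ α β
  simp only [one_mul] at m
  refine (Absorbed.cos_unit A fun α β => bracket_mono
    (Set.subset_union_right.trans Set.subset_union_left) (m α β)).congr fun a ha θ x hx α β => ?_
  simp only [e _ _ _ _ a (fun μ ν => (ha.F1 A).2 μ ν) x hx]

lemma absorbed_midDeriv_Fpm (hbg : bg.IsNullDust) {A B : 𝒜} (h : A ≠ B) (ε : ℤˣ) :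
    Absorbed bg fun θ a x α β => trigSign true * trig (!true) (angle (pm A B ε) θ)
      * lin2 (bg.G x) (fun κ μ α β => midDeriv (Gam bg.g₀) (bg.phase (pm A B ε)) (a.Fpm A B ε)
        κ μ α β x) α β := by
  have m := fun α β => lin2_mem (G_mem_one hbg) (midDeriv_mem (C := compFpm) hbg
    (S := fun a => a.Fpm A B ε) (fun μ ν => ⟨A, B, ε, μ, ν, h, rfl⟩)
    (contDiffOn_phase hbg.smooth_phase (pm A B ε))) α β
  simp only [one_mul] at m
  refine ((Absorbed.mixed_phase false (pm_mem_mixedPhases h ε) fun α β => bracket_mono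
    (Set.subset_union_left.trans Set.subset_union_left) (m α β)).const_mul (-1)).congr
    fun a ha θ x hx α β => ?_
  simp only [trigSign, Bool.not_true]
  ring

/-- The derivatives of the terms with factor `λ²`. -/
lemma absorbed_mid (hbg : bg.IsNullDust) : Absorbed bg fun θ a x α β =>
    ∑ i, (trigSign (secondTerm a i).b * trig (!(secondTerm a i).b)
          (angle (secondTerm a i).n θ)) * lin2 (bg.G x)
            (fun κ μ α β => midDeriv (Gam bg.g₀) (bg.phase (secondTerm a i).n)
              (secondTerm a i).S κ μ α β x) α β
      - ∑ A, Real.cos (θ A) * ((covD1 bg.g₀ (pol bg.g₀ (a.frakF A) (bg.u A)) α β x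
          + covD1 bg.g₀ (pol bg.g₀ (a.frakF A) (bg.u A)) β α x)
          + (bg.du x A α * divTerm bg (a.frakF A) β x + bg.du x A β * divTerm bg (a.frakF A) α x)
          - bg.transport A (a.frakF A) α β x)
      - ∑ A, Real.cos (θ A) * ((covD1 bg.g₀ (pol bg.g₀ (a.F21 A) (bg.u A)) α β x
          + covD1 bg.g₀ (pol bg.g₀ (a.F21 A) (bg.u A)) β α x) - bg.transport A (a.F21 A) α β x)
      - 2 * ∑ A, Real.sin (2 * θ A) * (bg.transport A (a.F22 A) α β x
          - (covD1 bg.g₀ (pol bg.g₀ (a.F22 A) (bg.u A)) α β x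
            + covD1 bg.g₀ (pol bg.g₀ (a.F22 A) (bg.u A)) β α x)) := by
  -- The divergence terms of `F21` and `F22` fit the null bracket, which contains their first
  -- derivatives. It contains none of `𝔉`, so the divergence term of `𝔉` is subtracted instead and
  -- will be matched with `Υ`.
  have m1 : ∀ A β, (fun (a : Amplitudes 𝒜) x => divTerm bg (a.F21 A) β x) ∈ class1h :=
    fun A β => bracket_mono (Set.subset_union_left.trans Set.subset_union_left)
      (divTerm_mem (C := compF21) hbg (S := fun a => a.F21 A) (fun μ ν => ⟨A, μ, ν, rfl⟩) β)
  have m2 : ∀ A β, (fun (a : Amplitudes 𝒜) x => divTerm bg (a.F22 A) β x) ∈ class1h :=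
    fun A β => bracket_mono (Set.subset_union_right.trans Set.subset_union_left)
      (divTerm_mem (C := compF22) hbg (S := fun a => a.F22 A) (fun μ ν => ⟨A, μ, ν, rfl⟩) β)
  refine (((Absorbed.sum Finset.univ fun A _ => Absorbed.null_unit hbg true A 1 (by simp)
    (m1 A)).sub ((Absorbed.sum Finset.univ fun A _ => Absorbed.null_unit hbg false A 2 (by simp)
    (m2 A)).const_mul 2)).add (Absorbed.sum (Finset.univ : Finset 𝒜).offDiag fun q hq =>
      Absorbed.sum Finset.univ fun ε _ => absorbed_midDeriv_Fpm hbg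
        (Finset.mem_offDiag.1 hq).2.2 ε)).congr fun a ha θ x hx α β => ?_
  rw [sum_secondTerm a (fun t => (trigSign t.b * trig (!t.b) (angle t.n θ)) * lin2 (bg.G x)
    (fun κ μ α β => midDeriv (Gam bg.g₀) (bg.phase t.n) t.S κ μ α β x) α β)]
  have z : lin2 (bg.G x) (fun κ μ α β => midDeriv (Gam bg.g₀) (bg.phase 0) a.h κ μ α β x) α β
      = 0 := by
    simp [midDeriv_zero, lin2]
  have e2 : ∀ A, lin2 (bg.G x) (fun κ μ α β => midDeriv (Gam bg.g₀) (bg.phase ((2 : ℤ) • unit A))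
      (a.F22 A) κ μ α β x) α β = 2 * lin2 (bg.G x) (fun κ μ α β =>
        midDeriv (Gam bg.g₀) (bg.u A) (a.F22 A) κ μ α β x) α β := by
    intro A
    have := lin2_sum_right (Finset.univ : Finset Unit) (fun _ => 2) (bg.G x)
      (fun _ κ μ α β => midDeriv (Gam bg.g₀) (bg.u A) (a.F22 A) κ μ α β x) α β
    simp only [Finset.univ_unique, Finset.sum_singleton] at this
    rw [← this]
    simp only [midDeriv_smul hbg hx, phase_unit]
    norm_num
  simp only [orderTwo, z, e2, phase_unit, lin2_midDeriv_phase hbg hx (ha.frakF _),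
    lin2_midDeriv_phase hbg hx (ha.F21 _), lin2_midDeriv_phase hbg hx (ha.F22 _), angle_unit,
    angle_smul, trig, trigSign, Bool.not_false, Bool.not_true, Int.cast_one, one_mul,
    Int.cast_ofNat]
  simp only [mul_add, mul_sub, Finset.sum_add_distrib, Finset.sum_sub_distrib, neg_mul,
    mul_left_comm _ (2 : ℝ), ← Finset.mul_sum, Finset.sum_neg_distrib]
  ring_nf

/-- The terms with factor `λ³`. -/
lemma sum_linPart_thirdTerm (hbg : bg.IsNullDust) (ha : a.Admissible bg) (hx : x ∈ slab)
    (θ : 𝒜 → ℝ) (α β : Fin 4) :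
    ∑ i, -trig (thirdTerm a i).b (angle (thirdTerm a i).n θ)
        * linPart (bg.G x) (bg.dv x (thirdTerm a i).n) ((thirdTerm a i).S.val x) α β
      = ∑ n ∈ nullPhases 𝒜, ∑ T, trig T (angle n θ)
          * (bg.dv x n α * (-pol bg.g₀ (a.g3h T n) (bg.phase n) β x)
            + bg.dv x n β * (-pol bg.g₀ (a.g3h T n) (bg.phase n) α x))
        + ∑ n ∈ mixedPhases 𝒜, ∑ T, trig T (angle n θ)
          * (pair bg.g₀ (bg.phase n) (bg.phase n) x * a.g3e T n α β x)
        - ∑ n ∈ mixedPhases 𝒜, ∑ T, trig T (angle n θ)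
          * (bg.dv x n α * pol bg.g₀ (a.g3e T n) (bg.phase n) β x
            + bg.dv x n β * pol bg.g₀ (a.g3e T n) (bg.phase n) α x) := by
  rw [sum_thirdTerm a (fun t => -trig t.b (angle t.n θ)
    * linPart (bg.G x) (bg.dv x t.n) (t.S.val x) α β), orderThree, add_sub_assoc,
    ← Finset.sum_sub_distrib]
  -- Multiples of `u_A` are null, so `𝔤^{(3,h)}` enters only through its polarization. For mixed
  -- phases the term with `g₀⁻¹(dv, dv)` remains.
  have hp : ∀ n ∈ nullPhases 𝒜, pair bg.g₀ (bg.phase n) (bg.phase n) x = 0 := by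
    intro n hn
    have : ∃ (k : ℤ) (A : 𝒜), n = k • unit A := by
      simp only [nullPhases, nullPhasesOf, Finset.mem_union, Finset.mem_image] at hn
      rcases hn with (⟨A, _, rfl⟩ | ⟨A, _, rfl⟩) | ⟨A, _, rfl⟩
      exacts [⟨_, A, rfl⟩, ⟨_, A, rfl⟩, ⟨_, A, rfl⟩]
    obtain ⟨k, A, rfl⟩ := this
    have e : ∀ μ, pd μ (bg.phase (k • unit A)) x = k * pd μ (bg.u A) x := fun μ => by
      have := dv_smul hbg hx k (unit A) μ
      rwa [Background.dv_unit] at this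
    have := hbg.eikonal x hx A
    simp only [pair] at this
    have e' : pair bg.g₀ (bg.phase (k • unit A)) (bg.phase (k • unit A)) x
        = k * k * ∑ μ, ∑ ν, inv bg.g₀ μ ν x * pd μ (bg.u A) x * pd ν (bg.u A) x := by
      simp only [pair, e, Finset.mul_sum]
      exact Finset.sum_congr rfl fun _ _ => Finset.sum_congr rfl fun _ _ => by ring
    rw [e', this, mul_zero]
  have l : ∀ (S : Tensor2) n, (∀ α β, S α β = S β α) → linPart (bg.G x) (bg.dv x n) (S.val x) α β
      = opP bg.g₀ (bg.phase n) S α β x := fun S n hS =>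
    linPart_eq_opP (G_symm hbg hx) (fun α β => congrFun (hS α β) x) _ α β
  congr 1
  · refine Finset.sum_congr rfl fun n hn => Finset.sum_congr rfl fun T _ => ?_
    simp only [l _ _ (ha.g3h T n hn).1, opP, hp n hn, Background.dv]
    ring
  · refine Finset.sum_congr rfl fun n hn => ?_
    rw [← Finset.sum_sub_distrib]
    refine Finset.sum_congr rfl fun T _ => ?_
    simp only [l _ _ (ha.g3e T n hn).1, opP, Background.dv]
    ring

/-- The interactions of the terms with factor `λ²` with the terms with factor `λ`. -/
lemma absorbed_interactions (hbg : bg.IsNullDust) : Absorbed bg fun θ a x α β =>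
    ∑ i, ∑ A, interaction bg a θ x (secondTerm a i) A α β
      - ∑ A, (2 * Real.sin (θ A) * Real.sin (2 * θ A) - Real.cos (θ A) * Real.cos (2 * θ A))
        * bg.LL A (a.F22 A) x * a.F1 A α β x
      + ∑ A, Real.sin (2 * θ A) * bg.LL A (a.frakF A) x * a.F1 A α β x
      - ∑ A, Real.cos (θ A)
        * (bg.du x A α * polVec (sandwich (bg.G x) (bg.G x) (a.h.val x)) (bg.du x A)
            ((a.F1 A).val x) β
          + bg.du x A β * polVec (sandwich (bg.G x) (bg.G x) (a.h.val x)) (bg.du x A)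
            ((a.F1 A).val x) α - bg.LL A a.h x * a.F1 A α β x) := by
  have t1 : Absorbed bg fun θ a x α β => ∑ A, ∑ B,
      interaction bg a θ x ⟨2, false, unit A, a.F21 A⟩ B α β := by
    refine Absorbed.sum _ fun A _ => Absorbed.sum _ fun B _ => ?_
    by_cases h : A = B
    · subst h; exact absorbed_interaction_F21_self hbg A
    · exact absorbed_interaction_unit (C := compF21) (S := fun a => a.F21 A) hbg
        (fun μ ν => ⟨A, μ, ν, rfl⟩) (fun m hm => by simp [hm]) h
  have t2 : Absorbed bg fun θ a x α β => ∑ A, ∑ B,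
      (interaction bg a θ x ⟨2, false, unit A, a.frakF A⟩ B α β + if A = B then
        Real.sin (2 * θ A) * bg.LL A (a.frakF A) x * a.F1 A α β x else 0) := by
    refine Absorbed.sum _ fun A _ => Absorbed.sum _ fun B _ => ?_
    by_cases h : A = B
    · subst h; simpa using absorbed_interaction_frakF_self hbg A
    · simpa [h] using absorbed_interaction_unit (C := compFrakF) (S := fun a => a.frakF A) hbg
        (fun μ ν => ⟨A, μ, ν, rfl⟩) (fun m hm => by simp [hm]) h
  have t3 : Absorbed bg fun θ a x α β => ∑ A, ∑ B,
      (interaction bg a θ x ⟨2, true, (2 : ℤ) • unit A, a.F22 A⟩ B α β - if A = B then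
        (2 * Real.sin (θ A) * Real.sin (2 * θ A) - Real.cos (θ A) * Real.cos (2 * θ A))
        * bg.LL A (a.F22 A) x * a.F1 A α β x else 0) := by
    refine Absorbed.sum _ fun A _ => Absorbed.sum _ fun B _ => ?_
    by_cases h : A = B
    · subst h; simpa using absorbed_interaction_F22_self hbg A
    · simpa [h] using absorbed_interaction_F22 hbg h
  have t4 : Absorbed bg fun θ a x α β => ∑ q ∈ (Finset.univ : Finset 𝒜).offDiag, ∑ ε : ℤˣ,
      ∑ D, interaction bg a θ x ⟨2, true, pm q.1 q.2 ε, a.Fpm q.1 q.2 ε⟩ D α β :=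
    Absorbed.sum _ fun q hq => Absorbed.sum _ fun ε _ => Absorbed.sum _ fun D _ =>
      absorbed_interaction_Fpm hbg (Finset.mem_offDiag.1 hq).2.2 ε D
  refine (((t1.add t2).add t3).add t4).congr fun a ha θ x hx α β => ?_
  rw [sum_secondTerm a (fun t => ∑ A, interaction bg a θ x t A α β)]
  simp only [orderTwo, interaction_h hbg ha hx, Finset.sum_add_distrib, Finset.sum_sub_distrib,
    Finset.sum_ite_eq, Finset.mem_univ, if_true]
  ring

/-- The six sums of `twoRicciCoeff_two` are treated separately once the explicit terms are removed.
The angles are free variables, so no relation between the phases is used, and the remainders are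
fixed before the angles and the amplitudes. -/
theorem absorbed_twoRicciCoeff_two (hbg : bg.IsNullDust) : Absorbed bg fun θ a x α β =>
    twoRicciCoeff bg a θ x α β 2 - orderOneMain bg a θ x α β - orderOneGauge bg a θ x α β := by
  refine (((((Absorbed.sum Finset.univ fun A _ => absorbed_nab2 hbg A).add
    (absorbed_mid hbg)).add (absorbed_interactions hbg)).add
    (Absorbed.sum Finset.univ fun A _ => Absorbed.sum Finset.univ fun B _ =>
      absorbed_derivInteraction hbg A B)).add
    (Absorbed.sum Finset.univ fun A _ => Absorbed.sum Finset.univ fun B _ =>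
      Absorbed.sum Finset.univ fun D _ => absorbed_cubic hbg A B D)).congr
      fun a ha θ x hx α β => ?_
  rw [twoRicciCoeff_two hbg hx, sum_linPart_thirdTerm hbg ha hx, orderOneMain, orderOneGauge]
  simp only [gaugeVec, covD1_pol_add hbg hx (ha.frakF _).2 (ha.F21 _).2, mul_add, mul_sub,
    Finset.sum_add_distrib, Finset.sum_sub_distrib]
  ring

end OrderOne

/-! ## The leading part of the derivatives of a profile -/

section Leading

variable {𝒜 : Type*} [Fintype 𝒜] [DecidableEq 𝒜]

/-- As `s → 0⁺`, the profile `f` tends to `k` and `s ∂_β f` tends to `k'`. -/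
structure Leading (bg : Background 𝒜) (x : Spacetime) (θ : 𝒜 → ℝ) (β : Fin 4)
    (f : ℝ × Spacetime × (𝒜 → ℝ) → ℝ) (k k' : ℝ) : Prop where
  diff : ∀ᶠ s in 𝓝[>] (0 : ℝ), DifferentiableWithinAt ℝ f (profileDomain 𝒜) (s, x, θ)
  val : Filter.Tendsto (fun s => f (s, x, θ)) (𝓝[>] (0 : ℝ)) (𝓝 k)
  deriv : Filter.Tendsto (fun s => s * (profile bg).d β f (s, x, θ)) (𝓝[>] (0 : ℝ)) (𝓝 k')

variable {bg : Background 𝒜} {a : Amplitudes 𝒜} {x : Spacetime} {θ : 𝒜 → ℝ} {β : Fin 4}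
  {f g : ℝ × Spacetime × (𝒜 → ℝ) → ℝ} {k k' l l' : ℝ}

lemma tendsto_id_zero : Filter.Tendsto (fun s : ℝ => s) (𝓝[>] (0 : ℝ)) (𝓝 0) :=
  (continuous_id.tendsto (0 : ℝ)).mono_left nhdsWithin_le_nhds

/-- The coefficient of `λ⁻¹` is the first limit in `laurentCoeff`, that of `s ∂_βΥ`. A full
expansion of `Υ` is not needed. -/
lemma dUpsilon_eq {lam : ℝ} {ρ : Fin 4}
    (h : Leading bg x (fun A => bg.u A x / lam) β (upsilon bg a (profile bg) ρ) k k') :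
    dUpsilon bg a lam β ρ x = k' := by
  rw [dUpsilon, coeffAt, show ((-1 : ℤ) + 1).toNat = 0 from rfl, laurentCoeff]
  refine Filter.Tendsto.limUnder_eq (h.deriv.congr fun s => ?_)
  simp [mul_comm]

namespace Leading

lemma congr (h : Leading bg x θ β f k k') (hk : k = l) (hk' : k' = l') :
    Leading bg x θ β f l l' := by
  rwa [hk, hk'] at h

section

variable (hbg : bg.IsNullDust) (hx : x ∈ slab)
include hbg hx

lemma add (h : Leading bg x θ β f k k') (h' : Leading bg x θ β g l l') :
    Leading bg x θ β (fun p => f p + g p) (k + l) (k' + l') := by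
  have R := realization_profile hbg.smooth_phase
  refine ⟨?_, h.val.add h'.val, (h.deriv.add h'.deriv).congr' ?_⟩
  · filter_upwards [h.diff, h'.diff] with s e e' using e.fun_add e'
  · filter_upwards [h.diff, h'.diff, eventually_mem_profileDomain (θ := θ) hx] with s e e' hs
    rw [R.frame.add hs e e', mul_add]

lemma mul (h : Leading bg x θ β f k k') (h' : Leading bg x θ β g l l') :
    Leading bg x θ β (fun p => f p * g p) (k * l) (k' * l + k * l') := by
  have R := realization_profile hbg.smooth_phase
  refine ⟨?_, h.val.mul h'.val, ((h.deriv.mul h'.val).add (h.val.mul h'.deriv)).congr' ?_⟩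
  · filter_upwards [h.diff, h'.diff] with s e e' using e.fun_mul e'
  · filter_upwards [h.diff, h'.diff, eventually_mem_profileDomain (θ := θ) hx] with s e e' hs
    rw [R.frame.mul hs e e']; ring

lemma const (r : ℝ) : Leading bg x θ β (fun _ => r) r 0 := by
  have R := realization_profile hbg.smooth_phase
  refine ⟨Filter.Eventually.of_forall fun _ => differentiableWithinAt_const _, tendsto_const_nhds,
    tendsto_const_nhds.congr' ?_⟩
  filter_upwards [eventually_mem_profileDomain (θ := θ) hx] with s hs
  rw [R.frame.const _ hs, mul_zero]

lemma sub (h : Leading bg x θ β f k k') (h' : Leading bg x θ β g l l') :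
    Leading bg x θ β (fun p => f p - g p) (k - l) (k' - l') := by
  have := h.add hbg hx ((const hbg hx (-1)).mul hbg hx h')
  simpa [sub_eq_add_neg] using this

lemma sum {ι : Type*} (t : Finset ι) {f : ι → ℝ × Spacetime × (𝒜 → ℝ) → ℝ} {k k' : ι → ℝ}
    (h : ∀ i ∈ t, Leading bg x θ β (f i) (k i) (k' i)) :
    Leading bg x θ β (fun p => ∑ i ∈ t, f i p) (∑ i ∈ t, k i) (∑ i ∈ t, k' i) := by
  classical
  induction t using Finset.induction_on with
  | empty => simpa using const hbg hx 0
  | insert i t hi ih =>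
    simp only [Finset.sum_insert hi]
    exact (h i (Finset.mem_insert_self _ _)).add hbg hx
      (ih fun j hj => h j (Finset.mem_insert_of_mem hj))

lemma field {S : Scalar} (hS : ContDiffOn ℝ 1 S slab) :
    Leading bg x θ β ((profile bg).field S) (S x) 0 := by
  have R := realization_profile hbg.smooth_phase
  refine ⟨?_, tendsto_const_nhds, ?_⟩
  · filter_upwards [eventually_mem_profileDomain (θ := θ) hx] with s hs
    exact (R.field_smooth 1 S hS _ hs).differentiableWithinAt (by norm_num)
  · have := tendsto_id_zero.mul_const (pd β S x)
    rw [zero_mul] at this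
    refine this.congr' ?_
    filter_upwards [eventually_mem_profileDomain (θ := θ) hx] with s hs
    rw [R.d_field _ _ _ hs]

lemma d_field {S : Scalar} (hS : ContDiffOn ℝ 2 S slab) (μ : Fin 4) :
    Leading bg x θ β ((profile bg).d μ ((profile bg).field S)) (pd μ S x) 0 := by
  have R := realization_profile hbg.smooth_phase
  have h := field (θ := θ) (β := β) hbg hx (isFrame_pd.contDiffOn hS μ)
  have e : ∀ q ∈ profileDomain 𝒜, (profile bg).d μ ((profile bg).field S) q
      = (profile bg).field (pd μ S) q := fun q hq => by
    rw [R.d_field _ _ q hq, R.field_apply]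
  refine ⟨?_, h.val.congr' ?_, h.deriv.congr' ?_⟩
  · filter_upwards [h.diff, eventually_mem_profileDomain (θ := θ) hx] with s hs hp
    exact hs.congr e (e _ hp)
  · filter_upwards [eventually_mem_profileDomain (θ := θ) hx] with s hp
    rw [e _ hp]
  · filter_upwards [h.diff, eventually_mem_profileDomain (θ := θ) hx] with s hs hp
    rw [R.frame.congr_on hp e hs]

lemma osc (b : Bool) (n : 𝒜 → ℤ) :
    Leading bg x θ β ((profile bg).osc (trig b) n) (trig b (angle n θ))
      (bg.dv x n β * (trigSign b * trig (!b) (angle n θ))) := by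
  have R := realization_profile hbg.smooth_phase
  refine ⟨?_, tendsto_const_nhds, tendsto_const_nhds.congr' ?_⟩
  · filter_upwards [eventually_mem_profileDomain (θ := θ) hx] with s hs
    exact (R.osc_smooth b n _ hs).differentiableWithinAt (by norm_num)
  · filter_upwards [eventually_mem_profileDomain (θ := θ) hx] with s hs
    have hs0 : s ≠ 0 := hs.1
    rw [R.d_osc _ _ _ _ hs, R.osc_apply]
    simp only [profile, Background.dv]
    field_simp

lemma osc_deriv (b : Bool) (n : 𝒜 → ℤ) :
    Leading bg x θ β ((profile bg).osc (_root_.deriv (trig b)) n)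
      (trigSign b * trig (!b) (angle n θ)) (-(bg.dv x n β * trig b (angle n θ))) := by
  have := (const hbg hx (trigSign b)).mul hbg hx (osc (θ := θ) (β := β) hbg hx (!b) n)
  rw [deriv_trig]
  refine this.congr rfl ?_
  have := trigSign_mul b
  rw [Bool.not_not]
  linear_combination (bg.dv x n β * trig b (angle n θ)) * this

/-- A factor `s` suppresses both the value and the leading derivative. This discards the sums in `Υ`
that carry an explicit `λ`. -/
lemma lam_mul (h : Leading bg x θ β f k k') :
    Leading bg x θ β (fun p => (profile bg).lam p * f p) 0 0 := by
  have R := realization_profile hbg.smooth_phase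
  have hl : Leading bg x θ β (profile bg).lam 0 0 := by
    refine ⟨?_, tendsto_id_zero, tendsto_const_nhds.congr' ?_⟩
    · filter_upwards [eventually_mem_profileDomain (θ := θ) hx] with s hs
      exact (R.lam_smooth _ hs).differentiableWithinAt (by norm_num)
    · filter_upwards [eventually_mem_profileDomain (θ := θ) hx] with s hs
      rw [show (profile bg).lam = fun q => id ((profile bg).lam q) from rfl, R.d_lam _ _ _ hs,
        mul_zero]
  exact (hl.mul hbg hx h).congr (by ring) (by ring)

lemma gaugeDeriv {S : Tensor2} (hS : ∀ μ ν, ContDiffOn ℝ 2 (S μ ν) slab) (μ ν σ : Fin 4) :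
    Leading bg x θ β (gaugeDeriv (profile bg) S μ ν σ)
      (pd μ (S σ ν) x - (1 / 2) * pd σ (S μ ν) x) 0 :=
  ((d_field hbg hx (hS σ ν) μ).sub hbg hx ((const hbg hx (1 / 2)).mul hbg hx
    (d_field hbg hx (hS μ ν) σ))).congr rfl (by ring)

lemma gaugeSymbol {v : Scalar} (hv : ContDiffOn ℝ 2 v slab) {S : Tensor2}
    (hS : ∀ μ ν, ContDiffOn ℝ 2 (S μ ν) slab) (μ ν σ : Fin 4) :
    Leading bg x θ β (gaugeSymbol (profile bg) v S μ ν σ)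
      (pd μ v x * S σ ν x - (1 / 2) * (pd σ v x * S μ ν x)) 0 := by
  have h := fun μ => field (θ := θ) (β := β) hbg hx (isFrame_pd.contDiffOn hv μ)
  have h' := fun μ ν => field (θ := θ) (β := β) hbg hx ((hS μ ν).of_le (by norm_num))
  exact (((h μ).mul hbg hx (h' σ ν)).sub hbg hx ((const hbg hx (1 / 2)).mul hbg hx
    ((h σ).mul hbg hx (h' μ ν)))).congr rfl (by ring)

end

end Leading

/-- The coordinate derivatives of the metric. -/
lemma d_metric {E : Type*} [NormedAddCommGroup E] [NormedSpace ℝ E] {c : Calculus 𝒜 E}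
    {D : Set E} {V : Fin 4 → E → E} {pos : E → Spacetime} {ang : E → 𝒜 → ℝ}
    (R : Realization bg c D V pos ang) (hbg : bg.IsNullDust) (ha : a.Admissible bg) {p : E}
    (hp : p ∈ D) (μ α β : Fin 4) : c.d μ (metric bg a c α β) p
      = ∑ m ∈ Finset.range 4, c.lam p ^ m * nabCoeff bg a 0 (ang p) (pos p) m μ α β := by
  rw [← nab_metric R hbg ha hp]
  simp [nab, R.field_apply]

/-- The oscillations of the metric start at order `λ`, so its first derivatives stay bounded and `s
∂g⁻¹` tends to zero. Inside the leading part of `∂Υ` the inverse metric may thus be replaced by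
`g₀⁻¹`. -/
lemma Leading.inv_metric (hbg : bg.IsNullDust) (ha : a.Admissible bg) (hx : x ∈ slab)
    (ρ σ : Fin 4) :
    Leading bg x θ β (inv (metric bg a (profile bg)) ρ σ) (bg.G x ρ σ) 0 := by
  have R := realization_profile hbg.smooth_phase
  have hm := fun a' b => (metric_smooth R hbg ha a' b).of_le (by norm_num : (1 : WithTop ℕ∞) ≤ 2)
  have hv : ∀ ρ σ, Filter.Tendsto (fun s => inv (metric bg a (profile bg)) ρ σ (s, x, θ))
      (𝓝[>] (0 : ℝ)) (𝓝 (bg.G x ρ σ)) := fun ρ σ => by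
    change Filter.Tendsto _ _ (𝓝 (invCoeff bg a θ x 0 ρ σ))
    simpa using (hasExp_inv_profile (a := a) (θ := θ) hbg hx ρ σ).tendsto
      (by norm_num : 0 < 3)
  have hd : ∀ μ ν, Filter.Tendsto (fun s => s * ∑ m ∈ Finset.range 4, s ^ m
      * nabCoeff bg a 0 θ x m β μ ν) (𝓝[>] (0 : ℝ)) (𝓝 0) := by
    intro μ ν
    have : Continuous fun s : ℝ => s * ∑ m ∈ Finset.range 4, s ^ m * nabCoeff bg a 0 θ x m β μ ν := by
      fun_prop
    simpa using (this.tendsto 0).mono_left nhdsWithin_le_nhds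
  have main : Filter.Tendsto (fun s => -∑ μ, ∑ ν, inv (metric bg a (profile bg)) ρ μ (s, x, θ)
      * (s * ∑ m ∈ Finset.range 4, s ^ m * nabCoeff bg a 0 θ x m β μ ν)
      * inv (metric bg a (profile bg)) ν σ (s, x, θ)) (𝓝[>] (0 : ℝ)) (𝓝 0) := by
    have := (tendsto_finsetSum Finset.univ fun μ _ => tendsto_finsetSum Finset.univ fun ν _ =>
      ((hv ρ μ).mul (hd μ ν)).mul (hv ν σ)).neg
    simpa using this
  refine ⟨?_, hv ρ σ, main.congr' ?_⟩
  · filter_upwards [eventually_mem_profileDomain (θ := θ) hx,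
      eventually_det_profile (a := a) (θ := θ) hbg hx] with s hs hdet
    exact (contDiffWithinAt_inv (fun a' b => hm a' b _ hs) hdet ρ σ).differentiableWithinAt
      (by norm_num)
  · filter_upwards [eventually_mem_profileDomain (θ := θ) hx,
      eventually_det_profile (a := a) (θ := θ) hbg hx] with s hs hdet
    rw [R.frame.deriv_inv hm hs hdet, mul_neg, Finset.mul_sum]
    congr 1
    refine Finset.sum_congr rfl fun μ _ => ?_
    rw [Finset.mul_sum]
    refine Finset.sum_congr rfl fun ν _ => ?_
    rw [d_metric R hbg ha hs]
    simp only [profile]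
    ring

omit [DecidableEq 𝒜] in
lemma raise_smooth (hbg : bg.IsNullDust) {S : Tensor2}
    (hS : ∀ μ ν, ContDiffOn ℝ 2 (S μ ν) slab) (μ ν : Fin 4) :
    ContDiffOn ℝ 2 (raise bg.g₀ S μ ν) slab :=
  ContDiffOn.sum fun α _ => ContDiffOn.sum fun β _ =>
    ((inv_g₀_smooth hbg μ α).mul (inv_g₀_smooth hbg ν β)).mul (hS α β)

/-- The leading part of the derivatives of `Υ`. -/
lemma exists_leading_upsilon (hbg : bg.IsNullDust) (ha : a.Admissible bg) (hx : x ∈ slab)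
    (ρ : Fin 4) : ∃ k, Leading bg x θ β (upsilon bg a (profile bg) ρ) k
      (∑ σ, bg.G x ρ σ * (∑ μ, ∑ ν, bg.G x μ ν
          * (∑ A, bg.du x A β * Real.cos (θ A)
              * (pd μ (a.frakF A σ ν) x - (1 / 2) * pd σ (a.frakF A μ ν) x)
            - ∑ n ∈ mixedPhases 𝒜, ∑ T, bg.dv x n β * trig T (angle n θ)
              * (pd μ (bg.phase n) x * a.g3e T n σ ν x
                - (1 / 2) * (pd σ (bg.phase n) x * a.g3e T n μ ν x)))
        + ∑ μ, ∑ ν, raise bg.g₀ a.h μ ν x * ∑ A, bg.du x A β * Real.cos (θ A)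
            * (pd μ (bg.u A) x * a.F1 A σ ν x - (1 / 2) * (pd σ (bg.u A) x * a.F1 A μ ν x)))) := by
  have i := fun ρ σ => Leading.inv_metric (θ := θ) (β := β) hbg ha hx ρ σ
  have gd := fun {S : Tensor2} (hS : IsSymmC2 S) (μ ν σ : Fin 4) =>
    Leading.gaugeDeriv (θ := θ) (β := β) hbg hx hS.2 μ ν σ
  have os := fun b n => Leading.osc (θ := θ) (β := β) hbg hx b n
  have od := fun b n => Leading.osc_deriv (θ := θ) (β := β) hbg hx b n
  have g0 := fun ρ σ => Leading.field (θ := θ) (β := β) hbg hx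
    ((inv_g₀_smooth hbg ρ σ).of_le (by norm_num))
  have rh := fun μ ν => Leading.field (θ := θ) (β := β) hbg hx
    ((raise_smooth hbg ha.h.2 μ ν).of_le (by norm_num))
  have gs := fun {v : Scalar} (hv : ContDiffOn ℝ 2 v slab) {S : Tensor2} (hS : IsSymmC2 S)
    (μ ν σ : Fin 4) => Leading.gaugeSymbol (θ := θ) (β := β) hbg hx hv hS.2 μ ν σ
  have K := fun μ ν σ => ((((gd ha.h μ ν σ).add hbg hx
    (Leading.sum hbg hx Finset.univ fun A _ =>
      (os false (unit A)).mul hbg hx (gd (ha.frakF A) μ ν σ))).add hbg hx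
    (Leading.lam_mul hbg hx (Leading.sum hbg hx (nullPhases 𝒜) fun n hn =>
      Leading.sum hbg hx Finset.univ fun T _ =>
        (os T n).mul hbg hx (gd (ha.g3h T n hn) μ ν σ)))).add hbg hx
    (Leading.lam_mul hbg hx (Leading.sum hbg hx (mixedPhases 𝒜) fun n hn =>
      Leading.sum hbg hx Finset.univ fun T _ =>
        (os T n).mul hbg hx (gd (ha.g3e T n hn) μ ν σ)))).add hbg hx
    (Leading.sum hbg hx (mixedPhases 𝒜) fun n hn =>
      Leading.sum hbg hx Finset.univ fun T _ =>
        (od T n).mul hbg hx (gs (contDiffOn_phase hbg.smooth_phase n) (ha.g3e T n hn) μ ν σ))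
  have W := fun μ ν σ => (Leading.gaugeDeriv (θ := θ) (β := β) hbg hx hbg.smooth_metric μ ν σ).sub
    hbg hx (Leading.sum hbg hx Finset.univ fun A _ =>
      (os false (unit A)).mul hbg hx (gs (hbg.smooth_phase A) (ha.F1 A) μ ν σ))
  have Y := (Leading.sum hbg hx Finset.univ fun σ _ => Leading.sum hbg hx Finset.univ fun μ _ =>
    Leading.sum hbg hx Finset.univ fun ν _ =>
      ((i ρ σ).mul hbg hx (i μ ν)).mul hbg hx (K μ ν σ)).sub hbg hx
    (Leading.sum hbg hx Finset.univ fun σ _ => Leading.sum hbg hx Finset.univ fun μ _ =>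
      Leading.sum hbg hx Finset.univ fun ν _ =>
        ((g0 ρ σ).mul hbg hx (rh μ ν)).mul hbg hx (W μ ν σ))
  -- Only the limit of `s ∂_βΥ` is used later, so the limit of `Υ` itself is left unnamed.
  refine ⟨_, Y.congr rfl ?_⟩
  simp only [mul_zero, zero_mul, zero_add, add_zero, Background.dv_unit, angle_unit, trigSign,
    Bool.not_false, show ∀ t, trig true t = Real.cos t from fun _ => rfl, one_mul, zero_sub, mul_neg]
  rw [← Finset.sum_sub_distrib]
  refine Finset.sum_congr rfl fun σ _ => ?_
  simp only [neg_mul, Finset.sum_neg_distrib, sub_neg_eq_add, ← sub_eq_add_neg]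
  rw [mul_add, Finset.mul_sum, Finset.mul_sum]
  congr 1 <;> refine Finset.sum_congr rfl fun μ _ => ?_ <;> rw [Finset.mul_sum] <;>
    exact Finset.sum_congr rfl fun ν _ => mul_assoc _ _ _

omit [Fintype 𝒜] [DecidableEq 𝒜] in
lemma weighted_sum_comm {ι : Type*} (t : Finset ι) (W : Fin 4 → Fin 4 → ℝ) (k : ι → ℝ)
    (K : ι → Fin 4 → Fin 4 → ℝ) : ∑ μ, ∑ ν, W μ ν * ∑ i ∈ t, k i * K i μ ν
      = ∑ i ∈ t, k i * ∑ μ, ∑ ν, W μ ν * K i μ ν := by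
  simp only [Finset.mul_sum]
  rw [Finset.sum_comm]
  conv_rhs => rw [Finset.sum_comm]; enter [2, μ]; rw [Finset.sum_comm]
  rw [Finset.sum_comm]
  exact Finset.sum_congr rfl fun _ _ => Finset.sum_congr rfl fun _ _ =>
    Finset.sum_congr rfl fun _ _ => mul_left_comm _ _ _

omit [Fintype 𝒜] [DecidableEq 𝒜] in
lemma weighted_sum_comm₂ {ι κ : Type*} (t : Finset ι) (t' : Finset κ) (W : Fin 4 → Fin 4 → ℝ)
    (k : ι → κ → ℝ) (K : ι → κ → Fin 4 → Fin 4 → ℝ) :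
    ∑ μ, ∑ ν, W μ ν * ∑ i ∈ t, ∑ j ∈ t', k i j * K i j μ ν
      = ∑ i ∈ t, ∑ j ∈ t', k i j * ∑ μ, ∑ ν, W μ ν * K i j μ ν := by
  have := weighted_sum_comm (t ×ˢ t') W (fun i => k i.1 i.2) fun i => K i.1 i.2
  simpa only [Finset.sum_product] using this

/-- The derivatives of `Υ` at leading order, with the index lowered. -/
lemma sum_dUpsilon (hbg : bg.IsNullDust) (ha : a.Admissible bg) (hx : x ∈ slab) (lam : ℝ)
    (α β : Fin 4) : ∑ ρ, bg.g₀ ρ α x * dUpsilon bg a lam β ρ x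
      = ∑ A, Real.cos (bg.u A x / lam) * (bg.du x A β * gaugeVec bg a x A α)
        - ∑ n ∈ mixedPhases 𝒜, ∑ T, trig T (bg.phase n x / lam)
          * (bg.dv x n β * pol bg.g₀ (a.g3e T n) (bg.phase n) α x) := by
  have Gs : ∀ μ ν, bg.G x μ ν = bg.G x ν μ := fun μ ν => inv_symm (g₀_symm hbg hx) μ ν
  have δ : ∀ f : Fin 4 → ℝ, ∑ ρ, bg.g₀ ρ α x * ∑ σ, bg.G x ρ σ * f σ = f α := by
    intro f
    simp only [Finset.mul_sum]
    rw [Finset.sum_comm]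
    have : ∀ σ, ∑ ρ, bg.g₀ ρ α x * (bg.G x ρ σ * f σ) = (if α = σ then 1 else 0) * f σ := by
      intro σ
      rw [← metric_mul_inv (g₀_det hbg hx) α σ, Finset.sum_mul]
      refine Finset.sum_congr rfl fun ρ _ => ?_
      rw [g₀_symm hbg hx ρ α, mul_assoc]; rfl
    simp [this]
  have e := fun ρ => (exists_leading_upsilon (θ := fun A => bg.u A x / lam) (β := β) hbg ha hx
    ρ).elim fun _ h => dUpsilon_eq h
  simp only [e]
  rw [δ]
  have h1 : ∀ A, ∑ μ, ∑ ν, bg.G x μ ν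
      * (pd μ (a.frakF A α ν) x - (1 / 2) * pd α (a.frakF A μ ν) x) = divTerm bg (a.frakF A) α x :=
    fun A => rfl
  -- This is the role of the symbols `E^v` in `Υ`: their trace is the polarization tensor left over
  -- from `𝒫_v(𝔤^{(3,e)})`.
  have h2 : ∀ n T, ∑ μ, ∑ ν, bg.G x μ ν * (pd μ (bg.phase n) x * a.g3e T n α ν x
      - (1 / 2) * (pd α (bg.phase n) x * a.g3e T n μ ν x))
      = pol bg.g₀ (a.g3e T n) (bg.phase n) α x := by
    intro n T
    simp only [pol, trace, mul_sub, Finset.sum_sub_distrib]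
    congr 1
    · rw [Finset.sum_comm]
      refine Finset.sum_congr rfl fun μ _ => Finset.sum_congr rfl fun ν _ => ?_
      rw [Gs]; simp only [Background.G]; ring
    · simp only [Finset.mul_sum, Finset.sum_mul]
      refine Finset.sum_congr rfl fun μ _ => Finset.sum_congr rfl fun ν _ => ?_
      simp only [Background.G]; ring
  have hr : ∀ μ ν, raise bg.g₀ a.h μ ν x = sandwich (bg.G x) (bg.G x) (a.h.val x) μ ν := by
    intro μ ν
    simp only [raise, sandwich]
    refine Finset.sum_congr rfl fun κ _ => Finset.sum_congr rfl fun τ _ => ?_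
    rw [Gs τ ν]; simp only [Background.G, Tensor2.val]; ring
  -- Contracting with the raised `h` reproduces the covector that `interaction_h` could not place in
  -- a bracket.
  have h3 : ∀ A, ∑ μ, ∑ ν, raise bg.g₀ a.h μ ν x * (pd μ (bg.u A) x * a.F1 A α ν x
      - (1 / 2) * (pd α (bg.u A) x * a.F1 A μ ν x))
      = polVec (sandwich (bg.G x) (bg.G x) (a.h.val x)) (bg.du x A) ((a.F1 A).val x) α := by
    intro A
    have hs := sandwich_symm Gs (f := a.h.val x) fun μ ν => by
      simp only [Tensor2.val, ha.h.1 μ ν]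
    simp only [hr, polVec, contr, up, mul_sub, Finset.sum_sub_distrib]
    congr 1
    · rw [Finset.sum_comm]
      refine Finset.sum_congr rfl fun μ _ => ?_
      rw [Finset.sum_mul]
      refine Finset.sum_congr rfl fun ν _ => ?_
      rw [hs, (ha.F1 A).1 α]; simp only [Background.du, Tensor2.val]; ring
    · simp only [Finset.mul_sum]
      refine Finset.sum_congr rfl fun μ _ => Finset.sum_congr rfl fun ν _ => ?_
      simp only [Background.du, Tensor2.val]; ring
  have s1 : ∑ μ, ∑ ν, bg.G x μ ν * (∑ A, bg.du x A β * Real.cos (bg.u A x / lam)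
        * (pd μ (a.frakF A α ν) x - 1 / 2 * pd α (a.frakF A μ ν) x)
      - ∑ n ∈ mixedPhases 𝒜, ∑ T, bg.dv x n β * trig T (angle n fun A => bg.u A x / lam)
        * (pd μ (bg.phase n) x * a.g3e T n α ν x - 1 / 2 * (pd α (bg.phase n) x * a.g3e T n μ ν x)))
      = ∑ A, bg.du x A β * Real.cos (bg.u A x / lam) * divTerm bg (a.frakF A) α x
        - ∑ n ∈ mixedPhases 𝒜, ∑ T, bg.dv x n β * trig T (angle n fun A => bg.u A x / lam)
          * pol bg.g₀ (a.g3e T n) (bg.phase n) α x := by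
    simp only [mul_sub (bg.G x _ _) (∑ A, _), Finset.sum_sub_distrib]
    congr 1
    · rw [weighted_sum_comm]; rfl
    · rw [weighted_sum_comm₂]; simp only [h2]
  rw [s1, weighted_sum_comm]
  simp only [h3, gaugeVec, angle_phase, mul_add, Finset.sum_add_distrib]
  simp only [add_sub_right_comm]
  simp only [mul_comm, mul_left_comm, mul_assoc]

/-- Symmetrization of `sum_dUpsilon`; the terms set aside at order `1` are exactly the contribution
of `Υ`. -/
lemma orderOneGauge_eq (hbg : bg.IsNullDust) (ha : a.Admissible bg) (hx : x ∈ slab) (lam : ℝ)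
    (α β : Fin 4) : orderOneGauge bg a (fun A => bg.u A x / lam) x α β
      = ∑ ρ, (bg.g₀ ρ α x * dUpsilon bg a lam β ρ x + bg.g₀ ρ β x * dUpsilon bg a lam α ρ x) := by
  rw [Finset.sum_add_distrib, sum_dUpsilon hbg ha hx, sum_dUpsilon hbg ha hx]
  simp only [orderOneGauge, angle_phase, mul_add, Finset.sum_add_distrib]
  ring

/-- The coefficient of order `1` of the Ricci tensor. -/
theorem exists_twoRicciCoeff_two (hbg : bg.IsNullDust) :
    ∃ r : Remainders 𝒜, r.IsSchematic ∧ ∀ a : Amplitudes 𝒜, a.Admissible bg → ∀ lam : ℝ,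
      ∀ x ∈ slab, ∀ α β, twoRicciCoeff bg a (fun A => bg.u A x / lam) x α β 2
        = 2 * R1 bg a lam (fun A μ ν => r.r11 A μ ν a) (fun A μ ν => r.r12 A μ ν a)
          (fun T n μ => r.rh T n μ a) (fun T n μ ν => r.re T n μ ν a) α β x := by
  obtain ⟨r, hr, h⟩ := absorbed_twoRicciCoeff_two hbg
  refine ⟨r, hr, fun a ha lam x hx α β => ?_⟩
  have e := h a ha (fun A => bg.u A x / lam) x hx α β
  beta_reduce at e
  rw [sub_sub, sub_eq_iff_eq_add] at e
  rw [e, orderOneGauge_eq hbg ha hx]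
  simp only [Remainders.total, orderOneMain, R1, twoR1null, twoR1mixed, angle_phase, mul_add,
    mul_sub, Finset.sum_add_distrib, Finset.sum_sub_distrib, mul_div_assoc, Background.dv, mul_neg,
    Finset.sum_neg_distrib, neg_add]
  ring

end Leading

/-! ## Closure properties of oscillating brackets -/

section OscBracket

variable {𝒜 : Type*} [Fintype 𝒜] {bg : Background 𝒜} {S S' : Set (OscFunctional 𝒜)}
  {Φ Ψ : OscFunctional 𝒜}

lemma mem_oscBracket {ι : Type*} [Fintype ι] (c : ι → Scalar) (k : ι → ℕ) (T : ι → Bool)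
    (z : ι → 𝒜 → ℤ) (m : ι → OscFunctional 𝒜) (hc : ∀ i, ContinuousOn (c i) slab)
    (hm : ∀ i, m i ∈ S) (h : ∀ lam a, ∀ x ∈ slab, Φ lam a x
      = ∑ i, c i x * lam ^ k i * trig (T i) (bg.phase (z i) x / lam) * m i lam a x) :
    Φ ∈ oscBracket bg S := by
  let e := Fintype.equivFin ι
  refine ⟨Fintype.card ι, fun j => c (e.symm j), fun j => k (e.symm j), fun j => T (e.symm j),
    fun j => z (e.symm j), fun j => m (e.symm j), fun j => hc _, fun j => hm _,
    fun lam a x hx => ?_⟩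
  rw [h lam a x hx]
  exact (e.symm.sum_comp fun i => c i x * lam ^ k i * trig (T i) (bg.phase (z i) x / lam)
    * m i lam a x).symm

lemma oscBracket_congr (hΨ : Ψ ∈ oscBracket bg S) (h : ∀ lam a, ∀ x ∈ slab, Φ lam a x = Ψ lam a x) :
    Φ ∈ oscBracket bg S := by
  obtain ⟨N, c, k, T, z, m, hc, hm, e⟩ := hΨ
  exact ⟨N, c, k, T, z, m, hc, hm, fun lam a x hx => by rw [h lam a x hx, e lam a x hx]⟩

lemma osc_mul_mem {c : Scalar} (hc : ContinuousOn c slab) {m : OscFunctional 𝒜} (hm : m ∈ S)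
    (b : Bool) (n : 𝒜 → ℤ) : (fun lam a x => trig b (angle n fun A => bg.u A x / lam)
      * (c x * m lam a x)) ∈ oscBracket bg S :=
  mem_oscBracket (fun _ : Unit => c) (fun _ => 0) (fun _ => b) (fun _ => n) (fun _ => m)
    (fun _ => hc) (fun _ => hm) fun lam a x _ => by
      simp only [angle, Background.phase, Finset.sum_div, mul_div_assoc, Finset.univ_unique,
        Finset.sum_singleton, pow_zero]
      ring

lemma mul_mem_oscBracket {c : Scalar} (hc : ContinuousOn c slab) {m : OscFunctional 𝒜}
    (hm : m ∈ S) : (fun lam a x => c x * m lam a x) ∈ oscBracket bg S :=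
  oscBracket_congr (osc_mul_mem hc hm true 0) fun lam a x _ => by
    simp [angle, trig]

lemma oscBracket_zero : (fun _ _ _ => (0 : ℝ)) ∈ oscBracket bg S :=
  mem_oscBracket (fun i : Empty => nomatch i) (fun i => nomatch i) (fun i => nomatch i)
    (fun i => nomatch i) (fun i => nomatch i) (fun i => nomatch i) (fun i => nomatch i)
    fun lam a x _ => by simp

lemma oscBracket_add (hΦ : Φ ∈ oscBracket bg S) (hΨ : Ψ ∈ oscBracket bg S) :
    (fun lam a x => Φ lam a x + Ψ lam a x) ∈ oscBracket bg S := by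
  obtain ⟨N, c, k, T, z, m, hc, hm, e⟩ := hΦ
  obtain ⟨N', c', k', T', z', m', hc', hm', e'⟩ := hΨ
  refine mem_oscBracket (Sum.elim c c') (Sum.elim k k') (Sum.elim T T') (Sum.elim z z')
    (Sum.elim m m') ?_ ?_ fun lam a x hx => ?_
  · rintro (i | i); exacts [hc i, hc' i]
  · rintro (i | i); exacts [hm i, hm' i]
  · rw [e lam a x hx, e' lam a x hx, Fintype.sum_sum_type]; rfl

lemma oscBracket_const_mul (r : ℝ) (hΦ : Φ ∈ oscBracket bg S) :
    (fun lam a x => r * Φ lam a x) ∈ oscBracket bg S := by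
  obtain ⟨N, c, k, T, z, m, hc, hm, e⟩ := hΦ
  refine ⟨N, fun i x => r * c i x, k, T, z, m, fun i => continuousOn_const.mul (hc i), hm,
    fun lam a x hx => ?_⟩
  simp only [e lam a x hx, Finset.mul_sum]
  exact Finset.sum_congr rfl fun i _ => by ring

lemma oscBracket_sub (hΦ : Φ ∈ oscBracket bg S) (hΨ : Ψ ∈ oscBracket bg S) :
    (fun lam a x => Φ lam a x - Ψ lam a x) ∈ oscBracket bg S :=
  oscBracket_congr (oscBracket_add hΦ (oscBracket_const_mul (-1) hΨ)) fun lam a x _ => by ring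

lemma oscBracket_sum {ι : Type*} (t : Finset ι) {Φ : ι → OscFunctional 𝒜}
    (h : ∀ i ∈ t, Φ i ∈ oscBracket bg S) :
    (fun lam a x => ∑ i ∈ t, Φ i lam a x) ∈ oscBracket bg S := by
  classical
  induction t using Finset.induction_on with
  | empty => simpa using oscBracket_zero
  | insert i t hi ih =>
    refine oscBracket_congr (oscBracket_add (h i (Finset.mem_insert_self i t))
      (ih fun j hj => h j (Finset.mem_insert_of_mem hj))) fun lam a x _ => ?_
    rw [Finset.sum_insert hi]

end OscBracket

/-! ## The quadratic part is a combination of products -/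

section QuadraticForms

/-- The components of an inverse metric and of the derivatives of a metric. -/
abbrev FirstJet : Type := (Fin 4 → Fin 4 → ℝ) × (Fin 4 → Fin 4 → Fin 4 → ℝ)

/-- The linear forms in the inverse metric. -/
def invForms : Submodule ℝ (FirstJet → ℝ) :=
  Submodule.span ℝ {f | ∃ ρ σ, f = fun p => p.1 ρ σ}

/-- The linear forms in the derivatives of the metric. -/
def derivForms : Submodule ℝ (FirstJet → ℝ) :=
  Submodule.span ℝ {f | ∃ μ α β, f = fun p => p.2 μ α β}

/-- A component of `g⁻¹ g⁻¹ ∂g ∂g`. -/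
def quadraticMonomial (i : Fin 4 → Fin 4) (j k : Fin 3 → Fin 4) (p : FirstJet) : ℝ :=
  p.1 (i 0) (i 1) * p.1 (i 2) (i 3) * p.2 (j 0) (j 1) (j 2) * p.2 (k 0) (k 1) (k 2)

lemma inv_mem_invForms (ρ σ : Fin 4) : (fun p : FirstJet => p.1 ρ σ) ∈ invForms :=
  Submodule.subset_span ⟨ρ, σ, rfl⟩

lemma deriv_mem_derivForms (μ α β : Fin 4) : (fun p : FirstJet => p.2 μ α β) ∈ derivForms :=
  Submodule.subset_span ⟨μ, α, β, rfl⟩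

lemma lower_mem_derivForms (μ ν σ : Fin 4) :
    (fun p : FirstJet => lower p.2 μ ν σ) ∈ derivForms :=
  derivForms.smul_mem (1 / 2) (derivForms.sub_mem (derivForms.add_mem
    (deriv_mem_derivForms μ ν σ) (deriv_mem_derivForms ν μ σ)) (deriv_mem_derivForms σ μ ν))

lemma forms_le_span : invForms * invForms * (derivForms * derivForms)
    ≤ Submodule.span ℝ {f | ∃ i j k, f = quadraticMonomial i j k} := by
  simp only [invForms, derivForms, Submodule.span_mul_span]
  refine Submodule.span_mono ?_
  rintro _ ⟨_, ⟨_, ⟨i, i', rfl⟩, _, ⟨j, j', rfl⟩, rfl⟩, _, ⟨_, ⟨k, k', k'', rfl⟩, _,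
    ⟨l, l', l'', rfl⟩, rfl⟩, rfl⟩
  refine ⟨![i, i', j, j'], ![k, k', k''], ![l, l', l''], funext fun p => ?_⟩
  simp [quadraticMonomial, mul_assoc]

/-- Taking a tail is linear, so it suffices to know that this form is a combination of monomials
`g⁻¹g⁻¹∂g∂g`. With the formal variables of `FirstJet`, the verification amounts to counting two
inverse metrics and two derivatives in every product. -/
lemma reducedQuad_mem_span (α β : Fin 4) : (fun p : FirstJet => reducedQuad p.1 p.2 α β)
    ∈ Submodule.span ℝ {f | ∃ i j k, f = quadraticMonomial i j k} := by
  refine forms_le_span ?_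
  have G := inv_mem_invForms
  have K := deriv_mem_derivForms
  have l := lower_mem_derivForms
  have two : ∀ (r : ℝ) {f : FirstJet → ℝ}, f ∈ derivForms → (fun p => r * f p) ∈ derivForms :=
    fun r f hf => derivForms.smul_mem r hf
  have su : ∀ {M : Submodule ℝ (FirstJet → ℝ)} {f : Fin 4 → FirstJet → ℝ}, (∀ i, f i ∈ M) →
      (fun p => ∑ i, f i p) ∈ M := by
    intro M f hf
    have := M.sum_mem (t := Finset.univ) fun i _ => hf i
    convert this using 1
    funext p; simp
  have mm : ∀ {M N : Submodule ℝ (FirstJet → ℝ)} {f g : FirstJet → ℝ}, f ∈ M → g ∈ N →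
      (fun p => f p * g p) ∈ M * N := fun hf hg => Submodule.mul_mem_mul hf hg
  have md : ∀ γ δ : Fin 4, (fun p : FirstJet => ∑ μ, ∑ ν,
      (∑ m, ∑ n, p.1 μ m * p.2 γ m n * p.1 n ν) * lower p.2 μ ν δ)
      ∈ invForms * invForms * (derivForms * derivForms) := by
    intro γ δ
    have : invForms * invForms * (derivForms * derivForms)
        = invForms * derivForms * invForms * derivForms := by ring
    rw [this]
    exact su fun μ => su fun ν => mm (su fun m => su fun n => mm (mm (G _ _) (K _ _ _)) (G _ _))
      (l _ _ _)
  have last : (fun p : FirstJet => ∑ ρ, (∑ μ, ∑ ν, p.1 μ ν * ∑ σ, p.1 ρ σ * lower p.2 μ ν σ)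
      * (p.2 ρ α β - p.2 β ρ α - p.2 α ρ β))
      ∈ invForms * invForms * (derivForms * derivForms) := by
    have : invForms * invForms * (derivForms * derivForms)
        = invForms * (invForms * derivForms) * derivForms := by ring
    rw [this]
    exact su fun ρ => mm (su fun μ => su fun ν => mm (G _ _) (su fun σ => mm (G _ _) (l _ _ _)))
      (derivForms.sub_mem (derivForms.sub_mem (K _ _ _) (K _ _ _)) (K _ _ _))
  refine Submodule.sub_mem _ (Submodule.add_mem _ ?_ (Submodule.add_mem _ (md β α) (md α β))) last
  refine su fun ρ => su fun μ => su fun σ => su fun ν => mm (mm (G _ _) (G _ _)) ?_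
  exact Submodule.sub_mem _ (Submodule.add_mem _ (Submodule.add_mem _
    (mm (two _ (K _ _ _)) (l _ _ _)) (mm (two _ (K _ _ _)) (l _ _ _)))
    (mm (two _ (l _ _ _)) (l _ _ _))) (mm (two _ (l _ _ _)) (l _ _ _))

end QuadraticForms


/-! ## Tails of expansions -/

section Tails

variable {𝒜 : Type*} [Fintype 𝒜] [DecidableEq 𝒜] {bg : Background 𝒜} {a : Amplitudes 𝒜}
  {lam : ℝ} {x : Spacetime}

/-- The function has an expansion of the form used to define its coefficients. -/
def Expands (bg : Background 𝒜) (lam : ℝ) (x : Spacetime)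
    (S : ℝ × Spacetime × (𝒜 → ℝ) → ℝ) (c : ℕ → ℝ) : Prop :=
  HasExp 3 (fun s => s * S (s, x, fun A => bg.u A x / lam)) c

omit [Fintype 𝒜] [DecidableEq 𝒜] in
lemma Expands.coeffAt {S : ℝ × Spacetime × (𝒜 → ℝ) → ℝ} {c : ℕ → ℝ} (h : Expands bg lam x S c)
    {k : ℤ} (hk : k < 2) : coeffAt bg lam S k x = c (k + 1).toNat :=
  laurentCoeff_of_hasExp h (by omega)

-- Once an expansion exists, the tail is a linear expression in the value and three coefficients,
-- and additivity of tails becomes visible.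
omit [Fintype 𝒜] [DecidableEq 𝒜] in
lemma tail_two_eq {S : ℝ × Spacetime × (𝒜 → ℝ) → ℝ} {c : ℕ → ℝ} (h : Expands bg lam x S c)
    (Sact : Scalar) : tail bg lam 2 Sact S x
      = lam ^ (-2 : ℤ) * (Sact x - (lam⁻¹ * c 0 + c 1 + lam * c 2)) := by
  have e : Finset.Ico (-1 : ℤ) 2 = {-1, 0, 1} := rfl
  rw [tail, e, Finset.sum_insert (by decide), Finset.sum_insert (by decide), Finset.sum_singleton,
    h.coeffAt (by norm_num), h.coeffAt (by norm_num), h.coeffAt (by norm_num)]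
  simp [add_assoc]

/-- The components of the tails of the inverse metric. -/
def invTailOf (bg : Background 𝒜) (k : ℤ) (ρ σ : Fin 4) : OscFunctional 𝒜 := fun lam a =>
  tail bg lam k (inv (metric bg a (actual bg lam)) ρ σ) (inv (metric bg a (profile bg)) ρ σ)

/-- Coefficients are numbered from `λ⁻¹`, where the inverse metric has none; hence the shift by one
and the zero entry. -/
lemma coeffAt_inv (hbg : bg.IsNullDust) (hx : x ∈ slab) (ρ σ : Fin 4) {k : ℕ} (hk : k < 4) :
    coeffAt bg lam (inv (metric bg a (profile bg)) ρ σ) ((k : ℤ) - 1) x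
      = match k with
        | 0 => 0
        | k + 1 => invCoeff bg a (fun A => bg.u A x / lam) x k ρ σ := by
  have h := (hasExp_inv_profile (a := a) (θ := fun A => bg.u A x / lam) hbg hx ρ σ).id_mul
  rw [coeffAt, laurentCoeff_of_hasExp h (by omega)]
  simp only [sub_add_cancel, Int.toNat_natCast]
  rcases k with _ | k <;> rfl

/-- The inverse metric in terms of its tails. -/
lemma inv_eq_invTailOf (hbg : bg.IsNullDust) (hx : x ∈ slab) (hl : lam ≠ 0) (ρ σ : Fin 4) {k : ℕ}
    (hk : k < 4) : inv (gLam bg a lam) ρ σ x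
      = ∑ j ∈ Finset.range k, lam ^ j * invCoeff bg a (fun A => bg.u A x / lam) x j ρ σ
        + lam ^ k * invTailOf bg k ρ σ lam a x := by
  have c := fun k hk => coeffAt_inv (a := a) (lam := lam) hbg hx ρ σ (k := k) hk
  have c0 := c 0 (by norm_num)
  have c1 := c 1 (by norm_num)
  have c2 := c 2 (by norm_num)
  have c3 := c 3 (by norm_num)
  norm_num at c0 c1 c2 c3
  have e0 : Finset.Ico (-1 : ℤ) 0 = {-1} := rfl
  have e1 : Finset.Ico (-1 : ℤ) 1 = {-1, 0} := rfl
  have e2 : Finset.Ico (-1 : ℤ) 2 = {-1, 0, 1} := rfl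
  have e3 : Finset.Ico (-1 : ℤ) 3 = {-1, 0, 1, 2} := rfl
  have z : ∀ n : ℕ, lam ^ (-(n : ℤ)) = (lam ^ n)⁻¹ := fun n => by rw [zpow_neg, zpow_natCast]
  rw [invTailOf, tail, z, mul_inv_cancel_left₀ (pow_ne_zero _ hl)]
  interval_cases k
  · simp [e0, c0, gLam]
  · simp [e1, c0, c1, gLam]
  · simp [e2, c0, c1, c2, gLam, Finset.sum_range_succ]
  · have : lam ^ (2 : ℤ) = lam ^ 2 := zpow_ofNat _ _
    simp [e3, c0, c1, c2, c3, gLam, Finset.sum_range_succ, this, add_assoc]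

lemma invTailOf_mem_invAny {k : ℕ} (hk : k < 4) (ρ σ : Fin 4) :
    invTailOf bg k ρ σ ∈ invAny bg := by
  have h : invTailOf bg k ρ σ ∈ invTail bg k := ⟨ρ, σ, rfl⟩
  interval_cases k
  · exact Or.inl (Or.inl (Or.inl h))
  · exact Or.inl (Or.inl (Or.inr h))
  · exact Or.inl (Or.inr h)
  · exact Or.inr h

end Tails

/-! ## The reduced form of the Ricci tensor -/

section Reduced

variable {𝒜 : Type*} [Fintype 𝒜] [DecidableEq 𝒜] {bg : Background 𝒜} {a : Amplitudes 𝒜}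
  {E : Type*} [NormedAddCommGroup E] [NormedSpace ℝ E] {c : Calculus 𝒜 E}
  {D : Set E} {V : Fin 4 → E → E} {pos : E → Spacetime} {ang : E → 𝒜 → ℝ} {p : E}

/-- The principal part `g^{ρσ} ∂_ρ ∂_σ g_{αβ}`. -/
def principal {X : Type*} (bg : Background 𝒜) (a : Amplitudes 𝒜) (c : Calculus 𝒜 X)
    (α β : Fin 4) : X → ℝ := fun p =>
  ∑ ρ, ∑ σ, inv (metric bg a c) ρ σ p * c.d ρ (c.d σ (metric bg a c α β)) p

/-- The part of the Ricci tensor which is quadratic in the first derivatives. -/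
def quadraticPart {X : Type*} (bg : Background 𝒜) (a : Amplitudes 𝒜) (c : Calculus 𝒜 X)
    (α β : Fin 4) : X → ℝ := fun p =>
  reducedQuad (fun ρ σ => inv (metric bg a c) ρ σ p)
    (fun μ κ ν => c.d μ (metric bg a c κ ν) p) α β

omit [DecidableEq 𝒜] in
lemma nab_zero (R : Realization bg c D V pos ang) (g : Fin 4 → Fin 4 → E → ℝ) (μ α β : Fin 4) :
    nab c.d (fun ρ μ ν => c.field ((0 : Fin 4 → Fin 4 → Fin 4 → Scalar) ρ μ ν)) g μ α β
      = c.d μ (g α β) := by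
  funext q; simp [nab, R.field_apply]

omit [DecidableEq 𝒜] in
lemma nab2_zero (R : Realization bg c D V pos ang) (g : Fin 4 → Fin 4 → E → ℝ)
    (κ μ α β : Fin 4) (q : E) :
    nab2 c.d (fun ρ μ ν => c.field ((0 : Fin 4 → Fin 4 → Fin 4 → Scalar) ρ μ ν)) g κ μ α β q
      = c.d κ (c.d μ (g α β)) q := by
  rw [nab2, nab_zero R]; simp [R.field_apply]

/-- The second coordinate derivatives of the metric. -/
lemma d_d_metric (R : Realization bg c D V pos ang) (hbg : bg.IsNullDust) (ha : a.Admissible bg)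
    (hp : p ∈ D) (κ μ α β : Fin 4) : c.d κ (c.d μ (metric bg a c α β)) p = (c.lam p)⁻¹
      * ∑ m ∈ Finset.range 5, c.lam p ^ m * nab2Coeff bg a 0 (ang p) (pos p) m κ μ α β := by
  rw [← nab2_zero R]
  exact nab2_metric R hbg ha (fun _ _ _ => contDiffOn_const) hp κ μ α β

lemma hess_zero (v : Scalar) (κ μ : Fin 4) : hess 0 v κ μ = pd κ (pd μ v) := by
  funext q; simp [hess]

lemma nab_pd_zero (S : Tensor2) (μ α β : Fin 4) : nab pd 0 S μ α β = pd μ (S α β) := by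
  funext q; simp [nab]

lemma nab2_pd_zero (S : Tensor2) (κ μ α β : Fin 4) :
    nab2 pd 0 S κ μ α β = pd κ (pd μ (S α β)) := by
  funext q; simp [nab2, nab_pd_zero]

/-- Each of the three terms in the second derivative of an oscillating term is symmetric, because
amplitudes and phases are of class `C²`. This supplies the commutation required by the gauge form of
the Ricci tensor. -/
lemma d_comm_metric (R : Realization bg c D V pos ang) (hbg : bg.IsNullDust)
    (ha : a.Admissible bg) (hp : p ∈ D) (κ μ α β : Fin 4) :
    c.d κ (c.d μ (metric bg a c α β)) p = c.d μ (c.d κ (metric bg a c α β)) p := by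
  have e := fun κ μ => R.nab2_eq (Γ := 0) hbg.smooth_phase (fun _ _ _ => contDiffOn_const)
    (ansatz_smooth hbg ha) (fun a b p _ => metric_eq_sum R a b p) hp κ μ α β
  rw [← nab2_zero R, ← nab2_zero R, e, e]
  refine Finset.sum_congr rfl fun i _ => ?_
  have hx := R.pos_mem p hp
  simp only [mono_apply R, nab2_pd_zero, midDeriv, nab_pd_zero, hess_zero]
  rw [pd_comm (ansatz_smooth hbg ha i α β) hx κ μ,
    pd_comm (contDiffOn_phase hbg.smooth_phase _) hx κ μ]
  ring

/-- The remainder is expressed by coordinate derivatives and `□̃`, so the zero connection is the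
appropriate one. The covariant form serves only to compute coefficients. -/
theorem two_ricci_reduced (R : Realization bg c D V pos ang) (hbg : bg.IsNullDust)
    (ha : a.Admissible bg) (hp : p ∈ D)
    (hdet : (Matrix.of fun μ ν => metric bg a c μ ν p).det ≠ 0) (α β : Fin 4) :
    2 * ricci c.d (metric bg a c) α β p = -principal bg a c α β p
      + gaugeTerm c.d (metric bg a c) α β p + quadraticPart bg a c α β p :=
  R.frame.two_ricci_eq_gauge (fun μ ν => metric_smooth R hbg ha μ ν)
    (fun q hq μ ν => metric_symm R hbg ha hq μ ν) hp hdet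
    (fun κ μ α β => d_comm_metric R hbg ha hp κ μ α β) α β

end Reduced

/-! ### The tail of the quadratic part -/

section Quadratic

variable {𝒜 : Type*} [Fintype 𝒜] [DecidableEq 𝒜] {bg : Background 𝒜}

/-- The inverse metric and the derivatives of the metric. -/
def firstJet {X : Type*} (bg : Background 𝒜) (a : Amplitudes 𝒜) (c : Calculus 𝒜 X) (p : X) :
    FirstJet :=
  (fun ρ σ => inv (metric bg a c) ρ σ p, fun μ κ ν => c.d μ (metric bg a c κ ν) p)

lemma exists_expands_quadratic (hbg : bg.IsNullDust) {a : Amplitudes 𝒜} (ha : a.Admissible bg)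
    {lam : ℝ} {x : Spacetime} (hx : x ∈ slab) (i : Fin 4 → Fin 4) (j k : Fin 3 → Fin 4) :
    ∃ c, Expands bg lam x (quadratic bg a (profile bg) i j k) c := by
  have R := realization_profile hbg.smooth_phase
  have hG := fun ρ σ => (hasExp_inv_profile (a := a) (θ := fun A => bg.u A x / lam) hbg hx
    ρ σ).of_succ
  have hK := fun μ α β => hasExp_nab (bg := bg) (a := a) (θ := fun A => bg.u A x / lam) (x := x) 2
    0 μ α β
  refine ⟨_, ((((hG (i 0) (i 1)).mul (hG (i 2) (i 3))).mul (hK (j 0) (j 1) (j 2))).mul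
    (hK (k 0) (k 1) (k 2))).id_mul.congr ?_ fun _ _ => rfl⟩
  filter_upwards [eventually_mem_profileDomain (θ := fun A => bg.u A x / lam) hx] with s hs
  simp only [quadratic]
  rw [d_metric R hbg ha hs, d_metric R hbg ha hs]
  rfl

/-- The tail of the quadratic part is schematic. -/
theorem exists_quadraticPart_tail (hbg : bg.IsNullDust) (α β : Fin 4) :
    ∃ Φ ∈ class2 bg, ∀ a : Amplitudes 𝒜, a.Admissible bg → ∀ lam : ℝ, ∀ x ∈ slab,
      (∃ c, Expands bg lam x (quadraticPart bg a (profile bg) α β) c) ∧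
      tail bg lam 2 (quadraticPart bg a (actual bg lam) α β) (quadraticPart bg a (profile bg) α β) x
        = Φ lam a x := by
  -- Induction over the span. The tails of the monomials generate the bracket by definition.
  -- Additivity of tails needs existing expansions, so their existence is carried through the
  -- induction.
  suffices h : ∀ f ∈ Submodule.span ℝ {f | ∃ i j k, f = quadraticMonomial i j k},
      ∃ Φ ∈ class2 bg, ∀ a : Amplitudes 𝒜, a.Admissible bg → ∀ lam : ℝ, ∀ x ∈ slab,
        (∃ c, Expands bg lam x (fun p => f (firstJet bg a (profile bg) p)) c) ∧
        tail bg lam 2 (fun p => f (firstJet bg a (actual bg lam) p))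
          (fun p => f (firstJet bg a (profile bg) p)) x = Φ lam a x from
    h _ (reducedQuad_mem_span α β)
  intro f hf
  induction hf using Submodule.span_induction with
  | mem f hf =>
    obtain ⟨i, j, k, rfl⟩ := hf
    refine ⟨_, oscBracket_congr (mul_mem_oscBracket (c := fun _ => 1) continuousOn_const
      (Or.inl (Or.inl ⟨i, j, k, rfl⟩))) fun lam a x _ => (one_mul _).symm, fun a ha lam x hx =>
        ⟨exists_expands_quadratic hbg ha hx i j k, rfl⟩⟩
  | zero =>
    refine ⟨_, oscBracket_zero, fun a ha lam x hx => ?_⟩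
    have e : Expands bg lam x (fun p => (0 : FirstJet → ℝ) (firstJet bg a (profile bg) p))
        fun _ => 0 :=
      (HasExp.zero 3).congr (Filter.Eventually.of_forall fun s => by simp) fun _ _ => rfl
    exact ⟨⟨_, e⟩, by rw [tail_two_eq e]; simp⟩
  | add f g _ _ hf hg =>
    obtain ⟨Φ, hΦ, h⟩ := hf
    obtain ⟨Ψ, hΨ, h'⟩ := hg
    refine ⟨_, oscBracket_add hΦ hΨ, fun a ha lam x hx => ?_⟩
    obtain ⟨⟨c, e⟩, t⟩ := h a ha lam x hx
    obtain ⟨⟨c', e'⟩, t'⟩ := h' a ha lam x hx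
    have e2 : Expands bg lam x (fun p => (f + g) (firstJet bg a (profile bg) p))
        fun i => c i + c' i :=
      (e.add e').congr (Filter.Eventually.of_forall fun s => mul_add _ _ _) fun _ _ => rfl
    refine ⟨⟨_, e2⟩, ?_⟩
    rw [← t, ← t', tail_two_eq e, tail_two_eq e', tail_two_eq e2]
    simp only [Pi.add_apply]
    ring
  | smul r f _ hf =>
    obtain ⟨Φ, hΦ, h⟩ := hf
    refine ⟨_, oscBracket_const_mul r hΦ, fun a ha lam x hx => ?_⟩
    obtain ⟨⟨c, e⟩, t⟩ := h a ha lam x hx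
    have e2 : Expands bg lam x (fun p => (r • f) (firstJet bg a (profile bg) p))
        fun i => r * c i :=
      (e.const_mul r).congr (Filter.Eventually.of_forall fun s => mul_left_comm _ _ _)
        fun _ _ => rfl
    refine ⟨⟨_, e2⟩, ?_⟩
    rw [← t, tail_two_eq e, tail_two_eq e2]
    simp only [Pi.smul_apply, smul_eq_mul]
    ring

end Quadratic


/-! ## The principal part -/

section Principal

variable {𝒜 : Type*} [Fintype 𝒜] [DecidableEq 𝒜] {bg : Background 𝒜}

/-- The components which may be multiplied by the inverse metric in the remainder. -/
def remainderFactors (𝒜 : Type*) [Fintype 𝒜] [DecidableEq 𝒜] : Set (Functional 𝒜) :=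
  derivsLE 1 compG3h ∪ derivsLE 1 compG3e ∪ derivsLE 2 compF1 ∪ derivsLE 1 compFrakF
    ∪ derivsLE 2 compF21 ∪ derivsLE 2 compF22 ∪ derivsLE 2 compFpm

omit [Fintype 𝒜] [DecidableEq 𝒜] in
lemma tensor_frakF_mem (A : 𝒜) (μ ν : Fin 4) :
    (fun a : Amplitudes 𝒜 => a.frakF A μ ν) ∈ compFrakF := ⟨A, μ, ν, rfl⟩

omit [Fintype 𝒜] [DecidableEq 𝒜] in
lemma tensor_F21_mem (A : 𝒜) (μ ν : Fin 4) :
    (fun a : Amplitudes 𝒜 => a.F21 A μ ν) ∈ compF21 := ⟨A, μ, ν, rfl⟩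

omit [Fintype 𝒜] [DecidableEq 𝒜] in
lemma tensor_F22_mem (A : 𝒜) (μ ν : Fin 4) :
    (fun a : Amplitudes 𝒜 => a.F22 A μ ν) ∈ compF22 := ⟨A, μ, ν, rfl⟩

omit [Fintype 𝒜] [DecidableEq 𝒜] in
lemma tensor_Fpm_mem {A B : 𝒜} (h : A ≠ B) (ε : ℤˣ) (μ ν : Fin 4) :
    (fun a : Amplitudes 𝒜 => a.Fpm A B ε μ ν) ∈ compFpm := ⟨A, B, ε, μ, ν, h, rfl⟩

lemma tensor_g3h_mem (T : Bool) {n : 𝒜 → ℤ} (hn : n ∈ nullPhases 𝒜) (μ ν : Fin 4) :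
    (fun a : Amplitudes 𝒜 => a.g3h T n μ ν) ∈ compG3h := ⟨T, n, hn, μ, ν, rfl⟩

lemma tensor_g3e_mem (T : Bool) {n : 𝒜 → ℤ} (hn : n ∈ mixedPhases 𝒜) (μ ν : Fin 4) :
    (fun a : Amplitudes 𝒜 => a.g3e T n μ ν) ∈ compG3e := ⟨T, n, hn, μ, ν, rfl⟩

lemma remainderFactors_G3h : derivsLE 1 (compG3h (𝒜 := 𝒜)) ⊆ remainderFactors 𝒜 :=
  fun _ h => .inl (.inl (.inl (.inl (.inl (.inl h)))))

lemma remainderFactors_G3e : derivsLE 1 (compG3e (𝒜 := 𝒜)) ⊆ remainderFactors 𝒜 :=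
  fun _ h => .inl (.inl (.inl (.inl (.inl (.inr h)))))

lemma remainderFactors_F1 : derivsLE 2 (compF1 (𝒜 := 𝒜)) ⊆ remainderFactors 𝒜 :=
  fun _ h => .inl (.inl (.inl (.inl (.inr h))))

lemma remainderFactors_frakF : derivsLE 1 (compFrakF (𝒜 := 𝒜)) ⊆ remainderFactors 𝒜 :=
  fun _ h => .inl (.inl (.inl (.inr h)))

lemma remainderFactors_F21 : derivsLE 2 (compF21 (𝒜 := 𝒜)) ⊆ remainderFactors 𝒜 :=
  fun _ h => .inl (.inl (.inr h))

lemma remainderFactors_F22 : derivsLE 2 (compF22 (𝒜 := 𝒜)) ⊆ remainderFactors 𝒜 :=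
  fun _ h => .inl (.inr h)

lemma remainderFactors_Fpm : derivsLE 2 (compFpm (𝒜 := 𝒜)) ⊆ remainderFactors 𝒜 :=
  fun _ h => .inr h

/-- A tail of the inverse metric times an oscillating amplitude. -/
lemma tail_mul_osc_mem {T : OscFunctional 𝒜} (hT : T ∈ invAny bg) {Φ : Functional 𝒜}
    (hΦ : Φ ∈ bracket (remainderFactors 𝒜)) (r : ℝ) (b : Bool) (n : 𝒜 → ℤ) :
    (fun lam a x => T lam a x * (r * trig b (angle n fun A => bg.u A x / lam) * Φ a x))
      ∈ class2 bg := by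
  obtain ⟨N, c, m, hc, hm, e⟩ := hΦ
  refine oscBracket_congr (oscBracket_sum Finset.univ fun i _ =>
    osc_mul_mem (c := fun x => r * c i x) (continuousOn_const.mul (hc i))
      (m := T * fun _ => m i) (Or.inr (Set.mul_mem_mul hT (Set.mem_image_of_mem _ (hm i)))) b n)
      fun lam a x hx => ?_
  simp only [e a x hx, Finset.mul_sum, Pi.mul_apply]
  exact Finset.sum_congr rfl fun i _ => by ring

/-- An expression in the coefficients and the amplitude of an oscillating term which involves at
most first derivatives of the amplitude and vanishes for the zero phase. -/
structure IsLowOrder (w : (𝒜 → ℤ) → Tensor2 → Scalar) : Prop where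
  mem : ∀ n (S : Amplitudes 𝒜 → Tensor2) (C : Set (Functional 𝒜)),
    (∀ μ ν, (fun a => S a μ ν) ∈ C) → derivsLE 1 C ⊆ remainderFactors 𝒜 →
      (fun a => w n (S a)) ∈ bracket (remainderFactors 𝒜)
  zero : ∀ S x, w 0 S x = 0

lemma isLowOrder_midDeriv (hbg : bg.IsNullDust) (κ μ α β : Fin 4) :
    IsLowOrder fun (n : 𝒜 → ℤ) S => midDeriv 0 (bg.phase n) S κ μ α β where
  mem n S C hS hC := by
    have hv := contDiffOn_phase hbg.smooth_phase n
    have h0 : ∀ μ ν, (fun a => S a μ ν) ∈ bracket (remainderFactors 𝒜) := fun μ ν =>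
      subset_bracket (hC (Or.inl (hS μ ν)))
    have h1 : ∀ κ μ ν, (fun a => pd κ (S a μ ν)) ∈ bracket (remainderFactors 𝒜) := fun κ μ ν =>
      subset_bracket (hC (Or.inr ⟨_, hS μ ν, κ, rfl⟩))
    refine bracket_congr (bracket_add (bracket_add
      (bracket_scalar_mul (dv_continuous hbg n κ) (h1 μ α β))
      (bracket_scalar_mul (dv_continuous hbg n μ) (h1 κ α β)))
      (bracket_scalar_mul (pd_continuousOn (isFrame_pd.contDiffOn hv μ) κ) (h0 α β)))
      fun a x _ => ?_
    simp only [midDeriv, nab_pd_zero, hess_zero, Background.dv]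
  zero S x := by
    have : ∀ μ, pd μ (fun _ => (0 : ℝ)) = fun _ => 0 := fun μ => funext fun _ => pd_zero μ
    simp [midDeriv, hess_zero, phase_zero, this]

lemma isLowOrder_symbol (hbg : bg.IsNullDust) (κ μ α β : Fin 4) :
    IsLowOrder fun (n : 𝒜 → ℤ) S x =>
      pd κ (bg.phase n) x * pd μ (bg.phase n) x * S α β x where
  mem n S C hS hC := bracket_scalar_mul ((dv_continuous hbg n κ).mul (dv_continuous hbg n μ))
    (subset_bracket (hC (Or.inl (hS α β))))
  zero S x := by simp [phase_zero, pd_zero]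

/-- Among the terms with factor `λ²`, only `h` is foreign to the bracket; its phase is zero and
`IsLowOrder.zero` removes it. The fields `𝔉` and `𝔤` are admitted with at most one derivative, which
is the bound built into `IsLowOrder`. -/
lemma IsLowOrder.tail_mul_orderSum_mem {w : (𝒜 → ℤ) → Tensor2 → Scalar} (h : IsLowOrder w)
    {T : OscFunctional 𝒜} (hT : T ∈ invAny bg) (r : Bool → ℝ) (τ : Bool → Bool) {m : ℕ}
    (hm : m ≠ 0) : (fun lam a x => T lam a x * orderSum bg a (fun t =>
      r t.b * trig (τ t.b) (angle t.n fun A => bg.u A x / lam) * w t.n t.S x) m) ∈ class2 bg := by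
  have s1 {C : Set (Functional 𝒜)} (hC : derivsLE 2 C ⊆ remainderFactors 𝒜) :=
    (derivsLE_le (S := C) 1).trans hC
  match m, hm with
  | 1, _ =>
    simp only [orderSum, Finset.mul_sum]
    exact oscBracket_sum _ fun A _ => tail_mul_osc_mem hT
      (h.mem _ _ _ (F1_mem A) (s1 remainderFactors_F1)) _ _ _
  | 2, _ =>
    have z : ∀ S x, w 0 S x = 0 := h.zero
    simp only [orderSum, orderTwo, z, mul_zero, add_zero, mul_add, Finset.mul_sum]
    exact oscBracket_add (oscBracket_add (oscBracket_add
      (oscBracket_sum _ fun A _ => tail_mul_osc_mem hT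
        (h.mem _ _ _ (tensor_frakF_mem A) remainderFactors_frakF) _ _ _)
      (oscBracket_sum _ fun A _ => tail_mul_osc_mem hT
        (h.mem _ _ _ (tensor_F21_mem A) (s1 remainderFactors_F21)) _ _ _))
      (oscBracket_sum _ fun A _ => tail_mul_osc_mem hT
        (h.mem _ _ _ (tensor_F22_mem A) (s1 remainderFactors_F22)) _ _ _))
      (oscBracket_sum _ fun q hq => oscBracket_sum _ fun ε _ => tail_mul_osc_mem hT
        (h.mem _ _ _ (tensor_Fpm_mem (Finset.mem_offDiag.1 hq).2.2 ε)
          (s1 remainderFactors_Fpm)) _ _ _)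
  | 3, _ =>
    simp only [orderSum, orderThree, mul_add, Finset.mul_sum]
    exact oscBracket_add
      (oscBracket_sum _ fun n hn => oscBracket_sum _ fun b _ => tail_mul_osc_mem hT
        (h.mem _ _ _ (tensor_g3h_mem b hn) remainderFactors_G3h) _ _ _)
      (oscBracket_sum _ fun n hn => oscBracket_sum _ fun b _ => tail_mul_osc_mem hT
        (h.mem _ _ _ (tensor_g3e_mem b hn) remainderFactors_G3e) _ _ _)
  | m + 4, _ =>
    simp only [orderSum, mul_zero]
    exact oscBracket_zero

/-- The sum of `F` over the terms `F^{(2,1)}`, `F^{(2,2)}` and `F^{(2,±)}` of the ansatz. -/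
def orderTwoFixed (a : Amplitudes 𝒜) (F : OscTerm 𝒜 → ℝ) : ℝ :=
  ∑ A, F ⟨2, false, unit A, a.F21 A⟩ + ∑ A, F ⟨2, true, (2 : ℤ) • unit A, a.F22 A⟩
    + ∑ q ∈ (Finset.univ : Finset 𝒜).offDiag, ∑ ε : ℤˣ,
        F ⟨2, true, pm q.1 q.2 ε, a.Fpm q.1 q.2 ε⟩

lemma secondDeriv_mem {C : Set (Functional 𝒜)} {S : Amplitudes 𝒜 → Tensor2}
    (hS : ∀ μ ν, (fun a => S a μ ν) ∈ C) (hC : derivsLE 2 C ⊆ remainderFactors 𝒜)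
    (κ μ α β : Fin 4) :
    (fun a => pd κ (pd μ (S a α β))) ∈ bracket (remainderFactors 𝒜) :=
  subset_bracket (hC (Or.inr ⟨_, Or.inr ⟨_, hS α β, μ, rfl⟩, κ, rfl⟩))

/-- The terms of the tail of the principal part which belong to the remainder. -/
def principalRest (bg : Background 𝒜) (α β ρ σ : Fin 4) : OscFunctional 𝒜 := fun lam a x =>
  let θ : 𝒜 → ℝ := fun A => bg.u A x / lam
  let nn : OscTerm 𝒜 → ℝ := fun t => 1 * trig t.b (angle t.n θ) * pd ρ (pd σ (t.S α β)) x
  let mm : OscTerm 𝒜 → ℝ := fun t =>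
    trigSign t.b * trig (!t.b) (angle t.n θ) * midDeriv 0 (bg.phase t.n) t.S ρ σ α β x
  let pp : OscTerm 𝒜 → ℝ := fun t => 1 * trig t.b (angle t.n θ)
    * (pd ρ (bg.phase t.n) x * pd σ (bg.phase t.n) x * t.S α β x)
  let T : ℕ → ℝ := fun k => invTailOf bg k ρ σ lam a x
  -- In every product the order of the tail complements the power of the other factor to `λ²`. For
  -- instance, two derivatives of the phase of a term `λ F1` leave `λ⁻¹` and go with the third tail.
  pd ρ (pd σ (bg.g₀ α β)) x * T 2
    + (T 1 * ∑ A, nn ⟨1, true, unit A, a.F1 A⟩ + T 0 * orderTwoFixed a nn)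
    + (T 2 * orderSum bg a mm 1 + T 1 * orderSum bg a mm 2 + T 0 * orderSum bg a mm 3)
    - (T 3 * orderSum bg a pp 1 + T 2 * orderSum bg a pp 2 + T 1 * orderSum bg a pp 3)

lemma principalRest_mem (hbg : bg.IsNullDust) (α β ρ σ : Fin 4) :
    principalRest bg α β ρ σ ∈ class2 bg := by
  have T := fun k (hk : k < 4) => invTailOf_mem_invAny (bg := bg) hk ρ σ
  have m := fun k (hk : k < 4) l (hl : l ≠ 0) => (isLowOrder_midDeriv hbg ρ σ α
    β).tail_mul_orderSum_mem (T k hk) trigSign (fun b => !b) (m := l) hl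
  have p := fun k (hk : k < 4) l (hl : l ≠ 0) => (isLowOrder_symbol hbg ρ σ α
    β).tail_mul_orderSum_mem (T k hk) (fun _ => 1) (fun b => b) (m := l) hl
  have n1 : (fun lam a x => invTailOf bg 1 ρ σ lam a x * ∑ A, 1 * trig true (angle (unit A)
      fun A => bg.u A x / lam) * pd ρ (pd σ (a.F1 A α β)) x) ∈ class2 bg := by
    simp only [Finset.mul_sum (Finset.univ : Finset 𝒜)]
    exact oscBracket_sum _ fun A _ => tail_mul_osc_mem (T 1 (by norm_num))
      (secondDeriv_mem (F1_mem A) remainderFactors_F1 ρ σ α β) _ _ _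
  have n2 : (fun lam a x => invTailOf bg 0 ρ σ lam a x * orderTwoFixed a fun t =>
      1 * trig t.b (angle t.n fun A => bg.u A x / lam) * pd ρ (pd σ (t.S α β)) x) ∈ class2 bg := by
    simp only [orderTwoFixed, mul_add, Finset.mul_sum]
    exact oscBracket_add (oscBracket_add
      (oscBracket_sum _ fun A _ => tail_mul_osc_mem (T 0 (by norm_num))
        (secondDeriv_mem (tensor_F21_mem A) remainderFactors_F21 ρ σ α β) _ _ _)
      (oscBracket_sum _ fun A _ => tail_mul_osc_mem (T 0 (by norm_num))
        (secondDeriv_mem (tensor_F22_mem A) remainderFactors_F22 ρ σ α β) _ _ _))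
      (oscBracket_sum _ fun q hq => oscBracket_sum _ fun ε _ =>
        tail_mul_osc_mem (T 0 (by norm_num)) (secondDeriv_mem (tensor_Fpm_mem (Finset.mem_offDiag.1 hq).2.2 ε) remainderFactors_Fpm ρ σ α β)
          _ _ _)
  have n0 : (fun lam a x => pd ρ (pd σ (bg.g₀ α β)) x * invTailOf bg 2 ρ σ lam a x) ∈ class2 bg :=
    mul_mem_oscBracket (pd_continuousOn (isFrame_pd.contDiffOn (hbg.smooth_metric α β) σ) ρ)
      (Or.inl (Or.inr ⟨ρ, σ, rfl⟩))
  exact oscBracket_sub (oscBracket_add (oscBracket_add n0 (oscBracket_add n1 n2))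
    (oscBracket_add (oscBracket_add (m 2 (by norm_num) 1 one_ne_zero)
      (m 1 (by norm_num) 2 two_ne_zero)) (m 0 (by norm_num) 3 three_ne_zero)))
    (oscBracket_add (oscBracket_add (p 3 (by norm_num) 1 one_ne_zero)
      (p 2 (by norm_num) 2 two_ne_zero)) (p 1 (by norm_num) 3 three_ne_zero))

end Principal


/-! ## The expansion of the Ricci tensor of the metric -/

section Remainder

variable {𝒜 : Type*} [Fintype 𝒜] [DecidableEq 𝒜] {bg : Background 𝒜} {a : Amplitudes 𝒜}
  {lam : ℝ} {x : Spacetime}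

-- A Leibniz rule for tails: the coefficient `kᵢ`, of order `i - 1`, meets the tail of order `3 - i`
-- for `i ≤ 2`, while `k₃` and `k₄` already carry enough powers to multiply `g` itself.
omit [Fintype 𝒜] [DecidableEq 𝒜] in
lemma product_tail (hl : lam ≠ 0) {g I₀ I₁ I₂ T₁ T₂ T₃ : ℝ} (h₁ : g = I₀ + lam * T₁)
    (h₂ : g = I₀ + lam * I₁ + lam ^ 2 * T₂) (h₃ : g = I₀ + lam * I₁ + lam ^ 2 * I₂ + lam ^ 3 * T₃)
    (k₀ k₁ k₂ k₃ k₄ : ℝ) :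
    (lam ^ 2)⁻¹ * (g * (lam⁻¹ * (k₀ + lam * k₁ + lam ^ 2 * k₂ + lam ^ 3 * k₃ + lam ^ 4 * k₄))
      - (lam⁻¹ * (I₀ * k₀) + (I₀ * k₁ + I₁ * k₀) + lam * (I₀ * k₂ + (I₁ * k₁ + I₂ * k₀))))
      = T₃ * k₀ + T₂ * k₁ + T₁ * k₂ + g * (k₃ + lam * k₄) := by
  field_simp
  linear_combination k₀ * h₃ + lam * k₁ * h₂ + lam ^ 2 * k₂ * h₁

lemma expands_principal (hbg : bg.IsNullDust) (ha : a.Admissible bg) (hx : x ∈ slab)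
    (α β : Fin 4) : Expands bg lam x (principal bg a (profile bg) α β) fun i =>
      ∑ ρ, ∑ σ, ∑ ij ∈ Finset.HasAntidiagonal.antidiagonal i,
        invCoeff bg a (fun A => bg.u A x / lam) x ij.1 ρ σ
          * if ij.2 < 5 then nab2Coeff bg a 0 (fun A => bg.u A x / lam) x ij.2 ρ σ α β else 0 := by
  have R := realization_profile hbg.smooth_phase
  refine (HasExp.sum Finset.univ fun ρ _ => HasExp.sum Finset.univ fun σ _ =>
    (hasExp_inv_profile (a := a) (θ := fun A => bg.u A x / lam) hbg hx ρ σ).mul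
      (hasExp_nab2 3 0 ρ σ α β)).congr ?_ fun _ _ => rfl
  filter_upwards [eventually_mem_profileDomain (θ := fun A => bg.u A x / lam) hx] with s hs
  have hs0 : s ≠ 0 := hs.1
  simp only [principal, d_d_metric R hbg ha hs, Finset.mul_sum (Finset.univ : Finset (Fin 4))]
  refine Finset.sum_congr rfl fun ρ _ => Finset.sum_congr rfl fun σ _ => ?_
  rw [show (profile bg).lam (s, x, fun A => bg.u A x / lam) = s from rfl]
  field_simp

lemma tail_principal (hbg : bg.IsNullDust) (ha : a.Admissible bg) (hx : x ∈ slab) (hl : lam ≠ 0)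
    (α β : Fin 4) :
    tail bg lam 2 (principal bg a (actual bg lam) α β) (principal bg a (profile bg) α β) x
      = ∑ ρ, ∑ σ,
        (invTailOf bg 3 ρ σ lam a x * nab2Coeff bg a 0 (fun A => bg.u A x / lam) x 0 ρ σ α β
        + invTailOf bg 2 ρ σ lam a x * nab2Coeff bg a 0 (fun A => bg.u A x / lam) x 1 ρ σ α β
        + invTailOf bg 1 ρ σ lam a x * nab2Coeff bg a 0 (fun A => bg.u A x / lam) x 2 ρ σ α β
        + inv (gLam bg a lam) ρ σ x
          * (nab2Coeff bg a 0 (fun A => bg.u A x / lam) x 3 ρ σ α β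
            + lam * nab2Coeff bg a 0 (fun A => bg.u A x / lam) x 4 ρ σ α β)) := by
  have R := realization_actual hbg.smooth_phase hl
  rw [tail_two_eq (expands_principal hbg ha hx α β), principal]
  simp only [d_d_metric R hbg ha hx, Finset.mul_sum (Finset.univ : Finset (Fin 4)),
    ← Finset.sum_add_distrib, ← Finset.sum_sub_distrib]
  refine Finset.sum_congr rfl fun ρ _ => Finset.sum_congr rfl fun σ _ => ?_
  have i1 := inv_eq_invTailOf (a := a) hbg hx hl ρ σ (k := 1) (by norm_num)
  have i2 := inv_eq_invTailOf (a := a) hbg hx hl ρ σ (k := 2) (by norm_num)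
  have i3 := inv_eq_invTailOf (a := a) hbg hx hl ρ σ (k := 3) (by norm_num)
  simp only [Finset.sum_range_succ, Finset.sum_range_zero, zero_add, pow_zero, one_mul, pow_one,
    Nat.cast_one, Nat.cast_ofNat] at i1 i2 i3
  simp only [Finset.Nat.antidiagonal_succ, Finset.Nat.antidiagonal_zero, Finset.map_singleton,
    Finset.sum_cons, Finset.sum_singleton, Function.Embedding.prodMap, Function.Embedding.coeFn_mk,
    Finset.map_cons, Prod.map, Function.Embedding.refl_apply]
  simp only [Finset.sum_range_succ, Finset.sum_range_zero, zero_add, pow_zero, one_mul, pow_one,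
    show (actual bg lam).lam x = lam from rfl, id]
  norm_num
  exact product_tail hl i1 i2 i3 _ _ _ _ _

omit [Fintype 𝒜] [DecidableEq 𝒜] in
lemma sum_mul_sum_mul (G H : Fin 4 → Fin 4 → ℝ) (r : ℝ) :
    ∑ ρ, ∑ σ, G ρ σ * (r * H ρ σ) = r * ∑ ρ, ∑ σ, G ρ σ * H ρ σ := by
  simp only [Finset.mul_sum, mul_left_comm]

lemma sum_mul_orderSum (G : Fin 4 → Fin 4 → ℝ) (F : Fin 4 → Fin 4 → OscTerm 𝒜 → ℝ) (m : ℕ) :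
    ∑ ρ, ∑ σ, G ρ σ * orderSum bg a (F ρ σ) m
      = orderSum bg a (fun t => ∑ ρ, ∑ σ, G ρ σ * F ρ σ t) m := by
  simp only [Fin.sum_univ_four, orderSum_add, orderSum_mul_left]

/-- The tail of the principal part. -/
lemma tail_principal_eq (hbg : bg.IsNullDust) (ha : a.Admissible bg) (hx : x ∈ slab)
    (hl : lam ≠ 0) (α β : Fin 4) :
    tail bg lam 2 (principal bg a (actual bg lam) α β) (principal bg a (profile bg) α β) x
      = boxTilde (gLam bg a lam) (a.h α β) x
        + ∑ A, Real.sin (bg.u A x / lam) * boxTilde (gLam bg a lam) (a.frakF A α β) x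
        + lam * ∑ n ∈ nullPhases 𝒜, ∑ T, trig T (bg.phase n x / lam)
            * boxTilde (gLam bg a lam) (a.g3h T n α β) x
        + lam * ∑ n ∈ mixedPhases 𝒜, ∑ T, trig T (bg.phase n x / lam)
            * boxTilde (gLam bg a lam) (a.g3e T n α β) x
        + ∑ ρ, ∑ σ, principalRest bg α β ρ σ lam a x := by
  set θ : 𝒜 → ℝ := fun A => bg.u A x / lam with hθ
  set nn : Fin 4 → Fin 4 → OscTerm 𝒜 → ℝ := fun ρ σ t =>
    trig t.b (angle t.n θ) * pd ρ (pd σ (t.S α β)) x with hnn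
  have box : ∀ m, ∑ ρ, ∑ σ, inv (gLam bg a lam) ρ σ x * orderSum bg a (nn ρ σ) m
      = orderSum bg a (fun t => trig t.b (angle t.n θ) * boxTilde (gLam bg a lam) (t.S α β) x) m := by
    intro m
    rw [sum_mul_orderSum]
    refine orderSum_congr bg a m fun t _ => ?_
    exact sum_mul_sum_mul _ _ _
  have frak := weighted_sum_comm Finset.univ (inv (gLam bg a lam) · · x)
    (fun A => Real.sin (bg.u A x / lam)) fun A ρ σ => pd ρ (pd σ (a.frakF A α β)) x
  -- Second derivatives of `h` and `𝔉` at order `2`, and of the `𝔤` at order `3`, come with the full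
  -- inverse metric and are singled out to form `□̃`. What is left is `principalRest`.
  have pt : ∀ ρ σ, invTailOf bg 3 ρ σ lam a x * nab2Coeff bg a 0 θ x 0 ρ σ α β
      + invTailOf bg 2 ρ σ lam a x * nab2Coeff bg a 0 θ x 1 ρ σ α β
      + invTailOf bg 1 ρ σ lam a x * nab2Coeff bg a 0 θ x 2 ρ σ α β
      + inv (gLam bg a lam) ρ σ x
        * (nab2Coeff bg a 0 θ x 3 ρ σ α β + lam * nab2Coeff bg a 0 θ x 4 ρ σ α β)
      = principalRest bg α β ρ σ lam a x
        + (inv (gLam bg a lam) ρ σ x * pd ρ (pd σ (a.h α β)) x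
          + inv (gLam bg a lam) ρ σ x
            * ∑ A, Real.sin (bg.u A x / lam) * pd ρ (pd σ (a.frakF A α β)) x
          + inv (gLam bg a lam) ρ σ x * (lam * orderSum bg a (nn ρ σ) 3)) := by
    intro ρ σ
    have T0 := inv_eq_invTailOf (a := a) hbg hx hl ρ σ (k := 0) (by norm_num)
    simp only [Finset.range_zero, Finset.sum_empty, zero_add, pow_zero, one_mul,
      Nat.cast_zero] at T0
    have zm : orderSum bg a (fun t => trigSign t.b * trig (!t.b) (angle t.n θ)
        * midDeriv 0 (bg.phase t.n) t.S ρ σ α β x) 0 = 0 := by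
      simp [orderSum, midDeriv_zero]
    have z4 : ∀ F, orderSum bg a F 4 = 0 := fun _ => rfl
    have z5 : ∀ F, orderSum bg a F 5 = 0 := fun _ => rfl
    have n0 : orderSum bg a (nn ρ σ) 0 = pd ρ (pd σ (bg.g₀ α β)) x := by
      simp [orderSum, hnn, angle_zero, trig]
    have n2 : orderSum bg a (nn ρ σ) 2 = orderTwoFixed a (nn ρ σ)
        + ∑ A, Real.sin (bg.u A x / lam) * pd ρ (pd σ (a.frakF A α β)) x
        + pd ρ (pd σ (a.h α β)) x := by
      simp only [orderSum, orderTwo, orderTwoFixed, hnn, angle_zero, angle_unit, trig,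
        Real.cos_zero, hθ]
      ring
    have n1 : orderSum bg a (nn ρ σ) 1 = ∑ A, nn ρ σ ⟨1, true, unit A, a.F1 A⟩ := rfl
    simp only [nab2Coeff, nab2_pd_zero, principalRest, one_mul, zm, z4, z5, Nat.cast_zero,
      Nat.cast_one, Nat.cast_ofNat]
    simp only [← hθ]
    change _ * (0 + 0 - _) + _ * (orderSum bg a (nn ρ σ) 0 + _ - _)
      + _ * (orderSum bg a (nn ρ σ) 1 + _ - _) + _ * (orderSum bg a (nn ρ σ) 2 + _ - 0
        + _ * (orderSum bg a (nn ρ σ) 3 + 0 - 0)) = _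
    rw [n0, n1, n2, T0]
    ring
  rw [tail_principal hbg ha hx hl, Finset.sum_congr rfl fun ρ _ => Finset.sum_congr rfl fun σ _ =>
    pt ρ σ]
  simp only [Finset.sum_add_distrib, frak, sum_mul_sum_mul, box]
  simp only [orderSum, orderThree, hθ, angle_phase, boxTilde]
  ring

/-- The expansion of the Ricci tensor up to order `1`, with its remainder. -/
theorem exists_remainder (hbg : bg.IsNullDust) :
    ∃ r : Fin 4 → Fin 4 → OscFunctional 𝒜, (∀ α β, r α β ∈ class2 bg) ∧
      ∀ a : Amplitudes 𝒜, a.Admissible bg → ∀ lam : ℝ, 0 < lam → ∀ x ∈ slab,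
        (Matrix.of fun μ ν => gLam bg a lam μ ν x).det ≠ 0 → ∀ α β,
        2 * ricci pd (gLam bg a lam) α β x
          = lam⁻¹ * twoRicciCoeff bg a (fun A => bg.u A x / lam) x α β 0
            + twoRicciCoeff bg a (fun A => bg.u A x / lam) x α β 1
            + lam * twoRicciCoeff bg a (fun A => bg.u A x / lam) x α β 2
            + lam ^ 2 * twoR2 bg a lam (fun μ ν => r μ ν lam a) α β x := by
  choose Φ hΦ h using exists_quadraticPart_tail hbg
  refine ⟨fun α β lam a x => Φ α β lam a x - ∑ ρ, ∑ σ, principalRest bg α β ρ σ lam a x,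
    fun α β => oscBracket_sub (hΦ α β) (oscBracket_sum _ fun ρ _ => oscBracket_sum _ fun σ _ =>
      principalRest_mem hbg α β ρ σ), fun a ha lam hl x hx hdet α β => ?_⟩
  have hl0 : lam ≠ 0 := hl.ne'
  obtain ⟨⟨q, hq⟩, tq⟩ := h α β a ha lam x hx
  have hp := expands_principal (lam := lam) hbg ha hx α β
  have tp := tail_principal_eq hbg ha hx hl0 α β
  have hr := hasExp_two_ricci (θ := fun A => bg.u A x / lam) hbg ha hx α β
  -- The gauge term needs no separate computation: it is twice the Ricci tensor plus the principal
  -- part minus the quadratic part, and these three have expansions.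
  have hg : Expands bg lam x (gaugeTerm (profile bg).d (metric bg a (profile bg)) α β) _ :=
    ((hr.add hp).sub hq).congr (by
      filter_upwards [eventually_det_profile (a := a) (θ := fun A => bg.u A x / lam) hbg hx,
        eventually_mem_profileDomain (θ := fun A => bg.u A x / lam) hx] with s hs hm
      rw [two_ricci_reduced (realization_profile hbg.smooth_phase) hbg ha hm hs α β]
      ring) fun _ _ => rfl
  have tg := tail_two_eq hg (gaugeTerm pd (gLam bg a lam) α β)
  rw [tail_two_eq hp] at tp
  rw [tail_two_eq hq] at tq
  have act := two_ricci_reduced (realization_actual hbg.smooth_phase hl0) hbg ha hx hdet α β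
  have z : lam ^ (-2 : ℤ) = (lam ^ 2)⁻¹ := by rw [zpow_neg]; norm_cast
  rw [z] at tp tq tg
  rw [inv_mul_eq_iff_eq_mul₀ (pow_ne_zero 2 hl0)] at tp tq
  rw [eq_inv_mul_iff_mul_eq₀ (pow_ne_zero 2 hl0)] at tg
  rw [twoR2]
  change 2 * ricci pd (gLam bg a lam) α β x = _ + gaugeTerm pd (gLam bg a lam) α β x + _ at act
  rw [act]
  -- The reduced identity holds both for the actual metric and for the coefficients of the profile,
  -- so the Ricci tensor minus its three coefficients is `λ²` times the corresponding combination of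
  -- tails.
  linear_combination -tp + tq - tg

end Remainder

end
end MultiphaseRicci

theorem proposition2p4 {𝒜 : Type*} [Fintype 𝒜] [DecidableEq 𝒜]
    (bg : MultiphaseRicci.Background 𝒜) (hbg : bg.IsNullDust) :
    ∃ (r11 r12 : 𝒜 → Fin 4 → Fin 4 → MultiphaseRicci.Functional 𝒜)
      (rh : Bool → (𝒜 → ℤ) → Fin 4 → MultiphaseRicci.Functional 𝒜)
      (re : Bool → (𝒜 → ℤ) → Fin 4 → Fin 4 → MultiphaseRicci.Functional 𝒜)
      (r2 : Fin 4 → Fin 4 → MultiphaseRicci.OscFunctional 𝒜),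
      (∀ A α β, r11 A α β ∈ MultiphaseRicci.class11) ∧
      (∀ A α β, r12 A α β ∈ MultiphaseRicci.class12) ∧
      (∀ T, ∀ n ∈ MultiphaseRicci.nullPhases 𝒜, ∀ β, rh T n β ∈ MultiphaseRicci.class1h) ∧
      (∀ T, ∀ n ∈ MultiphaseRicci.mixedPhases 𝒜, ∀ α β,
        re T n α β ∈ MultiphaseRicci.class1e) ∧
      (∀ α β, r2 α β ∈ MultiphaseRicci.class2 bg) ∧
      ∀ a : MultiphaseRicci.Amplitudes 𝒜, a.Admissible bg → ∀ lam : ℝ, 0 < lam →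
        (∀ x ∈ MultiphaseRicci.slab,
          (Matrix.of fun μ ν => MultiphaseRicci.gLam bg a lam μ ν x).det ≠ 0) →
        ∀ x ∈ MultiphaseRicci.slab, ∀ α β : Fin 4,
          -- the terms of order 0 and 1, written out
          let R0 : ℝ := MultiphaseRicci.R0 bg a lam α β x
          let R1 : ℝ := MultiphaseRicci.R1 bg a lam (fun A μ ν => r11 A μ ν a)
            (fun A μ ν => r12 A μ ν a) (fun T n μ => rh T n μ a)
            (fun T n μ ν => re T n μ ν a) α β x
          -- the remainder, written out
          let R2 : ℝ := (1 / 2) * MultiphaseRicci.twoR2 bg a lam (fun μ ν => r2 μ ν lam a) α β x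
          -- the coefficients of the Ricci tensor in powers of the parameter
          let coeff : ℤ → ℝ := fun k => MultiphaseRicci.coeffAt bg lam
            (MultiphaseRicci.ricci (MultiphaseRicci.profile bg).d
              (MultiphaseRicci.metric bg a (MultiphaseRicci.profile bg)) α β) k x
          MultiphaseRicci.ricci MultiphaseRicci.pd (MultiphaseRicci.gLam bg a lam) α β x
              = R0 + lam * R1 + lam ^ 2 * R2 ∧
            coeff (-1) = 0 ∧ coeff 0 = R0 ∧ coeff 1 = R1 := by
  -- The exact identity for the actual metric and the coefficients of the profile are both expressed
  -- by `twoRicciCoeff`, so its evaluation at the three orders serves all four conclusions.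
  obtain ⟨r, hr, h1⟩ := MultiphaseRicci.exists_twoRicciCoeff_two hbg
  obtain ⟨r2, hr2, h2⟩ := MultiphaseRicci.exists_remainder hbg
  refine ⟨r.r11, r.r12, r.rh, r.re, r2, hr.r11, hr.r12, fun T n _ β => hr.rh T n β,
    fun T n _ α β => hr.re T n α β, hr2, fun a ha lam hl hdet x hx α β => ?_⟩
  have c0 := MultiphaseRicci.twoRicciCoeff_zero_eq (a := a)
    (θ := fun A => bg.u A x / lam) hbg ha hx α β
  have c1 := MultiphaseRicci.twoRicciCoeff_one_eq hbg ha hx lam α β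
  have c2 := h1 a ha lam x hx α β
  have e := h2 a ha lam hl x hx (hdet x hx) α β
  rw [c0, c1, c2] at e
  have E : MultiphaseRicci.Expands bg lam x (MultiphaseRicci.ricci (MultiphaseRicci.profile bg).d
      (MultiphaseRicci.metric bg a (MultiphaseRicci.profile bg)) α β) _ :=
    ((MultiphaseRicci.hasExp_two_ricci (θ := fun A => bg.u A x / lam) hbg ha hx α β).const_mul
      (1 / 2)).congr (Filter.Eventually.of_forall fun s => by ring) fun _ _ => rfl
  refine ⟨by linear_combination (1 / 2) * e, ?_, ?_, ?_⟩
  · refine (E.coeffAt (by norm_num : (-1 : ℤ) < 2)).trans ?_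
    change 1 / 2 * MultiphaseRicci.twoRicciCoeff bg a _ x α β 0 = 0
    rw [c0, mul_zero]
  · refine (E.coeffAt (by norm_num : (0 : ℤ) < 2)).trans ?_
    change 1 / 2 * MultiphaseRicci.twoRicciCoeff bg a _ x α β 1 = _
    rw [c1]; ring
  · refine (E.coeffAt (by norm_num : (1 : ℤ) < 2)).trans ?_
    change 1 / 2 * MultiphaseRicci.twoRicciCoeff bg a _ x α β 2 = _
    rw [c2]; ring
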